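/- Let $K$ be a knot in $S^3$ whose unknotting number satisfies $u(K)\le 2$, and let $D$ be a diagram of $K$. (Knots are treated as planar knot diagrams modulo Reidemeister moves, and $u(K)$ is the least number of crossing changes, with Reidemeister moves allowed in between, that turn $K$ into the unknot.) Let $H_{Kh}(D)$ be the rational Khovanov homology, bigraded by homological and quantum grading. Let $H_{Lee}(D)$ be the homology of the Lee complex over $\mathbb{Q}[t]$, obtained from Khovanov's complex by replacing the relation $X^2=0$ by $X^2=t$. Let $s$ be Rasmussen's invariant, i.e. $s=s_{\max}-1$, where $s_{\max}$ is the largest filtration level of a nonzero class in the homology of Lee's filtered complex ($t=1$). Then: 1. the maximal order $\mathfrak{u}_t$ of $t$-torsion in $H_{Lee}(D)$ is at most $1$, i.e. every class annihilated by some power of $t$ is annihilated by $t$; 2. the Knight Move Conjecture holds for $K$: there are finitely many pairs of integers $(l_i,m_i)$ such that, as bigraded $\mathbb{Q}$-vector spaces, $$H_{Kh}(D)\;\cong\;\mathbb{Q}\{0,s-1\}\oplus\mathbb{Q}\{0,s+1\}\;\oplus\;\bigoplus_i\bigl(\mathbb{Q}\{l_i,m_i\}\oplus\mathbb{Q}\{l_i+1,m_i+4\}\bigr),$$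 where $\mathbb{Q}\{a,b\}$ is a copy of $\mathbb{Q}$ in homological grading $a$ and quantum grading $b$. -/

import Mathlib

/-! ## Oriented planar diagrams of knots

A diagram is given by its planar diagram code: a list of crossings and a list of marked
points on the strands, whose legs are labelled by the edges of the diagram. -/

/-- An oriented crossing.  The edges `a, b, c, d` are listed counterclockwise, starting from the
incoming end `a` of the lower strand.  So the lower strand runs from `a` to `c`; the upper strand
runs from `d` to `b` if the crossing is positive, and from `b` to `d` if it is negative. -/
structure Crossing (E : Type) where
  pos : Bool
  a : E
  b : E
  c : E
  d : E

namespace Crossing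

variable {E E' : Type}

/-- Relabelling of the edges. -/
def map (f : E → E') (x : Crossing E) : Crossing E' :=
  ⟨x.pos, f x.a, f x.b, f x.c, f x.d⟩

/-- The two strands through a crossing, as pairs (incoming edge, outgoing edge). -/
def strands (x : Crossing E) : List (E × E) :=
  [(x.a, x.c), if x.pos then (x.d, x.b) else (x.b, x.d)]

/-- The four corners at a crossing.  An edge `e` has a left side `(e, true)` and a right side
`(e, false)`; a corner is the pair of edge sides that bound it near the crossing. -/
def corners (x : Crossing E) : List ((E × Bool) × (E × Bool)) :=
  if x.pos then
    [((x.a, false), (x.b, false)), ((x.b, true), (x.c, false)),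
     ((x.c, true), (x.d, true)), ((x.d, false), (x.a, true))]
  else
    [((x.a, false), (x.b, true)), ((x.b, false), (x.c, false)),
     ((x.c, true), (x.d, false)), ((x.d, true), (x.a, true))]

/-- The two arcs of the `0`-resolution (`false`) and of the `1`-resolution (`true`).  The oriented
resolution is the `0`-resolution of a positive and the `1`-resolution of a negative crossing. -/
def arcs (x : Crossing E) : Bool → List (E × E)
  | false => [(x.a, x.b), (x.c, x.d)]
  | true => [(x.a, x.d), (x.b, x.c)]

/-- The crossing change: the upper strand becomes the lower strand. -/
def change (x : Crossing E) : Crossing E :=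
  if x.pos then ⟨false, x.d, x.a, x.b, x.c⟩ else ⟨true, x.b, x.c, x.d, x.a⟩

/-- Forgetting orientations, the crossing has the edges `a, b, c, d` in counterclockwise order,
and the strand through `a` and `c` is the lower one if `σ = true`, the upper one if `σ = false`. -/
def Looks (x : Crossing E) (σ : Bool) (a b c d : E) : Prop :=
  if σ then (x.a, x.b, x.c, x.d) = (a, b, c, d) ∨ (x.a, x.b, x.c, x.d) = (c, d, a, b)
  else (x.a, x.b, x.c, x.d) = (b, c, d, a) ∨ (x.a, x.b, x.c, x.d) = (d, a, b, c)

end Crossing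

/-- A planar diagram code with edges labelled by `E`.  A pair `(e, e')` in `joins` is a marked
point of a strand, at which the edge `e` ends and the edge `e'` begins. -/
structure PD (E : Type) where
  crossings : List (Crossing E)
  joins : List (E × E)

namespace PD

variable {E E' : Type}

/-- Relabelling of the edges. -/
def map (f : E → E') (D : PD E) : PD E' :=
  ⟨D.crossings.map (Crossing.map f), D.joins.map (Prod.map f f)⟩

/-- All passages (incoming edge, outgoing edge) of strands through crossings and marked points. -/
def strands (D : PD E) : List (E × E) :=
  D.crossings.flatMap Crossing.strands ++ D.joins

/-- The link components of the diagram. -/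
def Component (D : PD E) : Type :=
  Quot (fun e e' : E => (e, e') ∈ D.strands)

/-- The faces of the diagram: the classes of edge sides that are joined through corners (along a
marked point left sides meet left sides and right sides meet right sides). -/
def Face (D : PD E) : Type :=
  Quot (fun s s' : E × Bool =>
    (∃ x ∈ D.crossings, (s, s') ∈ x.corners) ∨ ((s.1, s'.1) ∈ D.joins ∧ s.2 = s'.2))

/-- The code describes a diagram of an oriented knot on the sphere: every edge ends at exactly one
place and begins at exactly one place, there is one component, and the Euler characteristic
`V - E + F` of the surface obtained by gluing a disc to every face is `2`. -/
structure IsKnot (D : PD E) : Prop where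
  ends_nodup : (D.strands.map Prod.fst).Nodup
  ends_all : ∀ e, e ∈ D.strands.map Prod.fst
  begins_nodup : (D.strands.map Prod.snd).Nodup
  begins_all : ∀ e, e ∈ D.strands.map Prod.snd
  one_component : Nat.card D.Component = 1
  planar : D.crossings.length + D.joins.length + Nat.card D.Face = Nat.card E + 2

/-- Elementary moves between codes: bookkeeping (renaming edges, reordering the lists, deleting a
marked point) and the Reidemeister moves.  The orientations of the crossings that appear are
determined by the requirement that both codes are codes of oriented knot diagrams. -/
inductive Move : {E E' : Type} → PD E → PD E' → Prop
  | relabel {E E' : Type} (f : E ≃ E') (D : PD E) : Move D (D.map f)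
  | reorder {E : Type} {L L' : List (Crossing E)} {J J' : List (E × E)}
      (hL : L.Perm L') (hJ : J.Perm J') : Move (⟨L, J⟩ : PD E) (⟨L', J'⟩ : PD E)
  /-- Deleting a marked point between two distinct edges `some a` and `none`. -/
  | unmark {E : Type} (a : E) (L : List (Crossing (Option E))) (J : List (Option E × Option E)) :
      Move (⟨L, (some a, none) :: J⟩ : PD (Option E)) ((⟨L, J⟩ : PD (Option E)).map (·.getD a))
  /-- The first move: a kink, whose loop is the new edge `none`. -/
  | r1 {E : Type} (σ : Bool) (a b : E) (p : E × E) (hp : p = (a, b) ∨ p = (b, a))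
      (x : Crossing (Option E)) (hx : x.Looks σ none none (some a) (some b))
      (L : List (Crossing E)) (J : List (E × E)) :
      Move (⟨L, p :: J⟩ : PD E)
        (⟨x :: L.map (Crossing.map some), J.map (Prod.map some some)⟩ : PD (Option E))
  /-- The second move: the strand with ends `c, d` is moved under the strand with ends `a, b`.
  The new edges `inr true` (upper strand) and `inr false` (lower strand) bound a bigon. -/
  | r2 {E : Type} (a b c d : E) (p q : E × E) (hp : p = (a, b) ∨ p = (b, a))
      (hq : q = (c, d) ∨ q = (d, c)) (x y : Crossing (E ⊕ Bool))
      (hx : x.Looks true (.inl c) (.inr true) (.inr false) (.inl a))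
      (hy : y.Looks true (.inr false) (.inr true) (.inl d) (.inl b))
      (L : List (Crossing E)) (J : List (E × E)) :
      Move (⟨L, p :: q :: J⟩ : PD E)
        (⟨x :: y :: L.map (Crossing.map Sum.inl), J.map (Prod.map Sum.inl Sum.inl)⟩ : PD (E ⊕ Bool))
  /-- The third move.  Three strands connect the ends `p₁, p₂, p₃` (at the bottom, from left to
  right) with the ends `q₃, q₂, q₁` (at the top, `q₁` on the left); the strand from `p₁` is the
  highest and the one from `p₃` the lowest for `σ = true`, vice versa for `σ = false`.  The edges
  `u, v, w` bound a triangle. -/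
  | r3 {E : Type} (σ : Bool) (p₁ p₂ p₃ q₁ q₂ q₃ u v w : E) (x y z x' y' z' : Crossing E)
      (hx : x.Looks σ p₂ u v p₁) (hy : y.Looks σ p₃ q₃ w u) (hz : z.Looks σ w q₂ q₁ v)
      (hx' : x'.Looks σ p₃ u v p₂) (hy' : y'.Looks σ v w q₁ p₁) (hz' : z'.Looks σ u q₃ q₂ w)
      (L : List (Crossing E)) (J : List (E × E)) :
      Move (⟨x :: y :: z :: L, J⟩ : PD E) (⟨x' :: y' :: z' :: L, J⟩ : PD E)

/-- Changing one crossing. -/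
inductive CrossingChange : {E E' : Type} → PD E → PD E' → Prop
  | mk {E : Type} (L₁ : List (Crossing E)) (x : Crossing E) (L₂ : List (Crossing E))
      (J : List (E × E)) :
      CrossingChange (⟨L₁ ++ x :: L₂, J⟩ : PD E) (⟨L₁ ++ x.change :: L₂, J⟩ : PD E)

end PD

/-- Diagrams of oriented knots. -/
structure KnotDiagram where
  E : Type
  pd : PD E
  isKnot : pd.IsKnot

/-- The diagram of the unknot without crossings: one edge, one marked point. -/
def unknotDiagram : KnotDiagram where
  E := Unit
  pd := ⟨[], [((), ())]⟩
  isKnot :=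
    { ends_nodup := by simp [PD.strands]
      ends_all := by simp [PD.strands]
      begins_nodup := by simp [PD.strands]
      begins_all := by simp [PD.strands]
      one_component := by
        rw [Nat.card_eq_one_iff_unique]
        exact ⟨⟨by rintro ⟨⟩ ⟨⟩; rfl⟩, ⟨Quot.mk _ ()⟩⟩
      planar := by
        let f : PD.Face (⟨[], [((), ())]⟩ : PD Unit) → Bool :=
          Quot.lift (fun s => s.2) (by rintro a b (⟨x, hx, _⟩ | ⟨_, h⟩); · simp at hx
                                       · exact h)
        have hf : Function.Bijective f := by
          constructor
          · rintro ⟨⟨⟨⟩, a⟩⟩ ⟨⟨⟨⟩, b⟩⟩ h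
            exact congrArg (fun t => Quot.mk _ ((), t)) (show a = b from h)
          · exact fun t => ⟨Quot.mk _ ((), t), rfl⟩
        rw [Nat.card_congr (Equiv.ofBijective f hf)]
        simp }

/-- Knots: knot diagrams modulo the equivalence relation generated by the moves. -/
def Knot : Type 1 := Quot (fun D D' : KnotDiagram => D.pd.Move D'.pd)

/-- The knot with a given diagram. -/
def KnotDiagram.knot (D : KnotDiagram) : Knot := Quot.mk _ D

/-- `K.UnknotsIn n`: the knot `K` can be turned into the unknot by `n` crossing changes, each of
them made in an arbitrary diagram of the knot at hand. -/
inductive Knot.UnknotsIn : Knot → ℕ → Prop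
  | zero : UnknotsIn unknotDiagram.knot 0
  | succ {D D' : KnotDiagram} {n : ℕ} (h : D.pd.CrossingChange D'.pd)
      (h' : UnknotsIn D'.knot n) : UnknotsIn D.knot (n + 1)

/-- The unknotting number. -/
noncomputable def Knot.unknottingNumber (K : Knot) : ℕ∞ :=
  ⨅ (n : ℕ) (_ : K.UnknotsIn n), (n : ℕ∞)

/-! ## The Khovanov complex and its deformations

The complex is formed over a commutative ring `k` with the relation `X ^ 2 = τ`, where `τ : k`.
Khovanov's complex is the case `k = ℚ`, `τ = 0`; the bigraded Lee complex is the case `k = ℚ[t]`,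
`τ = t`; Lee's original (filtered) complex is the case `k = ℚ`, `τ = 1`. -/

namespace PD

variable {E : Type}

/-- The vertices of the cube of resolutions. -/
abbrev Cube (D : PD E) : Type := Fin D.crossings.length → Bool

/-- The two edges are joined by an arc of the resolution `D_v`. -/
def Adjacent (D : PD E) (v : D.Cube) (e e' : E) : Prop :=
  (e, e') ∈ D.joins ∨ ∃ i, (e, e') ∈ (D.crossings.get i).arcs (v i)

/-- The two edges lie on the same circle of the resolution `D_v`. -/
def SameCircle (D : PD E) (v : D.Cube) (e e' : E) : Prop :=
  Relation.EqvGen (D.Adjacent v) e e'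

/-- The number of circles of the resolution `D_v`. -/
noncomputable def circles (D : PD E) (v : D.Cube) : ℕ := Nat.card (Quot (D.Adjacent v))

/-- The height of a vertex in the cube. -/
def height (D : PD E) (v : D.Cube) : ℕ := (Finset.univ.filter (fun i => v i = true)).card

/-- The number of positive crossings. -/
def nPos (D : PD E) : ℕ := D.crossings.countP (fun x => x.pos)

/-- The number of negative crossings. -/
def nNeg (D : PD E) : ℕ := D.crossings.countP (fun x => !x.pos)

open MvPolynomial

variable (k : Type) [CommRing k] (τ : k)

/-- The relations of the ring of `D_v`: `X_e ^ 2 = τ` for every edge, and `X_e = X_e'` if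
`e` and `e'` lie on the same circle. -/
noncomputable def relations (D : PD E) (v : D.Cube) : Ideal (MvPolynomial E k) :=
  Ideal.span ({f | ∃ e, f = X e ^ 2 - C τ} ∪ {f | ∃ e e', D.SameCircle v e e' ∧ f = X e - X e'})

/-- The ring `R_v` of the resolution `D_v`. -/
def VertexRing (D : PD E) (v : D.Cube) : Type :=
  MvPolynomial E k ⧸ D.relations k τ v

noncomputable instance (D : PD E) (v : D.Cube) : CommRing (D.VertexRing k τ v) :=
  inferInstanceAs (CommRing (MvPolynomial E k ⧸ D.relations k τ v))

noncomputable instance (D : PD E) (v : D.Cube) : Algebra k (D.VertexRing k τ v) :=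
  inferInstanceAs (Algebra k (MvPolynomial E k ⧸ D.relations k τ v))

/-- The projection of the polynomial ring in the edge variables to `R_v`. -/
noncomputable def toVertexRing (D : PD E) (v : D.Cube) :
    MvPolynomial E k →ₐ[k] D.VertexRing k τ v :=
  Ideal.Quotient.mkₐ k (D.relations k τ v)

open Classical in
/-- The factor of the edge map into `R_v` at the crossing `i`: it is `1` if the four edges at the
crossing lie on one circle of `D_v`, so that two circles merge, and `X_a + X_c` for two diagonal
edges if they lie on two circles of `D_v`, so that one circle splits. -/
noncomputable def edgeFactor (D : PD E) (v : D.Cube) (i : Fin D.crossings.length) :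
    MvPolynomial E k :=
  if D.SameCircle v (D.crossings.get i).a (D.crossings.get i).b then 1
  else X (D.crossings.get i).a + X (D.crossings.get i).c

theorem edgeFactor_mul_mem (D : PD E) (v : D.Cube) (i : Fin D.crossings.length)
    (hi : v i = true) :
    D.relations k τ (Function.update v i false) ≤
      Submodule.comap (LinearMap.mulLeft (MvPolynomial E k) (D.edgeFactor k v i))
        (D.relations k τ v) := by
  classical
  set I := D.relations k τ v with hI
  set x := D.crossings.get i with hx
  have sq : ∀ e, (X e ^ 2 - C τ : MvPolynomial E k) ∈ I := fun e =>
    Ideal.subset_span (Or.inl ⟨e, rfl⟩)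
  have same : ∀ {e e'}, D.SameCircle v e e' → (X e - X e' : MvPolynomial E k) ∈ I := fun h =>
    Ideal.subset_span (Or.inr ⟨_, _, h, rfl⟩)
  have had : D.SameCircle v x.a x.d :=
    .rel _ _ (Or.inr ⟨i, by rw [hi]; simp [Crossing.arcs, hx]⟩)
  have hbc : D.SameCircle v x.b x.c :=
    .rel _ _ (Or.inr ⟨i, by rw [hi]; simp [Crossing.arcs, hx]⟩)
  have key : ∀ e e', (e, e') ∈ x.arcs false →
      D.edgeFactor k v i * (X e - X e') ∈ I := by
    intro e e' he
    by_cases h : D.SameCircle v x.a x.b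
    · have hf : D.edgeFactor k v i = 1 := if_pos h
      rw [hf, one_mul]
      apply same
      simp only [Crossing.arcs, List.mem_cons, Prod.mk.injEq, List.not_mem_nil, or_false] at he
      rcases he with ⟨rfl, rfl⟩ | ⟨rfl, rfl⟩
      · exact h
      · exact (hbc.symm.trans _ _ _ (h.symm.trans _ _ _ had))
    · have hf : D.edgeFactor k v i = X x.a + X x.c := if_neg h
      rw [hf]
      simp only [Crossing.arcs, List.mem_cons, Prod.mk.injEq, List.not_mem_nil, or_false] at he
      rcases he with ⟨rfl, rfl⟩ | ⟨rfl, rfl⟩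
      · have e1 : (X x.a + X x.c : MvPolynomial E k) * (X x.a - X x.b) =
            (X x.a ^ 2 - C τ) - (X x.c ^ 2 - C τ) - (X x.a + X x.c) * (X x.b - X x.c) := by ring
        rw [e1]
        exact I.sub_mem (I.sub_mem (sq _) (sq _)) (I.mul_mem_left _ (same hbc))
      · have e1 : (X x.a + X x.c : MvPolynomial E k) * (X x.c - X x.d) =
            (X x.c ^ 2 - C τ) - (X x.a ^ 2 - C τ) + (X x.a + X x.c) * (X x.a - X x.d) := by ring
        rw [e1]
        exact I.add_mem (I.sub_mem (sq _) (sq _)) (I.mul_mem_left _ (same had))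
  have adj : ∀ e e', D.Adjacent (Function.update v i false) e e' →
      D.edgeFactor k v i * (X e - X e') ∈ I := by
    rintro e e' (h | ⟨j, h⟩)
    · exact I.mul_mem_left _ (same (.rel _ _ (Or.inl h)))
    · by_cases hj : j = i
      · subst hj
        exact key e e' (by simpa [hx] using h)
      · rw [Function.update_of_ne hj] at h
        exact I.mul_mem_left _ (same (.rel _ _ (Or.inr ⟨j, h⟩)))
  have gen : ∀ e e', D.SameCircle (Function.update v i false) e e' →
      D.edgeFactor k v i * (X e - X e') ∈ I := by
    intro e e' h
    induction h with
    | rel e e' h => exact adj e e' h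
    | refl e => simp
    | symm e e' _ ih => simpa [mul_sub] using I.neg_mem ih
    | trans e e' e'' _ _ ih ih' => simpa [mul_sub] using I.add_mem ih ih'
  refine Ideal.span_le.2 ?_
  rintro f (⟨e, rfl⟩ | ⟨e, e', h, rfl⟩)
  · exact I.mul_mem_left _ (sq e)
  · exact gen e e' h

/-- The map `R_u → R_v` along the edge `u ⋖ v` of the cube, where `u` is obtained from `v` by
changing `v i = 1` to `0`. -/
noncomputable def edgeMap (D : PD E) (v : D.Cube) (i : Fin D.crossings.length)
    (hi : v i = true) :
    D.VertexRing k τ (Function.update v i false) →ₗ[k] D.VertexRing k τ v :=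
  (Submodule.mapQ _ _ (LinearMap.mulLeft (MvPolynomial E k) (D.edgeFactor k v i))
    (D.edgeFactor_mul_mem k τ v i hi)).restrictScalars k

/-- The chain group `⨁ R_v`. -/
abbrev Chain (D : PD E) : Type := (v : D.Cube) → D.VertexRing k τ v

/-- The differential, the sum of the edge maps with the signs `(-1) ^ (∑ j < i, v j)`. -/
noncomputable def diff (D : PD E) : D.Chain k τ →ₗ[k] D.Chain k τ :=
  LinearMap.pi fun v => ∑ i : {i // v i = true},
    (-1 : k) ^ (Finset.univ.filter (fun j => j < i.1 ∧ v j = true)).card •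
      (D.edgeMap k τ v i.1 i.2 ∘ₗ LinearMap.proj (Function.update v i.1 false))

/-- The homology `ker d / im d` of the complex, a module over `k`. -/
abbrev Homology (D : PD E) : Type :=
  LinearMap.ker (D.diff k τ) ⧸
    (LinearMap.range (D.diff k τ)).submoduleOf (LinearMap.ker (D.diff k τ))

/-- The quantum grading of `1 ∈ R_v`. -/
noncomputable def topDegree (D : PD E) (v : D.Cube) : ℤ :=
  (D.nPos : ℤ) - 2 * D.nNeg + D.height v + D.circles v

/-- The part of `R_v` that is spanned by monomials in the `X_e` whose quantum grading satisfies
`P`, where every variable lowers the quantum grading by `2`. -/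
noncomputable def vertexPart (D : PD E) (v : D.Cube) (P : ℤ → Prop) :
    Submodule k (D.VertexRing k τ v) :=
  Submodule.span k {y | ∃ m : E →₀ ℕ, P (D.topDegree v - 2 * (m.degree : ℤ)) ∧
    y = D.toVertexRing k τ v (monomial m 1)}

end PD

namespace KnotDiagram

/-- Rational Khovanov homology. -/
abbrev Kh (D : KnotDiagram) : Type := D.pd.Homology ℚ 0

/-- The homogeneous part of Khovanov homology of homological grading `h` and quantum
grading `q`: the classes of cycles that are homogeneous of this bigrading. -/
def khPart (D : KnotDiagram) (h q : ℤ) : Set D.Kh :=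
  {y | ∃ z : LinearMap.ker (D.pd.diff ℚ 0), Submodule.Quotient.mk z = y ∧
    ∀ v, z.1 v ∈ D.pd.vertexPart ℚ 0 v (fun j => j = q) ∧
      (z.1 v ≠ 0 → (D.pd.height v : ℤ) - D.pd.nNeg = h)}

/-- Lee homology as a module over `ℚ[t]`. -/
abbrev LeeHomology (D : KnotDiagram) : Type := D.pd.Homology (Polynomial ℚ) Polynomial.X

open Classical in
/-- The maximal order of `t`-torsion in Lee homology, where the order of a torsion class `y` is
the least `n` with `t ^ n • y = 0`. -/
noncomputable def uT (D : KnotDiagram) : ℕ∞ :=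
  ⨆ (y : D.LeeHomology) (hy : ∃ n : ℕ, (Polynomial.X : Polynomial ℚ) ^ n • y = 0),
    ((Nat.find hy : ℕ) : ℕ∞)

/-- The subset of filtration level `q` in the homology of Lee's filtered complex, in which
`X ^ 2 = 1`: the classes of cycles all of whose terms have quantum grading at least `q`. -/
def leeFiltration (D : KnotDiagram) (q : ℤ) : Set (D.pd.Homology ℚ 1) :=
  {y | ∃ z : LinearMap.ker (D.pd.diff ℚ 1), Submodule.Quotient.mk z = y ∧
    ∀ v, z.1 v ∈ D.pd.vertexPart ℚ 1 v (fun j => q ≤ j)}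

/-- Rasmussen's invariant `s = s_max - 1`, where `s_max` is the largest filtration level of a
nonzero class in the homology of Lee's filtered complex. -/
noncomputable def s (D : KnotDiagram) : ℤ :=
  sSup {q : ℤ | ∃ y ∈ D.leeFiltration q, y ≠ 0} - 1

/-- Khovanov homology is the direct sum of a pawn move pair `ℚ{0, n - 1} ⊕ ℚ{0, n + 1}` and of
knight move pairs `ℚ{lᵢ, mᵢ} ⊕ ℚ{lᵢ + 1, mᵢ + 4}`: it has a basis of homogeneous elements with
these bigradings. -/
def HasKnightMoveDecomposition (D : KnotDiagram) (n : ℤ) : Prop :=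
  ∃ (r : ℕ) (l m : Fin r → ℤ) (b : Module.Basis (Bool ⊕ Fin r × Bool) ℚ D.Kh),
    b (.inl false) ∈ D.khPart 0 (n - 1) ∧
    b (.inl true) ∈ D.khPart 0 (n + 1) ∧
    ∀ i, b (.inr (i, false)) ∈ D.khPart (l i) (m i) ∧
      b (.inr (i, true)) ∈ D.khPart (l i + 1) (m i + 4)

end KnotDiagram

/-! On the complex over ℚ[t] the variable X of a base point satisfies X² = t, so it measures
t-torsion in half steps. Say that a diagram has bound n if Xⁿ annihilates every t-power torsion
class of its homology (`TorsionBound`, `PD.TB`). The unknot diagram without crossings has bound 0,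
since its complex is free with zero differential. The bound is invariant under the moves
(`PD.Move.tb_iff`), and a crossing change raises it by at most 1. So u(K) ≤ 2 gives bound 2, that
is, X² = t annihilates all torsion.

The step for a crossing change is short. The complex of a diagram is the cone of a saddle s : A → B
between the two resolutions of a crossing; after the change it is the cone of the reverse saddle s'
: B → A. Let X and Y be the variables of the opposite edges a and c. Then X = Y on images of
saddles, and both s's and ss' are X + Y. Hence there are maps f, g between the two cones, compatible
with the differentials up to sign, with gf = X − Y, while s' is a homotopy from X + Y to zero. So 2X
is homotopic to gf, and 2 is invertible (`TorsionBound.cone_swap`). The same homotopy gives X_a ≃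
−X_c, which makes the bound independent of the base point (`PD.IsKnot.tb_iff`). Invariance under the
Reidemeister moves comes from equivariant deformation retracts that cancel isolated circles.

Planarity is needed so that every edge of the cube merges or splits circles. The Euler
characteristic yields a checkerboard colouring (`PD.IsKnot.exists_check`). It turns the circles of a
resolution into the cycles of a permutation, and changing a resolution multiplies this permutation
by a transposition (`PD.rc_planar`).

For the knight moves, the differentials for τ = 0, t, 1 have the same integer matrix in the basis of
square-free monomials, up to powers of τ that are read off from the quantum degrees
(`ResCube.Planar.coord_diff`). At τ = 1 the differential is a sum of parts of degree 0, 4, and so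
on; the part of degree 0 is Khovanov's differential. Torsion of order at most 1 over ℚ[t] means that
the filtered differential is strict up to a shift by 4 (`ResCube.Planar.strict`). So the spectral
sequence from Khovanov to Lee homology has only one differential Φ, of bidegree (1, 4), and ker Φ /
im Φ is the associated graded space of Lee homology.

Lee homology of a knot is generated by the cycles of two complementary colourings, the eigenvectors
of the involution X. As X lowers the filtration by at most 2 and changes degrees by 2 modulo 4, the
two levels are s_max − 2 and s_max (`FilteredMatrix.exists_top_cycles`). Homogeneous elements whose
images under Φ form a basis of im Φ are paired with these images as knight moves, and the two
remaining classes form the exceptional pair (`exists_basis_of_range_of_ker`). -/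

/-! ## Circle rings and saddle maps -/

section CircleRings

open MvPolynomial

variable {E E' : Type} (k : Type) [CommRing k] (τ : k)

/-- The ideal generated by `X_e ^ 2 = τ` and `X_e = X_e'` for related edges. -/
noncomputable def circIdeal (r : Setoid E) : Ideal (MvPolynomial E k) :=
  Ideal.span ({f | ∃ e, f = X e ^ 2 - C τ} ∪ {f | ∃ e e', r e e' ∧ f = X e - X e'})

/-- The ring attached to a collection of circles, given as classes of edges. -/
def CircRing (r : Setoid E) : Type := MvPolynomial E k ⧸ circIdeal k τ r

noncomputable instance (r : Setoid E) : CommRing (CircRing k τ r) :=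
  inferInstanceAs (CommRing (MvPolynomial E k ⧸ circIdeal k τ r))

noncomputable instance (r : Setoid E) : Algebra k (CircRing k τ r) :=
  inferInstanceAs (Algebra k (MvPolynomial E k ⧸ circIdeal k τ r))

/-- The projection of the polynomial ring. -/
noncomputable def circMk (r : Setoid E) : MvPolynomial E k →ₐ[k] CircRing k τ r :=
  Ideal.Quotient.mkₐ k (circIdeal k τ r)

/-- The variable of an edge. -/
noncomputable def xv (r : Setoid E) (e : E) : CircRing k τ r := circMk k τ r (X e)

variable {k τ}

theorem circMk_surjective (r : Setoid E) : Function.Surjective (circMk k τ r) :=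
  Ideal.Quotient.mkₐ_surjective k _

theorem circMk_eq_zero {r : Setoid E} {p : MvPolynomial E k} :
    circMk k τ r p = 0 ↔ p ∈ circIdeal k τ r :=
  Ideal.Quotient.eq_zero_iff_mem

theorem circMk_X (r : Setoid E) (e : E) : circMk k τ r (X e) = xv k τ r e := rfl

theorem xv_sq (r : Setoid E) (e : E) : xv k τ r e * xv k τ r e = algebraMap k _ τ := by
  have : (X e ^ 2 - C τ : MvPolynomial E k) ∈ circIdeal k τ r :=
    Ideal.subset_span (Or.inl ⟨e, rfl⟩)
  have h := circMk_eq_zero.2 this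
  rw [map_sub, map_pow, sq, sub_eq_zero, ← MvPolynomial.algebraMap_eq, AlgHom.commutes] at h
  exact h

theorem xv_eq {r : Setoid E} {e e' : E} (h : r e e') : xv k τ r e = xv k τ r e' := by
  rw [← sub_eq_zero, xv, xv, ← map_sub]
  exact circMk_eq_zero.2 (Ideal.subset_span (Or.inr ⟨e, e', h, rfl⟩))

theorem circIdeal_le_of {A : Type} [CommRing A] [Algebra k A] (r : Setoid E)
    (f : MvPolynomial E k →ₐ[k] A) (h1 : ∀ e, f (X e) * f (X e) = algebraMap k A τ)
    (h2 : ∀ e e', r e e' → f (X e) = f (X e')) :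
    ∀ p ∈ circIdeal k τ r, f p = 0 := by
  intro p hp
  have : circIdeal k τ r ≤ RingHom.ker (f : MvPolynomial E k →+* A) := by
    refine Ideal.span_le.2 ?_
    rintro q (⟨e, rfl⟩ | ⟨e, e', h, rfl⟩)
    · simp only [SetLike.mem_coe, RingHom.mem_ker, RingHom.coe_coe, map_sub, sq, map_mul, h1]
      rw [← MvPolynomial.algebraMap_eq, AlgHom.commutes, sub_self]
    · simp [RingHom.mem_ker, h2 e e' h]
  exact this hp

/-- Algebra maps out of a circle ring. -/
noncomputable def circLift {A : Type} [CommRing A] [Algebra k A] (r : Setoid E) (x : E → A)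
    (h1 : ∀ e, x e * x e = algebraMap k A τ) (h2 : ∀ e e', r e e' → x e = x e') :
    CircRing k τ r →ₐ[k] A :=
  Ideal.Quotient.liftₐ _ (aeval x) (circIdeal_le_of r _ (by simpa using h1) (by simpa using h2))

@[simp]
theorem circLift_xv {A : Type} [CommRing A] [Algebra k A] (r : Setoid E) (x : E → A)
    (h1 : ∀ e, x e * x e = algebraMap k A τ) (h2 : ∀ e e', r e e' → x e = x e') (e : E) :
    circLift r x h1 h2 (xv k τ r e) = x e := by
  exact (Ideal.Quotient.lift_mk _ _ _).trans (aeval_X x e)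

/-- A submodule that contains `1` and is stable under all variables is everything. -/
theorem circ_submodule_eq_top (r : Setoid E) (U : Submodule k (CircRing k τ r)) (h1 : 1 ∈ U)
    (hX : ∀ e, ∀ z ∈ U, xv k τ r e * z ∈ U) (z : CircRing k τ r) : z ∈ U := by
  obtain ⟨p, rfl⟩ := circMk_surjective r z
  induction p using MvPolynomial.induction_on with
  | C a =>
    rw [← MvPolynomial.algebraMap_eq, AlgHom.commutes, Algebra.algebraMap_eq_smul_one]
    exact U.smul_mem _ h1
  | add p q hp hq => rw [map_add]; exact U.add_mem hp hq
  | mul_X p e hp => rw [map_mul, mul_comm]; exact hX e _ hp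

/-- Linear maps out of a circle ring that commute with the variables of a set of edges meeting
every circle are determined by the image of `1`. -/
theorem circ_ext {M : Type} [AddCommGroup M] [Module k M] (r : Setoid E) (O : Set E)
    (hO : ∀ e, ∃ e' ∈ O, r e e') (x : E → M → M) (φ ψ : CircRing k τ r →ₗ[k] M)
    (hφ : ∀ e ∈ O, ∀ z, φ (xv k τ r e * z) = x e (φ z))
    (hψ : ∀ e ∈ O, ∀ z, ψ (xv k τ r e * z) = x e (ψ z)) (h : φ 1 = ψ 1) : φ = ψ := by
  ext z
  refine circ_submodule_eq_top r (LinearMap.eqLocus φ ψ) h (fun e z hz => ?_) z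
  obtain ⟨e', he', hr⟩ := hO e
  change φ _ = ψ _
  rw [xv_eq hr, hφ e' he', hψ e' he', show φ z = ψ z from hz]

/-- The variant for one further circle, with a variable `n`. -/
theorem circ_ext_isolated {M : Type} [AddCommGroup M] [Module k M] (r : Setoid E) (n : E)
    (O : Set E) (hO : ∀ e, r n e ∨ ∃ e' ∈ O, r e e') (x : E → M → M)
    (φ ψ : CircRing k τ r →ₗ[k] M)
    (hφ : ∀ e ∈ O, ∀ z, φ (xv k τ r e * z) = x e (φ z))
    (hψ : ∀ e ∈ O, ∀ z, ψ (xv k τ r e * z) = x e (ψ z)) (h : φ 1 = ψ 1)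
    (hn : φ (xv k τ r n) = ψ (xv k τ r n)) : φ = ψ := by
  have key : ∀ e ∈ O, ∀ z, φ z = ψ z → φ (xv k τ r e * z) = ψ (xv k τ r e * z) := by
    intro e he z hz
    rw [hφ e he, hψ e he, hz]
  ext z
  -- The maps need not commute with the variable of `n`, so agreement is required at an element and
  -- at its product with that variable. As the square of the variable is the scalar τ, this subspace
  -- is stable.
  let U : Submodule k (CircRing k τ r) :=
    LinearMap.eqLocus φ ψ ⊓ (LinearMap.eqLocus φ ψ).comap (LinearMap.mulLeft k (xv k τ r n))
  have : z ∈ U := by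
    refine circ_submodule_eq_top r U ⟨h, ?_⟩ (fun e z hz => ?_) z
    · change φ (xv k τ r n * 1) = ψ (xv k τ r n * 1)
      rwa [mul_one]
    · have hz1 : φ z = ψ z := hz.1
      have hz2 : φ (xv k τ r n * z) = ψ (xv k τ r n * z) := hz.2
      refine ⟨?_, ?_⟩
      · change φ _ = ψ _
        rcases hO e with he | ⟨e', he', hr⟩
        · rw [← xv_eq he, hz2]
        · rw [xv_eq hr, key e' he' _ hz1]
      · change φ (xv k τ r n * _) = ψ (xv k τ r n * _)
        rcases hO e with he | ⟨e', he', hr⟩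
        · rw [← xv_eq he, ← mul_assoc, xv_sq, ← Algebra.smul_def, map_smul, map_smul, hz1]
        · rw [xv_eq hr, mul_left_comm, key e' he' _ hz2]
  exact this.1

/-! ### Saddles -/

/-- Two circle collections are joined by a saddle at the edges `a` and `c`. -/
structure Nb (r r' : Setoid E) (a c : E) : Prop where
  left : ∀ e e', r e e' → r' e e' ∨ (r' e a ∧ r' c e') ∨ (r' e c ∧ r' a e')
  right : ∀ e e', r' e e' → r e e' ∨ (r e a ∧ r c e') ∨ (r e c ∧ r a e')
  iff_not : r a c ↔ ¬ r' a c

/-- Each collection is contained in the gluing of the other at `a` and `c`, and `iff_not` says that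
exactly one direction is a merge. A saddle from one circle to one circle, as on a non-orientable
surface, is thereby excluded. -/
theorem Nb.symm {r r' : Setoid E} {a c : E} (h : Nb r r' a c) : Nb r' r a c :=
  ⟨h.right, h.left, by have := h.iff_not; tauto⟩

theorem Nb.swap {r r' : Setoid E} {a c : E} (h : Nb r r' a c) : Nb r r' c a := by
  refine ⟨fun e e' he => ?_, fun e e' he => ?_, ?_⟩
  · rcases h.left e e' he with h | h | h <;> tauto
  · rcases h.right e e' he with h | h | h <;> tauto
  · exact ⟨fun h1 h2 => h.iff_not.1 (r.symm' h1) (r'.symm' h2),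
      fun h1 => r.symm' (h.iff_not.2 fun h2 => h1 (r'.symm' h2))⟩

theorem Nb.le {r r' : Setoid E} {a c : E} (h : Nb r r' a c) (hm : r' a c) {e e' : E}
    (he : r e e') : r' e e' := by
  rcases h.left e e' he with h | h | h
  · exact h
  · exact r'.trans' h.1 (r'.trans' hm h.2)
  · exact r'.trans' h.1 (r'.trans' (r'.symm' hm) h.2)

variable (k) in
open Classical in
/-- The factor of a saddle map. -/
noncomputable def saddleFactor (r' : Setoid E) (a c : E) : MvPolynomial E k :=
  if r' a c then 1 else X a + X c

/-- In the split case, edges that are identified in `r` but not in `r'` give ±(X_a − X_c), which X_a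
+ X_c annihilates because both squares equal τ. -/
theorem saddleFactor_mul_mem {r r' : Setoid E} {a c : E}
    (h : ∀ e e', r e e' → r' e e' ∨ (r' e a ∧ r' c e') ∨ (r' e c ∧ r' a e')) :
    circIdeal k τ r ≤ Submodule.comap
      (LinearMap.mulLeft (MvPolynomial E k) (saddleFactor k r' a c)) (circIdeal k τ r') := by
  refine Ideal.span_le.2 ?_
  rintro f (⟨e, rfl⟩ | ⟨e, e', he, rfl⟩)
  · change saddleFactor k r' a c * (X e ^ 2 - C τ) ∈ circIdeal k τ r'
    exact Ideal.mul_mem_left _ _ (Ideal.subset_span (Or.inl ⟨e, rfl⟩))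
  · change saddleFactor k r' a c * (X e - X e') ∈ circIdeal k τ r'
    rw [← circMk_eq_zero, map_mul, map_sub, circMk_X, circMk_X]
    have key : (xv k τ r' a + xv k τ r' c) * (xv k τ r' a - xv k τ r' c) = 0 := by
      linear_combination xv_sq (k := k) (τ := τ) r' a - xv_sq (k := k) (τ := τ) r' c
    unfold saddleFactor
    split_ifs with hm
    · have : r' e e' := by
        rcases h e e' he with h | h | h
        · exact h
        · exact r'.trans' h.1 (r'.trans' hm h.2)
        · exact r'.trans' h.1 (r'.trans' (r'.symm' hm) h.2)
      rw [xv_eq this, sub_self, mul_zero]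
    · rw [map_add, circMk_X, circMk_X]
      rcases h e e' he with h | h | h
      · rw [xv_eq h, sub_self, mul_zero]
      · rw [xv_eq h.1, ← xv_eq h.2, key]
      · rw [xv_eq h.1, ← xv_eq h.2]
        linear_combination -key

variable (k τ) in
/-- The map of circle rings induced by multiplication with a polynomial. -/
noncomputable def polyMap (r r' : Setoid E) (f : MvPolynomial E k)
    (h : circIdeal k τ r ≤ Submodule.comap (LinearMap.mulLeft (MvPolynomial E k) f)
      (circIdeal k τ r')) : CircRing k τ r →ₗ[k] CircRing k τ r' :=
  (Submodule.mapQ _ _ (LinearMap.mulLeft (MvPolynomial E k) f) h).restrictScalars k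

theorem polyMap_mk (r r' : Setoid E) (f : MvPolynomial E k)
    (h : circIdeal k τ r ≤ Submodule.comap (LinearMap.mulLeft (MvPolynomial E k) f)
      (circIdeal k τ r')) (p : MvPolynomial E k) :
    polyMap k τ r r' f h (circMk k τ r p) = circMk k τ r' (f * p) := rfl

variable (k τ) in
open Classical in
/-- The saddle map between two circle rings (zero if there is no saddle). -/
noncomputable def saddle (r r' : Setoid E) (a c : E) : CircRing k τ r →ₗ[k] CircRing k τ r' :=
  if h : circIdeal k τ r ≤ Submodule.comap
      (LinearMap.mulLeft (MvPolynomial E k) (saddleFactor k r' a c)) (circIdeal k τ r') then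
    polyMap k τ r r' _ h
  else 0

theorem saddle_mk_of {r r' : Setoid E} {a c : E}
    (h : ∀ e e', r e e' → r' e e' ∨ (r' e a ∧ r' c e') ∨ (r' e c ∧ r' a e'))
    (p : MvPolynomial E k) :
    saddle k τ r r' a c (circMk k τ r p) = circMk k τ r' (saddleFactor k r' a c * p) := by
  rw [saddle, dif_pos (saddleFactor_mul_mem h), polyMap_mk]

/-- No saddle condition is needed: the default value zero is linear over the variables as well. -/
theorem saddle_xv_mul (r r' : Setoid E) (a c e : E) (z : CircRing k τ r) :
    saddle k τ r r' a c (xv k τ r e * z) = xv k τ r' e * saddle k τ r r' a c z := by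
  obtain ⟨p, rfl⟩ := circMk_surjective r z
  by_cases h : circIdeal k τ r ≤ Submodule.comap
      (LinearMap.mulLeft (MvPolynomial E k) (saddleFactor k r' a c)) (circIdeal k τ r')
  · rw [saddle, dif_pos h, xv, xv, ← map_mul, polyMap_mk, polyMap_mk, ← map_mul, mul_left_comm]
  · rw [saddle, dif_neg h]
    simp

theorem saddle_xv (r r' : Setoid E) (a c e : E) :
    saddle k τ r r' a c (xv k τ r e) = xv k τ r' e * saddle k τ r r' a c 1 := by
  rw [← saddle_xv_mul, mul_one]

open Classical in
theorem saddle_one_of {r r' : Setoid E} {a c : E}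
    (h : ∀ e e', r e e' → r' e e' ∨ (r' e a ∧ r' c e') ∨ (r' e c ∧ r' a e')) :
    saddle k τ r r' a c 1 = if r' a c then 1 else xv k τ r' a + xv k τ r' c := by
  rw [← map_one (circMk k τ r), saddle_mk_of h, mul_one, saddleFactor]
  split_ifs
  · exact map_one _
  · exact map_add _ _ _

open Classical in
theorem saddle_one {r r' : Setoid E} {a c : E} (h : Nb r r' a c) :
    saddle k τ r r' a c 1 = if r' a c then 1 else xv k τ r' a + xv k τ r' c :=
  saddle_one_of h.left

/-- The interleaved case: `p, q, s, t` lie on one circle and the first saddle separates `s` from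
`t`. The second one merges the pieces, so the four edges share a circle again, and either order is a
split followed by a merge. -/
theorem Nb.cross {r r₁ r₂ r₁₂ : Setoid E} {p q s t : E} (h1 : Nb r r₁ p q)
    (h12 : Nb r₁ r₁₂ s t) (h21 : Nb r₂ r₁₂ p q) (h : r s t) (h' : ¬ r₁ s t) :
    r p q ∧ ¬ r₂ p q ∧ ((r₁₂ p s ∧ r₁₂ q t) ∨ (r₁₂ p t ∧ r₁₂ q s)) := by
  have m : r₁₂ s t := by by_contra hn; exact h' (h12.iff_not.2 hn)
  have l : (r₁₂ p s ∧ r₁₂ q t) ∨ (r₁₂ p t ∧ r₁₂ q s) := by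
    rcases (h1.left s t h).resolve_left h' with ⟨h, h'⟩ | ⟨h, h'⟩
    · exact Or.inl ⟨r₁₂.symm' (h12.le m h), h12.le m h'⟩
    · exact Or.inr ⟨h12.le m h', r₁₂.symm' (h12.le m h)⟩
  refine ⟨h1.iff_not.2 fun hn => h' (h1.le hn h), fun hn => h21.iff_not.1 hn ?_, l⟩
  rcases l with ⟨h, h'⟩ | ⟨h, h'⟩
  · exact r₁₂.trans' h (r₁₂.trans' m (r₁₂.symm' h'))
  · exact r₁₂.trans' h (r₁₂.trans' (r₁₂.symm' m) (r₁₂.symm' h'))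

/-- This is `Nb.cross` with the first saddle run backwards: both saddles join the same two circles,
so either order is a merge followed by a split. -/
theorem Nb.cross' {r r₁ r₂ r₁₂ : Setoid E} {p q s t : E} (h1 : Nb r r₁ p q)
    (h2 : Nb r r₂ s t) (h12 : Nb r₁ r₁₂ s t) (h21 : Nb r₂ r₁₂ p q) (h : ¬ r s t) (h' : r₁ s t) :
    ¬ r p q ∧ r₂ p q ∧ ((r₁₂ p s ∧ r₁₂ q t) ∨ (r₁₂ p t ∧ r₁₂ q s)) := by
  have a := h1.symm.cross h2 h21.symm h' h
  have hp : ¬ r₁₂ p q := a.2.1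
  have hs : r₂ p q := h21.iff_not.2 hp
  have b := h12.left p q a.1
  refine ⟨h1.symm.iff_not.1 a.1, hs, ?_⟩
  rcases b.resolve_left hp with ⟨h, h'⟩ | ⟨h, h'⟩
  · exact Or.inl ⟨h, r₁₂.symm' h'⟩
  · exact Or.inr ⟨h, r₁₂.symm' h'⟩

/-- Both composites are linear over the variables, so only the image of 1 matters, which is a
product of two factors. If the saddles do not keep their types in both orders, the case is one of
`Nb.cross` and `Nb.cross'`, where X_p + X_q = X_s + X_t. -/
theorem saddle_comm {r r₁ r₂ r₁₂ : Setoid E} {p q s t : E} (h1 : Nb r r₁ p q)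
    (h2 : Nb r r₂ s t) (h12 : Nb r₁ r₁₂ s t) (h21 : Nb r₂ r₁₂ p q) (z : CircRing k τ r) :
    saddle k τ r₁ r₁₂ s t (saddle k τ r r₁ p q z) =
      saddle k τ r₂ r₁₂ p q (saddle k τ r r₂ s t z) := by
  classical
  suffices h : saddle k τ r₁ r₁₂ s t ∘ₗ saddle k τ r r₁ p q =
      saddle k τ r₂ r₁₂ p q ∘ₗ saddle k τ r r₂ s t from LinearMap.congr_fun h z
  refine circ_ext r Set.univ (fun e => ⟨e, trivial, r.refl' e⟩) (fun e z => xv k τ r₁₂ e * z) _ _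
    (fun e _ z => ?_) (fun e _ z => ?_) ?_
  · simp [saddle_xv_mul]
  · simp [saddle_xv_mul]
  have e1 : saddle k τ r₁ r₁₂ s t (saddle k τ r r₁ p q 1) =
      (if r₁ p q then 1 else xv k τ r₁₂ p + xv k τ r₁₂ q) *
        (if r₁₂ s t then 1 else xv k τ r₁₂ s + xv k τ r₁₂ t) := by
    rw [saddle_one h1]
    by_cases c1 : r₁ p q
    · rw [if_pos c1, if_pos c1, one_mul, saddle_one h12]
    · rw [if_neg c1, if_neg c1, map_add, saddle_xv, saddle_xv, saddle_one h12, add_mul]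
  have e2 : saddle k τ r₂ r₁₂ p q (saddle k τ r r₂ s t 1) =
      (if r₂ s t then 1 else xv k τ r₁₂ s + xv k τ r₁₂ t) *
        (if r₁₂ p q then 1 else xv k τ r₁₂ p + xv k τ r₁₂ q) := by
    rw [saddle_one h2]
    by_cases c1 : r₂ s t
    · rw [if_pos c1, if_pos c1, one_mul, saddle_one h21]
    · rw [if_neg c1, if_neg c1, map_add, saddle_xv, saddle_xv, saddle_one h21, add_mul]
  rw [LinearMap.comp_apply, LinearMap.comp_apply, e1, e2]
  have j1 : r₁ p q ↔ ¬ r p q := h1.symm.iff_not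
  have j2 : r₂ s t ↔ ¬ r s t := h2.symm.iff_not
  have j12 : r₁₂ s t ↔ ¬ r₁ s t := h12.symm.iff_not
  have j21 : r₁₂ p q ↔ ¬ r₂ p q := h21.symm.iff_not
  have f1 := h1.cross h12 h21
  have f2 := h1.cross' h2 h12 h21
  have f3 := h2.cross h21 h12
  have f4 := h2.cross' h1 h21 h12
  have hsum : (r₁₂ p s ∧ r₁₂ q t) ∨ (r₁₂ p t ∧ r₁₂ q s) →
      xv k τ r₁₂ p + xv k τ r₁₂ q = xv k τ r₁₂ s + xv k τ r₁₂ t := by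
    rintro (⟨h, h'⟩ | ⟨h, h'⟩)
    · rw [xv_eq h, xv_eq h']
    · rw [xv_eq h, xv_eq h', add_comm]
  simp only [j1, j2, j12, j21]
  by_cases Q0 : r s t <;> by_cases Q1 : r₁ s t <;> by_cases P0 : r p q <;>
    by_cases P2 : r₂ p q <;>
    simp only [Q0, Q1, P0, P2, not_true, not_false_iff, true_and, false_and, and_false,
      imp_false, true_imp_iff, false_imp_iff, if_true, if_false] at f1 f2 f3 f4 ⊢
  · ring
  · ring
  · rw [hsum f1, mul_comm]
  · rw [one_mul, one_mul, hsum f2]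
  · ring

/-- One of the two saddles is a merge with factor 1, the other a split with factor X_a + X_c. -/
theorem saddle_saddle {r r' : Setoid E} {a c : E} (h : Nb r r' a c) (z : CircRing k τ r) :
    saddle k τ r' r a c (saddle k τ r r' a c z) = xv k τ r a * z + xv k τ r c * z := by
  classical
  suffices h : saddle k τ r' r a c ∘ₗ saddle k τ r r' a c =
      LinearMap.mulLeft k (xv k τ r a + xv k τ r c) by
    rw [← add_mul]; exact LinearMap.congr_fun h z
  refine circ_ext r Set.univ (fun e => ⟨e, trivial, r.refl' e⟩) (fun e z => xv k τ r e * z) _ _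
    (fun e _ z => ?_) (fun e _ z => ?_) ?_
  · simp [saddle_xv_mul]
  · simp [mul_left_comm]
  rw [LinearMap.comp_apply, saddle_one h, LinearMap.mulLeft_apply, mul_one]
  have i := h.iff_not
  by_cases c1 : r' a c
  · rw [if_pos c1, saddle_one h.symm, if_neg (by tauto)]
  · rw [if_neg c1, map_add, saddle_xv, saddle_xv, saddle_one h.symm, if_pos (by tauto), mul_one,
      mul_one]

/-- After a merge the two variables coincide; after a split, (X_a − X_c)(X_a + X_c) = τ − τ = 0. -/
theorem xv_mul_saddle {r r' : Setoid E} {a c : E} (h : Nb r r' a c) (z : CircRing k τ r) :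
    xv k τ r' a * saddle k τ r r' a c z = xv k τ r' c * saddle k τ r r' a c z := by
  classical
  rw [← saddle_xv_mul, ← saddle_xv_mul]
  suffices h : saddle k τ r r' a c ∘ₗ LinearMap.mulLeft k (xv k τ r a) =
      saddle k τ r r' a c ∘ₗ LinearMap.mulLeft k (xv k τ r c) from LinearMap.congr_fun h z
  refine circ_ext r Set.univ (fun e => ⟨e, trivial, r.refl' e⟩) (fun e z => xv k τ r' e * z) _ _
    (fun e _ z => ?_) (fun e _ z => ?_) ?_
  · simp [saddle_xv_mul, mul_left_comm]
  · simp [saddle_xv_mul, mul_left_comm]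
  simp only [LinearMap.comp_apply, LinearMap.mulLeft_apply, saddle_xv_mul]
  rw [saddle_one h]
  split_ifs with c1
  · rw [xv_eq c1]
  · linear_combination xv_sq (k := k) (τ := τ) r' a - xv_sq (k := k) (τ := τ) r' c

/-! ### A circle that is merged into another one -/

theorem quad_algebraMap {A : Type} [CommRing A] [Algebra k A] (x y : A) (t : k) :
    algebraMap k (QuadraticAlgebra A x y) t = ⟨algebraMap k A t, 0⟩ := rfl

/-- The collection `ra` is obtained from `r` by merging the circle of `n` with the one of `a`. -/
structure Merge (r ra : Setoid E) (n a : E) : Prop extends Nb r ra n a where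
  same : ra n a

namespace Merge

variable {r ra rb : Setoid E} {n a b : E}

theorem not_rel (h : Merge r ra n a) : ¬ r n a := fun hn => h.iff_not.1 hn h.same

open Classical in
/-- The birth of a circle: the edges of the circle of `n` in `ra` are replaced by `a`. -/
noncomputable def birth (h : Merge r ra n a) : CircRing k τ ra →ₐ[k] CircRing k τ r :=
  circLift ra (fun e => if r n e then xv k τ r a else xv k τ r e)
    (fun e => by split_ifs <;> exact xv_sq _ _)
    (fun e e' he => by
      have hn := h.not_rel
      have hr := h.right e e' he
      have key : ∀ {e e'}, r e e' → ((r n e ∧ r n e') ∨ (¬ r n e ∧ ¬ r n e')) := by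
        intro e e' he
        by_cases c : r n e
        · exact Or.inl ⟨c, r.trans' c he⟩
        · exact Or.inr ⟨c, fun c' => c (r.trans' c' (r.symm' he))⟩
      rcases hr with hr | ⟨h1, h2⟩ | ⟨h1, h2⟩
      · rcases key hr with ⟨c, c'⟩ | ⟨c, c'⟩
        · rw [if_pos c, if_pos c']
        · rw [if_neg c, if_neg c', xv_eq hr]
      · rw [if_pos (r.symm' h1), if_neg fun c => hn (r.trans' c (r.symm' h2)), xv_eq h2]
      · rw [if_pos h2, if_neg fun c => hn (r.trans' c h1), xv_eq h1])

theorem birth_xv_mul (h : Merge r ra n a) {e : E} (he : ¬ r n e) (z : CircRing k τ ra) :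
    h.birth (xv k τ ra e * z) = xv k τ r e * h.birth (k := k) (τ := τ) z := by
  rw [map_mul, birth, circLift_xv, if_neg he]

open Classical in
/-- The coefficient of the variable of the circle of `n`. -/
noncomputable def coeff (h : Merge r ra n a) : CircRing k τ r →ₗ[k] CircRing k τ ra :=
  -- The ring of `r` is mapped to the ring of `ra` with a square root of τ adjoined, which is the
  -- image of the circle of `n`. The coefficient is then the imaginary part.
  let x : E → QuadraticAlgebra (CircRing k τ ra) (algebraMap k _ τ) 0 :=
    fun e => if r n e then ⟨0, 1⟩ else ⟨xv k τ ra e, 0⟩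
  ((QuadraticAlgebra.imₗ (algebraMap k (CircRing k τ ra) τ) 0).restrictScalars k) ∘ₗ
    (circLift r x
      (fun e => by
        simp only [x]
        split_ifs
        · rw [quad_algebraMap]; ext <;> simp
        · rw [quad_algebraMap]; ext <;> simp [xv_sq])
      (fun e e' he => by
        simp only [x]
        by_cases c : r n e
        · rw [if_pos c, if_pos (r.trans' c he)]
        · rw [if_neg c, if_neg fun c' => c (r.trans' c' (r.symm' he)), xv_eq (h.le h.same he)])
      ).toLinearMap

theorem coeff_one (h : Merge r ra n a) : h.coeff (k := k) (τ := τ) 1 = 0 := by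
  simp [coeff, QuadraticAlgebra.im_one]

theorem coeff_xv (h : Merge r ra n a) : h.coeff (k := k) (τ := τ) (xv k τ r n) = 1 := by
  simp [coeff]

theorem coeff_xv_mul (h : Merge r ra n a) {e : E} (he : ¬ r n e) (z : CircRing k τ r) :
    h.coeff (xv k τ r e * z) = xv k τ ra e * h.coeff z := by
  simp [coeff, he]

theorem saddle_one (h : Merge r ra n a) : saddle k τ r ra n a 1 = 1 := by
  rw [_root_.saddle_one h.toNb, if_pos h.same]

theorem saddle_symm_one (h : Merge r ra n a) :
    saddle k τ ra r n a 1 = xv k τ r n + xv k τ r a := by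
  rw [_root_.saddle_one h.toNb.symm, if_neg h.not_rel]

/-- The circle of `a` is not the one of `n`, and every edge is related to one off `n`. -/
theorem exists_outer (h : Merge r ra n a) (e : E) : ∃ e' ∈ {e' | ¬ r n e'}, ra e e' := by
  by_cases c : r n e
  · exact ⟨a, h.not_rel, ra.trans' (ra.symm' (h.le h.same c)) h.same⟩
  · exact ⟨e, c, ra.refl' e⟩

/-- The split multiplies by X_n + X_a, in which the circle of `n` has coefficient 1. -/
theorem coeff_saddle (h : Merge r ra n a) (z : CircRing k τ ra) :
    h.coeff (saddle k τ ra r n a z) = z := by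
  suffices e : h.coeff ∘ₗ saddle k τ ra r n a = LinearMap.id from LinearMap.congr_fun e z
  refine circ_ext ra _ h.exists_outer (fun e z => xv k τ ra e * z) _ _
    (fun e he z => ?_) (fun e _ z => rfl) ?_
  · rw [LinearMap.comp_apply, saddle_xv_mul, h.coeff_xv_mul he]; rfl
  · rw [LinearMap.comp_apply, h.saddle_symm_one, map_add, h.coeff_xv,
      ← mul_one (xv k τ r a), h.coeff_xv_mul h.not_rel, h.coeff_one]
    simp

theorem saddle_birth (h : Merge r ra n a) (z : CircRing k τ ra) :
    saddle k τ r ra n a (h.birth z) = z := by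
  suffices e : saddle k τ r ra n a ∘ₗ h.birth.toLinearMap = LinearMap.id from
    LinearMap.congr_fun e z
  refine circ_ext ra _ h.exists_outer (fun e z => xv k τ ra e * z) _ _
    (fun e he z => ?_) (fun e _ z => rfl) ?_
  · rw [LinearMap.comp_apply, AlgHom.toLinearMap_apply, h.birth_xv_mul he, saddle_xv_mul]; rfl
  · rw [LinearMap.comp_apply, AlgHom.toLinearMap_apply, map_one, h.saddle_one]; rfl

theorem coeff_birth (h : Merge r ra n a) (h' : Merge r rb n b) (z : CircRing k τ rb) :
    h.coeff (h'.birth z) = 0 := by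
  suffices e : h.coeff ∘ₗ h'.birth.toLinearMap = 0 from LinearMap.congr_fun e z
  refine circ_ext rb _ h'.exists_outer (fun e z => xv k τ ra e * z) _ _
    (fun e he z => ?_) (fun e _ z => by simp) ?_
  · rw [LinearMap.comp_apply, AlgHom.toLinearMap_apply, h'.birth_xv_mul he, h.coeff_xv_mul he]
    rfl
  · rw [LinearMap.comp_apply, AlgHom.toLinearMap_apply, map_one, h.coeff_one]; rfl

/-- The operator w = 1 − split ∘ coeff sends 1 to 1 and X_n to −X_a, so its image does not involve
the circle of `n`; on such elements merging and rebirth change nothing. The partners `a` and `b` may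
differ, as in the second Reidemeister move. -/
theorem birth_saddle (h : Merge r ra n a) (h' : Merge r rb n b) (z : CircRing k τ r) :
    h'.birth (saddle k τ r rb n b (z - saddle k τ ra r n a (h.coeff z))) =
      z - saddle k τ ra r n a (h.coeff z) := by
  let w : CircRing k τ r →ₗ[k] CircRing k τ r := LinearMap.id - saddle k τ ra r n a ∘ₗ h.coeff
  suffices e : h'.birth.toLinearMap ∘ₗ saddle k τ r rb n b ∘ₗ w = w from LinearMap.congr_fun e z
  have hw : ∀ e, ¬ r n e → ∀ z, w (xv k τ r e * z) = xv k τ r e * w z := by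
    intro e he z
    simp only [w, LinearMap.sub_apply, LinearMap.comp_apply, LinearMap.id_apply,
      h.coeff_xv_mul he, saddle_xv_mul, mul_sub]
  refine circ_ext_isolated r n {e' | ¬ r n e'} (fun e => ?_) (fun e z => xv k τ r e * z) _ _
    (fun e he z => ?_) hw ?_ ?_
  · by_cases c : r n e
    · exact Or.inl c
    · exact Or.inr ⟨e, c, r.refl' e⟩
  · simp only [LinearMap.comp_apply, AlgHom.toLinearMap_apply, hw e he, saddle_xv_mul,
      h'.birth_xv_mul he]
  · have : w 1 = 1 := by simp [w, h.coeff_one]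
    rw [LinearMap.comp_apply, LinearMap.comp_apply, this, h'.saddle_one,
      AlgHom.toLinearMap_apply, map_one]
  · have : w (xv k τ r n) = - (xv k τ r a) := by
      simp only [w, LinearMap.sub_apply, LinearMap.comp_apply, LinearMap.id_apply,
        h.coeff_xv, h.saddle_symm_one]
      abel
    rw [LinearMap.comp_apply, LinearMap.comp_apply, this, map_neg, saddle_xv, h'.saddle_one,
      AlgHom.toLinearMap_apply, map_neg, h'.birth_xv_mul h.not_rel, map_one, mul_one]

theorem rel_iff (h : Merge r ra n a) {p q : E} (hp : ¬ r n p) (hq : ¬ r n q) :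
    ra p q ↔ r p q := by
  refine ⟨fun hr => ?_, h.le h.same⟩
  rcases h.right p q hr with h | h | h
  · exact h
  · exact absurd (r.symm' h.1) hp
  · exact absurd h.2 hq

variable {r' ra' : Setoid E} {p q : E}

/-- A saddle with both feet off the circle of `n` does not interact with it. This makes the birth a
chain map, and `coeff_comm` does the same for the coefficient. -/
theorem birth_comm (h : Merge r ra n a) (h' : Merge r' ra' n a) (hs : Nb r r' p q)
    (hs' : Nb ra ra' p q) (hp : ¬ r n p) (hq : ¬ r n q) (hp' : ¬ r' n p) (hq' : ¬ r' n q)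
    (z : CircRing k τ ra) :
    h'.birth (saddle k τ ra ra' p q z) = saddle k τ r r' p q (h.birth z) := by
  classical
  have hN : ∀ e, r' n e → r n e := fun e he => by
    rcases hs.right n e he with h | h | h
    exacts [h, absurd h.1 hp, absurd h.1 hq]
  suffices e : h'.birth.toLinearMap ∘ₗ saddle k τ ra ra' p q =
      saddle k τ r r' p q ∘ₗ h.birth.toLinearMap from LinearMap.congr_fun e z
  refine circ_ext ra _ h.exists_outer (fun e z => xv k τ r' e * z) _ _
    (fun e he z => ?_) (fun e he z => ?_) ?_
  · simp only [LinearMap.comp_apply, AlgHom.toLinearMap_apply, saddle_xv_mul,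
      h'.birth_xv_mul fun c => he (hN e c)]
  · simp only [LinearMap.comp_apply, AlgHom.toLinearMap_apply, saddle_xv_mul,
      h.birth_xv_mul he]
  · simp only [LinearMap.comp_apply, AlgHom.toLinearMap_apply, map_one, _root_.saddle_one hs,
      _root_.saddle_one hs', h'.rel_iff hp' hq']
    split_ifs
    · rw [map_one]
    · rw [map_add, ← mul_one (xv k τ ra' p), ← mul_one (xv k τ ra' q), h'.birth_xv_mul hp',
        h'.birth_xv_mul hq', map_one, mul_one, mul_one]

theorem coeff_comm (h : Merge r ra n a) (h' : Merge r' ra' n a) (hs : Nb r r' p q)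
    (hs' : Nb ra ra' p q) (hp : ¬ r n p) (hq : ¬ r n q) (hp' : ¬ r' n p) (hq' : ¬ r' n q)
    (z : CircRing k τ r) :
    h'.coeff (saddle k τ r r' p q z) = saddle k τ ra ra' p q (h.coeff z) := by
  classical
  have hN : ∀ e, r' n e → r n e := fun e he => by
    rcases hs.right n e he with h | h | h
    exacts [h, absurd h.1 hp, absurd h.1 hq]
  suffices e : h'.coeff ∘ₗ saddle k τ r r' p q = saddle k τ ra ra' p q ∘ₗ h.coeff from
    LinearMap.congr_fun e z
  refine circ_ext_isolated r n {e' | ¬ r n e'} (fun e => ?_) (fun e z => xv k τ ra' e * z) _ _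
    (fun e he z => ?_) (fun e he z => ?_) ?_ ?_
  · by_cases c : r n e
    · exact Or.inl c
    · exact Or.inr ⟨e, c, r.refl' e⟩
  · simp only [LinearMap.comp_apply, saddle_xv_mul, h'.coeff_xv_mul fun c => he (hN e c)]
  · simp only [LinearMap.comp_apply, saddle_xv_mul, h.coeff_xv_mul he]
  · simp only [LinearMap.comp_apply, h.coeff_one, map_zero, _root_.saddle_one hs]
    split_ifs
    · rw [h'.coeff_one]
    · rw [map_add, ← mul_one (xv k τ r' p), ← mul_one (xv k τ r' q), h'.coeff_xv_mul hp',
        h'.coeff_xv_mul hq', h'.coeff_one, mul_zero, mul_zero, add_zero]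
  · simp only [LinearMap.comp_apply, h.coeff_xv, saddle_xv, _root_.saddle_one hs,
      _root_.saddle_one hs', h'.rel_iff hp' hq']
    split_ifs
    · rw [mul_one, h'.coeff_xv]
    · rw [mul_comm, add_mul, map_add, h'.coeff_xv_mul hp', h'.coeff_xv_mul hq', h'.coeff_xv,
        mul_one, mul_one]

end Merge

/-! ### Relabelling edges -/

/-- Mutually inverse correspondences of the circles of two collections. -/
structure CircIso (r : Setoid E) (r' : Setoid E') (f : E → E') (g : E' → E) : Prop where
  fwd : ∀ e e', r e e' → r' (f e) (f e')
  bwd : ∀ e e', r' e e' → r (g e) (g e')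
  gf : ∀ e, r (g (f e)) e
  fg : ∀ e, r' (f (g e)) e

namespace CircIso

variable {r₁ r₂ : Setoid E} {r₁' r₂' : Setoid E'} {f : E → E'} {g : E' → E}

/-- The induced isomorphism of circle rings. -/
noncomputable def equiv (h : CircIso r₁ r₁' f g) : CircRing k τ r₁ ≃ₐ[k] CircRing k τ r₁' :=
  AlgEquiv.ofAlgHom
    (circLift r₁ (fun e => xv k τ r₁' (f e)) (fun _ => xv_sq _ _)
      (fun e e' he => xv_eq (h.fwd e e' he)))
    (circLift r₁' (fun e => xv k τ r₁ (g e)) (fun _ => xv_sq _ _)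
      (fun e e' he => xv_eq (h.bwd e e' he)))
    (by
      apply AlgHom.toLinearMap_injective
      refine circ_ext r₁' Set.univ (fun e => ⟨e, trivial, r₁'.refl' e⟩)
        (fun e z => xv k τ r₁' e * z) _ _ (fun e _ z => ?_) (fun e _ z => rfl) ?_
      · simp [xv_eq (h.fg e)]
      · simp)
    (by
      apply AlgHom.toLinearMap_injective
      refine circ_ext r₁ Set.univ (fun e => ⟨e, trivial, r₁.refl' e⟩)
        (fun e z => xv k τ r₁ e * z) _ _ (fun e _ z => ?_) (fun e _ z => rfl) ?_
      · simp [xv_eq (h.gf e)]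
      · simp)

theorem equiv_xv (h : CircIso r₁ r₁' f g) (e : E) :
    h.equiv (k := k) (τ := τ) (xv k τ r₁ e) = xv k τ r₁' (f e) :=
  circLift_xv (τ := τ) r₁ _ (fun _ => xv_sq _ _) (fun e e' he => xv_eq (h.fwd e e' he)) e

theorem rel_iff (h : CircIso r₁ r₁' f g) {e e' : E} : r₁' (f e) (f e') ↔ r₁ e e' :=
  ⟨fun he => r₁.trans' (r₁.symm' (h.gf e)) (r₁.trans' (h.bwd _ _ he) (h.gf e')), h.fwd e e'⟩

theorem equiv_saddle (h₁ : CircIso r₁ r₁' f g) (h₂ : CircIso r₂ r₂' f g) {a c : E} {a' c' : E'}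
    (hs : Nb r₁ r₂ a c) (hs' : Nb r₁' r₂' a' c')
    (hac : (r₂' (f a) a' ∧ r₂' (f c) c') ∨ (r₂' (f a) c' ∧ r₂' (f c) a'))
    (z : CircRing k τ r₁) :
    h₂.equiv (saddle k τ r₁ r₂ a c z) = saddle k τ r₁' r₂' a' c' (h₁.equiv z) := by
  classical
  suffices e : h₂.equiv.toLinearMap ∘ₗ saddle k τ r₁ r₂ a c =
      saddle k τ r₁' r₂' a' c' ∘ₗ h₁.equiv.toLinearMap from LinearMap.congr_fun e z
  refine circ_ext r₁ Set.univ (fun e => ⟨e, trivial, r₁.refl' e⟩)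
    (fun e z => xv k τ r₂' (f e) * z) _ _ (fun e _ z => ?_) (fun e _ z => ?_) ?_
  · simp only [LinearMap.comp_apply, AlgEquiv.toLinearMap_apply, saddle_xv_mul, map_mul, equiv_xv]
  · simp only [LinearMap.comp_apply, AlgEquiv.toLinearMap_apply, saddle_xv_mul, map_mul, equiv_xv]
  · have hi : r₂' a' c' ↔ r₂ a c := by
      rw [← h₂.rel_iff]
      rcases hac with ⟨h, h'⟩ | ⟨h, h'⟩
      · exact ⟨fun c => r₂'.trans' h (r₂'.trans' c (r₂'.symm' h')),
          fun c => r₂'.trans' (r₂'.symm' h) (r₂'.trans' c h')⟩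
      · exact ⟨fun c => r₂'.trans' h (r₂'.trans' (r₂'.symm' c) (r₂'.symm' h')),
          fun c => r₂'.trans' (r₂'.symm' h') (r₂'.trans' (r₂'.symm' c) h)⟩
    simp only [LinearMap.comp_apply, AlgEquiv.toLinearMap_apply, map_one, saddle_one hs,
      saddle_one hs', hi]
    split_ifs
    · rw [map_one]
    · rw [map_add, equiv_xv, equiv_xv]
      rcases hac with ⟨h, h'⟩ | ⟨h, h'⟩
      · rw [xv_eq h, xv_eq h']
      · rw [xv_eq h, xv_eq h', add_comm]

end CircIso

end CircleRings

/-! ## Differential modules with an operator -/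

section DiffModules

variable {k : Type} [CommRing k] {A B C M Z : Type} [AddCommGroup A] [Module k A]
  [AddCommGroup B] [Module k B] [AddCommGroup C] [Module k C] [AddCommGroup M] [Module k M]
  [AddCommGroup Z] [Module k Z]

/-- Every cycle that represents a `t`-torsion class is annihilated by `x ^ n` in homology. -/
def TorsionBound (t : k) (d x : Module.End k M) (n : ℕ) : Prop :=
  ∀ z, d z = 0 → ∀ m : ℕ, t ^ m • z ∈ LinearMap.range d → (x ^ n) z ∈ LinearMap.range d

/-- The mapping cone of a map `s`. -/
def cone (dA : Module.End k A) (dB : Module.End k B) (s : A →ₗ[k] B) : Module.End k (A × B) :=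
  (dA ∘ₗ LinearMap.fst k A B).prod (s ∘ₗ LinearMap.fst k A B - dB ∘ₗ LinearMap.snd k A B)

@[simp]
theorem cone_apply (dA : Module.End k A) (dB : Module.End k B) (s : A →ₗ[k] B) (z : A × B) :
    cone dA dB s z = (dA z.1, s z.1 - dB z.2) := rfl

/-- The differential module `M` is a deformation retract of `Z`. -/
structure Retract (dZ xZ : Module.End k Z) (dM xM : Module.End k M) where
  i : M →ₗ[k] Z
  r : Z →ₗ[k] M
  H : Z →ₗ[k] Z
  i_d : ∀ m, dZ (i m) = i (dM m)
  r_d : ∀ z, r (dZ z) = dM (r z)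
  r_i : ∀ m, r (i m) = m
  htpy : ∀ z, z - i (r z) = dZ (H z) + H (dZ z)
  i_x : ∀ m, xZ (i m) = i (xM m)
  r_x : ∀ z, r (xZ z) = xM (r z)
  H_x : ∀ z, H (xZ z) = xZ (H z)

theorem pow_map_comm {x : Module.End k A} {y : Module.End k B} (f : A →ₗ[k] B)
    (h : ∀ a, f (x a) = y (f a)) (n : ℕ) (a : A) : f ((x ^ n) a) = (y ^ n) (f a) := by
  induction n generalizing a with
  | zero => rfl
  | succ n ih => rw [pow_succ, pow_succ, Module.End.mul_apply, Module.End.mul_apply, ih, h]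

/-- The torsion bound can be pulled back along a chain map with a homotopy left inverse. -/
theorem TorsionBound.of_htpy {t : k} {d x : Module.End k A} {d' x' : Module.End k B} {n : ℕ}
    (h : TorsionBound t d' x' n) (f : A →ₗ[k] B) (g : B →ₗ[k] A) (H : A →ₗ[k] A)
    (hf : ∀ a, f (d a) = d' (f a)) (hg : ∀ b, g (d' b) = d (g b))
    (hgx : ∀ b, g (x' b) = x (g b)) (hx : ∀ a, d (x a) = x (d a))
    (hH : ∀ a, a - g (f a) = d (H a) + H (d a)) : TorsionBound t d x n := by
  rintro z hz m ⟨w, hw⟩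
  obtain ⟨w', hw'⟩ := h (f z) (by rw [← hf, hz, map_zero]) m ⟨f w, by rw [← hf, hw, map_smul]⟩
  have e := hH z
  rw [hz, map_zero, add_zero, sub_eq_iff_eq_add] at e
  refine ⟨(x ^ n) (H z) + g w', ?_⟩
  rw [map_add, pow_map_comm d hx, ← hg, hw', pow_map_comm g hgx, ← map_add, ← e]

theorem Retract.torsionBound_iff {dZ xZ : Module.End k Z} {dM xM : Module.End k M}
    (R : Retract dZ xZ dM xM) (hx : ∀ a, dZ (xZ a) = xZ (dZ a))
    (hx' : ∀ a, dM (xM a) = xM (dM a)) {t : k} {n : ℕ} :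
    TorsionBound t dZ xZ n ↔ TorsionBound t dM xM n :=
  ⟨fun h => h.of_htpy R.i R.r 0 (fun m => (R.i_d m).symm) R.r_d R.r_x
    hx' (fun m => by simp [R.r_i]),
  fun h => h.of_htpy R.r R.i R.H R.r_d (fun m => (R.i_d m).symm) (fun m => (R.i_x m).symm)
    hx R.htpy⟩

theorem TorsionBound.of_equiv {t : k} {d x : Module.End k A} {d' x' : Module.End k B} {n : ℕ}
    (h : TorsionBound t d' x' n) (e : A ≃ₗ[k] B) (hd : ∀ a, e (d a) = d' (e a))
    (hx : ∀ a, e (x a) = x' (e a)) (hdx : ∀ a, d (x a) = x (d a)) : TorsionBound t d x n :=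
  h.of_htpy (e : A →ₗ[k] B) (e.symm : B →ₗ[k] A) 0 hd
    (fun b => by obtain ⟨a, rfl⟩ := e.surjective b; simp [← hd])
    (fun b => by obtain ⟨a, rfl⟩ := e.surjective b; simp [← hx]) hdx (fun a => by simp)

/-- `cone` negates the second differential, so some of the retracts end in a negated differential;
kernel and range do not see the sign. -/
theorem torsionBound_neg {t : k} {d x : Module.End k A} {n : ℕ} :
    TorsionBound t (-d) x n ↔ TorsionBound t d x n := by
  have : LinearMap.range (-d) = LinearMap.range d := LinearMap.range_neg d
  simp only [TorsionBound, this, LinearMap.neg_apply, neg_eq_zero]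

theorem TorsionBound.succ {t : k} {d x : Module.End k A} {n : ℕ} (h : TorsionBound t d x n)
    (hdx : ∀ a, d (x a) = x (d a)) : TorsionBound t d x (n + 1) := by
  rintro z hz m hm
  obtain ⟨w, hw⟩ := h z hz m hm
  exact ⟨x w, by rw [hdx, hw, pow_succ', Module.End.mul_apply]⟩

/-! ### Cones and retracts -/

variable {dZ xZ : Module.End k Z} {dM xM : Module.End k M} {dA xA : Module.End k A}
  {dB xB : Module.End k B} {dC xC : Module.End k C}

/-- A retract of the target of a map. -/
def Retract.coneRight (R : Retract dZ xZ dM xM) (hr : ∀ z, R.r (R.H z) = 0) (s : A →ₗ[k] Z)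
    (hs : ∀ a, s (dA a) = dZ (s a)) (hx : ∀ a, s (xA a) = xZ (s a)) :
    Retract (cone dA dZ s) (xA.prodMap xZ) (cone dA dM (R.r ∘ₗ s)) (xA.prodMap xM) where
  -- The part of `s a` outside `M` is compensated by `H (s a)`; the condition `hr` keeps `r ∘ i` the
  -- identity.
  i := (LinearMap.fst k A M).prod (R.i ∘ₗ LinearMap.snd k A M + R.H ∘ₗ s ∘ₗ LinearMap.fst k A M)
  r := LinearMap.prodMap LinearMap.id R.r
  H := -((0 : A × Z →ₗ[k] A).prod (R.H ∘ₗ LinearMap.snd k A Z))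
  i_d z := by
    have := R.htpy (s z.1)
    ext <;> simp [R.i_d, hs]
    grind
  r_d z := by ext <;> simp [R.r_d]
  r_i z := by ext <;> simp [R.r_i, hr]
  htpy z := by
    have := R.htpy z.2
    ext <;> simp
    grind
  i_x z := by ext <;> simp [R.i_x, R.H_x, hx]
  r_x z := by ext <;> simp [R.r_x]
  H_x z := by ext <;> simp [R.H_x]

/-- A retract of the source of a map. -/
def Retract.coneLeft (R : Retract dZ xZ dM xM) (hi : ∀ m, R.H (R.i m) = 0) (s : Z →ₗ[k] A)
    (hs : ∀ a, s (dZ a) = dA (s a)) (hx : ∀ a, s (xZ a) = xA (s a)) :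
    Retract (cone dZ dA s) (xZ.prodMap xA) (cone dM dA (s ∘ₗ R.i)) (xM.prodMap xA) where
  i := LinearMap.prodMap R.i LinearMap.id
  -- Dually, what `R.H` contracts is carried to `A` by `s` and subtracted; `hi` makes this
  -- correction vanish on the image of `i`.
  r := (R.r ∘ₗ LinearMap.fst k Z A).prod (LinearMap.snd k Z A - s ∘ₗ R.H ∘ₗ LinearMap.fst k Z A)
  H := (R.H ∘ₗ LinearMap.fst k Z A).prod 0
  i_d z := by ext <;> simp [R.i_d]
  r_d z := by
    have := congrArg s (R.htpy z.1)
    ext <;> simp [R.r_d, ← hs]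
    simp at this
    grind
  r_i z := by ext <;> simp [R.r_i, hi]
  htpy z := by
    have := R.htpy z.1
    ext <;> simp
    grind
  i_x z := by ext <;> simp [R.i_x]
  r_x z := by ext <;> simp [R.r_x, R.H_x, hx]
  H_x z := by ext <;> simp [R.H_x]

/-- The maps between a complex `C` with a further circle and complexes `A` and `B` in which this
circle is merged with other ones. -/
structure CircleMaps (dA xA : Module.End k A) (dC xC : Module.End k C)
    (dB xB : Module.End k B) where
  split : A →ₗ[k] C
  coeff : C →ₗ[k] A
  merge : C →ₗ[k] B
  birth : B →ₗ[k] C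
  split_d : ∀ z, split (dA z) = dC (split z)
  coeff_d : ∀ z, coeff (dC z) = dA (coeff z)
  merge_d : ∀ z, merge (dC z) = dB (merge z)
  birth_d : ∀ z, birth (dB z) = dC (birth z)
  split_x : ∀ z, split (xA z) = xC (split z)
  coeff_x : ∀ z, coeff (xC z) = xA (coeff z)
  merge_x : ∀ z, merge (xC z) = xB (merge z)
  birth_x : ∀ z, birth (xB z) = xC (birth z)
  coeff_split : ∀ z, coeff (split z) = z
  merge_birth : ∀ z, merge (birth z) = z
  coeff_birth : ∀ z, coeff (birth z) = 0
  birth_merge : ∀ z, birth (merge (z - split (coeff z))) = z - split (coeff z)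

namespace CircleMaps

/-- The first Reidemeister move with a merge map. -/
def r1Merge (S : CircleMaps dA xA dC xC dA xA) :
    Retract (cone dC dA S.merge) (xC.prodMap xA) dA xA where
  -- The merge is onto, with the birth as a section, so the cone retracts to its kernel. The
  -- correction moves the image of the split into that kernel.
  i := (S.split - S.birth ∘ₗ S.merge ∘ₗ S.split).prod 0
  r := S.coeff ∘ₗ LinearMap.fst k C A
  H := (S.birth ∘ₗ LinearMap.snd k C A).prod 0
  i_d z := by ext <;> simp [S.merge_birth, S.split_d, S.birth_d, S.merge_d]
  r_d z := by simp [S.coeff_d]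
  r_i z := by simp [S.coeff_split, S.coeff_birth]
  htpy z := by
    have := S.birth_merge z.1
    simp at this
    ext <;> simp [S.merge_birth, S.birth_d]
    grind
  i_x z := by ext <;> simp [S.split_x, S.birth_x, S.merge_x]
  r_x z := by simp [S.coeff_x]
  H_x z := by ext <;> simp [S.birth_x]

/-- The first Reidemeister move with a split map. -/
def r1Split (S : CircleMaps dA xA dC xC dA xA) :
    Retract (cone dA dC S.split) (xA.prodMap xC) (-dA) xA where
  i := (0 : A →ₗ[k] A).prod S.birth
  -- The split is injective, so the cone retracts to its cokernel. The correction makes this map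
  -- vanish on the image of the split.
  r := (S.merge - S.merge ∘ₗ S.split ∘ₗ S.coeff) ∘ₗ LinearMap.snd k A C
  H := (S.coeff ∘ₗ LinearMap.snd k A C).prod 0
  i_d z := by ext <;> simp [S.birth_d]
  r_d z := by simp [S.coeff_split, S.merge_d, S.split_d, S.coeff_d]
  r_i z := by simp [S.merge_birth, S.coeff_birth]
  htpy z := by
    have := S.birth_merge z.2
    simp at this
    ext <;> simp [S.coeff_split, S.coeff_d]
    grind
  i_x z := by ext <;> simp [S.birth_x]
  r_x z := by simp [S.merge_x, S.split_x, S.coeff_x]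
  H_x z := by ext <;> simp [S.coeff_x]

/-- The second Reidemeister move, with the circle in the second column of the square. -/
def r2 (S : CircleMaps dA xA dC xC dB xB) (s₁ : A →ₗ[k] M) (s₃ : M →ₗ[k] B)
    (h₁ : ∀ z, s₁ (dA z) = dM (s₁ z)) (h₃ : ∀ z, s₃ (dM z) = dB (s₃ z))
    (hx₁ : ∀ z, s₁ (xA z) = xM (s₁ z)) (hx₃ : ∀ z, s₃ (xM z) = xB (s₃ z))
    (h : ∀ z, s₃ (s₁ z) = S.merge (S.split z)) :
    Retract (cone (cone dA dM s₁) (cone dC dB S.merge) (S.split.prodMap s₃))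
      ((xA.prodMap xM).prodMap (xC.prodMap xB)) (-dM) xM where
  -- `A` cancels against the image of the split in `C`, and `B` against the image of the birth. The
  -- zigzag M → B → C corrects the inclusion of the survivor `M`, and C → A → M corrects the
  -- projection.
  i := ((0 : M →ₗ[k] A).prod LinearMap.id).prod ((S.birth ∘ₗ s₃).prod 0)
  r := LinearMap.snd k A M ∘ₗ LinearMap.fst k (A × M) (C × B) -
    s₁ ∘ₗ S.coeff ∘ₗ LinearMap.fst k C B ∘ₗ LinearMap.snd k (A × M) (C × B)
  H := ((S.coeff ∘ₗ LinearMap.fst k C B ∘ₗ LinearMap.snd k (A × M) (C × B)).prod 0).prod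
    ((-(S.birth ∘ₗ LinearMap.snd k C B ∘ₗ LinearMap.snd k (A × M) (C × B))).prod 0)
  i_d z := by ext <;> simp [S.merge_birth, h₃, S.birth_d]
  r_d z := by simp [S.coeff_split, S.coeff_d, h₁]
  r_i z := by simp [S.coeff_birth]
  htpy z := by
    have := S.birth_merge z.2.1
    simp at this
    ext <;> simp [S.merge_birth, S.coeff_split, S.coeff_d, S.birth_d, h]
    grind
  i_x z := by ext <;> simp [S.birth_x, hx₃]
  r_x z := by simp [S.coeff_x, hx₁]
  H_x z := by ext <;> simp [S.coeff_x, S.birth_x]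

/-- The second Reidemeister move, with the circle in the first column of the square. -/
def r2' (S : CircleMaps dA xA dC xC dB xB) (s₁ : A →ₗ[k] M) (s₃ : M →ₗ[k] B)
    (h₁ : ∀ z, s₁ (dA z) = dM (s₁ z)) (h₃ : ∀ z, s₃ (dM z) = dB (s₃ z))
    (hx₁ : ∀ z, s₁ (xA z) = xM (s₁ z)) (hx₃ : ∀ z, s₃ (xM z) = xB (s₃ z))
    (h : ∀ z, s₃ (s₁ z) = S.merge (S.split z)) :
    Retract (cone (cone dA dC S.split) (cone dM dB s₃) (s₁.prodMap S.merge))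
      ((xA.prodMap xC).prodMap (xM.prodMap xB)) (-dM) xM where
  i := ((0 : M →ₗ[k] A).prod (S.birth ∘ₗ s₃)).prod (LinearMap.id.prod 0)
  r := LinearMap.fst k M B ∘ₗ LinearMap.snd k (A × C) (M × B) -
    s₁ ∘ₗ S.coeff ∘ₗ LinearMap.snd k A C ∘ₗ LinearMap.fst k (A × C) (M × B)
  H := ((S.coeff ∘ₗ LinearMap.snd k A C ∘ₗ LinearMap.fst k (A × C) (M × B)).prod
    (S.birth ∘ₗ LinearMap.snd k M B ∘ₗ LinearMap.snd k (A × C) (M × B))).prod 0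
  i_d z := by ext <;> simp [S.merge_birth, h₃, S.birth_d]
  r_d z := by simp [S.coeff_split, S.coeff_d, h₁]
  r_i z := by simp [S.coeff_birth]
  htpy z := by
    have := S.birth_merge z.1.2
    simp at this
    ext <;> simp [S.merge_birth, S.coeff_split, S.coeff_d, S.birth_d, h]
    grind
  i_x z := by ext <;> simp [S.birth_x, hx₃]
  r_x z := by simp [S.coeff_x, hx₁]
  H_x z := by ext <;> simp [S.coeff_x, S.birth_x]

end CircleMaps

end DiffModules

/-! ## Cubes of resolutions -/

section Cubes

/-- A cube of circle collections on a set of edges, with the edges of the saddles. -/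
structure ResCube (E : Type) (n : ℕ) where
  rel : (Fin n → Bool) → Setoid E
  a : Fin n → E
  c : Fin n → E

namespace ResCube

variable {E E' : Type} {n : ℕ} (k : Type) [CommRing k] (τ : k)

/-- The chain group of a cube. -/
abbrev Chain (R : ResCube E n) : Type := (v : Fin n → Bool) → CircRing k τ (R.rel v)

/-- The exponent of the sign of an edge of the cube. -/
def sgn (v : Fin n → Bool) (i : Fin n) : ℕ :=
  (Finset.univ.filter (fun j => j < i ∧ v j = true)).card

/-- The differential of a cube. -/
noncomputable def diff (R : ResCube E n) : Module.End k (R.Chain k τ) :=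
  LinearMap.pi fun v => ∑ i, if v i = true then
    (-1 : k) ^ sgn v i • (saddle k τ (R.rel (Function.update v i false)) (R.rel v) (R.a i) (R.c i) ∘ₗ
      LinearMap.proj (Function.update v i false)) else 0

/-- A map of chain groups given by maps at the vertices. -/
noncomputable def mapV {R : ResCube E n} {R' : ResCube E' n}
    (φ : ∀ v, CircRing k τ (R.rel v) →ₗ[k] CircRing k τ (R'.rel v)) :
    R.Chain k τ →ₗ[k] R'.Chain k τ :=
  LinearMap.pi fun v => φ v ∘ₗ LinearMap.proj v

/-- Multiplication by the variable of an edge. -/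
noncomputable def mulX (R : ResCube E n) (e : E) : Module.End k (R.Chain k τ) :=
  mapV k τ fun v => LinearMap.mulLeft k (xv k τ (R.rel v) e)

/-- The saddle maps between two cubes. -/
noncomputable def saddleMap (R R' : ResCube E n) (a c : E) : R.Chain k τ →ₗ[k] R'.Chain k τ :=
  mapV k τ fun v => saddle k τ (R.rel v) (R'.rel v) a c

/-- All edges of the cube are saddles. -/
def Planar (R : ResCube E n) : Prop :=
  ∀ v i, v i = true → Nb (R.rel (Function.update v i false)) (R.rel v) (R.a i) (R.c i)

/-- The two faces of a cube in the first direction. -/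
abbrev face (R : ResCube E (n + 1)) (b : Bool) : ResCube E n where
  rel v := R.rel (Fin.cons b v : Fin (n + 1) → Bool)
  a i := R.a i.succ
  c i := R.c i.succ

variable {k τ}

theorem diff_apply (R : ResCube E n) (z : R.Chain k τ) (v : Fin n → Bool) :
    R.diff k τ z v = ∑ i, if v i = true then
      (-1 : k) ^ sgn v i • saddle k τ (R.rel (Function.update v i false)) (R.rel v) (R.a i) (R.c i)
        (z (Function.update v i false)) else 0 := by
  simp only [diff, LinearMap.pi_apply, LinearMap.sum_apply]
  refine Finset.sum_congr rfl fun i _ => ?_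
  split_ifs <;> rfl

@[simp]
theorem mapV_apply {R : ResCube E n} {R' : ResCube E' n}
    (φ : ∀ v, CircRing k τ (R.rel v) →ₗ[k] CircRing k τ (R'.rel v)) (z : R.Chain k τ)
    (v : Fin n → Bool) : mapV k τ φ z v = φ v (z v) := rfl

@[simp]
theorem mulX_apply (R : ResCube E n) (e : E) (z : R.Chain k τ) (v : Fin n → Bool) :
    R.mulX k τ e z v = xv k τ (R.rel v) e * z v := rfl

@[simp]
theorem saddleMap_apply (R R' : ResCube E n) (a c : E) (z : R.Chain k τ) (v : Fin n → Bool) :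
    saddleMap k τ R R' a c z v = saddle k τ (R.rel v) (R'.rel v) a c (z v) := rfl

theorem mapV_diff {R : ResCube E n} {R' : ResCube E' n}
    (φ : ∀ v, CircRing k τ (R.rel v) →ₗ[k] CircRing k τ (R'.rel v))
    (h : ∀ v i, v i = true → ∀ z,
      φ v (saddle k τ (R.rel (Function.update v i false)) (R.rel v) (R.a i) (R.c i) z) =
        saddle k τ (R'.rel (Function.update v i false)) (R'.rel v) (R'.a i) (R'.c i)
          (φ (Function.update v i false) z)) (z : R.Chain k τ) :
    mapV k τ φ (R.diff k τ z) = R'.diff k τ (mapV k τ φ z) := by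
  funext v
  rw [mapV_apply, diff_apply, diff_apply, map_sum]
  refine Finset.sum_congr rfl fun i _ => ?_
  split_ifs with hv
  · rw [map_smul, h v i hv, mapV_apply]
  · exact map_zero _

theorem diff_mulX (R : ResCube E n) (e : E) (z : R.Chain k τ) :
    R.diff k τ (R.mulX k τ e z) = R.mulX k τ e (R.diff k τ z) :=
  (mapV_diff (R := R) (R' := R) _ (fun _ _ _ _ => (saddle_xv_mul ..).symm) z).symm

theorem saddleMap_mulX (R R' : ResCube E n) (a c e : E) (z : R.Chain k τ) :
    saddleMap k τ R R' a c (R.mulX k τ e z) = R'.mulX k τ e (saddleMap k τ R R' a c z) := by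
  funext v
  simp [saddle_xv_mul]

theorem saddleMap_diff {R R' : ResCube E n} {a c : E} (hR : R.Planar) (hR' : R'.Planar)
    (ha : R.a = R'.a) (hc : R.c = R'.c) (h : ∀ v, Nb (R.rel v) (R'.rel v) a c)
    (z : R.Chain k τ) :
    saddleMap k τ R R' a c (R.diff k τ z) = R'.diff k τ (saddleMap k τ R R' a c z) := by
  refine mapV_diff _ (fun v i hv z => ?_) z
  have h' := hR' v i hv
  rw [← ha, ← hc] at h' ⊢
  exact saddle_comm (hR v i hv) (h _) (h v) h' z

theorem saddleMap_saddleMap {R R' : ResCube E n} {a c : E}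
    (h : ∀ v, Nb (R.rel v) (R'.rel v) a c) (z : R.Chain k τ) :
    saddleMap k τ R' R a c (saddleMap k τ R R' a c z) = R.mulX k τ a z + R.mulX k τ c z := by
  funext v
  simp [saddle_saddle (h v)]

theorem mulX_saddleMap {R R' : ResCube E n} {a c : E}
    (h : ∀ v, Nb (R.rel v) (R'.rel v) a c) (z : R.Chain k τ) :
    R'.mulX k τ a (saddleMap k τ R R' a c z) = R'.mulX k τ c (saddleMap k τ R R' a c z) := by
  funext v
  simp [xv_mul_saddle (h v)]

theorem saddleMap_comm {R₀ R₁ R₂ R₃ : ResCube E n} {p q s t : E}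
    (h1 : ∀ v, Nb (R₀.rel v) (R₁.rel v) p q) (h2 : ∀ v, Nb (R₀.rel v) (R₂.rel v) s t)
    (h12 : ∀ v, Nb (R₁.rel v) (R₃.rel v) s t) (h21 : ∀ v, Nb (R₂.rel v) (R₃.rel v) p q)
    (z : R₀.Chain k τ) :
    saddleMap k τ R₁ R₃ s t (saddleMap k τ R₀ R₁ p q z) =
      saddleMap k τ R₂ R₃ p q (saddleMap k τ R₀ R₂ s t z) := by
  funext v
  exact saddle_comm (h1 v) (h2 v) (h12 v) (h21 v) _

/-! ### Faces -/

theorem Planar.face {R : ResCube E (n + 1)} (h : R.Planar) (b : Bool) : (R.face b).Planar := by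
  intro v i hv
  have := h (Fin.cons b v) i.succ (by simpa using hv)
  rwa [← Fin.cons_update] at this

theorem Planar.nb {R : ResCube E (n + 1)} (h : R.Planar) (v : Fin n → Bool) :
    Nb ((R.face false).rel v) ((R.face true).rel v) (R.a 0) (R.c 0) := by
  have := h (Fin.cons true v) 0 rfl
  rwa [Fin.update_cons_zero] at this

variable (k τ) in
/-- The chain group of a cube is the product of the chain groups of two opposite faces. -/
noncomputable def consEquiv (R : ResCube E (n + 1)) :
    R.Chain k τ ≃ₗ[k] (R.face false).Chain k τ × (R.face true).Chain k τ where
  toFun z := (fun v => z (Fin.cons false v : Fin (n + 1) → Bool),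
    fun v => z (Fin.cons true v : Fin (n + 1) → Bool))
  map_add' _ _ := rfl
  map_smul' _ _ := rfl
  invFun z := Fin.consCases fun b v => match b with
    | false => z.1 v
    | true => z.2 v
  left_inv z := by
    funext v
    induction v using Fin.consCases with
    | cons b v => cases b <;> simp [Fin.consCases_cons]
  right_inv z := by
    ext v <;> simp [Fin.consCases_cons]

@[simp]
theorem consEquiv_fst (R : ResCube E (n + 1)) (z : R.Chain k τ) (v : Fin n → Bool) :
    (R.consEquiv k τ z).1 v = z (Fin.cons false v : Fin (n + 1) → Bool) := rfl

@[simp]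
theorem consEquiv_snd (R : ResCube E (n + 1)) (z : R.Chain k τ) (v : Fin n → Bool) :
    (R.consEquiv k τ z).2 v = z (Fin.cons true v : Fin (n + 1) → Bool) := rfl

theorem sgn_cons_succ (b : Bool) (v : Fin n → Bool) (i : Fin n) :
    sgn (Fin.cons b v : Fin (n + 1) → Bool) i.succ = (if b = true then 1 else 0) + sgn v i := by
  unfold sgn
  rw [Fin.card_filter_univ_succ']
  simp [Fin.succ_lt_succ_iff]

theorem sgn_zero (v : Fin (n + 1) → Bool) : sgn v 0 = 0 := by
  simp [sgn]

/-- On the face `true` every sign acquires a factor −1 from the first coordinate, which is the minus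
sign in `cone`. -/
theorem consEquiv_diff (R : ResCube E (n + 1)) (z : R.Chain k τ) :
    R.consEquiv k τ (R.diff k τ z) = cone ((R.face false).diff k τ) ((R.face true).diff k τ)
      (saddleMap k τ (R.face false) (R.face true) (R.a 0) (R.c 0)) (R.consEquiv k τ z) := by
  have key : ∀ (u u' v : Fin (n + 1) → Bool) (i : Fin (n + 1)), u = u' →
      saddle k τ (R.rel u) (R.rel v) (R.a i) (R.c i) (z u) =
        saddle k τ (R.rel u') (R.rel v) (R.a i) (R.c i) (z u') := by
    rintro u _ v i rfl; rfl
  ext v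
  · rw [consEquiv_fst, diff_apply, Fin.sum_univ_succ, cone_apply]
    change _ = (R.face false).diff k τ (R.consEquiv k τ z).1 v
    rw [diff_apply]
    simp only [Fin.cons_zero, Bool.false_eq_true, if_false, zero_add]
    refine Finset.sum_congr rfl fun i _ => ?_
    rw [Fin.cons_succ, sgn_cons_succ, key _ _ _ _ (Fin.cons_update ..).symm]
    simp only [Bool.false_eq_true, if_false, zero_add]
    rfl
  · rw [consEquiv_snd, diff_apply, Fin.sum_univ_succ, cone_apply]
    simp only [Fin.cons_zero, if_true, Pi.sub_apply]
    rw [diff_apply, sgn_zero, pow_zero, one_smul, key _ _ _ _ (Fin.update_cons_zero ..),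
      sub_eq_add_neg, ← Finset.sum_neg_distrib]
    refine congrArg₂ _ rfl (Finset.sum_congr rfl fun i _ => ?_)
    rw [Fin.cons_succ, sgn_cons_succ, key _ _ _ _ (Fin.cons_update ..).symm]
    simp only [if_true, pow_add, pow_one, neg_one_mul, neg_smul]
    split_ifs
    · rfl
    · exact neg_zero.symm

theorem consEquiv_mulX (R : ResCube E (n + 1)) (e : E) (z : R.Chain k τ) :
    R.consEquiv k τ (R.mulX k τ e z) =
      ((R.face false).mulX k τ e).prodMap ((R.face true).mulX k τ e) (R.consEquiv k τ z) := rfl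

/-- The torsion bound in terms of the cone on two faces. -/
theorem torsionBound_cons (R : ResCube E (n + 1)) (e : E) (t : k) (m : ℕ) :
    TorsionBound t (R.diff k τ) (R.mulX k τ e) m ↔
      TorsionBound t (cone ((R.face false).diff k τ) ((R.face true).diff k τ)
        (saddleMap k τ (R.face false) (R.face true) (R.a 0) (R.c 0)))
        (((R.face false).mulX k τ e).prodMap ((R.face true).mulX k τ e)) m := by
  refine ⟨fun h => h.of_equiv (R.consEquiv k τ).symm ?_ ?_ ?_,
    fun h => h.of_equiv (R.consEquiv k τ) R.consEquiv_diff (R.consEquiv_mulX e) (R.diff_mulX e)⟩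
  · intro z
    obtain ⟨w, rfl⟩ := (R.consEquiv k τ).surjective z
    rw [← consEquiv_diff, LinearEquiv.symm_apply_apply, LinearEquiv.symm_apply_apply]
  · intro z
    obtain ⟨w, rfl⟩ := (R.consEquiv k τ).surjective z
    rw [← consEquiv_mulX, LinearEquiv.symm_apply_apply, LinearEquiv.symm_apply_apply]
  · intro z
    simp [diff_mulX, saddleMap_mulX]

/-- Induction on the dimension: the cube is the cone of the saddle map, and a cone squares to zero
because this map commutes with the differentials of the faces. -/
theorem diff_diff {R : ResCube E n} (hR : R.Planar) (z : R.Chain k τ) :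
    R.diff k τ (R.diff k τ z) = 0 := by
  induction n with
  | zero => funext v; rw [diff_apply]; simp
  | succ n ih =>
    apply (R.consEquiv k τ).injective
    rw [consEquiv_diff, consEquiv_diff, map_zero, cone_apply, cone_apply]
    simp only [ih (hR.face _), map_sub, sub_zero]
    rw [saddleMap_diff (hR.face false) (hR.face true) rfl rfl hR.nb, sub_self]
    rfl

/-- Multiplication by `X_a + X_c` at the first crossing is null-homotopic. -/
theorem exists_nullHtpy {R : ResCube E (n + 1)} (hR : R.Planar) :
    ∃ H : Module.End k (R.Chain k τ), ∀ z,
      R.diff k τ (H z) + H (R.diff k τ z) = R.mulX k τ (R.a 0) z + R.mulX k τ (R.c 0) z := by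
  let S := saddleMap k τ (R.face false) (R.face true) (R.a 0) (R.c 0)
  -- The homotopy is the reverse saddle, from the 1-face to the 0-face. Both S'S and SS' are
  -- multiplication by X_a + X_c.
  let S' := saddleMap k τ (R.face true) (R.face false) (R.a 0) (R.c 0)
  let H₀ := (S' ∘ₗ LinearMap.snd k ((R.face false).Chain k τ) _).prod
    (0 : _ →ₗ[k] (R.face true).Chain k τ)
  refine ⟨(R.consEquiv k τ).symm.toLinearMap ∘ₗ H₀ ∘ₗ (R.consEquiv k τ).toLinearMap, fun z => ?_⟩
  apply (R.consEquiv k τ).injective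
  rw [map_add, map_add, R.consEquiv_diff, R.consEquiv_mulX, R.consEquiv_mulX]
  simp only [LinearMap.comp_apply, LinearEquiv.coe_coe, LinearEquiv.apply_symm_apply,
    R.consEquiv_diff]
  have h1 : ∀ z, S' ((R.face true).diff k τ z) = (R.face false).diff k τ (S' z) :=
    saddleMap_diff (hR.face true) (hR.face false) rfl rfl (fun v => (hR.nb v).symm)
  have h2 : ∀ z, S' (S z) = _ := saddleMap_saddleMap hR.nb
  have h3 : ∀ z, S (S' z) = _ := saddleMap_saddleMap fun v => (hR.nb v).symm
  change cone _ _ S _ + H₀ (cone _ _ S (R.consEquiv k τ z)) = _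
  ext1 <;> simp [H₀, h1, h2, h3]

end ResCube

end Cubes

/-! ## Isomorphisms of cubes -/

section CubeIso

namespace ResCube

variable {E E' : Type} {n n' : ℕ} {k : Type} [CommRing k] {τ : k}

/-- The isomorphism of chain groups induced by a correspondence of circles. -/
noncomputable def isoEquiv {R : ResCube E n} {R' : ResCube E' n} {f : E → E'} {g : E' → E}
    (h : ∀ v, CircIso (R.rel v) (R'.rel v) f g) : R.Chain k τ ≃ₗ[k] R'.Chain k τ :=
  LinearEquiv.piCongrRight fun v => (h v).equiv.toLinearEquiv

@[simp]
theorem isoEquiv_apply {R : ResCube E n} {R' : ResCube E' n} {f : E → E'} {g : E' → E}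
    (h : ∀ v, CircIso (R.rel v) (R'.rel v) f g) (z : R.Chain k τ) (v : Fin n → Bool) :
    isoEquiv h z v = (h v).equiv (z v) := rfl

theorem isoEquiv_mulX {R : ResCube E n} {R' : ResCube E' n} {f : E → E'} {g : E' → E}
    (h : ∀ v, CircIso (R.rel v) (R'.rel v) f g) (e : E) (z : R.Chain k τ) :
    isoEquiv h (R.mulX k τ e z) = R'.mulX k τ (f e) (isoEquiv h z) := by
  funext v
  simp [CircIso.equiv_xv]

theorem isoEquiv_diff {R : ResCube E n} {R' : ResCube E' n} {f : E → E'} {g : E' → E}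
    (h : ∀ v, CircIso (R.rel v) (R'.rel v) f g) (hR : R.Planar) (hR' : R'.Planar)
    (hac : ∀ v i, v i = true → (R'.rel v (f (R.a i)) (R'.a i) ∧ R'.rel v (f (R.c i)) (R'.c i)) ∨
      (R'.rel v (f (R.a i)) (R'.c i) ∧ R'.rel v (f (R.c i)) (R'.a i))) (z : R.Chain k τ) :
    isoEquiv h (R.diff k τ z) = R'.diff k τ (isoEquiv h z) :=
  mapV_diff (fun v => (h v).equiv.toLinearMap)
    (fun v i hv z => (h _).equiv_saddle (h v) (hR v i hv) (hR' v i hv) (hac v i hv) z) z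

/-- Renumbering the vertices of a cube. -/
def cubeEquiv (π : Fin n ≃ Fin n') : (Fin n → Bool) ≃ (Fin n' → Bool) :=
  Equiv.arrowCongr π (Equiv.refl Bool)

theorem cubeEquiv_symm_apply (π : Fin n ≃ Fin n') (v : Fin n' → Bool) (i : Fin n) :
    (cubeEquiv π).symm v i = v (π i) := rfl

/-- Renumbering the directions of a cube. -/
abbrev reindex (R : ResCube E n) (π : Fin n ≃ Fin n') : ResCube E n' where
  rel v := R.rel ((cubeEquiv π).symm v)
  a i := R.a (π.symm i)
  c i := R.c (π.symm i)

/-- The number of inversions at a vertex. -/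
def inversions (π : Fin n ≃ Fin n') (v : Fin n → Bool) : ℕ :=
  ∑ i, ∑ j, if i < j ∧ π j < π i then (v i).toNat * (v j).toNat else 0

/-- Lowering the coordinate `i` removes the inversions between `i` and the other raised coordinates.
Modulo two their number is the sum of the sign exponents before and after the renumbering. So the
sign (−1)^inversions turns a renumbering into a chain map. -/
theorem even_inversions (π : Fin n ≃ Fin n') (v : Fin n' → Bool) (i : Fin n)
    (hv : v (π i) = true) :
    Even ((inversions π ((cubeEquiv π).symm v) + sgn ((cubeEquiv π).symm v) i) +
      (sgn v (π i) + inversions π (Function.update ((cubeEquiv π).symm v) i false))) := by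
  classical
  set u := (cubeEquiv π).symm v with hu
  set u' := Function.update u i false with hu'
  have hui : u i = true := hv
  have hb : ∀ j, (u j).toNat = (u' j).toNat + if j = i then 1 else 0 := by
    intro j
    by_cases hj : j = i
    · subst hj; simp [hu', hui]
    · simp [hu', hj]
  have s1 : sgn u i = ∑ j, if j < i then (u' j).toNat else 0 := by
    rw [sgn, Finset.card_filter]
    refine Finset.sum_congr rfl fun j _ => ?_
    by_cases hj : j < i
    · simp only [hj, true_and, if_true, hu', Function.update_of_ne hj.ne]
      cases u j <;> rfl
    · simp [hj]
  have s2 : sgn v (π i) = ∑ j, if π j < π i then (u' j).toNat else 0 := by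
    rw [sgn, Finset.card_filter, ← Equiv.sum_comp π]
    refine Finset.sum_congr rfl fun j _ => ?_
    by_cases hj : π j < π i
    · have hne : j ≠ i := by rintro rfl; exact lt_irrefl _ hj
      simp only [hj, true_and, if_true, hu', Function.update_of_ne hne]
      rw [hu, cubeEquiv_symm_apply]
      cases v (π j) <;> rfl
    · simp [hj]
  have s3 : inversions π u = inversions π u' +
      ((∑ j, if i < j ∧ π j < π i then (u' j).toNat else 0) +
        ∑ j, if j < i ∧ π i < π j then (u' j).toNat else 0) := by
    have : ∀ j l, (if j < l ∧ π l < π j then (u j).toNat * (u l).toNat else 0) =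
        (if j < l ∧ π l < π j then (u' j).toNat * (u' l).toNat else 0) +
        ((if j = i then if i < l ∧ π l < π i then (u' l).toNat else 0 else 0) +
        (if l = i then if j < i ∧ π i < π j then (u' j).toNat else 0 else 0)) := by
      intro j l
      rw [hb j, hb l]
      by_cases hj : j = i <;> by_cases hl : l = i
      · subst hj; subst hl; simp
      · subst hj
        simp only [hl, if_true, if_false, add_zero, ← ite_add_zero]
        split_ifs <;> ring
      · subst hl
        simp only [hj, if_true, if_false, add_zero, zero_add]
        split_ifs <;> ring
      · simp [hj, hl]
    simp only [inversions, this, Finset.sum_add_distrib]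
    congr 2
    · rw [Finset.sum_comm]; simp
    · simp
  have s4 : Even ((∑ j, if i < j ∧ π j < π i then (u' j).toNat else 0) +
      (∑ j, if j < i ∧ π i < π j then (u' j).toNat else 0) + sgn u i + sgn v (π i)) := by
    rw [s1, s2, ← Finset.sum_add_distrib, ← Finset.sum_add_distrib, ← Finset.sum_add_distrib]
    refine Finset.even_sum _ fun j _ => ?_
    rcases lt_trichotomy i j with h | h | h
    · have h1 : ¬ j < i := not_lt.2 h.le
      by_cases h2 : π j < π i <;> simp [h, h1, h2]
    · subst h; simp
    · have h1 : ¬ i < j := not_lt.2 h.le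
      have h3 : π j ≠ π i := fun e => h.ne (π.injective e)
      rcases lt_or_gt_of_ne h3 with h2 | h2
      · simp [h, h1, h2, not_lt.2 h2.le]
      · simp [h, h1, h2, not_lt.2 h2.le]
  rw [s3]
  rw [Nat.even_iff] at s4 ⊢
  omega

/-- The chain groups of a cube and a renumbered cube are isomorphic. -/
noncomputable def reindexEquiv (R : ResCube E n) (π : Fin n ≃ Fin n') :
    R.Chain k τ ≃ₗ[k] (R.reindex π).Chain k τ :=
  LinearEquiv.piCongrLeft' k (fun v => CircRing k τ (R.rel v)) (cubeEquiv π) ≪≫ₗ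
    LinearEquiv.piCongrRight fun v =>
      LinearEquiv.smulOfUnit ((-1 : kˣ) ^ inversions π ((cubeEquiv π).symm v))

theorem reindexEquiv_apply (R : ResCube E n) (π : Fin n ≃ Fin n') (z : R.Chain k τ)
    (v : Fin n' → Bool) : R.reindexEquiv π z v =
      (-1 : k) ^ inversions π ((cubeEquiv π).symm v) • z ((cubeEquiv π).symm v) := by
  have : (((-1 : kˣ) ^ inversions π ((cubeEquiv π).symm v) : kˣ) : k) =
      (-1 : k) ^ inversions π ((cubeEquiv π).symm v) := by simp
  rw [← this]
  rfl

theorem cubeEquiv_symm_update (π : Fin n ≃ Fin n') (v : Fin n' → Bool) (i : Fin n) :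
    (cubeEquiv π).symm (Function.update v (π i) false) =
      Function.update ((cubeEquiv π).symm v) i false := by
  funext j
  simp [cubeEquiv_symm_apply, Function.update_apply]

theorem reindexEquiv_mulX (R : ResCube E n) (π : Fin n ≃ Fin n') (e : E) (z : R.Chain k τ) :
    R.reindexEquiv π (R.mulX k τ e z) = (R.reindex π).mulX k τ e (R.reindexEquiv π z) := by
  funext v
  rw [reindexEquiv_apply, mulX_apply, mulX_apply, reindexEquiv_apply, mul_smul_comm]

theorem reindexEquiv_diff (R : ResCube E n) (π : Fin n ≃ Fin n') (z : R.Chain k τ) :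
    R.reindexEquiv π (R.diff k τ z) = (R.reindex π).diff k τ (R.reindexEquiv π z) := by
  funext v
  rw [reindexEquiv_apply, diff_apply, diff_apply, Finset.smul_sum, ← Equiv.sum_comp π]
  refine Finset.sum_congr rfl fun i _ => ?_
  by_cases hv : v (π i) = true
  · rw [if_pos hv, if_pos (by exact hv), reindexEquiv_apply, map_smul, smul_smul, smul_smul,
      ← pow_add, ← pow_add]
    have key : ∀ u u' (w : Fin n → Bool) (i i' : Fin n), u = u' → i' = i →
        saddle k τ (R.rel u) (R.rel w) (R.a i) (R.c i) (z u) =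
          saddle k τ (R.rel u') (R.rel w) (R.a i') (R.c i') (z u') := by
      rintro u _ w i _ rfl rfl; rfl
    have h := even_inversions π v i hv
    rw [← cubeEquiv_symm_update] at h
    rw [neg_one_pow_congr (Nat.even_add.1 h)]
    congr 1
    exact key _ _ _ _ _ (cubeEquiv_symm_update π v i).symm (π.symm_apply_apply i)
  · rw [if_neg hv, if_neg (by exact hv), smul_zero]

theorem Planar.reindex {R : ResCube E n} (hR : R.Planar) (π : Fin n ≃ Fin n') :
    (R.reindex π).Planar := by
  intro v i hv
  have := hR ((cubeEquiv π).symm v) (π.symm i) (by simpa [cubeEquiv_symm_apply] using hv)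
  rw [← cubeEquiv_symm_update, π.apply_symm_apply] at this
  exact this

/-- An isomorphism of cubes, up to renumbering the directions and relabelling the edges. -/
structure Iso (R : ResCube E n) (R' : ResCube E' n') (π : Fin n ≃ Fin n') (f : E → E')
    (g : E' → E) : Prop where
  rel : ∀ v, CircIso (R.rel ((cubeEquiv π).symm v)) (R'.rel v) f g
  edges : ∀ v i, v (π i) = true →
    (R'.rel v (f (R.a i)) (R'.a (π i)) ∧ R'.rel v (f (R.c i)) (R'.c (π i))) ∨
      (R'.rel v (f (R.a i)) (R'.c (π i)) ∧ R'.rel v (f (R.c i)) (R'.a (π i)))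

/-- The isomorphism of chain complexes induced by an isomorphism of planar cubes. -/
theorem Iso.exists_equiv {R : ResCube E n} {R' : ResCube E' n'} {π : Fin n ≃ Fin n'}
    {f : E → E'} {g : E' → E} (h : R.Iso R' π f g) (hR : R.Planar) (hR' : R'.Planar) :
    ∃ F : R.Chain k τ ≃ₗ[k] R'.Chain k τ, (∀ z, F (R.diff k τ z) = R'.diff k τ (F z)) ∧
      (∀ e z, F (R.mulX k τ e z) = R'.mulX k τ (f e) (F z)) ∧
      ∀ z v, F z v = (-1 : k) ^ inversions π ((cubeEquiv π).symm v) •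
        (h.rel v).equiv (z ((cubeEquiv π).symm v)) := by
  refine ⟨R.reindexEquiv π ≪≫ₗ isoEquiv h.rel, fun z => ?_, fun e z => ?_, fun z v => ?_⟩
  · rw [LinearEquiv.trans_apply, LinearEquiv.trans_apply, reindexEquiv_diff]
    refine isoEquiv_diff (R := R.reindex π) h.rel (hR.reindex π) hR' (fun v i hv => ?_) _
    have := h.edges v (π.symm i) (by simpa using hv)
    rwa [π.apply_symm_apply] at this
  · rw [LinearEquiv.trans_apply, LinearEquiv.trans_apply, reindexEquiv_mulX]
    exact isoEquiv_mulX (R := R.reindex π) h.rel _ _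
  · rw [LinearEquiv.trans_apply, isoEquiv_apply, reindexEquiv_apply, map_smul]

theorem Iso.torsionBound_iff {R : ResCube E n} {R' : ResCube E' n'} {π : Fin n ≃ Fin n'}
    {f : E → E'} {g : E' → E} (h : R.Iso R' π f g) (hR : R.Planar) (hR' : R'.Planar) (e : E)
    (t : k) (m : ℕ) : TorsionBound t (R.diff k τ) (R.mulX k τ e) m ↔
      TorsionBound t (R'.diff k τ) (R'.mulX k τ (f e)) m := by
  obtain ⟨F, h1, h2, -⟩ := h.exists_equiv (k := k) (τ := τ) hR hR'
  refine ⟨fun H => H.of_equiv F.symm (fun z => ?_) (fun z => ?_) (R'.diff_mulX _),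
    fun H => H.of_equiv F h1 (h2 e) (R.diff_mulX e)⟩
  · obtain ⟨z, rfl⟩ := F.surjective z
    rw [← h1, F.symm_apply_apply, F.symm_apply_apply]
  · obtain ⟨z, rfl⟩ := F.surjective z
    rw [← h2, F.symm_apply_apply, F.symm_apply_apply]

theorem nullHtpy_of_iso {R : ResCube E n} {R' : ResCube E' n'} {π : Fin n ≃ Fin n'}
    {f : E → E'} {g : E' → E} (h : R.Iso R' π f g) (hR : R.Planar) (hR' : R'.Planar) {a c : E}
    (H : ∃ H : Module.End k (R'.Chain k τ), ∀ z,
      R'.diff k τ (H z) + H (R'.diff k τ z) = R'.mulX k τ (f a) z + R'.mulX k τ (f c) z) :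
    ∃ H : Module.End k (R.Chain k τ), ∀ z,
      R.diff k τ (H z) + H (R.diff k τ z) = R.mulX k τ a z + R.mulX k τ c z := by
  obtain ⟨F, h1, h2, -⟩ := h.exists_equiv (k := k) (τ := τ) hR hR'
  obtain ⟨H, hH⟩ := H
  refine ⟨F.symm.toLinearMap ∘ₗ H ∘ₗ F.toLinearMap, fun z => F.injective ?_⟩
  simp [h1, h2, hH]

end ResCube

end CubeIso

/-! ## Checkerboard colourings of planar diagrams -/

section Checkerboard

variable {E : Type}

/-- The orientation `o` of the edges (relative to the orientation of the knot) is alternating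
at the crossing. -/
def Crossing.Check (o : E → Bool) (x : Crossing E) : Prop :=
  if x.pos then o x.a = o x.b ∧ o x.c = o x.d ∧ o x.a ≠ o x.c
  else o x.a = o x.d ∧ o x.b = o x.c ∧ o x.a ≠ o x.c

/-- Alternating orientations of the edges of a diagram; equivalently, checkerboard colourings. -/
structure PD.Check (D : PD E) (o : E → Bool) : Prop where
  crossings : ∀ x ∈ D.crossings, x.Check o
  joins : ∀ p ∈ D.joins, o p.1 = o p.2

namespace PD

theorem IsKnot.finite {D : PD E} (h : D.IsKnot) : Finite E := by
  classical
  exact Finite.of_surjective (fun i : Fin (D.strands.map Prod.fst).length => _)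
    (fun e => List.mem_iff_get.1 (h.ends_all e))

/-- A function that is constant along strands is constant. -/
theorem IsKnot.const_of_strands {D : PD E} (h : D.IsKnot) {α : Type} (f : E → α)
    (hf : ∀ p ∈ D.strands, f p.1 = f p.2) (e e' : E) : f e = f e' := by
  have hs := (Nat.card_eq_one_iff_unique.1 h.one_component).1
  let F : D.Component → α := Quot.lift f fun e e' h => hf (e, e') h
  exact congrArg F (hs.allEq (Quot.mk _ e : D.Component) (Quot.mk _ e'))

theorem IsKnot.nonempty {D : PD E} (h : D.IsKnot) : Nonempty E := by
  obtain ⟨⟨e⟩⟩ := (Nat.card_eq_one_iff_unique.1 h.one_component).2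
  exact ⟨e⟩

/-- The vertices of the diagram. -/
abbrev Vertex (D : PD E) : Type := Fin D.crossings.length ⊕ Fin D.joins.length

/-- The strands at a vertex. -/
def vertexStrands (D : PD E) : D.Vertex → List (E × E)
  | .inl i => (D.crossings.get i).strands
  | .inr j => [D.joins.get j]

theorem sum_count_vertexStrands [DecidableEq E] (D : PD E) (f : E × E → E) (e : E) :
    ∑ x, ((D.vertexStrands x).map f).count e = (D.strands.map f).count e := by
  rw [Fintype.sum_sum_type, strands, List.map_append, List.count_append, List.map_flatMap,
    List.count_flatMap]
  congr 1
  · rw [← Fin.sum_univ_fun_getElem]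
    rfl
  · have : ∀ l : List (E × E), ∑ j : Fin l.length, (List.map f [l.get j]).count e =
        (l.map f).count e := by
      intro l
      induction l with
      | nil => simp
      | cons p l ih =>
        rw [List.map_cons, show f p :: l.map f = [f p] ++ l.map f from rfl, List.count_append, ← ih]
        exact Fin.sum_univ_succ _
    exact this D.joins

theorem mem_vertexStrands {D : PD E} {p : E × E} : p ∈ D.strands ↔ ∃ x, p ∈ D.vertexStrands x := by
  rw [strands, List.mem_append, List.mem_flatMap, Sum.exists]
  refine or_congr ?_ ?_
  · constructor
    · rintro ⟨x, hx, hp⟩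
      obtain ⟨i, rfl⟩ := List.mem_iff_get.1 hx
      exact ⟨i, hp⟩
    · rintro ⟨i, hp⟩
      exact ⟨_, List.get_mem _ i, hp⟩
  · simp only [vertexStrands, List.mem_singleton]
    rw [List.mem_iff_get]
    exact ⟨fun ⟨i, h⟩ => ⟨i, h.symm⟩, fun ⟨i, h⟩ => ⟨i, h.symm⟩⟩

open Classical in
/-- The incidence matrix modulo two of the vertices and the edges. -/
noncomputable def incidence (D : PD E) : Matrix D.Vertex E (ZMod 2) := fun x e =>
  ((((D.vertexStrands x).map Prod.fst).count e + ((D.vertexStrands x).map Prod.snd).count e : ℕ) :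
    ZMod 2)

theorem finrank_le_one_of_const {ι : Type} [Finite ι] (U : Submodule (ZMod 2) (ι → ZMod 2))
    (h : ∀ f ∈ U, ∀ i j, f i = f j) : Module.finrank (ZMod 2) U ≤ 1 := by
  have : U ≤ Submodule.span (ZMod 2) {fun _ => (1 : ZMod 2)} := by
    intro f hf
    rw [Submodule.mem_span_singleton]
    cases isEmpty_or_nonempty ι with
    | inl _ => exact ⟨0, Subsingleton.elim _ _⟩
    | inr hi =>
      obtain ⟨i⟩ := hi
      exact ⟨f i, funext fun j => by simp [h f hf i j]⟩
  refine (Submodule.finrank_mono this).trans ?_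
  exact (finrank_span_le_card _).trans (by simp)

/-- A function on the vertices in this kernel has equal values at the two ends of every edge, so it
is constant, as a single strand passes through everything. -/
theorem IsKnot.finrank_ker_transpose {D : PD E} (h : D.IsKnot) [Fintype E] :
    Module.finrank (ZMod 2) (LinearMap.ker D.incidence.transpose.mulVecLin) ≤ 1 := by
  classical
  refine finrank_le_one_of_const _ fun l hl => ?_
  -- For the first projection, `c f e` is the value of `l` at the vertex where `e` ends; for the
  -- second, at the vertex where `e` begins. There is exactly one such vertex.
  let c : (E × E → E) → E → ZMod 2 := fun f e =>
    ∑ x, (((D.vertexStrands x).map f).count e : ZMod 2) * l x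
  have hc : ∀ (f : E × E → E), (D.strands.map f).Nodup → ∀ x, ∀ p ∈ D.vertexStrands x,
      c f (f p) = l x := by
    intro f hf x p hp
    have hsum := D.sum_count_vertexStrands f (f p)
    have h1 : 1 ≤ ((D.vertexStrands x).map f).count (f p) :=
      List.one_le_count_iff.2 (List.mem_map_of_mem hp)
    have h2 := List.nodup_iff_count_le_one.1 hf (f p)
    rw [← Finset.add_sum_erase _ _ (Finset.mem_univ x)] at hsum
    have h3 : ∑ y ∈ Finset.univ.erase x, ((D.vertexStrands y).map f).count (f p) = 0 := by omega
    have h4 : ((D.vertexStrands x).map f).count (f p) = 1 := by omega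
    rw [Finset.sum_eq_zero_iff] at h3
    change ∑ x, _ = _
    rw [← Finset.add_sum_erase _ _ (Finset.mem_univ x), h4, Finset.sum_eq_zero, add_zero]
    · simp
    · intro y hy
      rw [h3 y hy]
      simp
  have hcc : ∀ e, c Prod.fst e = c Prod.snd e := by
    intro e
    have := congrFun (LinearMap.mem_ker.1 hl) e
    simp only [Matrix.mulVecLin_apply, Matrix.mulVec, dotProduct, Matrix.transpose_apply,
      incidence, Nat.cast_add, add_mul, Finset.sum_add_distrib, Pi.zero_apply] at this
    have h2 := CharTwo.add_eq_zero.1 this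
    exact h2
  have hconst := h.const_of_strands (c Prod.fst) (fun p hp => by
    obtain ⟨x, hx⟩ := mem_vertexStrands.1 hp
    rw [hc _ h.ends_nodup x p hx, hcc, hc _ h.begins_nodup x p hx])
  have hv : ∀ x, ∃ e, c Prod.fst e = l x := by
    rintro (i | j)
    · exact ⟨_, hc _ h.ends_nodup (.inl i) _ (List.mem_cons_self ..)⟩
    · exact ⟨_, hc _ h.ends_nodup (.inr j) _ (List.mem_cons_self ..)⟩
  intro i j
  obtain ⟨e, he⟩ := hv i
  obtain ⟨e', he'⟩ := hv j
  rw [← he, ← he', hconst e e']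

/-- The face at a side of an edge. -/
def faceOf (D : PD E) (s : E × Bool) : D.Face := Quot.mk _ s

/-- The coboundary of a function on the faces. -/
noncomputable def faceDelta (D : PD E) : (D.Face → ZMod 2) →ₗ[ZMod 2] (E → ZMod 2) :=
  LinearMap.pi fun e => LinearMap.proj (R := ZMod 2) (φ := fun _ => ZMod 2) (D.faceOf (e, false)) +
    LinearMap.proj (R := ZMod 2) (φ := fun _ => ZMod 2) (D.faceOf (e, true))

theorem faceDelta_apply (D : PD E) (β : D.Face → ZMod 2) (e : E) :
    D.faceDelta β e = β (D.faceOf (e, false)) + β (D.faceOf (e, true)) := rfl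

theorem face_corner {D : PD E} {x : Crossing E} (hx : x ∈ D.crossings) {s s' : E × Bool}
    (h : (s, s') ∈ x.corners) : D.faceOf s = D.faceOf s' :=
  Quot.sound (Or.inl ⟨x, hx, h⟩)

theorem face_join {D : PD E} {p : E × E} (hp : p ∈ D.joins) (b : Bool) :
    D.faceOf (p.1, b) = D.faceOf (p.2, b) :=
  Quot.sound (Or.inr ⟨hp, rfl⟩)

/-- Equal values on the two sides of each edge propagate through the corners at a crossing, and
hence along the strand. -/
theorem IsKnot.finrank_ker_faceDelta {D : PD E} (h : D.IsKnot) :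
    Module.finrank (ZMod 2) (LinearMap.ker D.faceDelta) ≤ 1 := by
  have := h.finite
  have : Finite D.Face := Quot.finite _
  refine finrank_le_one_of_const _ fun β hβ => ?_
  have hb : ∀ e, β (D.faceOf (e, false)) = β (D.faceOf (e, true)) := fun e =>
    CharTwo.add_eq_zero.1 (congrFun (LinearMap.mem_ker.1 hβ) e)
  have hconst := h.const_of_strands (fun e => β (D.faceOf (e, true))) (fun p hp => by
    obtain ⟨x, hx⟩ := mem_vertexStrands.1 hp
    rcases x with i | j
    · have hi := List.get_mem D.crossings i
      set x := D.crossings.get i with hxi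
      have hc : ∀ {s s' : E × Bool}, (s, s') ∈ x.corners →
          β (D.faceOf s) = β (D.faceOf s') := fun h => congrArg β (face_corner hi h)
      change p ∈ x.strands at hx
      unfold Crossing.strands at hx
      unfold Crossing.corners at hc
      cases hpos : x.pos
      · simp only [hpos, Bool.false_eq_true, if_false, List.mem_cons, List.not_mem_nil,
          or_false, Prod.mk.injEq] at hc hx
        have c1 := hc (Or.inl ⟨rfl, rfl⟩)
        have c2 := hc (Or.inr (Or.inl ⟨rfl, rfl⟩))
        have c3 := hc (Or.inr (Or.inr (Or.inl ⟨rfl, rfl⟩)))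
        rcases hx with rfl | rfl
        · change β (D.faceOf (x.a, true)) = β (D.faceOf (x.c, true))
          rw [← hb, ← hb, c1, ← hb, c2]
        · change β (D.faceOf (x.b, true)) = β (D.faceOf (x.d, true))
          rw [← hb, ← hb, c2, hb, c3]
      · simp only [hpos, if_true, List.mem_cons, List.not_mem_nil,
          or_false, Prod.mk.injEq] at hc hx
        have c1 := hc (Or.inl ⟨rfl, rfl⟩)
        have c2 := hc (Or.inr (Or.inl ⟨rfl, rfl⟩))
        have c3 := hc (Or.inr (Or.inr (Or.inl ⟨rfl, rfl⟩)))
        rcases hx with rfl | rfl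
        · change β (D.faceOf (x.a, true)) = β (D.faceOf (x.c, true))
          rw [← hb, ← hb, c1, hb, c2]
        · change β (D.faceOf (x.d, true)) = β (D.faceOf (x.b, true))
          rw [c2, hb, c3]
    · simp only [vertexStrands, List.mem_singleton] at hx
      have := face_join (List.get_mem D.joins j) true
      rw [← hx] at this
      exact congrArg β this)
  rintro ⟨e, b⟩ ⟨e', b'⟩
  have h1 : ∀ e b, β (D.faceOf (e, b)) = β (D.faceOf (e, true)) := by
    intro e b
    cases b
    · exact hb e
    · rfl
  exact (h1 e b).trans ((hconst e e').trans (h1 e' b').symm)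

theorem incidence_mulVec (D : PD E) [Fintype E] (g : E → ZMod 2) (x : D.Vertex) :
    D.incidence.mulVec g x = (((D.vertexStrands x).map fun p => g p.1 + g p.2)).sum := by
  classical
  have key : ∀ l : List E, ∑ e, ((l.count e : ℕ) : ZMod 2) * g e = (l.map g).sum := by
    intro l
    induction l with
    | nil => simp
    | cons a l ih =>
      simp only [List.count_cons, Nat.cast_add, add_mul, Finset.sum_add_distrib, ih,
        List.map_cons, List.sum_cons]
      rw [add_comm]
      congr 1
      simp [beq_iff_eq]
  simp only [Matrix.mulVec, dotProduct, incidence, Nat.cast_add, add_mul, Finset.sum_add_distrib,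
    key, List.map_map]
  rw [← List.sum_map_add]
  rfl

/-- Around the crossing each of the four corners is counted twice, so the sum vanishes modulo two.
-/
theorem sum_faceDelta_strands {D : PD E} {x : Crossing E} (hx : x ∈ D.crossings) (β : D.Face → ZMod 2) :
    ((x.strands.map fun p => D.faceDelta β p.1 + D.faceDelta β p.2)).sum = 0 := by
  have hc : ∀ {s s' : E × Bool}, (s, s') ∈ x.corners →
      β (D.faceOf s) = β (D.faceOf s') := fun h => congrArg β (face_corner hx h)
  have h2 : ∀ z : ZMod 2, z + z = 0 := CharTwo.add_self_eq_zero
  simp only [faceDelta_apply, Crossing.strands, List.map_cons, List.map_nil, List.sum_cons,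
    List.sum_nil]
  cases hpos : x.pos
  · have c1 := hc (s := (x.a, false)) (s' := (x.b, true)) (by simp [Crossing.corners, hpos])
    have c2 := hc (s := (x.b, false)) (s' := (x.c, false)) (by simp [Crossing.corners, hpos])
    have c3 := hc (s := (x.c, true)) (s' := (x.d, false)) (by simp [Crossing.corners, hpos])
    have c4 := hc (s := (x.d, true)) (s' := (x.a, true)) (by simp [Crossing.corners, hpos])
    simp only [Bool.false_eq_true, if_false, c1, c2, c3, c4]
    linear_combination h2 (β (D.faceOf (x.b, true))) + h2 (β (D.faceOf (x.c, false))) +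
      h2 (β (D.faceOf (x.d, false))) + h2 (β (D.faceOf (x.a, true)))
  · have c1 := hc (s := (x.a, false)) (s' := (x.b, false)) (by simp [Crossing.corners, hpos])
    have c2 := hc (s := (x.b, true)) (s' := (x.c, false)) (by simp [Crossing.corners, hpos])
    have c3 := hc (s := (x.c, true)) (s' := (x.d, true)) (by simp [Crossing.corners, hpos])
    have c4 := hc (s := (x.d, false)) (s' := (x.a, true)) (by simp [Crossing.corners, hpos])
    simp only [if_true, c1, c2, c3, c4]
    linear_combination h2 (β (D.faceOf (x.b, false))) + h2 (β (D.faceOf (x.c, false))) +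
      h2 (β (D.faceOf (x.d, true))) + h2 (β (D.faceOf (x.a, true)))

theorem range_faceDelta_le (D : PD E) [Fintype E] :
    LinearMap.range D.faceDelta ≤ LinearMap.ker D.incidence.mulVecLin := by
  rintro _ ⟨β, rfl⟩
  refine LinearMap.mem_ker.2 (funext fun x => ?_)
  rw [Matrix.mulVecLin_apply, incidence_mulVec]
  rcases x with i | j
  · exact sum_faceDelta_strands (List.get_mem _ i) β
  · have h1 := fun b => congrArg β (face_join (List.get_mem D.joins j) b)
    simp only [vertexStrands, List.map_cons, List.map_nil, List.sum_cons, List.sum_nil,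
      faceDelta_apply, h1]
    exact (add_zero _).trans (CharTwo.add_self_eq_zero _)

/-- The first cohomology of the sphere over 𝔽₂ vanishes, here by a dimension count. All vertices
have even degree, so the constant function 1 lies in the kernel of the incidence matrix and is the
coboundary of a function on the faces: the two sides of an edge get different colours. The colour on
the left of an edge is its alternating orientation. -/
theorem IsKnot.exists_check {D : PD E} (h : D.IsKnot) : ∃ o, D.Check o := by
  classical
  have := h.finite
  have : Fintype E := Fintype.ofFinite E
  have : Finite D.Face := Quot.finite _
  have : Fintype D.Face := Fintype.ofFinite _
  have h1 := D.faceDelta.finrank_range_add_finrank_ker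
  have h2 := D.incidence.mulVecLin.finrank_range_add_finrank_ker
  have h3 := D.incidence.transpose.mulVecLin.finrank_range_add_finrank_ker
  have h4 := h.finrank_ker_faceDelta
  have h5 := h.finrank_ker_transpose
  have h6 : Module.finrank (ZMod 2) (LinearMap.range D.incidence.transpose.mulVecLin) =
    Module.finrank (ZMod 2) (LinearMap.range D.incidence.mulVecLin) := D.incidence.rank_transpose
  have h7 := h.planar
  rw [Module.finrank_fintype_fun_eq_card] at h1 h2 h3
  rw [Nat.card_eq_fintype_card, Nat.card_eq_fintype_card] at h7
  rw [Fintype.card_sum, Fintype.card_fin, Fintype.card_fin] at h3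
  -- The range of the coboundary has dimension at least F − 1, the kernel of the incidence matrix
  -- has dimension at most E − (V − 1), and V − E + F = 2.
  have heq := Submodule.eq_of_le_of_finrank_le D.range_faceDelta_le (by omega)
  have hone : (fun _ => 1 : E → ZMod 2) ∈ LinearMap.range D.faceDelta := by
    rw [heq]
    refine LinearMap.mem_ker.2 (funext fun x => ?_)
    rw [Matrix.mulVecLin_apply, incidence_mulVec]
    rcases x with i | j <;>
      simp [CharTwo.add_self_eq_zero, vertexStrands, Crossing.strands]
  obtain ⟨β, hβ⟩ := hone
  have hf : ∀ e, β (D.faceOf (e, false)) = β (D.faceOf (e, true)) + 1 := fun e => by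
    have := congrFun hβ e
    rw [faceDelta_apply] at this
    linear_combination this - CharTwo.add_self_eq_zero (β (D.faceOf (e, true)))
  have hdec : ∀ z w : ZMod 2, decide (z = 1) = decide (w = 1) ↔ z = w := by decide
  have hdec' : ∀ z w : ZMod 2, decide (z = 1) ≠ decide (w = 1) ↔ z = w + 1 := by decide
  refine ⟨fun e => decide (β (D.faceOf (e, true)) = 1), fun x hx => ?_, fun p hp => ?_⟩
  · have hc : ∀ {s s' : E × Bool}, (s, s') ∈ x.corners →
        β (D.faceOf s) = β (D.faceOf s') := fun h => congrArg β (face_corner hx h)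
    have h11 : ∀ z : ZMod 2, z + 1 + 1 = z := by decide
    unfold Crossing.Check
    rw [hdec, hdec, hdec, hdec, hdec']
    cases hpos : x.pos
    · have c1 := hc (s := (x.a, false)) (s' := (x.b, true)) (by simp [Crossing.corners, hpos])
      have c2 := hc (s := (x.b, false)) (s' := (x.c, false)) (by simp [Crossing.corners, hpos])
      have c4 := hc (s := (x.d, true)) (s' := (x.a, true)) (by simp [Crossing.corners, hpos])
      rw [hf] at c1
      rw [hf, hf, add_left_inj] at c2
      exact ⟨c4.symm, c2, by rw [← c2, ← c1, h11]⟩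
    · have c1 := hc (s := (x.a, false)) (s' := (x.b, false)) (by simp [Crossing.corners, hpos])
      have c2 := hc (s := (x.b, true)) (s' := (x.c, false)) (by simp [Crossing.corners, hpos])
      have c3 := hc (s := (x.c, true)) (s' := (x.d, true)) (by simp [Crossing.corners, hpos])
      rw [hf, hf, add_left_inj] at c1
      rw [hf] at c2
      exact ⟨c1, c3, c1.trans c2⟩
  · rw [hdec]
    exact congrArg β (face_join hp true)

end PD

end Checkerboard

/-! ## The cube of resolutions of a planar diagram -/

section PlanarCube

variable {E : Type}

/-- Gluing two classes of an equivalence relation. -/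
def glueSetoid (r : Setoid E) (a c : E) : Setoid E where
  r e e' := r e e' ∨ (r e a ∧ r c e') ∨ (r e c ∧ r a e')
  iseqv :=
    { refl e := Or.inl (r.refl' e)
      symm h := by
        rcases h with h | h | h
        · exact Or.inl (r.symm' h)
        · exact Or.inr (Or.inr ⟨r.symm' h.2, r.symm' h.1⟩)
        · exact Or.inr (Or.inl ⟨r.symm' h.2, r.symm' h.1⟩)
      trans {x y z} h h' := by
        rcases h with h | h | h <;> rcases h' with h' | h' | h'
        · exact Or.inl (r.trans' h h')
        · exact Or.inr (Or.inl ⟨r.trans' h h'.1, h'.2⟩)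
        · exact Or.inr (Or.inr ⟨r.trans' h h'.1, h'.2⟩)
        · exact Or.inr (Or.inl ⟨h.1, r.trans' h.2 h'⟩)
        · exact Or.inr (Or.inl ⟨h.1, h'.2⟩)
        · exact Or.inl (r.trans' h.1 h'.2)
        · exact Or.inr (Or.inr ⟨h.1, r.trans' h.2 h'⟩)
        · exact Or.inl (r.trans' h.1 h'.2)
        · exact Or.inr (Or.inr ⟨h.1, h'.2⟩) }

theorem eqvGen_le {r : E → E → Prop} (s : Setoid E) (h : ∀ e e', r e e' → s e e') {e e' : E}
    (he : Relation.EqvGen.setoid r e e') : s e e' :=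
  Setoid.eqvGen_le h he

/-! ### Cycles of a permutation composed with a transposition. -/

namespace Equiv.Perm

variable [Finite E] [DecidableEq E]

/-- From `p` the product steps to σ q and then follows the σ-cycle of `q`, which does not contain
`p`, until it reaches `q`. -/
theorem sameCycle_mul_swap_of_not {σ : Perm E} {p q : E} (h : ¬ σ.SameCycle p q) :
    (σ * swap p q).SameCycle p q := by
  by_contra hn
  have key : ∀ k : ℕ, (σ * swap p q).SameCycle p ((σ ^ (k + 1)) q) := by
    intro k
    induction k with
    | zero => exact ⟨1, by simp⟩
    | succ k ih =>
      have h1 : (σ ^ (k + 1)) q ≠ p := fun e =>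
        h ((SameCycle.symm ⟨(k + 1 : ℕ), by rw [zpow_natCast]; exact e⟩))
      have h2 : (σ ^ (k + 1)) q ≠ q := fun e => hn (by rwa [e] at ih)
      refine ih.trans ⟨1, ?_⟩
      rw [zpow_one, mul_apply, swap_apply_of_ne_of_ne h1 h2, pow_succ' σ (k + 1), mul_apply]
  have hk := key (orderOf σ - 1)
  rw [Nat.sub_add_cancel (orderOf_pos σ), pow_orderOf_eq_one, one_apply] at hk
  exact hn hk

/-- With n minimal such that σⁿ p = q, the orbit of `q` under the product stays among the σʲ p with
0 < j ≤ n, and none of these is `p`. -/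
theorem not_sameCycle_mul_swap {σ : Perm E} {p q : E} (hpq : p ≠ q) (h : σ.SameCycle p q) :
    ¬ (σ * swap p q).SameCycle p q := by
  have hex : ∃ n : ℕ, (σ ^ n) p = q :=
     h.exists_nat_pow_eq
  classical
  set n := Nat.find hex with hn
  have hnq : (σ ^ n) p = q := Nat.find_spec hex
  have hmin : ∀ m < n, (σ ^ m) p ≠ q := fun m hm => Nat.find_min hex hm
  have hn0 : n ≠ 0 := by
    intro e
    rw [e] at hnq
    exact hpq hnq
  have hp : ∀ j, 0 < j → j ≤ n → (σ ^ j) p ≠ p := by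
    intro j h0 hj e
    refine hmin (n - j) (by omega) ?_
    have h1 := hnq
    rw [← Nat.sub_add_cancel hj, pow_add, mul_apply, e] at h1
    exact h1
  have key : ∀ k : ℕ, ∃ j, 0 < j ∧ j ≤ n ∧ ((σ * swap p q) ^ k) q = (σ ^ j) p := by
    intro k
    induction k with
    | zero => exact ⟨n, by omega, le_rfl, hnq.symm⟩
    | succ k ih =>
      obtain ⟨j, h0, hj, e⟩ := ih
      rw [pow_succ' (σ * swap p q), mul_apply, e, mul_apply]
      rcases hj.lt_or_eq with hj' | rfl
      · rw [swap_apply_of_ne_of_ne (hp j h0 hj) (hmin j hj')]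
        exact ⟨j + 1, by omega, hj', by rw [pow_succ', mul_apply]⟩
      · rw [hnq, swap_apply_right]
        exact ⟨1, one_pos, by omega, by rw [pow_one]⟩
  intro hs
  obtain ⟨k, hk⟩ := hs.symm.exists_nat_pow_eq
  obtain ⟨j, h0, hj, e⟩ := key k
  exact hp j h0 hj (e.symm.trans hk)

theorem sameCycle_mul_swap_iff {σ : Perm E} {p q : E} (hpq : p ≠ q) :
    (σ * swap p q).SameCycle p q ↔ ¬ σ.SameCycle p q :=
  ⟨fun h h' => not_sameCycle_mul_swap hpq h' h, sameCycle_mul_swap_of_not⟩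

end Equiv.Perm

namespace Crossing

/-- The edges whose alternating orientation ends at the crossing. -/
def hd (o : E → Bool) (x : Crossing E) (b : Bool) : E :=
  if o x.a then (if b then x.c else x.a) else (if b then x.d else x.b)

/-- The edges whose alternating orientation begins at the crossing. -/
def tl (o : E → Bool) (x : Crossing E) (b : Bool) : E :=
  if o x.a then (if b then x.d else x.b) else (if b then x.c else x.a)

/-- In an alternating orientation two opposite edges end at the crossing and the other two begin
there: `a` and `c` end if `o x.a` is true, `b` and `d` otherwise. -/
theorem Check.strands {o : E → Bool} {x : Crossing E} (h : x.Check o) {p : E × E}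
    (hp : p ∈ x.strands) :
    (o p.1 = true → ∃ b, x.hd o b = p.1) ∧ (o p.1 = false → ∃ b, x.tl o b = p.1) ∧
    (o p.2 = false → ∃ b, x.hd o b = p.2) ∧ (o p.2 = true → ∃ b, x.tl o b = p.2) := by
  unfold Check at h
  simp only [Crossing.strands, List.mem_cons, List.not_mem_nil, or_false] at hp
  unfold hd tl
  simp only [Bool.exists_bool]
  cases hpos : x.pos <;> simp only [hpos, Bool.false_eq_true, if_false, if_true] at h hp <;>
    obtain ⟨h1, h2, h3⟩ := h <;> rcases hp with rfl | rfl <;>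
    cases ha : o x.a <;> cases hb : o x.b <;> cases hc : o x.c <;> cases hd : o x.d <;>
    simp_all

end Crossing

namespace PD

/-- The cube of resolutions of a diagram. -/
def rc (D : PD E) : ResCube E D.crossings.length where
  rel v := Relation.EqvGen.setoid (D.Adjacent v)
  a i := (D.crossings.get i).a
  c i := (D.crossings.get i).c

theorem rc_adj {D : PD E} {v : D.Cube} {e e' : E} (h : D.Adjacent v e e') : D.rc.rel v e e' :=
  Relation.EqvGen.rel _ _ h

theorem rc_arc {D : PD E} {v : D.Cube} {e e' : E} (i : Fin D.crossings.length)
    (h : (e, e') ∈ (D.crossings.get i).arcs (v i)) : D.rc.rel v e e' :=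
  rc_adj (Or.inr ⟨i, h⟩)

theorem rc_join {D : PD E} {v : D.Cube} {e e' : E} (h : (e, e') ∈ D.joins) : D.rc.rel v e e' :=
  rc_adj (Or.inl h)

theorem rc_false {D : PD E} {v : D.Cube} {i : Fin D.crossings.length} (h : v i = false) :
    D.rc.rel v (D.crossings.get i).a (D.crossings.get i).b ∧
      D.rc.rel v (D.crossings.get i).c (D.crossings.get i).d :=
  ⟨rc_arc i (by rw [h]; simp [Crossing.arcs]), rc_arc i (by rw [h]; simp [Crossing.arcs])⟩

theorem rc_true {D : PD E} {v : D.Cube} {i : Fin D.crossings.length} (h : v i = true) :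
    D.rc.rel v (D.crossings.get i).a (D.crossings.get i).d ∧
      D.rc.rel v (D.crossings.get i).b (D.crossings.get i).c :=
  ⟨rc_arc i (by rw [h]; simp [Crossing.arcs]), rc_arc i (by rw [h]; simp [Crossing.arcs])⟩

variable {D : PD E} {o : E → Bool}

/-- The ends of the edges at the vertices of the diagram. -/
abbrev Port (D : PD E) : Type := Fin D.crossings.length × Bool ⊕ Fin D.joins.length

/-- The edge that ends at a port in the alternating orientation. -/
def hd (D : PD E) (o : E → Bool) : D.Port → E
  | .inl (i, b) => (D.crossings.get i).hd o b
  | .inr j => if o (D.joins.get j).1 then (D.joins.get j).1 else (D.joins.get j).2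

/-- The edge that begins at a port in the alternating orientation, for the `0`-resolution. -/
def tl (D : PD E) (o : E → Bool) : D.Port → E
  | .inl (i, b) => (D.crossings.get i).tl o b
  | .inr j => if o (D.joins.get j).1 then (D.joins.get j).2 else (D.joins.get j).1

theorem IsKnot.card_port (h : D.IsKnot) : Nat.card D.Port = Nat.card E := by
  classical
  have := h.finite
  have := Fintype.ofFinite E
  have h1 : D.strands.length = Fintype.card E := by
    have := List.toFinset_card_of_nodup h.ends_nodup
    rw [List.length_map] at this
    rw [← this, ← Finset.card_univ]
    congr 1
    ext e
    simp only [Finset.mem_univ, iff_true, List.mem_toFinset]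
    exact h.ends_all e
  have h2 : ∀ L : List (Crossing E), (L.flatMap Crossing.strands).length = L.length * 2 := by
    intro L
    induction L with
    | nil => rfl
    | cons x L ih => simp [ih, Crossing.strands]; ring
  rw [Nat.card_eq_fintype_card, Nat.card_eq_fintype_card, ← h1, strands, List.length_append, h2]
  simp

/-- An edge with `o e` true keeps the orientation of the knot and is found among the incoming edges;
otherwise it is reversed and found among the outgoing ones. -/
theorem Check.hd_surjective (h : D.Check o) (hD : D.IsKnot) : Function.Surjective (D.hd o) := by
  intro e
  cases ho : o e
  · obtain ⟨p, hp, rfl⟩ := List.mem_map.1 (hD.begins_all e)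
    obtain ⟨i | j, hx⟩ := mem_vertexStrands.1 hp
    · obtain ⟨b, hb⟩ := ((h.crossings _ (List.get_mem _ i)).strands hx).2.2.1 ho
      exact ⟨.inl (i, b), hb⟩
    · have hx : p = D.joins.get j := by simpa [vertexStrands] using hx
      have := h.joins _ (List.get_mem D.joins j)
      refine ⟨.inr j, ?_⟩
      subst hx
      simp only [hd, this, ho, Bool.false_eq_true, if_false]
  · obtain ⟨p, hp, rfl⟩ := List.mem_map.1 (hD.ends_all e)
    obtain ⟨i | j, hx⟩ := mem_vertexStrands.1 hp
    · obtain ⟨b, hb⟩ := ((h.crossings _ (List.get_mem _ i)).strands hx).1 ho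
      exact ⟨.inl (i, b), hb⟩
    · have hx : p = D.joins.get j := by simpa [vertexStrands] using hx
      refine ⟨.inr j, ?_⟩
      subst hx
      simp only [hd, ho, if_true]

theorem Check.tl_surjective (h : D.Check o) (hD : D.IsKnot) : Function.Surjective (D.tl o) := by
  intro e
  cases ho : o e
  · obtain ⟨p, hp, rfl⟩ := List.mem_map.1 (hD.ends_all e)
    obtain ⟨i | j, hx⟩ := mem_vertexStrands.1 hp
    · obtain ⟨b, hb⟩ := ((h.crossings _ (List.get_mem _ i)).strands hx).2.1 ho
      exact ⟨.inl (i, b), hb⟩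
    · have hx : p = D.joins.get j := by simpa [vertexStrands] using hx
      refine ⟨.inr j, ?_⟩
      subst hx
      simp only [tl, ho, Bool.false_eq_true, if_false]
  · obtain ⟨p, hp, rfl⟩ := List.mem_map.1 (hD.begins_all e)
    obtain ⟨i | j, hx⟩ := mem_vertexStrands.1 hp
    · obtain ⟨b, hb⟩ := ((h.crossings _ (List.get_mem _ i)).strands hx).2.2.2 ho
      exact ⟨.inl (i, b), hb⟩
    · have hx : p = D.joins.get j := by simpa [vertexStrands] using hx
      have := h.joins _ (List.get_mem D.joins j)
      refine ⟨.inr j, ?_⟩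
      subst hx
      simp only [tl, this, ho, if_true]

theorem bijective_of_surjective (hD : D.IsKnot) {f : D.Port → E} (hf : Function.Surjective f) :
    Function.Bijective f := by
  have := hD.finite
  exact hf.bijective_of_nat_card_le hD.card_port.le

/-- Exchanging the arcs at the crossings that are resolved by `1`. -/
def flipPort (v : D.Cube) : D.Port ≃ D.Port :=
  Function.Involutive.toPerm (Sum.map (fun p => (p.1, xor p.2 (v p.1))) id) (by
    rintro (⟨i, b⟩ | j) <;> simp)

theorem flipPort_inl (v : D.Cube) (i : Fin D.crossings.length) (b : Bool) :
    flipPort v (.inl (i, b)) = .inl (i, xor b (v i)) := rfl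

theorem flipPort_inr (v : D.Cube) (j : Fin D.joins.length) :
    flipPort v (.inr j) = .inr j := rfl

/-- The permutation of the edges whose cycles are the circles of a resolution. -/
noncomputable def circPerm (hD : D.IsKnot) (h : D.Check o) (v : D.Cube) : Equiv.Perm E :=
  (Equiv.ofBijective _ (bijective_of_surjective hD (h.hd_surjective hD))).symm.trans
    ((flipPort v).trans (Equiv.ofBijective _ (bijective_of_surjective hD (h.tl_surjective hD))))

theorem circPerm_hd (hD : D.IsKnot) (h : D.Check o) (v : D.Cube) (p : D.Port) :
    circPerm hD h v (D.hd o p) = D.tl o (flipPort v p) := by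
  have : (Equiv.ofBijective _ (bijective_of_surjective hD (h.hd_surjective hD))).symm
      (D.hd o p) = p := Equiv.ofBijective_symm_apply_apply ..
  rw [circPerm, Equiv.trans_apply, this]
  rfl

theorem hd_injective (hD : D.IsKnot) (h : D.Check o) : Function.Injective (D.hd o) :=
  (bijective_of_surjective hD (h.hd_surjective hD)).1

theorem rel_circPerm (hD : D.IsKnot) (h : D.Check o) (v : D.Cube) (e : E) :
    D.rc.rel v e (circPerm hD h v e) := by
  obtain ⟨p, rfl⟩ := h.hd_surjective hD e
  rw [circPerm_hd]
  rcases p with ⟨i, b⟩ | j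
  · change D.rc.rel v ((D.crossings.get i).hd o b) ((D.crossings.get i).tl o (xor b (v i)))
    cases hv : v i
    · have h1 := (rc_false hv).1
      have h2 := (rc_false hv).2
      have h3 := (D.rc.rel v).symm' h1
      have h4 := (D.rc.rel v).symm' h2
      unfold Crossing.hd Crossing.tl
      cases b <;> split_ifs <;> simp_all
    · have h1 := (rc_true hv).1
      have h2 := (rc_true hv).2
      have h3 := (D.rc.rel v).symm' h1
      have h4 := (D.rc.rel v).symm' h2
      unfold Crossing.hd Crossing.tl
      cases b <;> split_ifs <;> simp_all
  · have h1 : D.rc.rel v _ _ := rc_join (v := v) (List.get_mem D.joins j)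
    have h2 := (D.rc.rel v).symm' h1
    rw [flipPort_inr]
    unfold hd tl
    dsimp only
    split_ifs
    · exact h1
    · exact h2

theorem sameCycle_circPerm (hD : D.IsKnot) (h : D.Check o) (v : D.Cube) {e e' : E} :
    (circPerm hD h v).SameCycle e e' ↔ D.rc.rel v e e' := by
  constructor
  · rintro ⟨n, rfl⟩
    have key : ∀ n : ℕ, ∀ e, D.rc.rel v e (((circPerm hD h v) ^ n) e) := by
      intro n
      induction n with
      | zero => exact fun e => (D.rc.rel v).refl' e
      | succ n ih =>
        intro e
        rw [pow_succ', Equiv.Perm.mul_apply]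
        exact (D.rc.rel v).trans' (ih e) (rel_circPerm hD h v _)
    cases n with
    | ofNat n => exact key n e
    | negSucc n =>
      have := key (n + 1) (((circPerm hD h v) ^ (Int.negSucc n)) e)
      rw [zpow_negSucc, ← Equiv.Perm.mul_apply, mul_inv_cancel, Equiv.Perm.one_apply] at this
      rw [zpow_negSucc]
      exact (D.rc.rel v).symm' this
  · refine eqvGen_le (Equiv.Perm.SameCycle.setoid (circPerm hD h v)) ?_
    have one : ∀ p : D.Port, (circPerm hD h v).SameCycle (D.hd o p) (D.tl o (flipPort v p)) :=
      fun p => ⟨1, by rw [zpow_one, circPerm_hd]⟩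
    rintro e e' (he | ⟨i, he⟩)
    · obtain ⟨j, hj⟩ := List.mem_iff_get.1 he
      have h1 := one (.inr j)
      rw [flipPort_inr] at h1
      unfold hd tl at h1
      dsimp only at h1
      rw [hj] at h1
      split_ifs at h1
      · exact h1
      · exact h1.symm
    · have h1 : ∀ b, (circPerm hD h v).SameCycle ((D.crossings.get i).hd o b)
          ((D.crossings.get i).tl o (xor b (v i))) := fun b => one (.inl (i, b))
      have h2 := h1 false
      have h3 := h1 true
      have h4 := h2.symm
      have h5 := h3.symm
      change (circPerm hD h v).SameCycle e e'
      unfold Crossing.hd Crossing.tl at h2 h3 h4 h5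
      cases hv : v i <;> rw [hv] at he h2 h3 h4 h5 <;>
        simp only [Crossing.arcs, List.mem_cons, Prod.mk.injEq, List.not_mem_nil, or_false] at he <;>
        rcases he with ⟨rfl, rfl⟩ | ⟨rfl, rfl⟩ <;> split_ifs at h2 h3 h4 h5 <;> simp_all

/-- The two heads at the crossing exchange the tails to which they are joined. -/
theorem circPerm_update [DecidableEq E] (hD : D.IsKnot) (h : D.Check o) (v : D.Cube)
    (i : Fin D.crossings.length) (hv : v i = true) :
    circPerm hD h v = circPerm hD h (Function.update v i false) *
      Equiv.swap ((D.crossings.get i).hd o false) ((D.crossings.get i).hd o true) := by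
  ext e
  obtain ⟨p, rfl⟩ := h.hd_surjective hD e
  have hinj := hd_injective hD h
  rw [Equiv.Perm.mul_apply, circPerm_hd]
  change _ = circPerm hD h _ (Equiv.swap (D.hd o (.inl (i, false))) (D.hd o (.inl (i, true))) _)
  rw [← hinj.map_swap, circPerm_hd]
  congr 1
  rcases p with ⟨j, b⟩ | j
  · by_cases hj : j = i
    · subst hj
      cases b
      · rw [Equiv.swap_apply_left]; simp [flipPort_inl, hv]
      · rw [Equiv.swap_apply_right]; simp [flipPort_inl, hv]
    · rw [Equiv.swap_apply_of_ne_of_ne (by simp [hj]) (by simp [hj])]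
      simp [flipPort_inl, hj]
  · rw [Equiv.swap_apply_of_ne_of_ne (by simp) (by simp)]
    simp [flipPort_inr]

/-- The two resolutions differ in the arcs at one crossing, which gives the gluing conditions.
Planarity enters in the claim that exactly one of them joins `a` to `c`: their circles are the
cycles of permutations that differ by a transposition, which always merges or splits. -/
theorem rc_planar (hD : D.IsKnot) : D.rc.Planar := by
  classical
  obtain ⟨o, h⟩ := hD.exists_check
  have := hD.finite
  intro v i hv
  have hu : Function.update v i false i = false := Function.update_self ..
  have t := rc_true hv
  have f := rc_false hu
  set r := D.rc.rel (Function.update v i false)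
  set r' := D.rc.rel v
  refine ⟨fun e e' => eqvGen_le (glueSetoid r' (D.rc.a i) (D.rc.c i)) ?_,
    fun e e' => eqvGen_le (glueSetoid r (D.rc.a i) (D.rc.c i)) ?_, ?_⟩
  · rintro e e' (he | ⟨j, he⟩)
    · exact Or.inl (rc_join he)
    · by_cases hj : j = i
      · subst hj
        rw [hu] at he
        simp only [Crossing.arcs, List.mem_cons, Prod.mk.injEq, List.not_mem_nil, or_false] at he
        rcases he with ⟨rfl, rfl⟩ | ⟨rfl, rfl⟩
        · exact Or.inr (Or.inl ⟨r'.refl' _, r'.symm' t.2⟩)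
        · exact Or.inr (Or.inr ⟨r'.refl' _, t.1⟩)
      · rw [Function.update_of_ne hj] at he
        exact Or.inl (rc_arc j he)
  · rintro e e' (he | ⟨j, he⟩)
    · exact Or.inl (rc_join he)
    · by_cases hj : j = i
      · subst hj
        rw [hv] at he
        simp only [Crossing.arcs, List.mem_cons, Prod.mk.injEq, List.not_mem_nil, or_false] at he
        rcases he with ⟨rfl, rfl⟩ | ⟨rfl, rfl⟩
        · exact Or.inr (Or.inl ⟨r.refl' _, f.2⟩)
        · exact Or.inr (Or.inl ⟨r.symm' f.1, r.refl' _⟩)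
      · refine Or.inl (rc_arc j ?_)
        rwa [Function.update_of_ne hj]
  · have hne : (D.crossings.get i).hd o false ≠ (D.crossings.get i).hd o true := fun e => by
      have := hd_injective hD h (a₁ := .inl (i, false)) (a₂ := .inl (i, true)) e
      simp at this
    have key := Equiv.Perm.sameCycle_mul_swap_iff (σ := circPerm hD h (Function.update v i false)) hne
    rw [← circPerm_update hD h v i hv, sameCycle_circPerm, sameCycle_circPerm] at key
    change r' _ _ ↔ ¬ r _ _ at key
    change r (D.crossings.get i).a (D.crossings.get i).c ↔
      ¬ r' (D.crossings.get i).a (D.crossings.get i).c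
    unfold Crossing.hd at key
    -- The transposition exchanges the heads, which are `b` and `d` if `o a` is false. The arcs
    -- translate the statement to `a` and `c`.
    cases ha : o (D.crossings.get i).a
    · simp only [ha, Bool.false_eq_true, if_false, if_true] at key
      have e1 : r (D.crossings.get i).a (D.crossings.get i).c ↔
          r (D.crossings.get i).b (D.crossings.get i).d :=
        ⟨fun h => r.trans' (r.symm' f.1) (r.trans' h f.2),
          fun h => r.trans' f.1 (r.trans' h (r.symm' f.2))⟩
      have e2 : r' (D.crossings.get i).a (D.crossings.get i).c ↔
          r' (D.crossings.get i).b (D.crossings.get i).d :=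
        ⟨fun h => r'.trans' t.2 (r'.trans' (r'.symm' h) t.1),
          fun h => r'.trans' t.1 (r'.trans' (r'.symm' h) t.2)⟩
      rw [e1, e2, key, not_not]
    · simp only [ha, Bool.false_eq_true, if_false, if_true] at key
      rw [key, not_not]

end PD

end PlanarCube

/-! ## Torsion bounds of diagrams -/

section DiagramTorsion

theorem List.Perm.exists_equiv {α : Type} {L L' : List α} (h : L.Perm L') :
    ∃ π : Fin L.length ≃ Fin L'.length, ∀ i, L'.get (π i) = L.get i := by
  induction h with
  | nil => exact ⟨Equiv.refl _, fun i => i.elim0⟩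
  | @cons x l l' _ ih =>
    obtain ⟨π, hπ⟩ := ih
    refine ⟨(finSuccEquiv _).trans ((Equiv.optionCongr π).trans (finSuccEquiv _).symm), ?_⟩
    refine Fin.cases ?_ fun i => ?_
    · simp
    · simpa using hπ i
  | swap x y l =>
    refine ⟨Equiv.swap (0 : Fin (l.length + 2)) 1, ?_⟩
    refine Fin.cases ?_ (Fin.cases ?_ fun i => ?_)
    · rw [Equiv.swap_apply_left]; rfl
    · change List.get (x :: y :: l) (Equiv.swap (0 : Fin (l.length + 2)) 1 1) = _
      rw [Equiv.swap_apply_right]; rfl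
    · rw [Equiv.swap_apply_of_ne_of_ne (Fin.succ_ne_zero _)
        (by simp [Fin.ext_iff])]
      rfl
  | trans _ _ ih ih' =>
    obtain ⟨π, hπ⟩ := ih
    obtain ⟨π', hπ'⟩ := ih'
    exact ⟨π.trans π', fun i => (hπ' _).trans (hπ i)⟩

/-- The crossings agree up to orientation. -/
def Crossing.Sim {E : Type} (x y : Crossing E) : Prop :=
  (x.a, x.b, x.c, x.d) = (y.a, y.b, y.c, y.d) ∨ (x.a, x.b, x.c, x.d) = (y.c, y.d, y.a, y.b)

namespace Crossing

variable {E E' : Type}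

theorem Sim.refl (x : Crossing E) : x.Sim x := Or.inl rfl

theorem Sim.symm {x y : Crossing E} (h : x.Sim y) : y.Sim x := by
  unfold Sim at *
  simp only [Prod.mk.injEq] at *
  rcases h with h | h <;> simp [h]

theorem Sim.arcs {x y : Crossing E} (h : x.Sim y) (b : Bool) {p : E × E} (hp : p ∈ x.arcs b) :
    p ∈ y.arcs b ∨ p.swap ∈ y.arcs b := by
  unfold Sim at h
  simp only [Prod.mk.injEq] at h
  cases b <;> simp only [Crossing.arcs, List.mem_cons, List.not_mem_nil, or_false] at hp ⊢ <;>
    rcases h with ⟨h1, h2, h3, h4⟩ | ⟨h1, h2, h3, h4⟩ <;> rw [h1, h2, h3, h4] at hp <;>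
    rcases hp with rfl | rfl <;> simp

theorem arcs_map (f : E → E') (x : Crossing E) (b : Bool) :
    (x.map f).arcs b = (x.arcs b).map (Prod.map f f) := by
  cases b <;> rfl

/-- The normal form of a crossing that looks in a given way. -/
def look (σ : Bool) (a b c d : E) : Crossing E :=
  if σ then ⟨true, a, b, c, d⟩ else ⟨true, b, c, d, a⟩

/-- The cube does not depend on the field `pos`, so the normal form may carry an arbitrary sign. -/
theorem Looks.sim {x : Crossing E} {σ : Bool} {a b c d : E} (h : x.Looks σ a b c d) :
    x.Sim (look σ a b c d) := by
  cases σ <;> exact h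

end Crossing

namespace PD

variable {E E' : Type} {k : Type} [CommRing k] {τ : k}

theorem rc_rel_le {D : PD E} {v : D.Cube} (s : Setoid E) (hJ : ∀ p ∈ D.joins, s p.1 p.2)
    (hL : ∀ i, ∀ p ∈ (D.crossings.get i).arcs (v i), s p.1 p.2) {e e' : E}
    (h : D.rc.rel v e e') : s e e' := by
  refine eqvGen_le s ?_ h
  rintro e e' (h | ⟨i, h⟩)
  · exact hJ _ h
  · exact hL i _ h

/-- Isomorphisms of cubes of diagrams that differ by a map of the edges in the crossings. -/
theorem iso_of_map {D : PD E} {D' : PD E'} (π : Fin D.crossings.length ≃ Fin D'.crossings.length)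
    (f : E → E') (g : E' → E)
    (hget : ∀ i, (D'.crossings.get (π i)).Sim ((D.crossings.get i).map f))
    (hJ : ∀ v, ∀ p ∈ D.joins, D'.rc.rel v (f p.1) (f p.2))
    (hJ' : ∀ v, ∀ p ∈ D'.joins, D.rc.rel v (g p.1) (g p.2))
    (gf : ∀ v e, D.rc.rel v (g (f e)) e) (fg : ∀ v e, D'.rc.rel v (f (g e)) e) :
    D.rc.Iso D'.rc π f g := by
  refine ⟨fun v => ⟨fun e e' h => ?_, fun e e' h => ?_, gf _, fg _⟩, fun v i _ => ?_⟩
  · refine rc_rel_le ((D'.rc.rel v).comap f) (hJ v) (fun i p hp => ?_) h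
    have h1 : Prod.map f f p ∈ ((D.crossings.get i).map f).arcs (v (π i)) := by
      rw [Crossing.arcs_map]
      exact List.mem_map_of_mem hp
    rcases (hget i).symm.arcs _ h1 with h2 | h2
    · exact rc_arc _ h2
    · exact (D'.rc.rel v).symm' (rc_arc _ h2)
  · refine rc_rel_le ((D.rc.rel ((ResCube.cubeEquiv π).symm v)).comap g) (hJ' _)
      (fun i p hp => ?_) h
    obtain ⟨i, rfl⟩ := π.surjective i
    have key : ∀ p ∈ ((D.crossings.get i).map f).arcs (v (π i)),
        (D.rc.rel ((ResCube.cubeEquiv π).symm v)) (g p.1) (g p.2) := by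
      intro p hp
      rw [Crossing.arcs_map] at hp
      obtain ⟨q, hq, rfl⟩ := List.mem_map.1 hp
      exact Setoid.trans' _ (gf _ q.1) (Setoid.trans' _ (rc_arc i hq) (Setoid.symm' _ (gf _ q.2)))
    rcases (hget i).arcs _ hp with h2 | h2
    · exact key _ h2
    · exact Setoid.symm' _ (key _ h2)
  · have hs := hget i
    unfold Crossing.Sim at hs
    simp only [Prod.mk.injEq] at hs
    change (D'.rc.rel v _ (D'.crossings.get (π i)).a ∧ D'.rc.rel v _ (D'.crossings.get (π i)).c) ∨
      (D'.rc.rel v _ (D'.crossings.get (π i)).c ∧ D'.rc.rel v _ (D'.crossings.get (π i)).a)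
    rcases hs with ⟨h1, -, h3, -⟩ | ⟨h1, -, h3, -⟩ <;> rw [h1, h3]
    · exact Or.inl ⟨Setoid.refl' _ _, Setoid.refl' _ _⟩
    · exact Or.inr ⟨Setoid.refl' _ _, Setoid.refl' _ _⟩

/-- Fixing the resolution of a crossing turns its two arcs into marked points. The resulting code is
in general not one of a knot, which is why `Planar` is a property of cubes that passes to faces. -/
theorem face_rc (x : Crossing E) (L : List (Crossing E)) (J : List (E × E)) (b : Bool) :
    (⟨x :: L, J⟩ : PD E).rc.face b = (⟨L, x.arcs b ++ J⟩ : PD E).rc := by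
  have : (fun v => (⟨x :: L, J⟩ : PD E).rc.rel (Fin.cons b v : Fin (L.length + 1) → Bool)) =
      (⟨L, x.arcs b ++ J⟩ : PD E).rc.rel := by
    funext v
    have adj : (⟨x :: L, J⟩ : PD E).Adjacent (Fin.cons b v : Fin (L.length + 1) → Bool) =
        (⟨L, x.arcs b ++ J⟩ : PD E).Adjacent v := by
      funext e e'
      unfold Adjacent
      rw [List.mem_append, or_comm (a := (e, e') ∈ x.arcs b), or_assoc]
      exact propext (or_congr Iff.rfl Fin.exists_fin_succ)
    exact congrArg Relation.EqvGen.setoid adj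
  unfold ResCube.face
  rw [this]
  rfl

/-- The torsion bound of the complex of a diagram with a base point. -/
def TB (k : Type) [CommRing k] (τ t : k) (D : PD E) (e : E) (m : ℕ) : Prop :=
  TorsionBound t (D.rc.diff k τ) (D.rc.mulX k τ e) m

end PD

namespace ResCube

variable {E E' : Type} {n n' : ℕ} {k : Type} [CommRing k] {τ : k}

variable (k τ) in
/-- The saddle between the faces of a cube. -/
noncomputable abbrev faceMap (R : ResCube E (n + 1)) :
    (R.face false).Chain k τ →ₗ[k] (R.face true).Chain k τ :=
  saddleMap k τ (R.face false) (R.face true) (R.a 0) (R.c 0)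

variable (k τ) in
/-- The decomposition of a cube along the first two directions. -/
noncomputable def consConsEquiv (R : ResCube E (n + 2)) : R.Chain k τ ≃ₗ[k]
      (((R.face false).face false).Chain k τ × ((R.face false).face true).Chain k τ) ×
        (((R.face true).face false).Chain k τ × ((R.face true).face true).Chain k τ) :=
  R.consEquiv k τ ≪≫ₗ ((R.face false).consEquiv k τ).prodCongr ((R.face true).consEquiv k τ)

variable (k τ) in
/-- The differential of a cube in terms of the decomposition along two directions. -/
noncomputable abbrev coneCone (R : ResCube E (n + 2)) : Module.End k
      ((((R.face false).face false).Chain k τ × ((R.face false).face true).Chain k τ) ×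
        (((R.face true).face false).Chain k τ × ((R.face true).face true).Chain k τ)) :=
  cone (cone (((R.face false).face false).diff k τ) (((R.face false).face true).diff k τ)
      (faceMap k τ (R.face false)))
    (cone (((R.face true).face false).diff k τ) (((R.face true).face true).diff k τ)
      (faceMap k τ (R.face true)))
    ((saddleMap k τ ((R.face false).face false) ((R.face true).face false)
      (R.a 0) (R.c 0)).prodMap (saddleMap k τ ((R.face false).face true)
        ((R.face true).face true) (R.a 0) (R.c 0)))

variable (k τ) in
/-- The action of an edge in terms of the decomposition along two directions. -/
noncomputable abbrev mulXX (R : ResCube E (n + 2)) (e : E) : Module.End k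
      ((((R.face false).face false).Chain k τ × ((R.face false).face true).Chain k τ) ×
        (((R.face true).face false).Chain k τ × ((R.face true).face true).Chain k τ)) :=
  ((((R.face false).face false).mulX k τ e).prodMap
      (((R.face false).face true).mulX k τ e)).prodMap
    ((((R.face true).face false).mulX k τ e).prodMap (((R.face true).face true).mulX k τ e))

theorem consConsEquiv_diff (R : ResCube E (n + 2)) (z : R.Chain k τ) :
    R.consConsEquiv k τ (R.diff k τ z) = R.coneCone k τ (R.consConsEquiv k τ z) := by
  rw [consConsEquiv, LinearEquiv.trans_apply, consEquiv_diff]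
  refine Prod.ext ?_ ?_
  · exact (R.face false).consEquiv_diff _
  · change (R.face true).consEquiv k τ (_ - _) = _
    rw [map_sub]
    exact congrArg₂ _ rfl ((R.face true).consEquiv_diff _)

theorem consConsEquiv_mulX (R : ResCube E (n + 2)) (e : E) (z : R.Chain k τ) :
    R.consConsEquiv k τ (R.mulX k τ e z) = R.mulXX k τ e (R.consConsEquiv k τ z) := rfl

end ResCube

/-- Transporting a retract along an isomorphism. -/
def Retract.ofEquiv {k : Type} [CommRing k] {A M Z : Type} [AddCommGroup A] [Module k A]
    [AddCommGroup M] [Module k M] [AddCommGroup Z] [Module k Z] {dA xA : Module.End k A}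
    {dZ xZ : Module.End k Z} {dM xM : Module.End k M} (R : Retract dZ xZ dM xM) (F : A ≃ₗ[k] Z)
    (hd : ∀ a, F (dA a) = dZ (F a)) (hx : ∀ a, F (xA a) = xZ (F a)) : Retract dA xA dM xM where
  i := F.symm.toLinearMap ∘ₗ R.i
  r := R.r ∘ₗ F.toLinearMap
  H := F.symm.toLinearMap ∘ₗ R.H ∘ₗ F.toLinearMap
  i_d m := F.injective (by simp [hd, R.i_d])
  r_d z := by simp [hd, R.r_d]
  r_i m := by simp [R.r_i]
  htpy z := F.injective (by simp [hd, R.htpy])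
  i_x m := F.injective (by simp [hx, R.i_x])
  r_x z := by simp [hx, R.r_x]
  H_x z := F.injective (by simp [hx, R.H_x])

end DiagramTorsion

/-! ## Isolated circles in cubes -/

section IsolatedCircles

variable {E : Type} {k : Type} [CommRing k] {τ : k}

theorem saddle_congr {r r' : Setoid E} {a c a' c' : E} (h : Nb r r' a c) (h' : Nb r r' a' c')
    (hac : (r' a a' ∧ r' c c') ∨ (r' a c' ∧ r' c a')) (z : CircRing k τ r) :
    saddle k τ r r' a c z = saddle k τ r r' a' c' z := by
  classical
  suffices e : saddle k τ r r' a c = saddle k τ r r' a' c' from LinearMap.congr_fun e z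
  refine circ_ext r Set.univ (fun e => ⟨e, trivial, r.refl' e⟩) (fun e z => xv k τ r' e * z) _ _
    (fun e _ z => saddle_xv_mul ..) (fun e _ z => saddle_xv_mul ..) ?_
  rw [saddle_one h, saddle_one h']
  rcases hac with ⟨h1, h2⟩ | ⟨h1, h2⟩
  · have : r' a c ↔ r' a' c' :=
      ⟨fun h => r'.trans' (r'.symm' h1) (r'.trans' h h2),
        fun h => r'.trans' h1 (r'.trans' h (r'.symm' h2))⟩
    simp only [this, xv_eq h1, xv_eq h2]
  · have : r' a c ↔ r' a' c' :=
      ⟨fun h => r'.symm' (r'.trans' (r'.symm' h1) (r'.trans' h h2)),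
        fun h => r'.trans' h1 (r'.trans' (r'.symm' h) (r'.symm' h2))⟩
    simp only [this, xv_eq h1, xv_eq h2, add_comm]

theorem Nb.merge {r ra : Setoid E} {n a : E} (h : Nb r ra n a) (hn : ¬ r n a) : Merge r ra n a :=
  ⟨h, by by_contra h'; exact hn (h.iff_not.2 h')⟩

theorem Merge.change {r ra : Setoid E} {n n' a : E} (h : Merge r ra n a) (hn : r n n') :
    Merge r ra n' a := by
  have hn' := h.le h.same hn
  have same := ra.trans' (ra.symm' hn') h.same
  refine ⟨⟨fun e e' he => Or.inl (h.le h.same he), fun e e' he => ?_,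
    ⟨fun h1 => absurd (r.trans' hn h1) h.not_rel, fun h1 => absurd same h1⟩⟩, same⟩
  rcases h.right e e' he with h1 | h1 | h1
  · exact Or.inl h1
  · exact Or.inr (Or.inl ⟨r.trans' h1.1 hn, h1.2⟩)
  · exact Or.inr (Or.inr ⟨h1.1, r.trans' (r.symm' hn) h1.2⟩)

namespace ResCube

variable {n : ℕ}

/-- The edges that satisfy `P` form a circle in all resolutions, which is away from the
crossings. -/
structure Circ (R : ResCube E n) (P : E → Prop) (m : E) : Prop where
  mem : P m
  closed : ∀ v e e', R.rel v e e' → (P e ↔ P e')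
  conn : ∀ v e, P e → R.rel v m e
  off : ∀ i, ¬ P (R.a i) ∧ ¬ P (R.c i)

open Classical in
/-- The one of the edges `a, c` that does not satisfy `P`. -/
noncomputable def outer (P : E → Prop) (a c : E) : E := if P a then c else a

namespace Circ

variable {R Ra Rb : ResCube E n} {P : E → Prop} {m a c a' c' : E}

theorem rel_iff (h : R.Circ P m) (v : Fin n → Bool) (e : E) : R.rel v m e ↔ P e :=
  ⟨fun he => (h.closed v _ _ he).1 h.mem, h.conn v e⟩

/-- A saddle with exactly one foot on an isolated circle has its feet on different circles, so it is
a merge. -/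
theorem merge (h : R.Circ P m) {r' : Setoid E} {v : Fin n → Bool} (hs : P a ↔ ¬ P c)
    (hN : Nb (R.rel v) r' a c) : Merge (R.rel v) r' m (outer P a c) := by
  unfold outer
  split_ifs with hP
  · refine (hN.merge fun hr => (hs.1 hP) ((h.closed v _ _ hr).1 hP)).change ?_
    exact (R.rel v).symm' (h.conn v _ hP)
  · have hc : P c := by tauto
    refine (hN.swap.merge fun hr => hP ((h.closed v _ _ hr).1 hc)).change ?_
    exact (R.rel v).symm' (h.conn v _ hc)

theorem outer_spec (h : R.Circ P m) {r' : Setoid E} {v : Fin n → Bool} (hs : P a ↔ ¬ P c)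
    (hr : ∀ e e', R.rel v e e' → r' e e') :
    (r' a m ∧ r' c (outer P a c)) ∨ (r' a (outer P a c) ∧ r' c m) := by
  unfold outer
  split_ifs with hP
  · exact Or.inl ⟨hr _ _ ((R.rel v).symm' (h.conn v _ hP)), r'.refl' _⟩
  · exact Or.inr ⟨r'.refl' _, hr _ _ ((R.rel v).symm' (h.conn v _ (by tauto)))⟩

theorem saddle_eq (h : R.Circ P m) {r' : Setoid E} {v : Fin n → Bool} (hs : P a ↔ ¬ P c)
    (hN : Nb (R.rel v) r' a c) (z : CircRing k τ (R.rel v)) :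
    saddle k τ (R.rel v) r' a c z = saddle k τ (R.rel v) r' m (outer P a c) z :=
  saddle_congr hN (h.merge hs hN).toNb
    (h.outer_spec hs fun _ _ => (h.merge hs hN).le (h.merge hs hN).same) z

theorem saddle_symm_eq (h : R.Circ P m) {r' : Setoid E} {v : Fin n → Bool} (hs : P a ↔ ¬ P c)
    (hN : Nb (R.rel v) r' a c) (z : CircRing k τ r') :
    saddle k τ r' (R.rel v) a c z = saddle k τ r' (R.rel v) m (outer P a c) z :=
  saddle_congr hN.symm (h.merge hs hN).toNb.symm (h.outer_spec hs fun _ _ => id) z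

/-- The maps between the complexes of cubes that differ by a circle. -/
noncomputable def circleMaps (h : R.Circ P m) (hR : R.Planar) (hRa : Ra.Planar) (hRb : Rb.Planar)
    (ha : Ra.a = R.a) (hc : Ra.c = R.c) (ha' : Rb.a = R.a) (hc' : Rb.c = R.c)
    (hs : P a ↔ ¬ P c) (hs' : P a' ↔ ¬ P c') (hN : ∀ v, Nb (R.rel v) (Ra.rel v) a c)
    (hN' : ∀ v, Nb (R.rel v) (Rb.rel v) a' c') {e : E} (he : ¬ P e) :
    CircleMaps (Ra.diff k τ) (Ra.mulX k τ e) (R.diff k τ) (R.mulX k τ e) (Rb.diff k τ)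
      (Rb.mulX k τ e) where
  split := saddleMap k τ Ra R a c
  coeff := mapV k τ fun v => (h.merge hs (hN v)).coeff
  merge := saddleMap k τ R Rb a' c'
  birth := mapV k τ fun v => (h.merge hs' (hN' v)).birth.toLinearMap
  split_d := saddleMap_diff hRa hR ha hc fun v => (hN v).symm
  coeff_d := mapV_diff _ fun v i hv z => by
    have h1 := hRa v i hv
    rw [ha, hc] at h1 ⊢
    exact (h.merge hs (hN _)).coeff_comm (h.merge hs (hN v)) (hR v i hv) h1
      (by rw [h.rel_iff]; exact (h.off i).1) (by rw [h.rel_iff]; exact (h.off i).2)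
      (by rw [h.rel_iff]; exact (h.off i).1) (by rw [h.rel_iff]; exact (h.off i).2) z
  merge_d := saddleMap_diff hR hRb ha'.symm hc'.symm hN'
  birth_d := mapV_diff _ fun v i hv z => by
    have h1 := hRb v i hv
    rw [ha', hc'] at h1 ⊢
    exact (h.merge hs' (hN' _)).birth_comm (h.merge hs' (hN' v)) (hR v i hv) h1
      (by rw [h.rel_iff]; exact (h.off i).1) (by rw [h.rel_iff]; exact (h.off i).2)
      (by rw [h.rel_iff]; exact (h.off i).1) (by rw [h.rel_iff]; exact (h.off i).2) z
  split_x := saddleMap_mulX _ _ _ _ _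
  coeff_x z := by
    funext v
    exact (h.merge hs (hN v)).coeff_xv_mul (by rwa [h.rel_iff]) _
  merge_x := saddleMap_mulX _ _ _ _ _
  birth_x z := by
    funext v
    exact (h.merge hs' (hN' v)).birth_xv_mul (by rwa [h.rel_iff]) _
  coeff_split z := by
    funext v
    rw [mapV_apply, saddleMap_apply, h.saddle_symm_eq hs (hN v), Merge.coeff_saddle]
  merge_birth z := by
    funext v
    rw [saddleMap_apply, mapV_apply, h.saddle_eq hs' (hN' v)]
    exact (h.merge hs' (hN' v)).saddle_birth _
  coeff_birth z := by
    funext v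
    exact (h.merge hs (hN v)).coeff_birth (h.merge hs' (hN' v)) _
  birth_merge z := by
    funext v
    rw [mapV_apply, saddleMap_apply, h.saddle_eq hs' (hN' v), Pi.sub_apply, saddleMap_apply,
      mapV_apply, h.saddle_symm_eq hs (hN v)]
    exact (h.merge hs (hN v)).birth_saddle (h.merge hs' (hN' v)) _

end Circ

/-! ### Reidemeister retracts -/

variable {R : ResCube E (n + 1)} {Q : ResCube E (n + 2)} {P : E → Prop} {m e : E}

/-- A kink whose `0`-resolution contains an isolated circle. -/
noncomputable def retractMerge (hR : R.Planar) (h : (R.face false).Circ P m)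
    (hs : P (R.a 0) ↔ ¬ P (R.c 0)) (he : ¬ P e) :
    Retract (R.diff k τ) (R.mulX k τ e) ((R.face true).diff k τ) ((R.face true).mulX k τ e) :=
  (h.circleMaps (hR.face _) (hR.face true) (hR.face true) rfl rfl rfl rfl hs hs hR.nb hR.nb
    he).r1Merge.ofEquiv (R.consEquiv k τ) R.consEquiv_diff (R.consEquiv_mulX e)

/-- A kink whose `1`-resolution contains an isolated circle. -/
noncomputable def retractSplit (hR : R.Planar) (h : (R.face true).Circ P m)
    (hs : P (R.a 0) ↔ ¬ P (R.c 0)) (he : ¬ P e) :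
    Retract (R.diff k τ) (R.mulX k τ e) (-(R.face false).diff k τ)
      ((R.face false).mulX k τ e) :=
  (h.circleMaps (hR.face _) (hR.face false) (hR.face false) rfl rfl rfl rfl hs hs
    (fun v => (hR.nb v).symm) (fun v => (hR.nb v).symm) he).r1Split.ofEquiv (R.consEquiv k τ)
    R.consEquiv_diff (R.consEquiv_mulX e)

theorem Planar.nb₀ (hQ : Q.Planar) (b : Bool) (v : Fin n → Bool) :
    Nb (((Q.face false).face b).rel v) (((Q.face true).face b).rel v) (Q.a 0) (Q.c 0) :=
  hQ.nb (Fin.cons b v)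

theorem Planar.nb₁ (hQ : Q.Planar) (b : Bool) (v : Fin n → Bool) :
    Nb (((Q.face b).face false).rel v) (((Q.face b).face true).rel v) (Q.a 1) (Q.c 1) :=
  (hQ.face b).nb v

/-- The maps of the square of two crossings that has a circle in its second column. -/
noncomputable def circleMaps₁₀ (hQ : Q.Planar) (h : ((Q.face true).face false).Circ P m)
    (hs : P (Q.a 0) ↔ ¬ P (Q.c 0)) (hs' : P (Q.a 1) ↔ ¬ P (Q.c 1)) (he : ¬ P e) :=
  h.circleMaps (k := k) (τ := τ) ((hQ.face _).face _) ((hQ.face false).face false)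
    ((hQ.face true).face true) rfl rfl rfl rfl hs hs' (fun v => (hQ.nb₀ false v).symm)
    (hQ.nb₁ true) he

/-- The maps of the square of two crossings that has a circle in its first column. -/
noncomputable def circleMaps₀₁ (hQ : Q.Planar) (h : ((Q.face false).face true).Circ P m)
    (hs : P (Q.a 0) ↔ ¬ P (Q.c 0)) (hs' : P (Q.a 1) ↔ ¬ P (Q.c 1)) (he : ¬ P e) :=
  h.circleMaps (k := k) (τ := τ) ((hQ.face _).face _) ((hQ.face false).face false)
    ((hQ.face true).face true) rfl rfl rfl rfl hs' hs (fun v => (hQ.nb₁ false v).symm)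
    (hQ.nb₀ true) he

theorem square_comm (hQ : Q.Planar) (z : ((Q.face false).face false).Chain k τ) :
    faceMap k τ (Q.face true) (saddleMap k τ ((Q.face false).face false)
        ((Q.face true).face false) (Q.a 0) (Q.c 0) z) =
      saddleMap k τ ((Q.face false).face true) ((Q.face true).face true) (Q.a 0) (Q.c 0)
        (faceMap k τ (Q.face false) z) :=
  saddleMap_comm (hQ.nb₀ false) (hQ.nb₁ false) (hQ.nb₁ true) (hQ.nb₀ true) z

/-- A bigon, with the circle in the second column. -/
noncomputable def bigon₁₀ (hQ : Q.Planar) (h : ((Q.face true).face false).Circ P m)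
    (hs : P (Q.a 0) ↔ ¬ P (Q.c 0)) (hs' : P (Q.a 1) ↔ ¬ P (Q.c 1)) (he : ¬ P e) :
    Retract (Q.coneCone k τ) (Q.mulXX k τ e) (-((Q.face false).face true).diff k τ)
      (((Q.face false).face true).mulX k τ e) :=
  (circleMaps₁₀ hQ h hs hs' he).r2 (faceMap k τ (Q.face false))
    (saddleMap k τ ((Q.face false).face true) ((Q.face true).face true) (Q.a 0) (Q.c 0))
    (saddleMap_diff ((hQ.face _).face _) ((hQ.face _).face _) rfl rfl (hQ.nb₁ false))
    (saddleMap_diff ((hQ.face _).face _) ((hQ.face _).face _) rfl rfl (hQ.nb₀ true))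
    (saddleMap_mulX _ _ _ _ _) (saddleMap_mulX _ _ _ _ _) (fun z => (square_comm hQ z).symm)

/-- A bigon, with the circle in the first column. -/
noncomputable def bigon₀₁ (hQ : Q.Planar) (h : ((Q.face false).face true).Circ P m)
    (hs : P (Q.a 0) ↔ ¬ P (Q.c 0)) (hs' : P (Q.a 1) ↔ ¬ P (Q.c 1)) (he : ¬ P e) :
    Retract (Q.coneCone k τ) (Q.mulXX k τ e) (-((Q.face true).face false).diff k τ)
      (((Q.face true).face false).mulX k τ e) :=
  (circleMaps₀₁ hQ h hs hs' he).r2' (saddleMap k τ ((Q.face false).face false)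
      ((Q.face true).face false) (Q.a 0) (Q.c 0)) (faceMap k τ (Q.face true))
    (saddleMap_diff ((hQ.face _).face _) ((hQ.face _).face _) rfl rfl (hQ.nb₀ false))
    (saddleMap_diff ((hQ.face _).face _) ((hQ.face _).face _) rfl rfl (hQ.nb₁ true))
    (saddleMap_mulX _ _ _ _ _) (saddleMap_mulX _ _ _ _ _) (square_comm hQ)

end ResCube

end IsolatedCircles

/-! ## Invariance of torsion bounds -/

section Invariance

variable {k : Type} [CommRing k] {τ t : k}

/-- If x + y is null-homotopic, then xⁿ and (−1)ⁿ yⁿ agree on cycles up to boundaries. -/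
theorem TorsionBound.of_add {M : Type} [AddCommGroup M] [Module k M] {d x y : Module.End k M}
    {n : ℕ} (h : TorsionBound t d x n) (hx : ∀ z, d (x z) = x (d z)) (hy : ∀ z, d (y z) = y (d z))
    (H : Module.End k M) (hH : ∀ z, d (H z) + H (d z) = x z + y z) : TorsionBound t d y n := by
  have key : ∀ n : ℕ, ∀ z, d z = 0 → (x ^ n) z - (-1 : k) ^ n • (y ^ n) z ∈ LinearMap.range d := by
    intro n
    induction n with
    | zero => intro z _; simp
    | succ n ih =>
      intro z hz
      obtain ⟨w, hw⟩ := ih z hz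
      have hc : d ((y ^ n) z) = 0 := by
        rw [← pow_map_comm d hy n z |>.symm, hz, map_zero]
      have h1 := hH ((y ^ n) z)
      rw [hc, map_zero, add_zero] at h1
      refine ⟨x w + (-1 : k) ^ n • H ((y ^ n) z), ?_⟩
      rw [map_add, map_smul, hx, hw, h1, pow_succ' x, pow_succ' y, Module.End.mul_apply,
        Module.End.mul_apply, map_sub, map_smul, pow_succ (-1 : k), mul_neg_one, neg_smul, smul_add]
      abel
  intro z hz m hm
  have h1 := h z hz m hm
  have h2 := key n z hz
  have h3 := (LinearMap.range d).smul_mem ((-1 : k) ^ n) ((LinearMap.range d).sub_mem h1 h2)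
  rw [sub_sub_cancel, smul_smul, ← mul_pow] at h3
  simpa using h3

namespace ResCube

variable {E E' : Type} {n n' : ℕ}

theorem exists_nullHtpy_at {R : ResCube E n} (hR : R.Planar) (i : Fin n) :
    ∃ H : Module.End k (R.Chain k τ), ∀ z,
      R.diff k τ (H z) + H (R.diff k τ z) = R.mulX k τ (R.a i) z + R.mulX k τ (R.c i) z := by
  obtain _ | n := n
  · exact i.elim0
  let π := Equiv.swap 0 i
  have h : R.Iso (R.reindex π) π id id := by
    refine ⟨fun v => ⟨fun _ _ => id, fun _ _ => id, fun e => Setoid.refl' _ _,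
      fun e => Setoid.refl' _ _⟩, fun v j _ => Or.inl ?_⟩
    simp only [Equiv.symm_apply_apply]
    exact ⟨Setoid.refl' _ _, Setoid.refl' _ _⟩
  refine nullHtpy_of_iso h hR (hR.reindex π) ?_
  have := exists_nullHtpy (k := k) (τ := τ) (hR.reindex π)
  simpa [π] using this

theorem Iso.planar {R : ResCube E n} {R' : ResCube E n'} {π : Fin n ≃ Fin n'}
    (h : R.Iso R' π id id)
    (hac : ∀ i, (R'.a (π i) = R.a i ∧ R'.c (π i) = R.c i) ∨
      (R'.a (π i) = R.c i ∧ R'.c (π i) = R.a i)) (hR : R.Planar) : R'.Planar := by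
  intro v i hv
  have heq : ∀ v, R'.rel v = R.rel ((cubeEquiv π).symm v) := fun v =>
    Setoid.ext fun e e' => (h.rel v).rel_iff
  obtain ⟨i, rfl⟩ := π.surjective i
  have h1 := hR ((cubeEquiv π).symm v) i hv
  rw [heq, heq, cubeEquiv_symm_update]
  rcases hac i with ⟨h2, h3⟩ | ⟨h2, h3⟩ <;> rw [h2, h3]
  · exact h1
  · exact h1.swap

end ResCube

namespace PD

variable {E E' : Type} {m : ℕ}

-- Along a strand through a crossing the variable becomes its negative up to homotopy, and at a
-- marked point it does not change. As there is one component, all edges are reached.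
open ResCube in
theorem IsKnot.tb_iff {D : PD E} (hD : D.IsKnot) (e e' : E) : D.TB k τ t e m ↔ D.TB k τ t e' m := by
  have hP := rc_planar hD
  have swap : ∀ a c, (∃ H : Module.End k (D.rc.Chain k τ), ∀ z,
      D.rc.diff k τ (H z) + H (D.rc.diff k τ z) = D.rc.mulX k τ a z + D.rc.mulX k τ c z) →
      D.TB k τ t a m = D.TB k τ t c m := by
    rintro a c ⟨H, hH⟩
    refine propext ⟨fun h => h.of_add (D.rc.diff_mulX _) (D.rc.diff_mulX _) H hH,
      fun h => h.of_add (D.rc.diff_mulX _) (D.rc.diff_mulX _) H fun z => ?_⟩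
    rw [hH, add_comm]
  refine iff_of_eq (hD.const_of_strands (fun e => D.TB k τ t e m) (fun p hp => ?_) e e')
  obtain ⟨i | j, hx⟩ := mem_vertexStrands.1 hp
  · obtain ⟨H, hH⟩ := exists_nullHtpy_at (k := k) (τ := τ) hP i
    have h1 := swap _ _ ⟨H, hH⟩
    -- In each resolution X_b + X_d equals X_a + X_c, so the same homotopy serves the upper strand.
    have h2 := swap (D.crossings.get i).b (D.crossings.get i).d ⟨H, fun z => by
      rw [hH]
      funext v
      rw [Pi.add_apply, Pi.add_apply, mulX_apply, mulX_apply, mulX_apply, mulX_apply]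
      cases hv : v i
      · have := rc_false hv
        exact congrArg₂ (· + ·) (congrArg (· * _) (xv_eq this.1)) (congrArg (· * _) (xv_eq this.2))
      · have := rc_true hv
        rw [add_comm]
        exact congrArg₂ (· + ·) (congrArg (· * _) (xv_eq this.2).symm)
          (congrArg (· * _) (xv_eq this.1))⟩
    change p ∈ (D.crossings.get i).strands at hx
    simp only [Crossing.strands, List.mem_cons, List.not_mem_nil, or_false] at hx
    rcases hx with rfl | rfl
    · exact h1
    · split_ifs
      · exact h2.symm
      · exact h2
  · have hx : p = D.joins.get j := by simpa [vertexStrands] using hx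
    have : D.rc.mulX k τ p.1 = D.rc.mulX k τ p.2 := by
      refine LinearMap.ext fun z => funext fun v => ?_
      rw [mulX_apply, mulX_apply]
      exact congrArg (· * _) (xv_eq (rc_join (hx ▸ List.get_mem D.joins j)))
    simp only [TB, this]

theorem iso_of_sim {L L' : List (Crossing E)} (h : List.Forall₂ Crossing.Sim L L')
    (J : List (E × E)) : (⟨L, J⟩ : PD E).rc.Iso (⟨L', J⟩ : PD E).rc (finCongr h.length_eq) id id := by
  refine iso_of_map (D := ⟨L, J⟩) (D' := ⟨L', J⟩) _ id id (fun i => ?_) (fun v p hp => rc_join hp)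
    (fun v p hp => rc_join hp) (fun v e => Setoid.refl' _ _) (fun v e => Setoid.refl' _ _)
  exact (h.get i.2 (h.length_eq ▸ i.2)).symm

theorem planar_of_sim {L L' : List (Crossing E)} (h : List.Forall₂ Crossing.Sim L L')
    {J : List (E × E)} (hP : (⟨L, J⟩ : PD E).rc.Planar) : (⟨L', J⟩ : PD E).rc.Planar := by
  refine (iso_of_sim h J).planar (fun i => ?_) hP
  have := (h.get i.2 (h.length_eq ▸ i.2)).symm
  unfold Crossing.Sim at this
  simp only [Prod.mk.injEq] at this
  rcases this with ⟨h1, -, h3, -⟩ | ⟨h1, -, h3, -⟩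
  · exact Or.inl ⟨h1, h3⟩
  · exact Or.inr ⟨h1, h3⟩

theorem tb_sim {L L' : List (Crossing E)} (h : List.Forall₂ Crossing.Sim L L')
    {J : List (E × E)} (hP : (⟨L, J⟩ : PD E).rc.Planar) (e : E) :
    (⟨L, J⟩ : PD E).TB k τ t e m ↔ (⟨L', J⟩ : PD E).TB k τ t e m :=
  (iso_of_sim h J).torsionBound_iff hP (planar_of_sim h hP) e t m

theorem tb_relabel (f : E ≃ E') (D : PD E) (hD : D.rc.Planar) (hD' : (D.map f).rc.Planar) (e : E) :
    D.TB k τ t e m ↔ (D.map f).TB k τ t (f e) m := by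
  refine (iso_of_map (D := D) (D' := D.map f) (finCongr (by simp [map])) f f.symm (fun i => ?_)
    (fun v p hp => rc_join ?_) (fun v p hp => ?_) (fun v e => ?_) fun v e => ?_).torsionBound_iff
      hD hD' e t m
  · simp only [map, List.get_eq_getElem, List.getElem_map]
    exact Crossing.Sim.refl _
  · exact List.mem_map_of_mem (f := Prod.map f f) hp
  · obtain ⟨q, hq, rfl⟩ := List.mem_map.1 hp
    simpa using rc_join hq
  · simp
  · simp

theorem iso_reorder {L L' : List (Crossing E)} {J J' : List (E × E)} (hL : L.Perm L')
    (hJ : J.Perm J') : ∃ π, (⟨L, J⟩ : PD E).rc.Iso (⟨L', J'⟩ : PD E).rc π id id ∧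
      ∀ i, L'.get (π i) = L.get i := by
  obtain ⟨π, hπ⟩ := hL.exists_equiv
  refine ⟨π, iso_of_map (D := ⟨L, J⟩) (D' := ⟨L', J'⟩) π id id (fun i => ?_)
    (fun v p hp => rc_join (hJ.mem_iff.1 hp)) (fun v p hp => rc_join (hJ.mem_iff.2 hp))
    (fun v e => Setoid.refl' _ _) (fun v e => Setoid.refl' _ _), hπ⟩
  change (L'.get (π i)).Sim _
  rw [hπ]
  exact Crossing.Sim.refl _

theorem planar_reorder {L L' : List (Crossing E)} {J J' : List (E × E)} (hL : L.Perm L')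
    (hJ : J.Perm J') (hP : (⟨L, J⟩ : PD E).rc.Planar) : (⟨L', J'⟩ : PD E).rc.Planar := by
  obtain ⟨π, h, hπ⟩ := iso_reorder hL hJ
  refine h.planar (fun i => Or.inl ?_) hP
  exact ⟨congrArg Crossing.a (hπ i), congrArg Crossing.c (hπ i)⟩

theorem tb_reorder {L L' : List (Crossing E)} {J J' : List (E × E)} (hL : L.Perm L')
    (hJ : J.Perm J') (hP : (⟨L, J⟩ : PD E).rc.Planar) (e : E) :
    (⟨L, J⟩ : PD E).TB k τ t e m ↔ (⟨L', J'⟩ : PD E).TB k τ t e m := by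
  obtain ⟨π, h, -⟩ := iso_reorder hL hJ
  exact h.torsionBound_iff hP (planar_reorder hL hJ hP) e t m

theorem tb_unmark (a : E) (L : List (Crossing (Option E))) (J : List (Option E × Option E))
    (hD : (⟨L, (some a, none) :: J⟩ : PD (Option E)).rc.Planar)
    (hD' : ((⟨L, J⟩ : PD (Option E)).map (·.getD a)).rc.Planar) (e : Option E) :
    (⟨L, (some a, none) :: J⟩ : PD (Option E)).TB k τ t e m ↔
      ((⟨L, J⟩ : PD (Option E)).map (·.getD a)).TB k τ t (e.getD a) m := by
  have gf : ∀ v e, (⟨L, (some a, none) :: J⟩ : PD (Option E)).rc.rel v (some (e.getD a)) e := by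
    rintro v (_ | e)
    · exact rc_join (List.mem_cons_self ..)
    · exact Setoid.refl' _ _
  refine (iso_of_map (D := ⟨L, (some a, none) :: J⟩) (D' := (⟨L, J⟩ : PD (Option E)).map (·.getD a))
    (finCongr (by simp [map])) (·.getD a) some (fun i => ?_)
    (fun v p hp => ?_) (fun v p hp => ?_) gf fun v e => Setoid.refl' _ _).torsionBound_iff
      hD hD' e t m
  · simp only [map, List.get_eq_getElem, List.getElem_map]
    exact Crossing.Sim.refl _
  · rcases List.mem_cons.1 hp with rfl | hp
    · exact Setoid.refl' _ _
    · exact rc_join (List.mem_map_of_mem (f := Prod.map (·.getD a) (·.getD a)) hp)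
  · obtain ⟨q, hq, rfl⟩ := List.mem_map.1 hp
    exact Setoid.trans' _ (gf v _) (Setoid.trans' _ (rc_join (List.mem_cons_of_mem _ hq))
      (Setoid.symm' _ (gf v _)))

/-- A criterion for an isolated circle. -/
theorem circ_of {D : PD E} {P : E → Prop} {e₀ : E} (h₀ : P e₀)
    (hJ : ∀ p ∈ D.joins, P p.1 ↔ P p.2)
    (hL : ∀ x ∈ D.crossings, ¬ P x.a ∧ ¬ P x.b ∧ ¬ P x.c ∧ ¬ P x.d)
    (conn : ∀ v e, P e → D.rc.rel v e₀ e) : D.rc.Circ P e₀ where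
  mem := h₀
  closed v e e' h := by
    let s : Setoid E := ⟨fun e e' => P e ↔ P e', fun _ => Iff.rfl, Iff.symm, Iff.trans⟩
    refine rc_rel_le s hJ (fun i p hp => ?_) h
    obtain ⟨h1, h2, h3, h4⟩ := hL _ (List.get_mem D.crossings i)
    have : ¬ P p.1 ∧ ¬ P p.2 := by
      revert hp
      cases v i <;> simp only [Crossing.arcs, List.mem_cons, List.not_mem_nil, or_false] <;>
        rintro (rfl | rfl) <;> constructor <;> assumption
    exact iff_of_false this.1 this.2
  conn := conn
  off i := ⟨(hL _ (List.get_mem D.crossings i)).1, (hL _ (List.get_mem D.crossings i)).2.2.1⟩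

theorem not_of_mem_map {P : E' → Prop} {f : E → E'} (hf : ∀ e, ¬ P (f e)) (L : List (Crossing E)) :
    ∀ x ∈ L.map (Crossing.map f), ¬ P x.a ∧ ¬ P x.b ∧ ¬ P x.c ∧ ¬ P x.d := by
  intro x hx
  obtain ⟨y, -, rfl⟩ := List.mem_map.1 hx
  exact ⟨hf _, hf _, hf _, hf _⟩

/-- One resolution of the kink splits off the loop as a circle, the other one restores the strand.
For `σ = true` the circle is in the 0-resolution and gets merged; for `σ = false` it is in the
1-resolution and arises from a split. -/
theorem tb_r1 (σ : Bool) (a b : E) (p : E × E) (hp : p = (a, b) ∨ p = (b, a))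
    (L : List (Crossing E)) (J : List (E × E))
    (hD : (⟨L, p :: J⟩ : PD E).rc.Planar)
    (hD' : (⟨Crossing.look σ none none (some a) (some b) :: L.map (Crossing.map some),
      J.map (Prod.map some some)⟩ : PD (Option E)).rc.Planar) (e : E) :
    (⟨L, p :: J⟩ : PD E).TB k τ t e m ↔
      (⟨Crossing.look σ none none (some a) (some b) :: L.map (Crossing.map some),
      J.map (Prod.map some some)⟩ : PD (Option E)).TB k τ t (some e) m := by
  set x := Crossing.look σ none none (some a) (some b) with hx
  set D' : PD (Option E) := ⟨x :: L.map (Crossing.map some), J.map (Prod.map some some)⟩ with hD'e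
  have hcirc : (D'.rc.face (!σ)).Circ (· = none) none := by
    rw [face_rc]
    refine circ_of rfl (fun q hq => ?_) (not_of_mem_map (P := (· = none)) (by simp) L)
      (fun v e he => he ▸ Setoid.refl' _ _)
    rcases List.mem_append.1 hq with hq | hq
    · rw [hx] at hq
      cases σ <;> simp [Crossing.look, Crossing.arcs] at hq <;> rcases hq with rfl | rfl <;> simp
    · obtain ⟨r, -, rfl⟩ := List.mem_map.1 hq
      simp
  have hiso : ∃ π, (⟨L, p :: J⟩ : PD E).rc.Iso (D'.rc.face σ) π some (·.getD a) := by
    rw [face_rc]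
    have hJ : ∀ q : Option E × Option E, q ∈ J.map (Prod.map some some) ↔
        ∃ r ∈ J, Prod.map some some r = q := fun q => List.mem_map
    have hmem : ∀ v, (⟨L.map (Crossing.map some), x.arcs σ ++ J.map (Prod.map some some)⟩ :
        PD (Option E)).rc.rel v none (some a) ∧ (⟨L.map (Crossing.map some),
          x.arcs σ ++ J.map (Prod.map some some)⟩ : PD (Option E)).rc.rel v none (some b) := by
      intro v
      cases σ
      · exact ⟨rc_join (by simp [hx, Crossing.look, Crossing.arcs]),
          Setoid.symm' _ (rc_join (by simp [hx, Crossing.look, Crossing.arcs]))⟩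
      · exact ⟨rc_join (by simp [hx, Crossing.look, Crossing.arcs]),
          rc_join (by simp [hx, Crossing.look, Crossing.arcs])⟩
    have hab : ∀ v, (⟨L, p :: J⟩ : PD E).rc.rel v a b := by
      intro v
      rcases hp with rfl | rfl
      · exact rc_join (List.mem_cons_self ..)
      · exact Setoid.symm' _ (rc_join (List.mem_cons_self ..))
    refine ⟨finCongr (by simp), iso_of_map (D := ⟨L, p :: J⟩)
      (D' := ⟨L.map (Crossing.map some), x.arcs σ ++ J.map (Prod.map some some)⟩) _ some (·.getD a)
      (fun i => ?_) (fun v q hq => ?_) (fun v q hq => ?_) (fun v e => Setoid.refl' _ _)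
      fun v e => ?_⟩
    · simp [Crossing.Sim.refl]
    · rcases List.mem_cons.1 hq with rfl | hq
      · rcases hp with rfl | rfl
        · exact Setoid.trans' _ (Setoid.symm' _ (hmem v).1) (hmem v).2
        · exact Setoid.trans' _ (Setoid.symm' _ (hmem v).2) (hmem v).1
      · exact rc_join (List.mem_append_right _ (List.mem_map_of_mem (f := Prod.map some some) hq))
    · rcases List.mem_append.1 hq with hq | hq
      · cases σ <;> simp [hx, Crossing.look, Crossing.arcs] at hq <;> rcases hq with rfl | rfl
        · exact Setoid.refl' _ _
        · exact Setoid.symm' _ (hab v)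
        · exact hab v
        · exact Setoid.refl' _ _
      · obtain ⟨r, hr, rfl⟩ := List.mem_map.1 hq
        exact rc_join (List.mem_cons_of_mem _ hr)
    · cases e with
      | none => exact Setoid.symm' _ (hmem v).1
      | some e => exact Setoid.refl' _ _
  obtain ⟨π, hiso⟩ := hiso
  refine (hiso.torsionBound_iff hD (hD'.face σ) e t m).trans ?_
  cases σ
  · exact ((ResCube.retractSplit hD' hcirc (by simp [rc, hD'e, hx, Crossing.look]) (by simp)).torsionBound_iff
      (D'.rc.diff_mulX _) (fun z => by simp [ResCube.diff_mulX])).trans torsionBound_neg |>.symm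
  · exact ((ResCube.retractMerge hD' hcirc (by simp [rc, hD'e, hx, Crossing.look]) (by simp)).torsionBound_iff
      (D'.rc.diff_mulX _) (ResCube.diff_mulX _ _)).symm

end PD

end Invariance

/-! ## The second and the third Reidemeister move -/

section Slides

variable {E E' : Type} {k : Type} [CommRing k] {τ : k}

open Classical in
/-- The image of `1` under a saddle. -/
noncomputable def saddleOne (k : Type) [CommRing k] (τ : k) (r : Setoid E) (a c : E) :
    CircRing k τ r :=
  if r a c then 1 else xv k τ r a + xv k τ r c

theorem saddle_one_eq {r r' : Setoid E} {a c : E} (h : Nb r r' a c) :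
    saddle k τ r r' a c 1 = saddleOne k τ r' a c :=
  saddle_one h

theorem saddleOne_congr {r : Setoid E} {a c a' c' : E}
    (h : (r a a' ∧ r c c') ∨ (r a c' ∧ r c a')) :
    saddleOne k τ r a c = saddleOne k τ r a' c' := by
  classical
  unfold saddleOne
  rcases h with ⟨h1, h2⟩ | ⟨h1, h2⟩
  · have : r a c ↔ r a' c' :=
      ⟨fun h => r.trans' (r.symm' h1) (r.trans' h h2),
        fun h => r.trans' h1 (r.trans' h (r.symm' h2))⟩
    rw [xv_eq h1, xv_eq h2]
    exact if_congr this rfl rfl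
  · have : r a c ↔ r a' c' :=
      ⟨fun h => r.symm' (r.trans' (r.symm' h1) (r.trans' h h2)),
        fun h => r.trans' h1 (r.trans' (r.symm' h) (r.symm' h2))⟩
    rw [xv_eq h1, xv_eq h2, add_comm]
    exact if_congr this rfl rfl

theorem CircIso.equiv_saddleOne {r : Setoid E} {r' : Setoid E'} {f : E → E'} {g : E' → E}
    (h : CircIso r r' f g) (a c : E) :
    h.equiv (saddleOne k τ r a c) = saddleOne k τ r' (f a) (f c) := by
  unfold saddleOne
  rw [h.rel_iff]
  split_ifs <;> simp [equiv_xv]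

theorem Merge.birth_xv {r ra : Setoid E} {n a : E} (h : Merge r ra n a) {e : E} (he : ¬ r n e) :
    h.birth (xv k τ ra e) = xv k τ r e := by
  have := h.birth_xv_mul (k := k) (τ := τ) he 1
  rwa [mul_one, map_one, mul_one] at this

theorem Merge.birth_saddleOne {r ra : Setoid E} {n a p q : E} (h : Merge r ra n a) (hp : ¬ r n p)
    (hq : ¬ r n q) : h.birth (saddleOne k τ ra p q) = saddleOne k τ r p q := by
  unfold saddleOne
  rw [h.rel_iff hp hq]
  split_ifs <;> simp [h.birth_xv hp, h.birth_xv hq]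

theorem Merge.saddle_saddleOne {r ra : Setoid E} {n a p q b c : E} (h : Merge r ra n a)
    (hp : ¬ r n p) (hq : ¬ r n q) (h1 : saddle k τ r ra b c 1 = 1) :
    saddle k τ r ra b c (saddleOne k τ r p q) = saddleOne k τ ra p q := by
  unfold saddleOne
  rw [h.rel_iff hp hq]
  split_ifs
  · exact h1
  · rw [map_add, saddle_xv, saddle_xv, h1, mul_one, mul_one]

theorem Merge.coeff_add {r ra : Setoid E} {n a p q : E} (h : Merge r ra n a)
    (hpq : (r n p ∧ ¬ r n q) ∨ (r n q ∧ ¬ r n p)) :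
    h.coeff (xv k τ r p + xv k τ r q) = 1 := by
  have h0 : ∀ {e}, ¬ r n e → h.coeff (xv k τ r e) = 0 := by
    intro e he
    rw [← mul_one (xv k τ r e), h.coeff_xv_mul he, h.coeff_one, mul_zero]
  rcases hpq with ⟨hp, hq⟩ | ⟨hq, hp⟩
  · rw [map_add, ← xv_eq hp, h.coeff_xv, h0 hq, add_zero]
  · rw [map_add, ← xv_eq hq, h.coeff_xv, h0 hp, zero_add]

theorem not_rel_of_circle {r : Setoid E} {m p q : E}
    (hpq : (r m p ∧ ¬ r m q) ∨ (r m q ∧ ¬ r m p)) : ¬ r p q := by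
  rcases hpq with ⟨hp, hq⟩ | ⟨hq, hp⟩
  · exact fun h => hq (r.trans' hp h)
  · exact fun h => hp (r.trans' hq (r.symm' h))

variable {f f₂ : E → E'} {g g₂ : E' → E}

/-- In the third move, one component of the map into a cancelled bigon runs through the isolated
circle and back by the coefficient. It is linear over the outer variables, and its first step sends
1 to a sum with exactly one term on the circle, which the coefficient turns into 1. So only the last
saddle matters, and it matches the saddle of the other diagram. -/
theorem slide_coeff {r rC rA rM : Setoid E} {r' rM' : Setoid E'} {a c m p a₁ c₁ : E} {a' c' : E'}
    (hθ : CircIso r r' f g) (hψ : CircIso rM rM' f₂ g₂) (hC : Nb r rC a c) (hm : Merge rC rA m p)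
    (hA : Nb rA rM a₁ c₁) (h' : Nb r' rM' a' c')
    (hac : (rC m a ∧ ¬ rC m c) ∨ (rC m c ∧ ¬ rC m a))
    (hO : ∀ e, ∃ e' ∈ {e' | ¬ rC m e' ∧ f₂ e' = f e'}, r e e')
    (h1 : (rM' (f₂ a₁) a' ∧ rM' (f₂ c₁) c') ∨ (rM' (f₂ a₁) c' ∧ rM' (f₂ c₁) a'))
    (z : CircRing k τ r) :
    hψ.equiv (saddle k τ rA rM a₁ c₁ (hm.coeff (saddle k τ r rC a c z))) =
      saddle k τ r' rM' a' c' (hθ.equiv z) := by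
  suffices e : hψ.equiv.toLinearMap ∘ₗ saddle k τ rA rM a₁ c₁ ∘ₗ hm.coeff ∘ₗ saddle k τ r rC a c =
      saddle k τ r' rM' a' c' ∘ₗ hθ.equiv.toLinearMap from LinearMap.congr_fun e z
  refine circ_ext r _ hO (fun e z => xv k τ rM' (f e) * z) _ _ (fun e he z => ?_)
    (fun e he z => ?_) ?_
  · simp [saddle_xv_mul, hm.coeff_xv_mul he.1, CircIso.equiv_xv, ← he.2]
  · simp [saddle_xv_mul, CircIso.equiv_xv]
  · simp only [LinearMap.comp_apply, AlgEquiv.toLinearMap_apply, map_one]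
    rw [saddle_one_eq hC, saddleOne, if_neg (not_rel_of_circle hac), hm.coeff_add hac,
      saddle_one_eq hA, saddle_one_eq h', CircIso.equiv_saddleOne, saddleOne_congr h1]

theorem slide_coeff' {r rM : Setoid E} {r' rM' rC rA : Setoid E'} {a c : E} {m p a₁ c₁ a' c' : E'}
    (hθ : CircIso r r' f g) (hψ : CircIso rM rM' f₂ g₂) (h : Nb r rM a c) (hC : Nb r' rC a' c')
    (hm : Merge rC rA m p) (hA : Nb rA rM' a₁ c₁)
    (hac : (rC m a' ∧ ¬ rC m c') ∨ (rC m c' ∧ ¬ rC m a'))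
    (hO : ∀ e, ∃ e' ∈ {e' | ¬ rC m (f e') ∧ f₂ e' = f e'}, r e e')
    (h1 : (rM' (f₂ a) a₁ ∧ rM' (f₂ c) c₁) ∨ (rM' (f₂ a) c₁ ∧ rM' (f₂ c) a₁))
    (z : CircRing k τ r) :
    hψ.equiv (saddle k τ r rM a c z) =
      saddle k τ rA rM' a₁ c₁ (hm.coeff (saddle k τ r' rC a' c' (hθ.equiv z))) := by
  suffices e : hψ.equiv.toLinearMap ∘ₗ saddle k τ r rM a c = saddle k τ rA rM' a₁ c₁ ∘ₗ hm.coeff ∘ₗ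
      saddle k τ r' rC a' c' ∘ₗ hθ.equiv.toLinearMap from LinearMap.congr_fun e z
  refine circ_ext r _ hO (fun e z => xv k τ rM' (f e) * z) _ _ (fun e he z => ?_)
    (fun e he z => ?_) ?_
  · simp [saddle_xv_mul, CircIso.equiv_xv, ← he.2]
  · simp [saddle_xv_mul, hm.coeff_xv_mul he.1, CircIso.equiv_xv]
  · simp only [LinearMap.comp_apply, AlgEquiv.toLinearMap_apply, map_one]
    rw [saddle_one_eq hC, saddleOne, if_neg (not_rel_of_circle hac), hm.coeff_add hac,
      saddle_one_eq hA, saddle_one_eq h, CircIso.equiv_saddleOne, saddleOne_congr h1]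

/-- The counterpart for maps out of a cancelled bigon: a circle is born, the factor of the preceding
saddle lies off it, and the next merge absorbs it. -/
theorem slide_birth {r rM rB rC : Setoid E} {r' rM' : Setoid E'} {m p b a₂ c₂ a₃ c₃ a₄ c₄ : E}
    {a' c' : E'} (hθ : CircIso r r' f g) (hψ : CircIso rM rM' f₂ g₂) (h3 : Nb rM rB a₃ c₃)
    (hb : Merge rC rB m b) (hr : Merge rC r m p) (h2 : saddle k τ rC r a₂ c₂ 1 = 1)
    (h' : Nb rM' r' a' c') (ha : ¬ rC m a₄) (hc : ¬ rC m c₄) (h34 : rB a₃ a₄ ∧ rB c₃ c₄)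
    (h4 : r' (f a₄) a' ∧ r' (f c₄) c') (hO : ∀ e, ∃ e' ∈ {e' | ¬ rC m e' ∧ f₂ e' = f e'}, rM e e')
    (z : CircRing k τ rM) :
    hθ.equiv (saddle k τ rC r a₂ c₂ (hb.birth (saddle k τ rM rB a₃ c₃ z))) =
      saddle k τ rM' r' a' c' (hψ.equiv z) := by
  suffices e : hθ.equiv.toLinearMap ∘ₗ saddle k τ rC r a₂ c₂ ∘ₗ hb.birth.toLinearMap ∘ₗ
      saddle k τ rM rB a₃ c₃ = saddle k τ rM' r' a' c' ∘ₗ hψ.equiv.toLinearMap from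
    LinearMap.congr_fun e z
  refine circ_ext rM _ hO (fun e z => xv k τ r' (f e) * z) _ _ (fun e he z => ?_)
    (fun e he z => ?_) ?_
  · simp only [LinearMap.comp_apply, AlgEquiv.toLinearMap_apply, AlgHom.toLinearMap_apply,
      saddle_xv_mul, hb.birth_xv_mul he.1, map_mul, CircIso.equiv_xv]
  · simp [saddle_xv_mul, CircIso.equiv_xv, he.2]
  · simp only [LinearMap.comp_apply, AlgEquiv.toLinearMap_apply, map_one, AlgHom.toLinearMap_apply]
    rw [saddle_one_eq h3, saddleOne_congr (Or.inl h34), hb.birth_saddleOne ha hc,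
      hr.saddle_saddleOne ha hc h2, CircIso.equiv_saddleOne, saddle_one_eq h',
      saddleOne_congr (Or.inl h4)]

theorem slide_birth' {r rM : Setoid E} {r' rM' rB rC : Setoid E'} {m p b a₂ c₂ a₃ c₃ a₄ c₄ : E'}
    {a c : E} (hθ : CircIso r r' f g) (hψ : CircIso rM rM' f₂ g₂) (h : Nb rM r a c)
    (h3 : Nb rM' rB a₃ c₃) (hb : Merge rC rB m b) (hr : Merge rC r' m p)
    (h2 : saddle k τ rC r' a₂ c₂ 1 = 1) (ha : ¬ rC m a₄) (hc : ¬ rC m c₄)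
    (h34 : rB a₃ a₄ ∧ rB c₃ c₄) (h4 : r' (f a) a₄ ∧ r' (f c) c₄)
    (hO : ∀ e, ∃ e' ∈ {e' | ¬ rC m (f e') ∧ f₂ e' = f e'}, rM e e') (z : CircRing k τ rM) :
    hθ.equiv (saddle k τ rM r a c z) =
      saddle k τ rC r' a₂ c₂ (hb.birth (saddle k τ rM' rB a₃ c₃ (hψ.equiv z))) := by
  suffices e : hθ.equiv.toLinearMap ∘ₗ saddle k τ rM r a c = saddle k τ rC r' a₂ c₂ ∘ₗ
      hb.birth.toLinearMap ∘ₗ saddle k τ rM' rB a₃ c₃ ∘ₗ hψ.equiv.toLinearMap from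
    LinearMap.congr_fun e z
  refine circ_ext rM _ hO (fun e z => xv k τ r' (f e) * z) _ _ (fun e he z => ?_)
    (fun e he z => ?_) ?_
  · simp [saddle_xv_mul, CircIso.equiv_xv]
  · simp only [LinearMap.comp_apply, AlgEquiv.toLinearMap_apply, AlgHom.toLinearMap_apply,
      saddle_xv_mul, map_mul, CircIso.equiv_xv, he.2, hb.birth_xv_mul he.1]
  · simp only [LinearMap.comp_apply, AlgEquiv.toLinearMap_apply, map_one, AlgHom.toLinearMap_apply]
    rw [saddle_one_eq h3, saddleOne_congr (Or.inl h34), hb.birth_saddleOne ha hc,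
      hr.saddle_saddleOne ha hc h2, saddle_one_eq h, CircIso.equiv_saddleOne,
      saddleOne_congr (Or.inl h4)]

end Slides

/-! ### Comparison of cones and the second Reidemeister move. -/

section Reidemeister

variable {k : Type} [CommRing k] {τ t : k}

theorem torsionBound_cone_congr {A B A' B' : Type} [AddCommGroup A] [Module k A] [AddCommGroup B]
    [Module k B] [AddCommGroup A'] [Module k A'] [AddCommGroup B'] [Module k B']
    {dA xA : Module.End k A} {dB xB : Module.End k B} {dA' xA' : Module.End k A'}
    {dB' xB' : Module.End k B'} {s : A →ₗ[k] B} {s' : A' →ₗ[k] B'} {m : ℕ} (F : A ≃ₗ[k] A')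
    (G : B ≃ₗ[k] B') (hF : ∀ z, F (dA z) = dA' (F z)) (hG : ∀ z, G (dB z) = dB' (G z))
    (hFx : ∀ z, F (xA z) = xA' (F z)) (hGx : ∀ z, G (xB z) = xB' (G z))
    (hs : ∀ z, G (s z) = s' (F z)) (hdA : ∀ z, dA (xA z) = xA (dA z))
    (hdB : ∀ z, dB (xB z) = xB (dB z)) (hsx : ∀ z, s (xA z) = xB (s z)) :
    TorsionBound t (cone dA dB s) (xA.prodMap xB) m ↔
      TorsionBound t (cone dA' dB' s') (xA'.prodMap xB') m := by
  have hd : ∀ z, F.prodCongr G (cone dA dB s z) = cone dA' dB' s' (F.prodCongr G z) := fun z =>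
    Prod.ext (hF _) (by simp [hs, hG])
  have hx : ∀ z, F.prodCongr G (xA.prodMap xB z) = xA'.prodMap xB' (F.prodCongr G z) := fun z =>
    Prod.ext (hFx _) (hGx _)
  have hdx : ∀ z, cone dA dB s (xA.prodMap xB z) = xA.prodMap xB (cone dA dB s z) := fun z =>
    Prod.ext (by simp [hdA]) (by simp [hdB, hsx])
  refine ⟨fun h => h.of_equiv (F.prodCongr G).symm (fun z => ?_) (fun z => ?_) (fun z => ?_),
    fun h => h.of_equiv (F.prodCongr G) hd hx hdx⟩
  · obtain ⟨z, rfl⟩ := (F.prodCongr G).surjective z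
    rw [← hd, LinearEquiv.symm_apply_apply, LinearEquiv.symm_apply_apply]
  · obtain ⟨z, rfl⟩ := (F.prodCongr G).surjective z
    rw [← hx, LinearEquiv.symm_apply_apply, LinearEquiv.symm_apply_apply]
  · obtain ⟨z, rfl⟩ := (F.prodCongr G).surjective z
    rw [← hx, ← hd, hdx, ← hd, hx]

namespace PD

variable {E E' : Type} {m : ℕ}

theorem face_face_rc (x y : Crossing E) (L : List (Crossing E)) (J : List (E × E)) (b b' : Bool) :
    ((⟨x :: y :: L, J⟩ : PD E).rc.face b).face b' =
      (⟨L, y.arcs b' ++ (x.arcs b ++ J)⟩ : PD E).rc := by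
  rw [face_rc]
  exact face_rc _ _ _ _

/-- Among the four resolutions, (1, 0) contains a circle formed by the two edges of the bigon, and
(0, 1) is the diagram with the strands pulled apart. The circle makes the three resolutions other
than (0, 1) cancel. -/
theorem tb_r2 (a b c d : E) (p q : E × E) (hp : p = (a, b) ∨ p = (b, a))
    (hq : q = (c, d) ∨ q = (d, c)) (L : List (Crossing E)) (J : List (E × E))
    (hD : (⟨L, p :: q :: J⟩ : PD E).rc.Planar)
    (hD' : (⟨Crossing.look true (.inl c) (.inr true) (.inr false) (.inl a) ::
      Crossing.look true (.inr false) (.inr true) (.inl d) (.inl b) :: L.map (Crossing.map Sum.inl),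
      J.map (Prod.map Sum.inl Sum.inl)⟩ : PD (E ⊕ Bool)).rc.Planar) (e : E) :
    (⟨L, p :: q :: J⟩ : PD E).TB k τ t e m ↔
      (⟨Crossing.look true (.inl c) (.inr true) (.inr false) (.inl a) ::
      Crossing.look true (.inr false) (.inr true) (.inl d) (.inl b) :: L.map (Crossing.map Sum.inl),
      J.map (Prod.map Sum.inl Sum.inl)⟩ : PD (E ⊕ Bool)).TB k τ t (.inl e) m := by
  set x : Crossing (E ⊕ Bool) := Crossing.look true (.inl c) (.inr true) (.inr false) (.inl a)
    with hx
  set y : Crossing (E ⊕ Bool) := Crossing.look true (.inr false) (.inr true) (.inl d) (.inl b)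
    with hy
  set D' : PD (E ⊕ Bool) := ⟨x :: y :: L.map (Crossing.map Sum.inl),
    J.map (Prod.map Sum.inl Sum.inl)⟩ with hD'e
  let P : E ⊕ Bool → Prop := fun e => e.isRight
  have hcirc : ((D'.rc.face true).face false).Circ P (.inr true) := by
    rw [face_face_rc]
    refine circ_of rfl (fun q hq => ?_) (not_of_mem_map (P := P) (by simp [P]) L)
      (fun v e he => ?_)
    · rcases List.mem_append.1 hq with hq | hq
      · rw [hy] at hq
        simp [Crossing.look, Crossing.arcs] at hq
        rcases hq with rfl | rfl <;> simp [P]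
      · rcases List.mem_append.1 hq with hq | hq
        · rw [hx] at hq
          simp [Crossing.look, Crossing.arcs] at hq
          rcases hq with rfl | rfl <;> simp [P]
        · obtain ⟨r, -, rfl⟩ := List.mem_map.1 hq
          simp [P]
    · rcases e with e | (_ | _)
      · simp [P] at he
      · exact rc_join (by simp [hx, Crossing.look, Crossing.arcs])
      · exact Setoid.refl' _ _
  have hiso : ∃ π, (⟨L, p :: q :: J⟩ : PD E).rc.Iso ((D'.rc.face false).face true) π Sum.inl
      (Sum.elim id fun b => if b then c else a) := by
    rw [face_face_rc]
    set M : PD (E ⊕ Bool) := ⟨L.map (Crossing.map Sum.inl), y.arcs true ++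
      (x.arcs false ++ J.map (Prod.map Sum.inl Sum.inl))⟩ with hM
    have h1 : ∀ v, M.rc.rel v (.inr false) (.inl b) := fun v =>
      rc_join (by simp [hM, hy, Crossing.look, Crossing.arcs])
    have h2 : ∀ v, M.rc.rel v (.inr true) (.inl d) := fun v =>
      rc_join (by simp [hM, hy, Crossing.look, Crossing.arcs])
    have h3 : ∀ v, M.rc.rel v (.inl c) (.inr true) := fun v =>
      rc_join (by simp [hM, hx, Crossing.look, Crossing.arcs])
    have h4 : ∀ v, M.rc.rel v (.inr false) (.inl a) := fun v =>
      rc_join (by simp [hM, hx, Crossing.look, Crossing.arcs])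
    have hab : ∀ v, (⟨L, p :: q :: J⟩ : PD E).rc.rel v a b := by
      intro v
      rcases hp with rfl | rfl
      · exact rc_join (by simp)
      · exact Setoid.symm' _ (rc_join (by simp))
    have hcd : ∀ v, (⟨L, p :: q :: J⟩ : PD E).rc.rel v c d := by
      intro v
      rcases hq with rfl | rfl
      · exact rc_join (by simp)
      · exact Setoid.symm' _ (rc_join (by simp))
    refine ⟨finCongr (by simp [hM]), iso_of_map (D := ⟨L, p :: q :: J⟩)
      (D' := M) _ Sum.inl (Sum.elim id fun b => if b then c else a)
      (fun i => ?_) (fun v r hr => ?_) (fun v r hr => ?_) (fun v e => Setoid.refl' _ _)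
      fun v e => ?_⟩
    · simp [hM, Crossing.Sim.refl]
    · have ab := Setoid.trans' _ (Setoid.symm' _ (h4 v)) (h1 v)
      have cd := Setoid.trans' _ (h3 v) (h2 v)
      rcases List.mem_cons.1 hr with rfl | hr
      · rcases hp with rfl | rfl
        · exact ab
        · exact Setoid.symm' _ ab
      · rcases List.mem_cons.1 hr with rfl | hr
        · rcases hq with rfl | rfl
          · exact cd
          · exact Setoid.symm' _ cd
        · exact rc_join (List.mem_append_right _ (List.mem_append_right _
            (List.mem_map_of_mem (f := Prod.map Sum.inl Sum.inl) hr)))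
    · rcases List.mem_append.1 hr with hr | hr
      · rw [hy] at hr
        simp [Crossing.look, Crossing.arcs] at hr
        rcases hr with rfl | rfl
        · exact hab v
        · exact hcd v
      · rcases List.mem_append.1 hr with hr | hr
        · rw [hx] at hr
          simp [Crossing.look, Crossing.arcs] at hr
          rcases hr with rfl | rfl
          · exact Setoid.refl' _ _
          · exact Setoid.refl' _ _
        · obtain ⟨r, hr', rfl⟩ := List.mem_map.1 hr
          exact rc_join (List.mem_cons_of_mem _ (List.mem_cons_of_mem _ hr'))
    · rcases e with e | (_ | _)
      · exact Setoid.refl' _ _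
      · exact Setoid.symm' _ (h4 v)
      · exact h3 v
  obtain ⟨π, hiso⟩ := hiso
  refine (hiso.torsionBound_iff hD ((hD'.face false).face true) e t m).trans ?_
  have hR := (ResCube.bigon₁₀ (k := k) (τ := τ) (e := .inl e) hD' hcirc
    (by simp [rc, hD'e, hx, Crossing.look, P]) (by simp [rc, hD'e, hy, Crossing.look, P])
    (by simp [P])).ofEquiv (D'.rc.consConsEquiv k τ) (ResCube.consConsEquiv_diff _)
    (ResCube.consConsEquiv_mulX _ _)
  exact ((hR.torsionBound_iff (D'.rc.diff_mulX _) (fun z => by simp [ResCube.diff_mulX])).trans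
    torsionBound_neg).symm

end PD

end Reidemeister

/-! ## The third Reidemeister move: combinatorics -/

section TriangleCombinatorics

variable {E E' : Type}

/-- The class of an edge. -/
def cl (s : Setoid E) (e : E) : Quotient s := Quotient.mk s e

theorem cl_eq {s : Setoid E} {e e' : E} : cl s e = cl s e' ↔ s e e' := Quotient.eq

/-- The rotated labels for `σ = false` make the σ-resolution pair the same edges for both values of
σ, up to the direction of the arcs. This lets one combinatorial argument serve both versions of the
third move. -/
theorem look_arcs_same {s : Setoid E} {σ : Bool} {a b c d : E} :
    (∀ p ∈ (Crossing.look σ a b c d).arcs σ, s p.1 p.2) ↔ cl s a = cl s d ∧ cl s b = cl s c := by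
  rw [cl_eq, cl_eq]
  cases σ
  · simp only [Crossing.look, Crossing.arcs, Bool.false_eq_true, if_false, List.forall_mem_cons,
      List.not_mem_nil, false_implies, implies_true, and_true]
    exact ⟨fun h => ⟨s.symm' h.2, h.1⟩, fun h => ⟨h.2, s.symm' h.1⟩⟩
  · simp [Crossing.look, Crossing.arcs]

theorem look_arcs_ne {s : Setoid E} {σ : Bool} {a b c d : E} :
    (∀ p ∈ (Crossing.look σ a b c d).arcs (!σ), s p.1 p.2) ↔ cl s a = cl s b ∧ cl s c = cl s d := by
  rw [cl_eq, cl_eq]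
  cases σ
  · simp only [Crossing.look, Crossing.arcs, Bool.not_false, Bool.false_eq_true, if_false,
      List.forall_mem_cons, List.not_mem_nil, false_implies, implies_true, and_true]
    exact ⟨fun h => ⟨s.symm' h.1, h.2⟩, fun h => ⟨s.symm' h.1, h.2⟩⟩
  · simp [Crossing.look, Crossing.arcs]

namespace PD

/-- Unlike in `iso_of_map`, corresponding edges at a crossing need only lie on the same circle. -/
theorem iso_of_match {D : PD E} {D' : PD E'}
    (π : Fin D.crossings.length ≃ Fin D'.crossings.length) (f : E → E') (g : E' → E)
    (hget : ∀ v i, ∀ F : Crossing E → E, ∀ F' : Crossing E' → E',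
      (F, F') ∈ [(Crossing.a, Crossing.a), (Crossing.b, Crossing.b), (Crossing.c, Crossing.c),
        (Crossing.d, Crossing.d)] →
      D'.rc.rel v (f (F (D.crossings.get i))) (F' (D'.crossings.get (π i))) ∧
        D.rc.rel ((ResCube.cubeEquiv π).symm v) (g (F' (D'.crossings.get (π i))))
          (F (D.crossings.get i)))
    (hJ : ∀ v, ∀ p ∈ D.joins, D'.rc.rel v (f p.1) (f p.2))
    (hJ' : ∀ v, ∀ p ∈ D'.joins, D.rc.rel v (g p.1) (g p.2))
    (gf : ∀ v e, D.rc.rel v (g (f e)) e) (fg : ∀ v e, D'.rc.rel v (f (g e)) e) :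
    D.rc.Iso D'.rc π f g := by
  refine ⟨fun v => ⟨fun e e' h => ?_, fun e e' h => ?_, gf _, fg _⟩, fun v i _ => Or.inl ⟨?_, ?_⟩⟩
  · refine rc_rel_le ((D'.rc.rel v).comap f) (hJ v) (fun i p hp => ?_) h
    have ha := (hget v i Crossing.a Crossing.a (by simp)).1
    have hb := (hget v i Crossing.b Crossing.b (by simp)).1
    have hc := (hget v i Crossing.c Crossing.c (by simp)).1
    have hd := (hget v i Crossing.d Crossing.d (by simp)).1
    change D'.rc.rel v _ _
    have key : ∀ q ∈ (D'.crossings.get (π i)).arcs (v (π i)), D'.rc.rel v q.1 q.2 :=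
      fun q hq => rc_arc _ hq
    change p ∈ (D.crossings.get i).arcs (v (π i)) at hp
    rw [← cl_eq] at *
    cases hv : v (π i) <;> rw [hv] at hp key <;>
      simp only [Crossing.arcs, List.mem_cons, List.not_mem_nil, or_false, forall_eq_or_imp,
        forall_eq, ← cl_eq] at hp key ha hb hc hd <;>
      rcases hp with rfl | rfl <;> grind
  · refine rc_rel_le ((D.rc.rel ((ResCube.cubeEquiv π).symm v)).comap g) (hJ' _)
      (fun i p hp => ?_) h
    obtain ⟨i, rfl⟩ := π.surjective i
    have ha := (hget v i Crossing.a Crossing.a (by simp)).2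
    have hb := (hget v i Crossing.b Crossing.b (by simp)).2
    have hc := (hget v i Crossing.c Crossing.c (by simp)).2
    have hd := (hget v i Crossing.d Crossing.d (by simp)).2
    change D.rc.rel _ _ _
    have key : ∀ q ∈ (D.crossings.get i).arcs (v (π i)),
        D.rc.rel ((ResCube.cubeEquiv π).symm v) q.1 q.2 :=
      fun q hq => rc_arc _ hq
    rw [← cl_eq] at *
    cases hv : v (π i) <;> rw [hv] at hp key <;>
      simp only [Crossing.arcs, List.mem_cons, List.not_mem_nil, or_false, forall_eq_or_imp,
        forall_eq, ← cl_eq] at hp key ha hb hc hd <;>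
      rcases hp with rfl | rfl <;> grind
  · exact (hget v i Crossing.a Crossing.a (by simp)).1
  · exact (hget v i Crossing.c Crossing.c (by simp)).1

end PD

/-- The edges at the triangle of the third Reidemeister move, and the rest of the diagram. -/
structure Triangle (E : Type) where
  (p₁ p₂ p₃ q₁ q₂ q₃ u v w : E)
  L : List (Crossing E)
  J : List (E × E)

namespace Triangle

variable (T : Triangle E) (σ : Bool)

/-- The diagram before the move. -/
abbrev D : PD E := ⟨Crossing.look σ T.w T.q₂ T.q₁ T.v :: Crossing.look σ T.p₂ T.u T.v T.p₁ ::
  Crossing.look σ T.p₃ T.q₃ T.w T.u :: T.L, T.J⟩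

/-- The diagram after the move. -/
abbrev D' : PD E := ⟨Crossing.look σ T.p₃ T.u T.v T.p₂ :: Crossing.look σ T.v T.w T.q₁ T.p₁ ::
  Crossing.look σ T.u T.q₃ T.q₂ T.w :: T.L, T.J⟩

/-- The edges of the triangle. -/
def Inner (e : E) : Prop := e = T.u ∨ e = T.v ∨ e = T.w

/-- The edges of the triangle are distinct and do not occur elsewhere. -/
structure Free : Prop where
  p₁ : ¬ T.Inner T.p₁
  p₂ : ¬ T.Inner T.p₂
  p₃ : ¬ T.Inner T.p₃
  q₁ : ¬ T.Inner T.q₁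
  q₂ : ¬ T.Inner T.q₂
  q₃ : ¬ T.Inner T.q₃
  uv : T.u ≠ T.v
  uw : T.u ≠ T.w
  vw : T.v ≠ T.w
  L : ∀ x ∈ T.L, ¬ T.Inner x.a ∧ ¬ T.Inner x.b ∧ ¬ T.Inner x.c ∧ ¬ T.Inner x.d
  J : ∀ p ∈ T.J, ¬ T.Inner p.1 ∧ ¬ T.Inner p.2

open Classical in
/-- Substitution for the edges of the triangle. -/
noncomputable def subst (x y z e : E) : E :=
  if e = T.u then x else if e = T.v then y else if e = T.w then z else e

theorem subst_of_not {x y z e : E} (h : ¬ T.Inner e) : T.subst x y z e = e := by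
  simp only [Inner, not_or] at h
  simp [subst, h]

theorem subst_u (x y z : E) : T.subst x y z T.u = x := by simp [subst]

variable {T} {σ}

theorem Free.subst_v (h : T.Free) (x y z : E) : T.subst x y z T.v = y := by
  simp [subst, h.uv.symm]

theorem Free.subst_w (h : T.Free) (x y z : E) : T.subst x y z T.w = z := by
  simp [subst, h.uw.symm, h.vw.symm]

variable {b₀ b₁ b₂ : Bool} {n : Fin T.L.length → Bool}

/-- The circles of a resolution before the move. -/
abbrev rel (T : Triangle E) (σ b₀ b₁ b₂ : Bool) (n : Fin T.L.length → Bool) : Setoid E :=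
  ((((T.D σ).rc.face b₀).face b₁).face b₂).rel n

/-- The circles of a resolution after the move. -/
abbrev rel' (T : Triangle E) (σ b₀ b₁ b₂ : Bool) (n : Fin T.L.length → Bool) : Setoid E :=
  ((((T.D' σ).rc.face b₀).face b₁).face b₂).rel n

theorem arc₀ {x y z : Crossing E} {L : List (Crossing E)} {J : List (E × E)}
    {n : Fin L.length → Bool} : ∀ p ∈ x.arcs b₀,
      ((((⟨x :: y :: z :: L, J⟩ : PD E).rc.face b₀).face b₁).face b₂).rel n p.1 p.2 :=
  fun _ hp => PD.rc_arc (D := ⟨x :: y :: z :: L, J⟩)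
    (v := (Fin.cons b₀ (Fin.cons b₁ (Fin.cons b₂ n : Fin (L.length + 1) → Bool) :
      Fin (L.length + 2) → Bool) : Fin (L.length + 3) → Bool)) (0 : Fin (L.length + 3)) hp

theorem arc₁ {x y z : Crossing E} {L : List (Crossing E)} {J : List (E × E)}
    {n : Fin L.length → Bool} : ∀ p ∈ y.arcs b₁,
      ((((⟨x :: y :: z :: L, J⟩ : PD E).rc.face b₀).face b₁).face b₂).rel n p.1 p.2 :=
  fun _ hp => PD.rc_arc (D := ⟨x :: y :: z :: L, J⟩)
    (v := (Fin.cons b₀ (Fin.cons b₁ (Fin.cons b₂ n : Fin (L.length + 1) → Bool) :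
      Fin (L.length + 2) → Bool) : Fin (L.length + 3) → Bool)) (1 : Fin (L.length + 3)) hp

theorem arc₂ {x y z : Crossing E} {L : List (Crossing E)} {J : List (E × E)}
    {n : Fin L.length → Bool} : ∀ p ∈ z.arcs b₂,
      ((((⟨x :: y :: z :: L, J⟩ : PD E).rc.face b₀).face b₁).face b₂).rel n p.1 p.2 :=
  fun _ hp => PD.rc_arc (D := ⟨x :: y :: z :: L, J⟩)
    (v := (Fin.cons b₀ (Fin.cons b₁ (Fin.cons b₂ n : Fin (L.length + 1) → Bool) :
      Fin (L.length + 2) → Bool) : Fin (L.length + 3) → Bool)) (2 : Fin (L.length + 3)) hp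

theorem rel_facts : (b₀ = σ → cl (T.rel σ b₀ b₁ b₂ n) T.w = cl _ T.v ∧
      cl (T.rel σ b₀ b₁ b₂ n) T.q₂ = cl _ T.q₁) ∧
    (b₀ = !σ → cl (T.rel σ b₀ b₁ b₂ n) T.w = cl _ T.q₂ ∧
      cl (T.rel σ b₀ b₁ b₂ n) T.q₁ = cl _ T.v) ∧
    (b₁ = σ → cl (T.rel σ b₀ b₁ b₂ n) T.p₂ = cl _ T.p₁ ∧
      cl (T.rel σ b₀ b₁ b₂ n) T.u = cl _ T.v) ∧
    (b₁ = !σ → cl (T.rel σ b₀ b₁ b₂ n) T.p₂ = cl _ T.u ∧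
      cl (T.rel σ b₀ b₁ b₂ n) T.v = cl _ T.p₁) ∧
    (b₂ = σ → cl (T.rel σ b₀ b₁ b₂ n) T.p₃ = cl _ T.u ∧
      cl (T.rel σ b₀ b₁ b₂ n) T.q₃ = cl _ T.w) ∧
    (b₂ = !σ → cl (T.rel σ b₀ b₁ b₂ n) T.p₃ = cl _ T.q₃ ∧
      cl (T.rel σ b₀ b₁ b₂ n) T.w = cl _ T.u) := by
  refine ⟨?_, ?_, ?_, ?_, ?_, ?_⟩ <;> rintro rfl
  · exact look_arcs_same.1 arc₀
  · exact look_arcs_ne.1 arc₀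
  · exact look_arcs_same.1 arc₁
  · exact look_arcs_ne.1 arc₁
  · exact look_arcs_same.1 arc₂
  · exact look_arcs_ne.1 arc₂

theorem rel'_facts : (b₀ = σ → cl (T.rel' σ b₀ b₁ b₂ n) T.p₃ = cl _ T.p₂ ∧
      cl (T.rel' σ b₀ b₁ b₂ n) T.u = cl _ T.v) ∧
    (b₀ = !σ → cl (T.rel' σ b₀ b₁ b₂ n) T.p₃ = cl _ T.u ∧
      cl (T.rel' σ b₀ b₁ b₂ n) T.v = cl _ T.p₂) ∧
    (b₁ = σ → cl (T.rel' σ b₀ b₁ b₂ n) T.v = cl _ T.p₁ ∧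
      cl (T.rel' σ b₀ b₁ b₂ n) T.w = cl _ T.q₁) ∧
    (b₁ = !σ → cl (T.rel' σ b₀ b₁ b₂ n) T.v = cl _ T.w ∧
      cl (T.rel' σ b₀ b₁ b₂ n) T.q₁ = cl _ T.p₁) ∧
    (b₂ = σ → cl (T.rel' σ b₀ b₁ b₂ n) T.u = cl _ T.w ∧
      cl (T.rel' σ b₀ b₁ b₂ n) T.q₃ = cl _ T.q₂) ∧
    (b₂ = !σ → cl (T.rel' σ b₀ b₁ b₂ n) T.u = cl _ T.q₃ ∧
      cl (T.rel' σ b₀ b₁ b₂ n) T.q₂ = cl _ T.w) := by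
  refine ⟨?_, ?_, ?_, ?_, ?_, ?_⟩ <;> rintro rfl
  · exact look_arcs_same.1 arc₀
  · exact look_arcs_ne.1 arc₀
  · exact look_arcs_same.1 arc₁
  · exact look_arcs_ne.1 arc₁
  · exact look_arcs_same.1 arc₂
  · exact look_arcs_ne.1 arc₂

theorem face_face_face (x y z : Crossing E) (L : List (Crossing E)) (J : List (E × E)) :
    (((⟨x :: y :: z :: L, J⟩ : PD E).rc.face b₀).face b₁).face b₂ =
      (⟨L, z.arcs b₂ ++ (y.arcs b₁ ++ (x.arcs b₀ ++ J))⟩ : PD E).rc := by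
  rw [PD.face_face_rc]
  exact PD.face_rc _ _ _ _

/-- The setoid of a predicate. -/
def predSetoid (P : E → Prop) : Setoid E := ⟨fun e e' => P e ↔ P e', fun _ => Iff.rfl, Iff.symm, Iff.trans⟩

theorem inner_u : T.Inner T.u := Or.inl rfl
theorem inner_v : T.Inner T.v := Or.inr (Or.inl rfl)
theorem inner_w : T.Inner T.w := Or.inr (Or.inr rfl)

/-- In this resolution the sides of the triangle close up, and no outer edge is joined to them. -/
theorem circ (h : T.Free) : ((((T.D σ).rc.face σ).face σ).face (!σ)).Circ T.Inner T.u := by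
  have facts := fun n => rel_facts (T := T) (σ := σ) (b₀ := σ) (b₁ := σ) (b₂ := !σ) (n := n)
  have hc : ∀ n e, T.Inner e → T.rel σ σ σ (!σ) n T.u e := by
    intro n e he
    obtain ⟨f0, -, f1, -, -, f2⟩ := facts n
    rw [← cl_eq]
    rcases he with rfl | rfl | rfl
    · rfl
    · exact (f1 rfl).2
    · exact ((f2 rfl).2).symm
  unfold rel at hc
  rw [face_face_face] at hc ⊢
  have ht : ∀ {e}, ¬ T.Inner e → (T.Inner e ↔ False) := fun h => iff_false_intro h
  refine PD.circ_of inner_u ?_ h.L hc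
  have key : ∀ e e', cl (predSetoid T.Inner) e = cl _ e' ↔ (T.Inner e ↔ T.Inner e') := fun e e' =>
    cl_eq
  change ∀ p : E × E, p ∈ (_ : List (E × E)) → predSetoid T.Inner p.1 p.2
  simp only [List.forall_mem_append, look_arcs_same, look_arcs_ne, key]
  have := h.p₁; have := h.p₂; have := h.p₃; have := h.q₁; have := h.q₂; have := h.q₃
  refine ⟨?_, ?_, ?_, fun p hp => iff_of_false (h.J p hp).1 (h.J p hp).2⟩ <;>
    simp only [*, inner_u, inner_v, inner_w, and_self]

theorem circ' (h : T.Free) : ((((T.D' σ).rc.face σ).face (!σ)).face σ).Circ T.Inner T.u := by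
  have facts := fun n => rel'_facts (T := T) (σ := σ) (b₀ := σ) (b₁ := !σ) (b₂ := σ) (n := n)
  have hc : ∀ n e, T.Inner e → T.rel' σ σ (!σ) σ n T.u e := by
    intro n e he
    obtain ⟨f0, -, -, f1, f2, -⟩ := facts n
    rw [← cl_eq]
    rcases he with rfl | rfl | rfl
    · rfl
    · exact (f0 rfl).2
    · exact (f2 rfl).1
  unfold rel' at hc
  rw [face_face_face] at hc ⊢
  refine PD.circ_of inner_u ?_ h.L hc
  have key : ∀ e e', cl (predSetoid T.Inner) e = cl _ e' ↔ (T.Inner e ↔ T.Inner e') := fun e e' =>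
    cl_eq
  change ∀ p : E × E, p ∈ (_ : List (E × E)) → predSetoid T.Inner p.1 p.2
  simp only [List.forall_mem_append, look_arcs_same, look_arcs_ne, key]
  have := h.p₁; have := h.p₂; have := h.p₃; have := h.q₁; have := h.q₂; have := h.q₃
  refine ⟨?_, ?_, ?_, fun p hp => iff_of_false (h.J p hp).1 (h.J p hp).2⟩ <;>
    simp only [*, inner_u, inner_v, inner_w, and_self]

/-- These are the resolutions that survive when the bigons are cancelled. Each side of the triangle
is replaced by an outer edge on the same circle of its own diagram. -/
theorem isoM (h : T.Free) : ((((T.D σ).rc.face σ).face (!σ)).face σ).Iso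
    ((((T.D' σ).rc.face σ).face σ).face (!σ)) (Equiv.refl _) (T.subst T.p₃ T.p₁ T.q₃)
      (T.subst T.p₁ T.p₁ T.q₁) := by
  have facts := fun n => rel_facts (T := T) (σ := σ) (b₀ := σ) (b₁ := !σ) (b₂ := σ) (n := n)
  have facts' := fun n => rel'_facts (T := T) (σ := σ) (b₀ := σ) (b₁ := σ) (b₂ := !σ) (n := n)
  unfold rel at facts
  unfold rel' at facts'
  rw [face_face_face] at facts ⊢
  rw [face_face_face] at facts' ⊢
  have o1 := fun x y z => T.subst_of_not (x := x) (y := y) (z := z) h.p₁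
  have o2 := fun x y z => T.subst_of_not (x := x) (y := y) (z := z) h.p₂
  have o3 := fun x y z => T.subst_of_not (x := x) (y := y) (z := z) h.p₃
  have o4 := fun x y z => T.subst_of_not (x := x) (y := y) (z := z) h.q₁
  have o5 := fun x y z => T.subst_of_not (x := x) (y := y) (z := z) h.q₂
  have o6 := fun x y z => T.subst_of_not (x := x) (y := y) (z := z) h.q₃
  have ou := T.subst_u
  have ov := h.subst_v
  have ow := h.subst_w
  set D : PD E := ⟨T.L, (Crossing.look σ T.p₃ T.q₃ T.w T.u).arcs σ ++
    ((Crossing.look σ T.p₂ T.u T.v T.p₁).arcs (!σ) ++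
      ((Crossing.look σ T.w T.q₂ T.q₁ T.v).arcs σ ++ T.J))⟩ with hD
  set D' : PD E := ⟨T.L, (Crossing.look σ T.u T.q₃ T.q₂ T.w).arcs (!σ) ++
    ((Crossing.look σ T.v T.w T.q₁ T.p₁).arcs σ ++
      ((Crossing.look σ T.p₃ T.u T.v T.p₂).arcs σ ++ T.J))⟩ with hD'
  refine PD.iso_of_match (D := D) (D' := D') (Equiv.refl (Fin T.L.length)) _ _ ?_ ?_ ?_ ?_ ?_
  · intro v i F F' hF
    have hL := h.L _ (List.get_mem T.L i)
    change D'.rc.rel v (T.subst _ _ _ (F (T.L.get i))) (F' (T.L.get i)) ∧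
      D.rc.rel _ (T.subst _ _ _ (F' (T.L.get i))) (F (T.L.get i))
    simp only [List.mem_cons, Prod.mk.injEq, List.not_mem_nil, or_false] at hF
    rcases hF with ⟨rfl, rfl⟩ | ⟨rfl, rfl⟩ | ⟨rfl, rfl⟩ | ⟨rfl, rfl⟩ <;>
      simp only [T.subst_of_not hL.1, T.subst_of_not hL.2.1,
        T.subst_of_not hL.2.2.1, T.subst_of_not hL.2.2.2] <;>
      exact ⟨Setoid.refl' _ _, Setoid.refl' _ _⟩
  · intro v
    obtain ⟨f0, -, f1, -, -, f2⟩ := facts' v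
    have f0 := f0 rfl
    have f1 := f1 rfl
    have f2 := f2 rfl
    change ∀ p ∈ D.joins, (Setoid.comap (T.subst T.p₃ T.p₁ T.q₃) (D'.rc.rel v)) p.1 p.2
    simp only [hD, List.forall_mem_append, look_arcs_same, look_arcs_ne]
    simp only [cl_eq, Setoid.comap_rel, o1, o2, o3, o4, o5, o6, ou, ov, ow]
    simp only [← cl_eq]
    refine ⟨by grind, by grind, by grind, fun p hp => ?_⟩
    rw [T.subst_of_not (h.J p hp).1, T.subst_of_not (h.J p hp).2, cl_eq]
    exact PD.rc_join (by simp [hD', hp])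
  · intro v
    obtain ⟨f0, -, -, f1, f2, -⟩ := facts v
    have f0 := f0 rfl
    have f1 := f1 rfl
    have f2 := f2 rfl
    change ∀ p ∈ D'.joins, (Setoid.comap (T.subst T.p₁ T.p₁ T.q₁) (D.rc.rel v)) p.1 p.2
    simp only [hD', List.forall_mem_append, look_arcs_same, look_arcs_ne]
    simp only [cl_eq, Setoid.comap_rel, o1, o2, o3, o4, o5, o6, ou, ov, ow]
    simp only [← cl_eq]
    refine ⟨by grind, by grind, by grind, fun p hp => ?_⟩
    rw [T.subst_of_not (h.J p hp).1, T.subst_of_not (h.J p hp).2, cl_eq]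
    exact PD.rc_join (by simp [hD, hp])
  · intro v e
    obtain ⟨f0, -, -, f1, f2, -⟩ := facts v
    have f0 := f0 rfl
    have f1 := f1 rfl
    have f2 := f2 rfl
    rw [← cl_eq]
    by_cases he : T.Inner e
    · rcases he with rfl | rfl | rfl <;> simp only [ou, ov, ow, o1, o2, o3, o4, o5, o6] <;> grind
    · rw [T.subst_of_not he, T.subst_of_not he]
  · intro v e
    obtain ⟨f0, -, f1, -, -, f2⟩ := facts' v
    have f0 := f0 rfl
    have f1 := f1 rfl
    have f2 := f2 rfl
    rw [← cl_eq]
    by_cases he : T.Inner e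
    · rcases he with rfl | rfl | rfl <;> simp only [ou, ov, ow, o1, o2, o3, o4, o5, o6] <;> grind
    · rw [T.subst_of_not he, T.subst_of_not he]

/-- With the first crossing resolved the other way, both codes describe the same diagram; the marked
points left by its arcs identify the labels at the two remaining crossings of the triangle. -/
theorem isoTurn (h : T.Free) : ((T.D σ).rc.face (!σ)).Iso ((T.D' σ).rc.face (!σ)) (Equiv.refl _)
    (T.subst T.w T.q₁ T.q₂) (T.subst T.p₃ T.p₂ T.u) := by
  rw [PD.face_rc, PD.face_rc]
  have o1 := fun x y z => T.subst_of_not (x := x) (y := y) (z := z) h.p₁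
  have o2 := fun x y z => T.subst_of_not (x := x) (y := y) (z := z) h.p₂
  have o3 := fun x y z => T.subst_of_not (x := x) (y := y) (z := z) h.p₃
  have o4 := fun x y z => T.subst_of_not (x := x) (y := y) (z := z) h.q₁
  have o5 := fun x y z => T.subst_of_not (x := x) (y := y) (z := z) h.q₂
  have o6 := fun x y z => T.subst_of_not (x := x) (y := y) (z := z) h.q₃
  have ou := T.subst_u
  have ov := h.subst_v
  have ow := h.subst_w
  set D : PD E := ⟨Crossing.look σ T.p₂ T.u T.v T.p₁ :: Crossing.look σ T.p₃ T.q₃ T.w T.u :: T.L,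
    (Crossing.look σ T.w T.q₂ T.q₁ T.v).arcs (!σ) ++ T.J⟩ with hD
  set D' : PD E := ⟨Crossing.look σ T.v T.w T.q₁ T.p₁ :: Crossing.look σ T.u T.q₃ T.q₂ T.w :: T.L,
    (Crossing.look σ T.p₃ T.u T.v T.p₂).arcs (!σ) ++ T.J⟩ with hD'
  have f : ∀ v, cl (D.rc.rel v) T.w = cl _ T.q₂ ∧ cl (D.rc.rel v) T.q₁ = cl _ T.v := fun v =>
    look_arcs_ne.1 fun p hp => PD.rc_join (List.mem_append_left _ hp)
  have f' : ∀ v, cl (D'.rc.rel v) T.p₃ = cl _ T.u ∧ cl (D'.rc.rel v) T.v = cl _ T.p₂ := fun v =>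
    look_arcs_ne.1 fun p hp => PD.rc_join (List.mem_append_left _ hp)
  refine PD.iso_of_match (D := D) (D' := D') (Equiv.refl _) _ _ ?_ ?_ ?_ ?_ ?_
  · intro v i F F' hF
    have f := f ((ResCube.cubeEquiv (Equiv.refl _)).symm v)
    have f' := f' v
    rw [← cl_eq, ← cl_eq]
    generalize D.rc.rel ((ResCube.cubeEquiv (Equiv.refl _)).symm v) = s at f ⊢
    generalize D'.rc.rel v = s' at f' ⊢
    simp only [List.mem_cons, Prod.mk.injEq, List.not_mem_nil, or_false] at hF
    revert i
    refine Fin.cases ?_ (Fin.cases ?_ fun i => ?_)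
    · change cl s' (T.subst _ _ _ (F (Crossing.look σ T.p₂ T.u T.v T.p₁))) =
        cl s' (F' (Crossing.look σ T.v T.w T.q₁ T.p₁)) ∧
        cl s (T.subst _ _ _ (F' (Crossing.look σ T.v T.w T.q₁ T.p₁))) =
        cl s (F (Crossing.look σ T.p₂ T.u T.v T.p₁))
      rcases hF with ⟨rfl, rfl⟩ | ⟨rfl, rfl⟩ | ⟨rfl, rfl⟩ | ⟨rfl, rfl⟩ <;> cases σ <;>
        simp only [Crossing.look, Bool.false_eq_true, if_false, if_true, ou, ov, ow, o1, o2, o3, o4,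
          o5, o6] <;> grind
    · change cl s' (T.subst _ _ _ (F (Crossing.look σ T.p₃ T.q₃ T.w T.u))) =
        cl s' (F' (Crossing.look σ T.u T.q₃ T.q₂ T.w)) ∧
        cl s (T.subst _ _ _ (F' (Crossing.look σ T.u T.q₃ T.q₂ T.w))) =
        cl s (F (Crossing.look σ T.p₃ T.q₃ T.w T.u))
      rcases hF with ⟨rfl, rfl⟩ | ⟨rfl, rfl⟩ | ⟨rfl, rfl⟩ | ⟨rfl, rfl⟩ <;> cases σ <;>
        simp only [Crossing.look, Bool.false_eq_true, if_false, if_true, ou, ov, ow, o1, o2, o3, o4,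
          o5, o6] <;> grind
    · change cl s' (T.subst _ _ _ (F (T.L.get i))) = cl s' (F' (T.L.get i)) ∧
        cl s (T.subst _ _ _ (F' (T.L.get i))) = cl s (F (T.L.get i))
      have hL := h.L _ (List.get_mem T.L i)
      rcases hF with ⟨rfl, rfl⟩ | ⟨rfl, rfl⟩ | ⟨rfl, rfl⟩ | ⟨rfl, rfl⟩ <;>
        simp only [T.subst_of_not hL.1, T.subst_of_not hL.2.1,
          T.subst_of_not hL.2.2.1, T.subst_of_not hL.2.2.2, and_self]
  · intro v
    have f' := f' v
    change ∀ p ∈ D.joins, (Setoid.comap (T.subst T.w T.q₁ T.q₂) (D'.rc.rel v)) p.1 p.2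
    simp only [hD, List.forall_mem_append, look_arcs_ne]
    simp only [cl_eq, Setoid.comap_rel, o1, o2, o3, o4, o5, o6, ou, ov, ow]
    refine ⟨⟨Setoid.refl' _ _, Setoid.refl' _ _⟩, fun p hp => ?_⟩
    rw [T.subst_of_not (h.J p hp).1, T.subst_of_not (h.J p hp).2]
    exact PD.rc_join (by simp [hD', hp])
  · intro v
    change ∀ p ∈ D'.joins, (Setoid.comap (T.subst T.p₃ T.p₂ T.u) (D.rc.rel v)) p.1 p.2
    simp only [hD', List.forall_mem_append, look_arcs_ne]
    simp only [cl_eq, Setoid.comap_rel, o1, o2, o3, o4, o5, o6, ou, ov, ow]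
    refine ⟨⟨Setoid.refl' _ _, Setoid.refl' _ _⟩, fun p hp => ?_⟩
    rw [T.subst_of_not (h.J p hp).1, T.subst_of_not (h.J p hp).2]
    exact PD.rc_join (by simp [hD, hp])
  · intro v e
    have f := f v
    rw [← cl_eq]
    by_cases he : T.Inner e
    · rcases he with rfl | rfl | rfl <;> simp only [ou, ov, ow, o1, o2, o3, o4, o5, o6] <;> grind
    · rw [T.subst_of_not he, T.subst_of_not he]
  · intro v e
    have f' := f' v
    rw [← cl_eq]
    by_cases he : T.Inner e
    · rcases he with rfl | rfl | rfl <;> simp only [ou, ov, ow, o1, o2, o3, o4, o5, o6] <;> grind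
    · rw [T.subst_of_not he, T.subst_of_not he]

end Triangle

end TriangleCombinatorics

/-! ## The third Reidemeister move -/

section TriangleMove

variable {k : Type} [CommRing k] {τ t : k} {E : Type} {m : ℕ}

namespace CircleMaps

variable {A B C M : Type} [AddCommGroup A] [Module k A]
  [AddCommGroup B] [Module k B] [AddCommGroup C] [Module k C] [AddCommGroup M] [Module k M]
  {dM xM : Module.End k M} {dA xA : Module.End k A}
  {dB xB : Module.End k B} {dC xC : Module.End k C}

/-- The annihilation conditions that `Retract.coneRight` and `Retract.coneLeft` require hold for the
bigon because the coefficient of a newborn circle is zero. -/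
theorem r2_r_H (S : CircleMaps dA xA dC xC dB xB) {s₁ : A →ₗ[k] M} {s₃ : M →ₗ[k] B}
    (h₁ : ∀ z, s₁ (dA z) = dM (s₁ z)) (h₃ : ∀ z, s₃ (dM z) = dB (s₃ z))
    (hx₁ : ∀ z, s₁ (xA z) = xM (s₁ z)) (hx₃ : ∀ z, s₃ (xM z) = xB (s₃ z))
    (h : ∀ z, s₃ (s₁ z) = S.merge (S.split z)) (z) :
    (S.r2 s₁ s₃ h₁ h₃ hx₁ hx₃ h).r ((S.r2 s₁ s₃ h₁ h₃ hx₁ hx₃ h).H z) = 0 := by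
  simp [r2, S.coeff_birth]

theorem r2_H_i (S : CircleMaps dA xA dC xC dB xB) {s₁ : A →ₗ[k] M} {s₃ : M →ₗ[k] B}
    (h₁ : ∀ z, s₁ (dA z) = dM (s₁ z)) (h₃ : ∀ z, s₃ (dM z) = dB (s₃ z))
    (hx₁ : ∀ z, s₁ (xA z) = xM (s₁ z)) (hx₃ : ∀ z, s₃ (xM z) = xB (s₃ z))
    (h : ∀ z, s₃ (s₁ z) = S.merge (S.split z)) (z) :
    (S.r2 s₁ s₃ h₁ h₃ hx₁ hx₃ h).H ((S.r2 s₁ s₃ h₁ h₃ hx₁ hx₃ h).i z) = 0 := by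
  simp [r2, S.coeff_birth]

theorem r2'_r_H (S : CircleMaps dA xA dC xC dB xB) {s₁ : A →ₗ[k] M} {s₃ : M →ₗ[k] B}
    (h₁ : ∀ z, s₁ (dA z) = dM (s₁ z)) (h₃ : ∀ z, s₃ (dM z) = dB (s₃ z))
    (hx₁ : ∀ z, s₁ (xA z) = xM (s₁ z)) (hx₃ : ∀ z, s₃ (xM z) = xB (s₃ z))
    (h : ∀ z, s₃ (s₁ z) = S.merge (S.split z)) (z) :
    (S.r2' s₁ s₃ h₁ h₃ hx₁ hx₃ h).r ((S.r2' s₁ s₃ h₁ h₃ hx₁ hx₃ h).H z) = 0 := by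
  simp [r2', S.coeff_birth]

theorem r2'_H_i (S : CircleMaps dA xA dC xC dB xB) {s₁ : A →ₗ[k] M} {s₃ : M →ₗ[k] B}
    (h₁ : ∀ z, s₁ (dA z) = dM (s₁ z)) (h₃ : ∀ z, s₃ (dM z) = dB (s₃ z))
    (hx₁ : ∀ z, s₁ (xA z) = xM (s₁ z)) (hx₃ : ∀ z, s₃ (xM z) = xB (s₃ z))
    (h : ∀ z, s₃ (s₁ z) = S.merge (S.split z)) (z) :
    (S.r2' s₁ s₃ h₁ h₃ hx₁ hx₃ h).H ((S.r2' s₁ s₃ h₁ h₃ hx₁ hx₃ h).i z) = 0 := by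
  simp [r2', S.coeff_birth]

end CircleMaps

namespace ResCube

variable {n : ℕ} {R : ResCube E (n + 3)} {e : E} {M : ResCube E n}

/-- The cube is the cone of the saddle between two faces. Contracting the bigon in the target by
`Retract.coneRight` replaces this saddle by its composite with the projection. -/
theorem torsionBound_face_true (hR : R.Planar) 
    (B : Retract ((R.face true).coneCone k τ) ((R.face true).mulXX k τ e) (-M.diff k τ)
      (M.mulX k τ e)) (hB : ∀ z, B.r (B.H z) = 0) :
    TorsionBound t (R.diff k τ) (R.mulX k τ e) m ↔
      TorsionBound t (cone ((R.face false).diff k τ) (-M.diff k τ)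
        (B.r ∘ₗ ((R.face true).consConsEquiv k τ).toLinearMap ∘ₗ R.faceMap k τ))
        (((R.face false).mulX k τ e).prodMap (M.mulX k τ e)) m := by
  rw [torsionBound_cons]
  have hS := saddleMap_diff (k := k) (τ := τ) (hR.face false) (hR.face true) rfl rfl hR.nb
  have hSx := saddleMap_mulX (k := k) (τ := τ) (R.face false) (R.face true) (R.a 0) (R.c 0) e
  let B' := B.ofEquiv ((R.face true).consConsEquiv k τ) (consConsEquiv_diff _)
    (consConsEquiv_mulX _ _)
  have hB' : ∀ z, B'.r (B'.H z) = 0 := fun z => by simp [B', Retract.ofEquiv, hB]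
  refine (B'.coneRight hB' (R.faceMap k τ) hS hSx).torsionBound_iff (fun z => ?_) (fun z => ?_)
  · ext1 <;> simp [diff_mulX, saddleMap_mulX]
  · have h1 := fun z => B'.r_x z
    ext1
    · simp [diff_mulX]
    · simp [diff_mulX, saddleMap_mulX, h1]

theorem torsionBound_face_false (hR : R.Planar)
    (B : Retract ((R.face false).coneCone k τ) ((R.face false).mulXX k τ e) (-M.diff k τ)
      (M.mulX k τ e)) (hB : ∀ z, B.H (B.i z) = 0) :
    TorsionBound t (R.diff k τ) (R.mulX k τ e) m ↔
      TorsionBound t (cone (-M.diff k τ) ((R.face true).diff k τ)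
        (R.faceMap k τ ∘ₗ ((R.face false).consConsEquiv k τ).symm.toLinearMap ∘ₗ B.i))
        ((M.mulX k τ e).prodMap ((R.face true).mulX k τ e)) m := by
  rw [torsionBound_cons]
  have hS := saddleMap_diff (k := k) (τ := τ) (hR.face false) (hR.face true) rfl rfl hR.nb
  have hSx := saddleMap_mulX (k := k) (τ := τ) (R.face false) (R.face true) (R.a 0) (R.c 0) e
  let B' := B.ofEquiv ((R.face false).consConsEquiv k τ) (consConsEquiv_diff _)
    (consConsEquiv_mulX _ _)
  have hB' : ∀ z, B'.H (B'.i z) = 0 := fun z => by simp [B', Retract.ofEquiv, hB]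
  refine (B'.coneLeft hB' (R.faceMap k τ) hS hSx).torsionBound_iff (fun z => ?_) (fun z => ?_)
  · ext1 <;> simp [diff_mulX, saddleMap_mulX]
  · have h1 := fun z => B'.i_x z
    ext1
    · simp [diff_mulX]
    · simp [diff_mulX, saddleMap_mulX, ← h1]

theorem torsionBound_congr_face_true {E' : Type} {R' : ResCube E' (n + 3)} {M' : ResCube E' n}
    {e' : E'} (hR : R.Planar) (hR' : R'.Planar) (hM : M.Planar) (hM' : M'.Planar)
    (B : Retract ((R.face true).coneCone k τ) ((R.face true).mulXX k τ e) (-M.diff k τ)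
      (M.mulX k τ e)) (hB : ∀ z, B.r (B.H z) = 0)
    (B' : Retract ((R'.face true).coneCone k τ) ((R'.face true).mulXX k τ e') (-M'.diff k τ)
      (M'.mulX k τ e')) (hB' : ∀ z, B'.r (B'.H z) = 0) {f f₂ : E → E'} {g g₂ : E' → E}
    (hf : (R.face false).Iso (R'.face false) (Equiv.refl _) f g)
    (hm : M.Iso M' (Equiv.refl _) f₂ g₂) (he : f e = e') (he₂ : f₂ e = e')
    (hs : ∀ z, -(isoEquiv hm.rel (B.r ((R.face true).consConsEquiv k τ (R.faceMap k τ z)))) =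
      B'.r ((R'.face true).consConsEquiv k τ (R'.faceMap k τ
        (isoEquiv (R := R.face false) (R' := R'.face false) hf.rel z)))) :
    TorsionBound t (R.diff k τ) (R.mulX k τ e) m ↔
      TorsionBound t (R'.diff k τ) (R'.mulX k τ e') m := by
  refine (torsionBound_face_true hR B hB).trans
    (Iff.trans ?_ (torsionBound_face_true hR' B' hB').symm)
  have h1 := fun z => B.r_x z
  -- In the application the survivors sit in different corners of the two squares, and the
  -- projections carry a minus sign at the other corner. Hence the identification of the survivors
  -- is negated.
  refine torsionBound_cone_congr (isoEquiv (R := R.face false) (R' := R'.face false) hf.rel)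
    ((isoEquiv (R := M) (R' := M') hm.rel).trans (LinearEquiv.neg k))
    (isoEquiv_diff (R := R.face false) (R' := R'.face false) hf.rel
      (hR.face _) (hR'.face _) hf.edges) (fun z => ?_) (fun z => ?_) (fun z => ?_)
    hs (diff_mulX _ _) (fun z => by simp [diff_mulX]) (fun z => ?_)
  · simp only [LinearEquiv.trans_apply, LinearEquiv.neg_apply, LinearMap.neg_apply, map_neg]
    exact congrArg _ (congrArg _ (isoEquiv_diff (R := M) (R' := M') hm.rel hM hM' hm.edges z))
  · exact (isoEquiv_mulX (R := R.face false) (R' := R'.face false) hf.rel e z).trans (by rw [he])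
  · simp only [LinearEquiv.trans_apply, LinearEquiv.neg_apply, map_neg]
    exact congrArg _ ((isoEquiv_mulX (R := M) (R' := M') hm.rel e z).trans (by rw [he₂]))
  · simp only [LinearMap.comp_apply, saddleMap_mulX, LinearEquiv.coe_coe]
    exact (congrArg B.r (consConsEquiv_mulX (R.face true) e _)).trans (h1 _)

theorem torsionBound_congr_face_false {E' : Type} {R' : ResCube E' (n + 3)} {M' : ResCube E' n}
    {e' : E'} (hR : R.Planar) (hR' : R'.Planar) (hM : M.Planar) (hM' : M'.Planar)
    (B : Retract ((R.face false).coneCone k τ) ((R.face false).mulXX k τ e) (-M.diff k τ)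
      (M.mulX k τ e)) (hB : ∀ z, B.H (B.i z) = 0)
    (B' : Retract ((R'.face false).coneCone k τ) ((R'.face false).mulXX k τ e') (-M'.diff k τ)
      (M'.mulX k τ e')) (hB' : ∀ z, B'.H (B'.i z) = 0) {f f₂ : E → E'} {g g₂ : E' → E}
    (hf : (R.face true).Iso (R'.face true) (Equiv.refl _) f g)
    (hm : M.Iso M' (Equiv.refl _) f₂ g₂) (he : f e = e') (he₂ : f₂ e = e')
    (hs : ∀ z, isoEquiv (R := R.face true) (R' := R'.face true) hf.rel
        (R.faceMap k τ (((R.face false).consConsEquiv k τ).symm (B.i z))) =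
      R'.faceMap k τ (((R'.face false).consConsEquiv k τ).symm (B'.i
        (isoEquiv (R := M) (R' := M') hm.rel z)))) :
    TorsionBound t (R.diff k τ) (R.mulX k τ e) m ↔
      TorsionBound t (R'.diff k τ) (R'.mulX k τ e') m := by
  refine (torsionBound_face_false hR B hB).trans
    (Iff.trans ?_ (torsionBound_face_false hR' B' hB').symm)
  have h1 := fun z => B.i_x z
  refine torsionBound_cone_congr (isoEquiv (R := M) (R' := M') hm.rel)
    (isoEquiv (R := R.face true) (R' := R'.face true) hf.rel) (fun z => ?_)
    (isoEquiv_diff (R := R.face true) (R' := R'.face true) hf.rel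
      (hR.face _) (hR'.face _) hf.edges) (fun z => ?_) (fun z => ?_)
    hs (fun z => by simp [diff_mulX]) (diff_mulX _ _) (fun z => ?_)
  · simp only [LinearMap.neg_apply, map_neg]
    exact congrArg _ (isoEquiv_diff (R := M) (R' := M') hm.rel hM hM' hm.edges z)
  · exact (isoEquiv_mulX (R := M) (R' := M') hm.rel e z).trans (by rw [he₂])
  · exact (isoEquiv_mulX (R := R.face true) (R' := R'.face true) hf.rel e z).trans (by rw [he])
  · have h2 : ∀ z, ((R.face false).consConsEquiv k τ).symm ((R.face false).mulXX k τ e z) =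
        (R.face false).mulX k τ e (((R.face false).consConsEquiv k τ).symm z) := fun z => by
      rw [LinearEquiv.symm_apply_eq, consConsEquiv_mulX, LinearEquiv.apply_symm_apply]
    simp only [LinearMap.comp_apply, LinearEquiv.coe_coe, ← h1, h2]
    exact saddleMap_mulX _ _ _ _ _ _

end ResCube

namespace Triangle

open ResCube

variable {T : Triangle E} {e : E}

/-- The bigon in the diagram before the move, for `σ = true`. -/
noncomputable abbrev bigonT (h : T.Free) (hD : (T.D true).rc.Planar) (he : ¬ T.Inner e) :=
  bigon₁₀ (k := k) (τ := τ) (Q := (T.D true).rc.face true) (hD.face true) (circ (σ := true) h)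
    (iff_of_false h.p₂ (not_not.2 inner_v)) (iff_of_false h.p₃ (not_not.2 inner_w)) he

/-- The bigon in the diagram after the move, for `σ = true`. -/
noncomputable abbrev bigonT' (h : T.Free) (hD : (T.D' true).rc.Planar) (he : ¬ T.Inner e) :=
  bigon₀₁ (k := k) (τ := τ) (Q := (T.D' true).rc.face true) (hD.face true) (circ' (σ := true) h)
    (iff_of_true inner_v h.q₁) (iff_of_true inner_u h.q₂) he

/-- The bigon in the diagram before the move, for `σ = false`. -/
noncomputable abbrev bigonF (h : T.Free) (hD : (T.D false).rc.Planar) (he : ¬ T.Inner e) :=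
  bigon₀₁ (k := k) (τ := τ) (Q := (T.D false).rc.face false) (hD.face false) (circ (σ := false) h)
    (iff_of_true inner_u h.p₁) (iff_of_false h.q₃ (not_not.2 inner_u)) he

/-- The bigon in the diagram after the move, for `σ = false`. -/
noncomputable abbrev bigonF' (h : T.Free) (hD : (T.D' false).rc.Planar) (he : ¬ T.Inner e) :=
  bigon₁₀ (k := k) (τ := τ) (Q := (T.D' false).rc.face false) (hD.face false)
    (circ' (σ := false) h) (iff_of_true inner_w h.p₁) (iff_of_false h.q₃ (not_not.2 inner_w)) he

/-- In these resolutions every circle passes through an edge outside the triangle, so maps that are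
linear over the outer variables are determined by the image of 1. -/
theorem rel_outer (h : T.Free) {b₀ b₁ b₂ : Bool} {n : Fin T.L.length → Bool} {P : E → Prop}
    (hP : ∀ e, ¬ T.Inner e → P e) (σ : Bool)
    (hb : (b₀, b₁, b₂) ∈ [(!σ, σ, !σ), (!σ, !σ, σ), (σ, !σ, σ)]) (e : E) :
    ∃ e' ∈ {e | P e}, T.rel σ b₀ b₁ b₂ n e e' := by
  obtain ⟨f1, f2, f3, f4, f5, f6⟩ := rel_facts (T := T) (σ := σ) (b₀ := b₀) (b₁ := b₁) (b₂ := b₂)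
    (n := n)
  by_cases he : T.Inner e
  · simp only [← cl_eq]
    simp only [List.mem_cons, Prod.mk.injEq, List.not_mem_nil, or_false] at hb
    rcases hb with ⟨rfl, rfl, rfl⟩ | ⟨rfl, rfl, rfl⟩ | ⟨rfl, rfl, rfl⟩ <;>
      rcases he with rfl | rfl | rfl
    · exact ⟨_, hP _ h.q₂, by grind⟩
    · exact ⟨_, hP _ h.q₁, by grind⟩
    · exact ⟨_, hP _ h.q₂, by grind⟩
    · exact ⟨_, hP _ h.p₂, by grind⟩
    · exact ⟨_, hP _ h.q₁, by grind⟩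
    · exact ⟨_, hP _ h.q₂, by grind⟩
    · exact ⟨_, hP _ h.p₂, by grind⟩
    · exact ⟨_, hP _ h.p₁, by grind⟩
    · exact ⟨_, hP _ h.q₃, by grind⟩
  · exact ⟨e, hP e he, Setoid.refl' _ _⟩

/-- Two components matter. At (1, 0) the map before the move passes through the circle and the one
after the move is direct; at (0, 1) it is the other way round. The detours enter with a minus sign,
which explains the overall sign. -/
theorem slide_true (h : T.Free) (hD : (T.D true).rc.Planar) (hD' : (T.D' true).rc.Planar)
    (he : ¬ T.Inner e) (z : ((T.D true).rc.face false).Chain k τ) :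
    -(isoEquiv (isoM h).rel ((bigonT (k := k) (τ := τ) h hD he).r
      (((T.D true).rc.face true).consConsEquiv k τ ((T.D true).rc.faceMap k τ z)))) =
    (bigonT' (k := k) (τ := τ) h hD' he).r (((T.D' true).rc.face true).consConsEquiv k τ
      ((T.D' true).rc.faceMap k τ (isoEquiv (isoTurn (σ := true) h).rel z))) := by
  funext v
  have c := circ (σ := true) h
  have c' := circ' (σ := true) h
  have hcirc : ∀ {e}, T.rel true true true false v T.u e ↔ T.Inner e := fun {e} => c.rel_iff v e
  have hcirc' : ∀ {e}, T.rel' true true false true v T.u e ↔ T.Inner e := fun {e} => c'.rel_iff v e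
  have h10 := slide_coeff (k := k) (τ := τ)
    ((isoTurn (σ := true) h).rel (Fin.cons true (Fin.cons false v : Fin _ → Bool)))
    ((isoM (σ := true) h).rel v) (hD.nb (Fin.cons true (Fin.cons false v : Fin _ → Bool)))
    (c.merge (a := T.p₂) (c := T.v) (iff_of_false h.p₂ (not_not.2 inner_v))
      (((hD.face true).nb₀ false v).symm))
    ((hD.face true).nb₁ false v) (hD'.nb (Fin.cons true (Fin.cons false v : Fin _ → Bool)))
    (Or.inl ⟨hcirc.2 inner_w, mt hcirc.1 h.q₁⟩)
    (rel_outer h (fun e he => ⟨mt hcirc.1 he, by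
      rw [T.subst_of_not he, T.subst_of_not he]⟩) true (by simp))
    (by
      obtain ⟨f1, -, f3, -, -, f6⟩ := rel'_facts (T := T) (σ := true) (b₀ := true) (b₁ := true)
        (b₂ := false) (n := v)
      left
      constructor
      · exact cl_eq.1 (congrArg _ (T.subst_of_not h.p₃))
      · refine cl_eq.1 ((congrArg _ (h.subst_w _ _ _)).trans ?_)
        change cl (T.rel' true true true false v) T.q₃ = cl _ T.v
        grind)
    (z (Fin.cons true (Fin.cons false v : Fin _ → Bool)))
  have h01 := slide_coeff' (k := k) (τ := τ)
    ((isoTurn (σ := true) h).rel (Fin.cons false (Fin.cons true v : Fin _ → Bool)))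
    ((isoM (σ := true) h).rel v) (hD.nb (Fin.cons false (Fin.cons true v : Fin _ → Bool)))
    (hD'.nb (Fin.cons false (Fin.cons true v : Fin _ → Bool)))
    (c'.merge (a := T.u) (c := T.q₂) (iff_of_true inner_u h.q₂)
      (((hD'.face true).nb₁ false v).symm))
    ((hD'.face true).nb₀ false v)
    (Or.inr ⟨hcirc'.2 inner_v, mt hcirc'.1 h.p₃⟩)
    (rel_outer h (fun e he => ⟨by rw [T.subst_of_not he]; exact mt hcirc'.1 he, by
      rw [T.subst_of_not he, T.subst_of_not he]⟩) true (by simp))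
    (by
      obtain ⟨f1, -, f3, -, -, f6⟩ := rel'_facts (T := T) (σ := true) (b₀ := true) (b₁ := true)
        (b₂ := false) (n := v)
      left
      constructor
      · refine cl_eq.1 ((congrArg _ (h.subst_w _ _ _)).trans ?_)
        change cl (T.rel' true true true false v) T.q₃ = cl _ T.v
        grind
      · exact cl_eq.1 (congrArg _ (T.subst_of_not h.q₁)))
    (z (Fin.cons false (Fin.cons true v : Fin _ → Bool)))
  have key : ∀ a b, -(((isoM (σ := true) h).rel v).equiv (k := k) (τ := τ) (a - b)) =
      ((isoM (σ := true) h).rel v).equiv b - ((isoM (σ := true) h).rel v).equiv a :=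
    fun a b => by rw [map_sub, neg_sub]
  exact (key _ _).trans (congrArg₂ (· - ·) h10 h01)

theorem tb_r3_true (h : T.Free) (hD : (T.D true).rc.Planar) (hD' : (T.D' true).rc.Planar)
    (he : ¬ T.Inner e) : (T.D true).TB k τ t e m ↔ (T.D' true).TB k τ t e m :=
  torsionBound_congr_face_true hD hD' (((hD.face _).face _).face _) (((hD'.face _).face _).face _)
    (bigonT h hD he) (CircleMaps.r2_r_H _ _ _ _ _ _) (bigonT' h hD' he)
    (CircleMaps.r2'_r_H _ _ _ _ _ _) (isoTurn (σ := true) h) (isoM (σ := true) h)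
    (T.subst_of_not he) (T.subst_of_not he) (slide_true h hD hD' he)

/-- Here the bigons are in the source. The inclusions of the survivors have components at (0, 1) and
(1, 0) only; one is direct, the other one is a birth, and the move exchanges their roles. -/
theorem slide_false (h : T.Free) (hD : (T.D false).rc.Planar) (hD' : (T.D' false).rc.Planar)
    (he : ¬ T.Inner e) (z) :
    isoEquiv (R := (T.D false).rc.face true) (R' := (T.D' false).rc.face true) (isoTurn h).rel
      ((T.D false).rc.faceMap k τ ((((T.D false).rc.face false).consConsEquiv k τ).symm
        ((bigonF (k := k) (τ := τ) h hD he).i z))) =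
    (T.D' false).rc.faceMap k τ ((((T.D' false).rc.face false).consConsEquiv k τ).symm
      ((bigonF' (k := k) (τ := τ) h hD' he).i (isoEquiv
        (R := (((T.D false).rc.face false).face true).face false)
        (R' := (((T.D' false).rc.face false).face false).face true) (isoM h).rel z))) := by
  funext v
  have c := circ (σ := false) h
  have c' := circ' (σ := false) h
  obtain ⟨b₁, w, rfl⟩ : ∃ b w, v = Fin.cons b w := ⟨v 0, Fin.tail v, (Fin.cons_self_tail v).symm⟩
  obtain ⟨b₂, n, rfl⟩ : ∃ b n, w = Fin.cons b n := ⟨w 0, Fin.tail w, (Fin.cons_self_tail w).symm⟩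
  change ((isoTurn (σ := false) h).rel _).equiv (saddle k τ _ _ _ _ _) = saddle k τ _ _ _ _ _
  have h00 : ((isoTurn (σ := false) h).rel (Fin.cons false (Fin.cons false n : Fin _ → Bool))).equiv
      (saddle k τ (T.rel false false false false n) (T.rel false true false false n)
        ((T.D false).rc.a 0) ((T.D false).rc.c 0) 0) =
      saddle k τ (T.rel' false false false false n) (T.rel' false true false false n)
        ((T.D' false).rc.a 0) ((T.D' false).rc.c 0) 0 :=
    (congrArg _ (map_zero _)).trans ((map_zero _).trans (map_zero _).symm)
  have h11 : ((isoTurn (σ := false) h).rel (Fin.cons true (Fin.cons true n : Fin _ → Bool))).equiv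
      (saddle k τ (T.rel false false true true n) (T.rel false true true true n)
        ((T.D false).rc.a 0) ((T.D false).rc.c 0) 0) =
      saddle k τ (T.rel' false false true true n) (T.rel' false true true true n)
        ((T.D' false).rc.a 0) ((T.D' false).rc.c 0) 0 :=
    (congrArg _ (map_zero _)).trans ((map_zero _).trans (map_zero _).symm)
  have h01 : ((isoTurn (σ := false) h).rel (Fin.cons false (Fin.cons true n : Fin _ → Bool))).equiv
      (saddle k τ (T.rel false false false true n) (T.rel false true false true n)
        ((T.D false).rc.a 0) ((T.D false).rc.c 0)
        (((bigonF (k := k) (τ := τ) h hD he).i z).1.2 n)) =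
      saddle k τ (T.rel' false false false true n) (T.rel' false true false true n)
        ((T.D' false).rc.a 0) ((T.D' false).rc.c 0)
        (((isoM (σ := false) h).rel n).equiv (z n)) := by
    have hcirc : ∀ {e}, T.rel false false false true n T.u e ↔ T.Inner e :=
      fun {e} => c.rel_iff n e
    have hr := c.merge (a := T.q₂) (c := T.v) (iff_of_false h.q₂ (not_not.2 inner_v))
      (hD.nb (Fin.cons false (Fin.cons true n : Fin _ → Bool)))
    refine slide_birth (k := k) (τ := τ)
      ((isoTurn (σ := false) h).rel (Fin.cons false (Fin.cons true n : Fin _ → Bool)))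
      ((isoM (σ := false) h).rel n) ((hD.face false).nb₁ true n)
      (c.merge (a := T.u) (c := T.p₁) (iff_of_true inner_u h.p₁) ((hD.face false).nb₀ true n))
      hr ?_ (hD'.nb (Fin.cons false (Fin.cons true n : Fin _ → Bool)))
      (a₄ := T.q₃) (c₄ := T.p₂) (mt hcirc.1 h.q₃) (mt hcirc.1 h.p₂) ⟨Setoid.refl' _ _, ?_⟩ ⟨?_, ?_⟩
      (rel_outer h (fun e he => ⟨mt hcirc.1 he, by
        rw [T.subst_of_not he, T.subst_of_not he]⟩) false (by simp)) (z n)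
    · exact (c.saddle_eq (iff_of_false h.q₂ (not_not.2 inner_v))
        (hD.nb (Fin.cons false (Fin.cons true n : Fin _ → Bool))) 1).trans hr.saddle_one
    · exact cl_eq.1 ((rel_facts (T := T) (σ := false)).2.2.2.1 rfl).1.symm
    · rw [T.subst_of_not h.q₃]
      exact cl_eq.1 ((rel'_facts (T := T) (σ := false)).2.2.2.2.2 rfl).1.symm
    · rw [T.subst_of_not h.p₂]
      exact Setoid.refl' _ _
  have h10 : ((isoTurn (σ := false) h).rel (Fin.cons true (Fin.cons false n : Fin _ → Bool))).equiv
      (saddle k τ (T.rel false false true false n) (T.rel false true true false n)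
        ((T.D false).rc.a 0) ((T.D false).rc.c 0) (z n)) =
      saddle k τ (T.rel' false false true false n) (T.rel' false true true false n)
        ((T.D' false).rc.a 0) ((T.D' false).rc.c 0)
        (((bigonF' (k := k) (τ := τ) h hD' he).i (isoEquiv
        (R := (((T.D false).rc.face false).face true).face false)
        (R' := (((T.D' false).rc.face false).face false).face true) (isoM h).rel z)).2.1 n) := by
    have hcirc : ∀ {e}, T.rel' false false true false n T.u e ↔ T.Inner e :=
      fun {e} => c'.rel_iff n e
    have hr := c'.merge (a := T.u) (c := T.p₂) (iff_of_true inner_u h.p₂)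
      (hD'.nb (Fin.cons true (Fin.cons false n : Fin _ → Bool)))
    refine slide_birth' (k := k) (τ := τ)
      ((isoTurn (σ := false) h).rel (Fin.cons true (Fin.cons false n : Fin _ → Bool)))
      ((isoM (σ := false) h).rel n) (hD.nb (Fin.cons true (Fin.cons false n : Fin _ → Bool)))
      ((hD'.face false).nb₀ true n)
      (c'.merge (a := T.q₃) (c := T.w) (iff_of_false h.q₃ (not_not.2 inner_w))
        ((hD'.face false).nb₁ true n))
      hr ?_ (a₄ := T.q₂) (c₄ := T.p₁) (mt hcirc.1 h.q₂) (mt hcirc.1 h.p₁)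
      ⟨?_, Setoid.refl' _ _⟩ ⟨?_, ?_⟩
      (rel_outer h (fun e he => ⟨by rw [T.subst_of_not he]; exact mt hcirc.1 he, by
        rw [T.subst_of_not he, T.subst_of_not he]⟩) false (by simp)) (z n)
    · exact (c'.saddle_eq (iff_of_true inner_u h.p₂)
        (hD'.nb (Fin.cons true (Fin.cons false n : Fin _ → Bool))) 1).trans hr.saddle_one
    · exact cl_eq.1 ((rel'_facts (T := T) (σ := false)).2.2.2.2.2 rfl).2.symm
    · refine cl_eq.1 (congrArg _ (T.subst_of_not h.q₂))
    · refine cl_eq.1 ((congrArg _ (h.subst_v _ _ _)).trans ?_)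
      exact ((rel'_facts (T := T) (σ := false)).2.2.2.1 rfl).2
  cases b₁ <;> cases b₂
  · exact h00
  · exact h01
  · exact h10
  · exact h11

theorem tb_r3_false (h : T.Free) (hD : (T.D false).rc.Planar) (hD' : (T.D' false).rc.Planar)
    (he : ¬ T.Inner e) : (T.D false).TB k τ t e m ↔ (T.D' false).TB k τ t e m :=
  torsionBound_congr_face_false hD hD' (((hD.face _).face _).face _)
    (((hD'.face _).face _).face _)
    (bigonF h hD he) (CircleMaps.r2'_H_i _ _ _ _ _ _) (bigonF' h hD' he)
    (CircleMaps.r2_H_i _ _ _ _ _ _) (isoTurn (σ := false) h) (isoM (σ := false) h)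
    (T.subst_of_not he) (T.subst_of_not he) (slide_false h hD hD' he)

end Triangle

end TriangleMove

/-! ## Invariance of torsion bounds under moves -/

section Moves

variable {k : Type} [CommRing k] {τ t : k} {E E' : Type} {m : ℕ}

open Classical in
/-- The indicator function of equality. -/
noncomputable def ind (e f : E) : ℕ := if f = e then 1 else 0

theorem ind_self (e : E) : ind e e = 1 := if_pos rfl

namespace PD

/-- Every edge has two ends. -/
theorem IsKnot.sum_ind {D : PD E} (hD : D.IsKnot) (e : E) :
    (D.crossings.map fun x => ind e x.a + ind e x.b + ind e x.c + ind e x.d).sum +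
      (D.joins.map fun p => ind e p.1 + ind e p.2).sum = 2 := by
  classical
  have key : ∀ (f : E × E → E) (l : List (E × E)), (l.map f).count e =
      (l.map fun p => ind e (f p)).sum := by
    intro f l
    induction l with
    | nil => rfl
    | cons p l ih =>
      simp only [List.map_cons, List.count_cons, ih, List.sum_cons, ind, beq_iff_eq]
      omega
  have h1 := List.count_eq_one_of_mem hD.ends_nodup (hD.ends_all e)
  have h2 := List.count_eq_one_of_mem hD.begins_nodup (hD.begins_all e)
  rw [key, strands, List.map_append, List.sum_append, List.map_flatMap] at h1 h2
  have h3 : ∀ l : List (Crossing E), (l.map fun x =>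
      ind e x.a + ind e x.b + ind e x.c + ind e x.d).sum =
      (l.flatMap fun x => x.strands.map fun p => ind e p.1).sum +
      (l.flatMap fun x => x.strands.map fun p => ind e p.2).sum := by
    intro l
    induction l with
    | nil => rfl
    | cons x l ih =>
      simp only [List.map_cons, List.sum_cons, List.flatMap_cons, List.sum_append, ih,
        Crossing.strands]
      split_ifs <;> simp <;> ring
  have h4 : ∀ l : List (E × E), (l.map fun p => ind e p.1 + ind e p.2).sum =
      (l.map fun p => ind e p.1).sum + (l.map fun p => ind e p.2).sum := fun l => List.sum_map_add
  rw [h3, h4]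
  omega

theorem tb_all {D : PD E} (hD : D.IsKnot) (e : E) :
    (∀ e, D.TB k τ t e m) ↔ D.TB k τ t e m :=
  ⟨fun h => h e, fun h e' => (hD.tb_iff e e').1 h⟩

end PD

theorem Crossing.Looks.sum_ind {x : Crossing E} {σ : Bool} {a b c d : E} (h : x.Looks σ a b c d)
    (e : E) : ind e x.a + ind e x.b + ind e x.c + ind e x.d =
      ind e a + ind e b + ind e c + ind e d := by
  cases σ <;> simp only [Crossing.Looks, Bool.false_eq_true, if_false, if_true, Prod.mk.injEq] at h <;>
    rcases h with ⟨h1, h2, h3, h4⟩ | ⟨h1, h2, h3, h4⟩ <;> rw [h1, h2, h3, h4] <;> ring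

namespace Triangle

/-- Each side of the triangle already occurs twice at the three crossings, and an edge has only two
ends. -/
theorem free_of_isKnot {σ : Bool} {T : Triangle E} {x y z : Crossing E}
    (hx : x.Looks σ T.p₂ T.u T.v T.p₁) (hy : y.Looks σ T.p₃ T.q₃ T.w T.u)
    (hz : z.Looks σ T.w T.q₂ T.q₁ T.v) (hD : (⟨x :: y :: z :: T.L, T.J⟩ : PD E).IsKnot) :
    T.Free := by
  have h := hD.sum_ind
  simp only [List.map_cons, List.sum_cons, hx.sum_ind, hy.sum_ind, hz.sum_ind] at h
  have hu := h T.u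
  have hv := h T.v
  have hw := h T.w
  have u1 := ind_self T.u
  have v1 := ind_self T.v
  have w1 := ind_self T.w
  have key : ∀ e f : E, ind f e = 0 → e ≠ f := fun e f h0 h1 => by
    rw [h1, ind_self] at h0
    exact one_ne_zero h0
  have out : ∀ e, ind T.u e = 0 → ind T.v e = 0 → ind T.w e = 0 → ¬ T.Inner e := by
    rintro e hu hv hw (h | h | h)
    · exact key _ _ hu h
    · exact key _ _ hv h
    · exact key _ _ hw h
  have le1 : ∀ e, ∀ x ∈ T.L, ind e x.a + ind e x.b + ind e x.c + ind e x.d ≤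
      (T.L.map fun x => ind e x.a + ind e x.b + ind e x.c + ind e x.d).sum := fun e x hx =>
    List.le_sum_of_mem (List.mem_map_of_mem (f := fun x : Crossing E => _) hx)
  have le2 : ∀ e, ∀ p ∈ T.J, ind e p.1 + ind e p.2 ≤
      (T.J.map fun p => ind e p.1 + ind e p.2).sum := fun e x hx =>
    List.le_sum_of_mem (List.mem_map_of_mem (f := fun p : E × E => _) hx)
  refine ⟨out _ ?_ ?_ ?_, out _ ?_ ?_ ?_, out _ ?_ ?_ ?_, out _ ?_ ?_ ?_, out _ ?_ ?_ ?_,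
    out _ ?_ ?_ ?_, key _ _ ?_, key _ _ ?_, key _ _ ?_, fun x hx => ?_, fun p hp => ?_⟩
  -- Three inequalities for each of the six outer edges, and three between the sides.
  iterate 21 omega
  · have a := le1 T.u x hx
    have b := le1 T.v x hx
    have c := le1 T.w x hx
    refine ⟨out _ ?_ ?_ ?_, out _ ?_ ?_ ?_, out _ ?_ ?_ ?_, out _ ?_ ?_ ?_⟩ <;> omega
  · have a := le2 T.u p hp
    have b := le2 T.v p hp
    have c := le2 T.w p hp
    exact ⟨out _ (by omega) (by omega) (by omega), out _ (by omega) (by omega) (by omega)⟩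

theorem tb_r3 {σ : Bool} {T : Triangle E} {e : E} (h : T.Free) (hD : (T.D σ).rc.Planar)
    (hD' : (T.D' σ).rc.Planar) (he : ¬ T.Inner e) :
    (T.D σ).TB k τ t e m ↔ (T.D' σ).TB k τ t e m := by
  cases σ
  · exact tb_r3_false h hD hD' he
  · exact tb_r3_true h hD hD' he

end Triangle

namespace PD

theorem forall₂_sim (L : List (Crossing E)) : List.Forall₂ Crossing.Sim L L :=
  List.forall₂_same.2 fun x _ => .refl x

theorem Move.tb_iff {D : PD E} {D' : PD E'} (h : D.Move D') (hD : D.IsKnot) (hD' : D'.IsKnot) :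
    (∀ e, D.TB k τ t e m) ↔ ∀ e, D'.TB k τ t e m := by
  obtain ⟨e⟩ := hD.nonempty
  have hP := rc_planar hD
  have hP' := rc_planar hD'
  cases h with
  | relabel f D =>
    rw [tb_all hD e, tb_all hD' (f e)]
    exact tb_relabel f D hP hP' e
  | reorder hL hJ =>
    rw [tb_all hD e, tb_all hD' e]
    exact tb_reorder hL hJ hP e
  | unmark a L J =>
    rw [tb_all hD e, tb_all hD' (e.getD a)]
    exact tb_unmark a L J hP hP' e
  | r1 σ a b p hp x hx L J =>
    rw [tb_all hD e, tb_all hD' (some e)]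
    have hs := List.Forall₂.cons hx.sim (forall₂_sim (L.map (Crossing.map some)))
    exact (tb_r1 σ a b p hp L J hP (planar_of_sim hs hP') e).trans (tb_sim hs hP' _).symm
  | r2 a b c d p q hp hq x y hx hy L J =>
    rw [tb_all hD e, tb_all hD' (.inl e)]
    have hs := List.Forall₂.cons hx.sim (List.Forall₂.cons hy.sim
      (forall₂_sim (L.map (Crossing.map Sum.inl))))
    exact (tb_r2 a b c d p q hp hq L J hP (planar_of_sim hs hP') e).trans (tb_sim hs hP' _).symm
  | r3 σ p₁ p₂ p₃ q₁ q₂ q₃ u v w x y z x' y' z' hx hy hz hx' hy' hz' L J =>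
    let T : Triangle E := ⟨p₁, p₂, p₃, q₁, q₂, q₃, u, v, w, L, J⟩
    have hT : T.Free := Triangle.free_of_isKnot (T := T) hx hy hz hD
    rw [tb_all hD p₁, tb_all hD' p₁]
    -- `Triangle.D` lists `z` first, the crossing whose two resolutions give the bigon and the
    -- common diagram.
    have hperm : (x :: y :: z :: L).Perm (z :: x :: y :: L) :=
      ((List.Perm.swap z y L).cons x).trans (List.Perm.swap z x (y :: L))
    have hs := List.Forall₂.cons hz.sim (List.Forall₂.cons hx.sim (List.Forall₂.cons hy.sim
      (forall₂_sim L)))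
    have hs' := List.Forall₂.cons hx'.sim (List.Forall₂.cons hy'.sim (List.Forall₂.cons hz'.sim
      (forall₂_sim L)))
    have hP₁ := planar_reorder hperm (List.Perm.refl J) hP
    exact (tb_reorder hperm (List.Perm.refl J) hP p₁).trans ((tb_sim hs hP₁ p₁).trans
      ((Triangle.tb_r3 (T := T) hT (planar_of_sim hs hP₁) (planar_of_sim hs' hP') hT.p₁).trans
        (tb_sim hs' hP' p₁).symm))

end PD

end Moves

/-! ## Coordinates on circle rings -/

section Coordinates

open MvPolynomial

/-- The odd entries of a multiset. -/
noncomputable def oddPart {Q : Type} (M : Q →₀ ℕ) : Finset Q :=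
  M.support.filter fun C => Odd (M C)

theorem mem_oddPart {Q : Type} {M : Q →₀ ℕ} {C : Q} : C ∈ oddPart M ↔ Odd (M C) := by
  simp only [oddPart, Finset.mem_filter, Finsupp.mem_support_iff, and_iff_right_iff_imp]
  rintro h h0
  simp [h0] at h

/-- The number of pairs in a multiset. -/
noncomputable def half {Q : Type} (M : Q →₀ ℕ) : ℕ := M.sum fun _ n => n / 2

theorem oddPart_add_two {Q : Type} (M : Q →₀ ℕ) (C : Q) :
    oddPart (M + Finsupp.single C 2) = oddPart M := by
  ext C'
  rw [mem_oddPart, mem_oddPart, Finsupp.add_apply, Nat.odd_add]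
  by_cases h : C = C'
  · simp [h, Finsupp.single_eq_same]
  · simp [Finsupp.single_eq_of_ne (Ne.symm h)]

theorem half_add_two {Q : Type} (M : Q →₀ ℕ) (C : Q) :
    half (M + Finsupp.single C 2) = half M + 1 := by
  classical
  have h1 : (M + Finsupp.single C 2).support ⊆ insert C M.support := by
    intro x hx
    by_contra h
    simp only [Finset.mem_insert, Finsupp.mem_support_iff, not_or, not_not] at h
    rw [Finsupp.mem_support_iff, Finsupp.add_apply, h.2,
      Finsupp.single_eq_of_ne h.1] at hx
    exact hx rfl
  rw [half, half, Finsupp.sum_of_support_subset _ h1 _ (by simp),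
    Finsupp.sum_of_support_subset M (Finset.subset_insert C _) _ (by simp),
    ← Finset.add_sum_erase _ _ (Finset.mem_insert_self C _),
    ← Finset.add_sum_erase (insert C M.support) (fun x => M x / 2) (Finset.mem_insert_self C _)]
  have h2 : ∀ x ∈ (insert C M.support).erase C, (M + Finsupp.single C 2 : Q →₀ ℕ) x / 2 = M x / 2 := by
    intro x hx
    rw [Finsupp.add_apply, Finsupp.single_eq_of_ne (Finset.ne_of_mem_erase hx), add_zero]
  rw [Finset.sum_congr rfl h2, Finsupp.add_apply, Finsupp.single_eq_same]
  omega

theorem degree_eq_half {Q : Type} (M : Q →₀ ℕ) : M.degree = (oddPart M).card + 2 * half M := by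
  classical
  rw [oddPart, Finset.card_filter, half, Finsupp.sum, Finset.mul_sum, ← Finset.sum_add_distrib,
    Finsupp.degree]
  refine Finset.sum_congr rfl fun C _ => ?_
  split_ifs with h
  · obtain ⟨j, hj⟩ := h; omega
  · obtain ⟨j, hj⟩ := Nat.not_odd_iff_even.1 h; omega

variable {E : Type} (k : Type) [CommRing k] (τ : k) (r : Setoid E)

/-- The circles of a monomial in the edges, with multiplicity. -/
noncomputable def circlesOf (m : E →₀ ℕ) : Quotient r →₀ ℕ := m.mapDomain (cl r)

theorem circlesOf_add (m m' : E →₀ ℕ) :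
    circlesOf r (m + m') = circlesOf r m + circlesOf r m' := Finsupp.mapDomain_add

theorem circlesOf_single (e : E) (n : ℕ) :
    circlesOf r (Finsupp.single e n) = Finsupp.single (cl r e) n := Finsupp.mapDomain_single

theorem degree_circlesOf (m : E →₀ ℕ) : (circlesOf r m).degree = m.degree := by
  classical
  induction m using Finsupp.induction_linear with
  | zero => simp [circlesOf]
  | add m m' h h' => rw [circlesOf_add, map_add, map_add, h, h']
  | single e n => rw [circlesOf_single]; simp [Finsupp.degree_single]

/-- The coordinates of a polynomial in a circle ring. -/
noncomputable def polyCoord : MvPolynomial E k →ₗ[k] (Finset (Quotient r) →₀ k) :=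
  (basisMonomials E k).constr k fun m =>
    Finsupp.single (oddPart (circlesOf r m)) (τ ^ half (circlesOf r m))

variable {k τ}

theorem polyCoord_monomial (m : E →₀ ℕ) : polyCoord k τ r (monomial m 1) =
    Finsupp.single (oddPart (circlesOf r m)) (τ ^ half (circlesOf r m)) := by
  have h := congrFun (coe_basisMonomials E k) m
  rw [← h, polyCoord, Module.Basis.constr_basis]

/-- It suffices to multiply generators by monomials. A factor X_e² adds a pair on one circle, so the
odd part is unchanged and `half` grows by one, which matches the factor τ. -/
theorem polyCoord_eq_zero {f : MvPolynomial E k} (hf : f ∈ circIdeal k τ r) :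
    polyCoord k τ r f = 0 := by
  suffices h : ∀ p, polyCoord k τ r (p * f) = 0 by simpa using h 1
  have mono : ∀ f : MvPolynomial E k, (∀ n, polyCoord k τ r (monomial n 1 * f) = 0) →
      ∀ p, polyCoord k τ r (p * f) = 0 := by
    intro f h p
    have : polyCoord k τ r ∘ₗ LinearMap.mulRight k f = 0 :=
      (basisMonomials E k).ext fun n => by simpa using h n
    exact LinearMap.congr_fun this p
  induction hf using Submodule.span_induction with
  | zero => simp
  | add f g _ _ hf hg => intro p; rw [mul_add, map_add, hf, hg, add_zero]
  | smul a f _ hf => intro p; rw [smul_eq_mul, ← mul_assoc]; exact hf _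
  | mem f hf =>
    refine mono f fun n => ?_
    rcases hf with ⟨e, rfl⟩ | ⟨e, e', h, rfl⟩
    · have h1 : (monomial n 1 * (X e ^ 2 - C τ) : MvPolynomial E k) =
          monomial (n + Finsupp.single e 2) 1 - τ • monomial n 1 := by
        rw [mul_sub, X_pow_eq_monomial, monomial_mul, mul_one, mul_comm _ (C τ), ← smul_eq_C_mul]
      rw [h1, map_sub, map_smul, polyCoord_monomial, polyCoord_monomial, circlesOf_add,
        circlesOf_single, oddPart_add_two, half_add_two, Finsupp.smul_single, smul_eq_mul,
        pow_succ', sub_self]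
    · have h1 : (monomial n 1 * (X e - X e') : MvPolynomial E k) =
          monomial (n + Finsupp.single e 1) 1 - monomial (n + Finsupp.single e' 1) 1 := by
        rw [mul_sub, X, X, monomial_mul, monomial_mul, mul_one]
      rw [h1, map_sub, polyCoord_monomial, polyCoord_monomial, circlesOf_add, circlesOf_add,
        circlesOf_single, circlesOf_single, cl_eq.2 h, sub_self]

/-- The coordinates on a circle ring. -/
noncomputable def circCoord : CircRing k τ r →ₗ[k] (Finset (Quotient r) →₀ k) :=
  ((circIdeal k τ r).restrictScalars k).liftQ (polyCoord k τ r)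
    (fun _ hf => polyCoord_eq_zero r hf) ∘ₗ
      (Submodule.Quotient.restrictScalarsEquiv k (circIdeal k τ r)).symm.toLinearMap

theorem circCoord_mk (p : MvPolynomial E k) :
    circCoord r (circMk k τ r p) = polyCoord k τ r p := rfl

/-- The variable of a circle. -/
noncomputable def circleVar (C : Quotient r) : CircRing k τ r :=
  Quotient.lift (xv k τ r) (fun _ _ => xv_eq) C

/-- The product of the variables of a set of circles. -/
noncomputable def circleMonomial (S : Finset (Quotient r)) : CircRing k τ r :=
  ∏ C ∈ S, circleVar r C

theorem circleVar_sq (C : Quotient r) :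
    circleVar r C ^ 2 = algebraMap k (CircRing k τ r) τ := by
  obtain ⟨e⟩ := C
  rw [sq]
  exact xv_sq r e

theorem circMk_monomial (m : E →₀ ℕ) : circMk k τ r (monomial m 1) =
    τ ^ half (circlesOf r m) • circleMonomial r (oddPart (circlesOf r m)) := by
  have h1 : circMk k τ r (monomial m 1) =
      (circlesOf r m).prod fun C n => circleVar (k := k) (τ := τ) r C ^ n := by
    rw [circlesOf, Finsupp.prod_mapDomain_index (fun _ => pow_zero _) (fun _ _ _ => pow_add _ _ _),
      monomial_eq, map_one, one_mul, Finsupp.prod, map_prod]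
    exact Finset.prod_congr rfl fun e _ => map_pow _ _ _
  have h2 : ∀ (C : Quotient r) (n : ℕ), circleVar (k := k) (τ := τ) r C ^ n =
      algebraMap k _ τ ^ (n / 2) * if Odd n then circleVar r C else 1 := by
    intro C n
    rw [← circleVar_sq r C, ← pow_mul]
    split_ifs with h
    · obtain ⟨j, rfl⟩ := h
      rw [← pow_succ]
      congr 1
      omega
    · obtain ⟨j, rfl⟩ := Nat.not_odd_iff_even.1 h
      rw [mul_one]
      congr 1
      omega
  rw [h1, Finsupp.prod, Finset.prod_congr rfl fun C _ => h2 C _, Finset.prod_mul_distrib,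
    Finset.prod_pow_eq_pow_sum, ← Finset.prod_filter, Algebra.smul_def, map_pow]
  rfl

/-- A monomial in the edges for a set of circles. -/
noncomputable def edgeMonomial (S : Finset (Quotient r)) : E →₀ ℕ :=
  ∑ C ∈ S, Finsupp.single C.out 1

theorem circlesOf_edgeMonomial (S : Finset (Quotient r)) :
    circlesOf r (edgeMonomial r S) = ∑ C ∈ S, Finsupp.single C 1 := by
  rw [edgeMonomial, circlesOf, Finsupp.mapDomain_finset_sum]
  refine Finset.sum_congr rfl fun C _ => ?_
  rw [Finsupp.mapDomain_single]
  exact congrArg (Finsupp.single · 1) (Quotient.out_eq C)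

theorem degree_edgeMonomial (S : Finset (Quotient r)) : (edgeMonomial r S).degree = S.card := by
  rw [edgeMonomial, map_sum]
  simp [Finsupp.degree_single]

theorem oddPart_edgeMonomial (S : Finset (Quotient r)) :
    oddPart (circlesOf r (edgeMonomial r S)) = S := by
  classical
  ext C
  rw [mem_oddPart, circlesOf_edgeMonomial, Finsupp.finsetSum_apply]
  by_cases h : C ∈ S
  · rw [Finset.sum_eq_single_of_mem C h (fun C' _ h' => Finsupp.single_eq_of_ne h'.symm),
      Finsupp.single_eq_same]
    simpa using h
  · rw [Finset.sum_eq_zero fun C' h' => Finsupp.single_eq_of_ne (ne_of_mem_of_not_mem h' h).symm]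
    simpa using h

theorem half_edgeMonomial (S : Finset (Quotient r)) :
    half (circlesOf r (edgeMonomial r S)) = 0 := by
  have h1 := degree_eq_half (circlesOf r (edgeMonomial r S))
  rw [oddPart_edgeMonomial, degree_circlesOf, degree_edgeMonomial] at h1
  omega

theorem circleMonomial_eq (S : Finset (Quotient r)) :
    circleMonomial r S = circMk k τ r (monomial (edgeMonomial r S) 1) := by
  rw [circMk_monomial, oddPart_edgeMonomial, half_edgeMonomial, pow_zero, one_smul]

theorem circCoord_circleMonomial (S : Finset (Quotient r)) :
    circCoord r (circleMonomial (k := k) (τ := τ) r S) = Finsupp.single S 1 := by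
  rw [circleMonomial_eq, circCoord_mk, polyCoord_monomial, oddPart_edgeMonomial,
    half_edgeMonomial, pow_zero]

variable (k τ) in
/-- The coordinate isomorphism of a circle ring. -/
noncomputable def circEquiv : CircRing k τ r ≃ₗ[k] (Finset (Quotient r) →₀ k) :=
  LinearEquiv.ofLinear (circCoord r) (Finsupp.linearCombination k (circleMonomial r))
    (by ext S : 2; simp [circCoord_circleMonomial])
    (by
      ext z
      obtain ⟨p, rfl⟩ := circMk_surjective r z
      have : (Finsupp.linearCombination k (circleMonomial r) ∘ₗ circCoord r) ∘ₗ
          (circMk k τ r).toLinearMap = (circMk k τ r).toLinearMap := by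
        refine (basisMonomials E k).ext fun m => ?_
        rw [coe_basisMonomials]
        change Finsupp.linearCombination k (circleMonomial r)
          (circCoord r (circMk k τ r (monomial m 1))) = circMk k τ r (monomial m 1)
        rw [circCoord_mk, polyCoord_monomial, Finsupp.linearCombination_single, circMk_monomial]
      exact LinearMap.congr_fun this p)

theorem circEquiv_monomial (m : E →₀ ℕ) : circEquiv k τ r (circMk k τ r (monomial m 1)) =
    Finsupp.single (oddPart (circlesOf r m)) (τ ^ half (circlesOf r m)) :=
  polyCoord_monomial r m

theorem circEquiv_circleMonomial (S : Finset (Quotient r)) :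
    circEquiv k τ r (circleMonomial r S) = Finsupp.single S 1 := circCoord_circleMonomial r S

theorem circRing_smul_eq_zero [NoZeroDivisors k] {x : k} (hx : x ≠ 0) {z : CircRing k τ r}
    (h : x • z = 0) : z = 0 := by
  apply (circEquiv k τ r).injective
  have h1 := congrArg (circEquiv k τ r) h
  rw [map_smul, map_zero] at h1
  ext S
  have h2 := DFunLike.congr_fun h1 S
  rw [map_zero]
  simpa [hx] using h2

end Coordinates

/-! ## Crossing changes -/

section CrossingChanges

variable {k : Type} [CommRing k] {τ t : k} {E : Type} {m n : ℕ}

/-- Interchanging the two sides of a cone. -/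
theorem TorsionBound.cone_swap {A B : Type} [AddCommGroup A] [Module k A] [AddCommGroup B]
    [Module k B] {dA xA yA : Module.End k A} {dB xB yB : Module.End k B} {s : A →ₗ[k] B}
    {s' : B →ₗ[k] A} (hA : ∀ z, dA (xA z) = xA (dA z)) (hA' : ∀ z, dA (yA z) = yA (dA z))
    (hB : ∀ z, dB (xB z) = xB (dB z)) (hB' : ∀ z, dB (yB z) = yB (dB z))
    (hAA : ∀ z, xA (yA z) = yA (xA z)) (hs : ∀ z, s (xA z) = xB (s z))
    (hsy : ∀ z, s (yA z) = yB (s z)) (hsx' : ∀ z, s' (xB z) = xA (s' z))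
    (hsy' : ∀ z, s' (yB z) = yA (s' z)) (hs' : ∀ z, s' (dB z) = dA (s' z)) (hxy : ∀ z, xB (s z) = yB (s z))
    (hxy' : ∀ z, xA (s' z) = yA (s' z)) (h₁ : ∀ z, s' (s z) = xA z + yA z)
    (h₂ : ∀ z, s (s' z) = xB z + yB z) (h2 : IsUnit (2 : k))
    (h : TorsionBound t (cone dB dA s') (xB.prodMap xA) m) :
    TorsionBound t (cone dA dB s) (xA.prodMap xB) (m + 1) := by
  -- These maps exchange the two sides and multiply one of them by x − y. They anticommute with the
  -- differentials since x − y vanishes on the images of `s` and `s'`.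
  let f : A × B →ₗ[k] B × A :=
    ((xB - yB) ∘ₗ LinearMap.snd k A B).prod (LinearMap.fst k A B)
  let g : B × A →ₗ[k] A × B :=
    ((xA - yA) ∘ₗ LinearMap.snd k B A).prod (LinearMap.fst k B A)
  let x : Module.End k (A × B) := xA.prodMap xB
  let y : Module.End k (A × B) := yA.prodMap yB
  let H : Module.End k (A × B) := (s' ∘ₗ LinearMap.snd k A B).prod 0
  have hf : ∀ z, f (cone dA dB s z) = -cone dB dA s' (f z) := fun z => by
    ext1 <;> simp [f, hxy, hxy', hB, hB', hsx', hsy']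
  have hg : ∀ z, g (cone dB dA s' z) = -cone dA dB s (g z) := fun z => by
    ext1 <;> simp [g, hxy, hxy', hA, hA', hs, hsy]
  have hgx : ∀ z, g ((xB.prodMap xA) z) = x (g z) := fun z => by
    ext1 <;> simp [g, x, hAA]
  have hgf : ∀ z, g (f z) = x z - y z := fun z => by ext1 <;> simp [f, g, x, y]
  have hH : ∀ z, cone dA dB s (H z) + H (cone dA dB s z) = x z + y z := fun z => by
    ext1 <;> simp [H, x, y, h₁, h₂, hs']
  have hdx : ∀ z, cone dA dB s (x z) = x (cone dA dB s z) := fun z => by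
    ext1 <;> simp [x, hA, hB, hs]
  rintro z hz j ⟨w, hw⟩
  obtain ⟨w', hw'⟩ := h (f z) (neg_eq_zero.1 (by rw [← hf, hz, map_zero])) j
    ⟨-f w, by rw [map_neg, ← hf, hw, map_smul]⟩
  have e1 : (x ^ m) (x z) - (x ^ m) (y z) = -cone dA dB s (g w') := by
    rw [← map_sub, ← hgf, ← pow_map_comm g hgx, ← hw', hg]
  have e3 : (x ^ m) (x z) + (x ^ m) (y z) = cone dA dB s ((x ^ m) (H z)) := by
    rw [← map_add, ← hH, hz, map_zero, add_zero, pow_map_comm _ hdx]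
  obtain ⟨u, hu⟩ := h2
  refine ⟨(↑u⁻¹ : k) • ((x ^ m) (H z) - g w'), ?_⟩
  -- The sum of x − y = gf and x + y = dH + Hd is 2x. Since xᵐ sends f z to a boundary, one further
  -- factor x suffices for z after division by two.
  have e4 : cone dA dB s ((x ^ m) (H z) - g w') = (u : k) • (x ^ (m + 1)) z := by
    rw [map_sub, ← e3, sub_eq_add_neg, ← e1, hu, two_smul, pow_succ, Module.End.mul_apply]
    abel
  rw [map_smul, e4, smul_smul, Units.inv_mul, one_smul]

namespace ResCube

theorem mulX_comm (R : ResCube E n) (e e' : E) (z : R.Chain k τ) :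
    R.mulX k τ e (R.mulX k τ e' z) = R.mulX k τ e' (R.mulX k τ e z) := by
  funext v
  exact mul_left_comm (xv k τ (R.rel v) e) (xv k τ (R.rel v) e') (z v)

/-- A crossing change exchanges the two resolutions, so the new complex is the cone of the reverse
saddle between the same faces. -/
theorem torsionBound_change {R R' : ResCube E (n + 1)} (hR : R.Planar) (hR' : R'.Planar)
    (h₁ : R'.face true = R.face false) (h₀ : R'.face false = R.face true)
    (hac : ∀ v, ((R.face false).rel v (R'.a 0) (R.a 0) ∧ (R.face false).rel v (R'.c 0) (R.c 0)) ∨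
      ((R.face false).rel v (R'.a 0) (R.c 0) ∧ (R.face false).rel v (R'.c 0) (R.a 0)))
    (h2 : IsUnit (2 : k)) (h : TorsionBound t (R'.diff k τ) (R'.mulX k τ (R.a 0)) m) :
    TorsionBound t (R.diff k τ) (R.mulX k τ (R.a 0)) (m + 1) := by
  have hN' := hR'.nb
  rw [torsionBound_cons] at h ⊢
  rw [h₀, h₁] at h hN'
  have hN := hR.nb
  have hS : saddleMap k τ (R.face true) (R.face false) (R'.a 0) (R'.c 0) =
      saddleMap k τ (R.face true) (R.face false) (R.a 0) (R.c 0) :=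
    LinearMap.ext fun z => funext fun v => saddle_congr (hN' v) (hN v).symm (hac v) (z v)
  rw [hS] at h
  exact h.cone_swap (diff_mulX _ _) (diff_mulX _ _) (diff_mulX _ _) (diff_mulX _ _)
    (mulX_comm _ _ _) (saddleMap_mulX _ _ _ _ _) (saddleMap_mulX _ _ _ _ _)
    (saddleMap_mulX _ _ _ _ _) (saddleMap_mulX _ _ _ _ _)
    (saddleMap_diff (hR.face true) (hR.face false) rfl rfl fun v => (hN v).symm)
    (mulX_saddleMap hN) (mulX_saddleMap fun v => (hN v).symm) (saddleMap_saddleMap hN)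
    (saddleMap_saddleMap fun v => (hN v).symm) h2

end ResCube

namespace PD

theorem rc_congr_joins {L : List (Crossing E)} {J J' : List (E × E)}
    (h : ∀ p ∈ J, p ∈ J' ∨ p.swap ∈ J') (h' : ∀ p ∈ J', p ∈ J ∨ p.swap ∈ J) :
    (⟨L, J⟩ : PD E).rc = (⟨L, J'⟩ : PD E).rc := by
  have key : ∀ {J J' : List (E × E)}, (∀ p ∈ J, p ∈ J' ∨ p.swap ∈ J') →
      ∀ (v : Fin L.length → Bool) e e', (⟨L, J⟩ : PD E).rc.rel v e e' →
        (⟨L, J'⟩ : PD E).rc.rel v e e' := by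
    intro J J' h v e e' he
    refine rc_rel_le (D := ⟨L, J⟩) _ (fun p hp => ?_) (fun i p hp => ?_) he
    · rcases h p hp with h1 | h1
      · exact rc_join h1
      · exact Setoid.symm' _ (rc_join h1)
    · exact rc_arc (D := ⟨L, J'⟩) i hp
  have : (⟨L, J⟩ : PD E).rc.rel = (⟨L, J'⟩ : PD E).rc.rel :=
    funext fun v => Setoid.ext fun e e' => ⟨key h v e e', key h' v e e'⟩
  unfold rc at *
  simp only at this ⊢
  rw [this]

theorem tb_change (x : Crossing E) (L : List (Crossing E)) (J : List (E × E))
    (hD : (⟨x :: L, J⟩ : PD E).rc.Planar) (hD' : (⟨x.change :: L, J⟩ : PD E).rc.Planar)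
    (h2 : IsUnit (2 : k)) (h : (⟨x.change :: L, J⟩ : PD E).TB k τ t x.a m) :
    (⟨x :: L, J⟩ : PD E).TB k τ t x.a (m + 1) := by
  have hx : ∀ b, ∀ p ∈ x.change.arcs (!b) ++ J, p ∈ x.arcs b ++ J ∨ p.swap ∈ x.arcs b ++ J := by
    intro b p hp
    obtain ⟨s, xa, xb, xc, xd⟩ := x
    rcases List.mem_append.1 hp with hp | hp
    · cases s <;> cases b <;> simp [Crossing.change, Crossing.arcs] at hp ⊢ <;>
        rcases hp with rfl | rfl <;> simp
    · exact Or.inl (List.mem_append_right _ hp)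
  have hx' : ∀ b, ∀ p ∈ x.arcs b ++ J, p ∈ x.change.arcs (!b) ++ J ∨
      p.swap ∈ x.change.arcs (!b) ++ J := by
    intro b p hp
    obtain ⟨s, xa, xb, xc, xd⟩ := x
    rcases List.mem_append.1 hp with hp | hp
    · cases s <;> cases b <;> simp [Crossing.change, Crossing.arcs] at hp ⊢ <;>
        rcases hp with rfl | rfl <;> simp
    · exact Or.inl (List.mem_append_right _ hp)
  refine ResCube.torsionBound_change (R := (⟨x :: L, J⟩ : PD E).rc)
    (R' := (⟨x.change :: L, J⟩ : PD E).rc) hD hD' ?_ ?_ (fun v => ?_) h2 h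
  · rw [face_rc, face_rc]
    exact rc_congr_joins (hx false) (hx' false)
  · rw [face_rc, face_rc]
    exact rc_congr_joins (hx true) (hx' true)
  · have h1 := rc_false (D := ⟨x :: L, J⟩) (v := (Fin.cons false v : Fin (L.length + 1) → Bool))
      (i := (0 : Fin (L.length + 1))) rfl
    change ((⟨x :: L, J⟩ : PD E).rc.rel (Fin.cons false v : Fin (L.length + 1) → Bool) x.change.a x.a
      ∧ (⟨x :: L, J⟩ : PD E).rc.rel (Fin.cons false v : Fin (L.length + 1) → Bool) x.change.c x.c) ∨
      ((⟨x :: L, J⟩ : PD E).rc.rel (Fin.cons false v : Fin (L.length + 1) → Bool) x.change.a x.c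
      ∧ (⟨x :: L, J⟩ : PD E).rc.rel (Fin.cons false v : Fin (L.length + 1) → Bool) x.change.c x.a)
    change (⟨x :: L, J⟩ : PD E).rc.rel (Fin.cons false v : Fin (L.length + 1) → Bool) x.a x.b ∧
      (⟨x :: L, J⟩ : PD E).rc.rel (Fin.cons false v : Fin (L.length + 1) → Bool) x.c x.d at h1
    unfold Crossing.change
    split_ifs
    · exact Or.inr ⟨Setoid.symm' _ h1.2, Setoid.symm' _ h1.1⟩
    · exact Or.inl ⟨Setoid.symm' _ h1.1, Setoid.symm' _ h1.2⟩

theorem CrossingChange.tb {E' : Type} {D : PD E} {D' : PD E'} (h : D.CrossingChange D')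
    (hD : D.IsKnot) (hD' : D'.IsKnot) (h2 : IsUnit (2 : k)) (hT : ∀ e, D'.TB k τ t e m) (e : E) :
    D.TB k τ t e (m + 1) := by
  obtain ⟨L₁, x, L₂, J⟩ := h
  have p1 : (L₁ ++ x :: L₂).Perm (x :: (L₁ ++ L₂)) := List.perm_middle
  have p2 : (L₁ ++ x.change :: L₂).Perm (x.change :: (L₁ ++ L₂)) := List.perm_middle
  have hP := planar_reorder p1 (List.Perm.refl J) (rc_planar hD)
  have hP' := planar_reorder p2 (List.Perm.refl J) (rc_planar hD')
  rw [hD.tb_iff e x.a, tb_reorder p1 (List.Perm.refl J) (rc_planar hD)]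
  exact tb_change x _ J hP hP' h2
    ((tb_reorder p2 (List.Perm.refl J) (rc_planar hD') x.a).1 (hT x.a))

end PD

theorem KnotDiagram.tb_of_knot_eq {D D' : KnotDiagram} (h : D.knot = D'.knot) :
    (∀ e, D.pd.TB k τ t e m) ↔ ∀ e, D'.pd.TB k τ t e m := by
  have h' := Quot.eqvGen_exact h
  clear h
  induction h' with
  | rel D D' h => exact h.tb_iff D.isKnot D'.isKnot
  | refl D => rfl
  | symm D D' _ ih => exact ih.symm
  | trans D D' D'' _ _ ih ih' => exact ih.trans ih'

/-- The differential is zero and the chain group is free, so a cycle that represents a torsion class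
is itself zero. -/
theorem unknotDiagram_tb [NoZeroDivisors k] (ht : t ≠ 0) (e) : unknotDiagram.pd.TB k τ t e 0 := by
  rintro z - m ⟨w, hw⟩
  refine ⟨0, ?_⟩
  have : t ^ m • z = 0 := by
    rw [← hw]
    funext v
    rw [ResCube.diff_apply]
    exact Finset.sum_empty (ι := Fin 0)
  rw [map_zero, pow_zero, Module.End.one_apply]
  funext v
  have h0 := congrFun this v
  have : Nontrivial k := ⟨t, 0, ht⟩
  exact (circRing_smul_eq_zero _ (pow_ne_zero m ht) h0).symm

/-- Each crossing change costs one power of X. The bound is stated for all diagrams of the knot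
because the changes are made in arbitrary ones. -/
theorem Knot.UnknotsIn.tb [NoZeroDivisors k] (ht : t ≠ 0) (h2 : IsUnit (2 : k)) {K : Knot}
    (h : K.UnknotsIn n) : ∀ D : KnotDiagram, D.knot = K → ∀ e, D.pd.TB k τ t e n := by
  induction h with
  | zero => exact fun D hD => (KnotDiagram.tb_of_knot_eq hD).2 (unknotDiagram_tb ht)
  | succ h _ ih =>
    exact fun D hD => (KnotDiagram.tb_of_knot_eq hD).2 (h.tb (KnotDiagram.isKnot _)
      (KnotDiagram.isKnot _) h2 (ih _ rfl))

end CrossingChanges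

/-! ## The order of torsion -/

section TorsionOrder

variable {k : Type} [CommRing k] {τ t : k} {E : Type} {n : ℕ}

namespace PD

variable (k τ) in
/-- The chain group of a diagram as the chain group of its cube. -/
noncomputable def toRc (D : PD E) : D.Chain k τ ≃ₗ[k] D.rc.Chain k τ :=
  LinearEquiv.refl k (D.Chain k τ)

/-- One factor tests whether `a` and `b` lie on the same circle, the other one tests `a` and `c`; at
the target of an edge of the cube `b` and `c` are joined. -/
theorem toRc_diff {D : PD E} (hD : D.rc.Planar) (z : D.Chain k τ) :
    D.toRc k τ (D.diff k τ z) = D.rc.diff k τ (D.toRc k τ z) := by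
  funext v
  rw [ResCube.diff_apply, ← Finset.sum_filter,
    Finset.sum_subtype (p := fun i => v i = true) _ (by simp)]
  change D.diff k τ z v = _
  rw [diff, LinearMap.pi_apply, LinearMap.sum_apply]
  refine Finset.sum_congr rfl fun i _ => ?_
  rw [LinearMap.smul_apply, LinearMap.comp_apply, LinearMap.proj_apply]
  refine congrArg _ ?_
  obtain ⟨p, hp⟩ := circMk_surjective (k := k) (τ := τ)
    (D.rc.rel (Function.update v i.1 false)) (D.toRc k τ z (Function.update v i.1 false))
  rw [← hp, saddle_mk_of (hD v i.1 i.2).left p]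
  change D.edgeMap k τ v i.1 i.2 (D.toRc k τ z (Function.update v i.1 false)) = _
  rw [← hp]
  have hf : D.edgeFactor k v i.1 = saddleFactor k (D.rc.rel v) (D.rc.a i.1) (D.rc.c i.1) := by
    unfold edgeFactor saddleFactor
    have hbc := (rc_true (D := D) i.2).2
    have : D.SameCircle v (D.crossings.get i.1).a (D.crossings.get i.1).b ↔
        D.rc.rel v (D.rc.a i.1) (D.rc.c i.1) :=
      ⟨fun h => Setoid.trans' _ h hbc, fun h => Setoid.trans' _ h (Setoid.symm' _ hbc)⟩
    by_cases h : D.rc.rel v (D.rc.a i.1) (D.rc.c i.1)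
    · rw [if_pos (this.2 h), if_pos h]
    · rw [if_neg (mt this.1 h), if_neg h]
      rfl
  rw [← hf]
  rfl

theorem mulX_mulX (R : ResCube E n) (e : E) (z : R.Chain k τ) :
    R.mulX k τ e (R.mulX k τ e z) = τ • z := by
  funext v
  change xv k τ (R.rel v) e * (xv k τ (R.rel v) e * z v) = τ • z v
  rw [← mul_assoc, xv_sq, Algebra.smul_def]

/-- With t = τ = X² the exponent 2 for X is the exponent 1 for t. -/
theorem smul_mem_range_of_tb {D : PD E} {e : E} (h : D.TB k τ τ e 2) {z : D.rc.Chain k τ}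
    (hz : D.rc.diff k τ z = 0) (hn : τ ^ n • z ∈ LinearMap.range (D.rc.diff k τ)) :
    τ • z ∈ LinearMap.range (D.rc.diff k τ) := by
  have := h z hz n hn
  rwa [pow_two, Module.End.mul_apply, mulX_mulX] at this

end PD

open Polynomial in
theorem KnotDiagram.smul_mem_range {D : KnotDiagram} (h : D.knot.unknottingNumber ≤ 2)
    {z : D.pd.rc.Chain ℚ[X] X} (hz : D.pd.rc.diff ℚ[X] X z = 0)
    (hn : (X : ℚ[X]) ^ n • z ∈ LinearMap.range (D.pd.rc.diff ℚ[X] X)) :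
    (X : ℚ[X]) • z ∈ LinearMap.range (D.pd.rc.diff ℚ[X] X) := by
  obtain ⟨e⟩ := D.isKnot.nonempty
  -- The unknotting number is an infimum of natural numbers in `ℕ∞`; if no sequence of at most two
  -- changes existed, it would be at least 3.
  obtain ⟨j, hj, hK⟩ : ∃ j ≤ 2, D.knot.UnknotsIn j := by
    by_contra! hc
    have : (3 : ℕ∞) ≤ D.knot.unknottingNumber := le_iInf₂ fun j hj => by
      have : 3 ≤ j := by by_contra hlt; exact hc j (by omega) hj
      exact_mod_cast this
    exact absurd (this.trans h) (by decide)
  have h2 : IsUnit (2 : ℚ[X]) :=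
    Polynomial.isUnit_C.2 (isUnit_iff_ne_zero.2 (two_ne_zero (α := ℚ)))
  -- If fewer than two changes suffice, the bound is weakened to 2.
  have hT : ∀ i, D.pd.TB ℚ[X] X X e (j + i) := by
    intro i
    induction i with
    | zero => exact hK.tb X_ne_zero h2 D rfl e
    | succ i ih => exact ih.succ (D.pd.rc.diff_mulX e)
  obtain ⟨i, hi⟩ := Nat.exists_eq_add_of_le hj
  have := hT i
  rw [← hi] at this
  exact PD.smul_mem_range_of_tb this hz hn

open Polynomial in
theorem KnotDiagram.uT_le_one {D : KnotDiagram} (h : D.knot.unknottingNumber ≤ 2) : D.uT ≤ 1 := by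
  classical
  have hP := PD.rc_planar D.isKnot
  refine iSup₂_le fun y hy => ?_
  have : (X : ℚ[X]) ^ 1 • y = 0 := by
    obtain ⟨m, hm⟩ := hy
    obtain ⟨⟨z, hz⟩, rfl⟩ := Submodule.Quotient.mk_surjective _ y
    rw [← Submodule.Quotient.mk_smul, Submodule.Quotient.mk_eq_zero] at hm ⊢
    obtain ⟨w, hw⟩ := hm
    have hz' := PD.toRc_diff hP z
    rw [LinearMap.mem_ker.1 hz, map_zero] at hz'
    obtain ⟨u, hu⟩ := KnotDiagram.smul_mem_range h hz'.symm
      ⟨D.pd.toRc ℚ[X] X w, (PD.toRc_diff hP w).symm.trans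
        ((congrArg (D.pd.toRc ℚ[X] X) hw).trans (map_smul (D.pd.toRc ℚ[X] X) _ z))⟩
    refine ⟨(D.pd.toRc ℚ[X] X).symm u, (D.pd.toRc ℚ[X] X).injective ?_⟩
    rw [PD.toRc_diff hP, LinearEquiv.apply_symm_apply, hu, pow_one]
    exact (map_smul (D.pd.toRc ℚ[X] X) _ z).symm
  exact_mod_cast Nat.find_min' hy this

end TorsionOrder

/-! ## The matrix of the differential -/

section DifferentialMatrix

open MvPolynomial

variable {E : Type} {k : Type} [CommRing k] {τ : k} {n : ℕ}

theorem Nb.card_quotient [Finite E] {r r' : Setoid E} {a c : E} (h : Nb r r' a c) (hm : r' a c) :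
    Nat.card (Quotient r) = Nat.card (Quotient r') + 1 := by
  have hac : ¬ r a c := fun hr => h.iff_not.1 hr hm
  let f : {x : Quotient r // x ≠ cl r c} → Quotient r' := fun x =>
    Quotient.map' id (fun _ _ he => h.le hm he) x.1
  have hf : Function.Bijective f := by
    constructor
    · rintro ⟨⟨e⟩, he⟩ ⟨⟨e'⟩, he'⟩ hee
      have he : ¬ r e c := fun h => he (cl_eq.2 h)
      have he' : ¬ r e' c := fun h => he' (cl_eq.2 h)
      have h1 : r' e e' := cl_eq.1 hee
      refine Subtype.ext (cl_eq.2 ?_)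
      rcases h.right _ _ h1 with h2 | h2 | h2
      · exact h2
      · exact absurd (r.symm' h2.2) he'
      · exact absurd h2.1 he
    · rintro ⟨e⟩
      by_cases he : r e c
      · exact ⟨⟨cl r a, fun h => hac (cl_eq.1 h)⟩,
          cl_eq.2 (r'.trans' hm (r'.symm' (h.le hm he)))⟩
      · exact ⟨⟨cl r e, fun h => he (cl_eq.1 h)⟩, rfl⟩
  classical
  rw [← Nat.card_congr (Equiv.optionSubtypeNe (cl r c)), Finite.card_option,
    Nat.card_congr (Equiv.ofBijective f hf)]

open Classical in
/-- The monomials of the factor of a saddle map. -/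
noncomputable def saddleTerms (r' : Setoid E) (a c : E) : List (E →₀ ℕ) :=
  if r' a c then [0] else [Finsupp.single a 1, Finsupp.single c 1]

theorem saddleFactor_eq_sum (r' : Setoid E) (a c : E) :
    saddleFactor k r' a c = ((saddleTerms r' a c).map fun m => monomial m 1).sum := by
  unfold saddleFactor saddleTerms
  split_ifs
  · simp
  · simp [X]

/-- A merge has factor 1 and loses a circle; a split has a factor of degree 1 and gains one. So the
differential is homogeneous up to applications of X² = τ. -/
theorem Nb.degree_of_mem [Finite E] {r r' : Setoid E} {a c : E} (h : Nb r r' a c) {m : E →₀ ℕ}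
    (hm : m ∈ saddleTerms r' a c) :
    2 * m.degree + Nat.card (Quotient r) = 1 + Nat.card (Quotient r') := by
  unfold saddleTerms at hm
  split_ifs at hm with hac
  · rw [List.mem_singleton.1 hm, map_zero, h.card_quotient hac]
    omega
  · have h1 : m.degree = 1 := by
      rcases List.mem_pair.1 hm with rfl | rfl <;> exact Finsupp.degree_single ..
    have h2 := h.symm.card_quotient (by_contra fun hr => hac (not_not.1 (mt h.iff_not.2 hr)))
    omega

theorem circ_eq_sum [Finite E] (r : Setoid E) [Fintype (Finset (Quotient r))]
    (z : CircRing k τ r) : z = ∑ S, circEquiv k τ r z S • circleMonomial r S := by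
  apply (circEquiv k τ r).injective
  rw [map_sum]
  simp only [map_smul, circEquiv_circleMonomial]
  ext S
  simp

open Classical in
theorem circEquiv_saddle [Finite E] {r r' : Setoid E} [Fintype (Finset (Quotient r))] {a c : E}
    (h : Nb r r' a c) (z : CircRing k τ r) (T : Finset (Quotient r')) :
    circEquiv k τ r' (saddle k τ r r' a c z) T = ∑ S, circEquiv k τ r z S *
      ((saddleTerms r' a c).map fun m =>
        if oddPart (circlesOf r' (edgeMonomial r S + m)) = T then
          τ ^ half (circlesOf r' (edgeMonomial r S + m)) else 0).sum := by
  conv_lhs => rw [circ_eq_sum r z]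
  rw [map_sum, map_sum, Finsupp.finsetSum_apply]
  refine Finset.sum_congr rfl fun S _ => ?_
  rw [map_smul, map_smul, Finsupp.smul_apply, smul_eq_mul, circleMonomial_eq, saddle_mk_of h.left,
    saddleFactor_eq_sum]
  congr 1
  induction saddleTerms r' a c with
  | nil => simp
  | cons m l ih =>
    rw [List.map_cons, List.sum_cons, add_mul, map_add, map_add, Finsupp.add_apply, ih, List.map_cons,
      List.sum_cons, monomial_mul, one_mul, add_comm m, circEquiv_monomial, Finsupp.single_apply]

namespace ResCube

variable (R : ResCube E n)

/-- The set of basis elements of the chain group. -/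
abbrev Idx : Type := (v : Fin n → Bool) × Finset (Quotient (R.rel v))

noncomputable instance [Finite E] : Fintype R.Idx := Fintype.ofFinite _

variable (k τ) in
/-- The coordinates of the chain group. -/
noncomputable def coord [Finite E] : R.Chain k τ ≃ₗ[k] (R.Idx → k) where
  toFun z α := circEquiv k τ (R.rel α.1) (z α.1) α.2
  map_add' z w := by ext; simp
  map_smul' x z := by ext; simp
  invFun f v := (circEquiv k τ (R.rel v)).symm (Finsupp.equivFunOnFinite.symm fun S => f ⟨v, S⟩)
  left_inv z := by
    funext v
    rw [LinearEquiv.symm_apply_eq]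
    ext S
    rfl
  right_inv f := by
    funext α
    change circEquiv k τ (R.rel α.1) ((circEquiv k τ (R.rel α.1)).symm _) α.2 = _
    rw [LinearEquiv.apply_symm_apply]
    rfl

/-- The height of a vertex. -/
def hgt (v : Fin n → Bool) : ℕ := (Finset.univ.filter fun i => v i = true).card

theorem hgt_update {v : Fin n → Bool} {i : Fin n} (hi : v i = true) :
    hgt v = hgt (Function.update v i false) + 1 := by
  have h1 : (Finset.univ.filter fun j => v j = true) =
      insert i (Finset.univ.filter fun j => Function.update v i false j = true) := by
    ext j
    by_cases hj : j = i
    · simp [hj, hi]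
    · simp [hj]
  rw [hgt, h1, Finset.card_insert_of_notMem (by simp)]
  rfl

/-- The quantum grading, up to a shift. -/
noncomputable def qdeg (α : R.Idx) : ℤ :=
  hgt α.1 + Nat.card (Quotient (R.rel α.1)) - 2 * α.2.card

open Classical in
/-- The matrix of the differential without the powers of `τ`. -/
noncomputable def mat (β α : R.Idx) : ℤ :=
  ∑ i, if β.1 i = true ∧ α.1 = Function.update β.1 i false then
    (-1) ^ sgn β.1 i * ((saddleTerms (R.rel β.1) (R.a i) (R.c i)).countP fun m =>
      oddPart (circlesOf (R.rel β.1) (edgeMonomial (R.rel α.1) α.2 + m)) = β.2 : ℤ) else 0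

variable {R}

/-- Each reduction X² = τ removes two variables and so raises the quantum degree by 4. -/
theorem Planar.half_eq [Finite E] (hR : R.Planar) {v : Fin n → Bool} {i : Fin n} (hi : v i = true)
    {S : Finset (Quotient (R.rel (Function.update v i false)))} {T : Finset (Quotient (R.rel v))}
    {m : E →₀ ℕ} (hm : m ∈ saddleTerms (R.rel v) (R.a i) (R.c i))
    (hT : oddPart (circlesOf (R.rel v) (edgeMonomial _ S + m)) = T) :
    R.qdeg ⟨v, T⟩ = R.qdeg ⟨Function.update v i false, S⟩ +
      4 * half (circlesOf (R.rel v) (edgeMonomial _ S + m)) := by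
  have h1 := degree_eq_half (circlesOf (R.rel v) (edgeMonomial _ S + m))
  rw [degree_circlesOf, hT, map_add, degree_edgeMonomial] at h1
  have h2 := (hR v i hi).degree_of_mem hm
  have h3 := hgt_update hi
  simp only [qdeg]
  omega

theorem Planar.mat_ne_zero [Finite E] (hR : R.Planar) {β α : R.Idx} (h : R.mat β α ≠ 0) :
    (∃ j : ℕ, R.qdeg β = R.qdeg α + 4 * j) ∧ hgt β.1 = hgt α.1 + 1 := by
  classical
  obtain ⟨i, -, hi⟩ := Finset.exists_ne_zero_of_sum_ne_zero h
  obtain ⟨⟨hi1, hi2⟩, hi3⟩ := ite_ne_right_iff.1 hi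
  obtain ⟨v, T⟩ := β
  obtain ⟨u, S⟩ := α
  simp only at hi1 hi2 hi3 ⊢
  subst hi2
  refine ⟨?_, hgt_update hi1⟩
  have h1 := right_ne_zero_of_mul hi3
  obtain ⟨m, hm, hT⟩ := List.countP_pos_iff.1 (Nat.pos_of_ne_zero (by exact_mod_cast h1))
  exact ⟨_, hR.half_eq hi1 hm (by simpa using hT)⟩

/-- The integer matrix does not depend on τ, and the power of τ is determined by the degrees of the
basis elements. The cases τ = 0, 1, t relate Khovanov's complex, Lee's filtered complex and its
homogeneous form. -/
theorem Planar.coord_diff [Finite E] (hR : R.Planar) (z : R.Chain k τ) (β : R.Idx) :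
    R.coord k τ (R.diff k τ z) β = ∑ α, (R.mat β α : k) *
      τ ^ ((R.qdeg β - R.qdeg α) / 4).toNat * R.coord k τ z α := by
  classical
  obtain ⟨v, T⟩ := β
  have : ∀ v, Fintype (Finset (Quotient (R.rel v))) := fun v => Fintype.ofFinite _
  change circEquiv k τ (R.rel v) (R.diff k τ z v) T = _
  have hs : ∀ f : R.Idx → k, ∑ α, f α = ∑ u, ∑ S, f ⟨u, S⟩ := fun f => by
    rw [← Fintype.sum_sigma']
    exact Finset.sum_congr (Finset.ext fun _ => by simp) fun _ _ => rfl
  rw [hs, diff_apply, map_sum, Finsupp.finsetSum_apply]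
  simp only [mat, Int.cast_sum, Finset.sum_mul]
  have hswap : ∀ f : (Fin n → Bool) → Fin n → k, (∀ u i, u ≠ Function.update v i false → f u i = 0) →
      ∑ u, ∑ i, f u i = ∑ i, f (Function.update v i false) i := by
    intro f hf
    rw [Finset.sum_comm]
    exact Finset.sum_congr rfl fun i _ => Finset.sum_eq_single _ (fun u _ hu => hf u i hu) (by simp)
  refine Eq.trans ?_ (Finset.sum_congr rfl fun u _ => Finset.sum_comm).symm
  rw [hswap _ (fun u i hu => Finset.sum_eq_zero fun S _ => by
    rw [if_neg fun h => hu h.2, Int.cast_zero, zero_mul, zero_mul])]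
  refine Finset.sum_congr rfl fun i _ => ?_
  by_cases hi : v i = true
  · rw [if_pos hi, map_smul, Finsupp.smul_apply, circEquiv_saddle (hR v i hi), smul_eq_mul,
      Finset.mul_sum]
    refine Finset.sum_congr rfl fun S _ => ?_
    rw [if_pos ⟨hi, rfl⟩]
    have key : ∀ l ⊆ saddleTerms (R.rel v) (R.a i) (R.c i),
        (l.map fun m => if oddPart (circlesOf (R.rel v) (edgeMonomial _ S + m)) = T then
          τ ^ half (circlesOf (R.rel v) (edgeMonomial _ S + m)) else 0).sum =
        ((l.countP fun m => oddPart (circlesOf (R.rel v) (edgeMonomial _ S + m)) = T : ℕ) : k) *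
          τ ^ ((R.qdeg ⟨v, T⟩ - R.qdeg ⟨Function.update v i false, S⟩) / 4).toNat := by
      intro l hl
      induction l with
      | nil => simp
      | cons m l ih =>
        rw [List.map_cons, List.sum_cons, List.countP_cons, ih (fun _ h => hl (List.mem_cons_of_mem _ h))]
        split_ifs with h1 h2 h2
        · have := hR.half_eq hi (hl (List.mem_cons_self ..)) h1
          have h3 : ((R.qdeg ⟨v, T⟩ - R.qdeg ⟨Function.update v i false, S⟩) / 4).toNat =
              half (circlesOf (R.rel v) (edgeMonomial _ S + m)) := by omega
          rw [h3]
          push_cast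
          ring
        · simp [h1] at h2
        · simp [h1] at h2
        · simp
    rw [key _ (List.Subset.refl _)]
    push_cast
    change _ * (circEquiv k τ _ (z _) S * _) = _ * circEquiv k τ _ (z _) S
    ring
  · rw [if_neg hi]
    simp [hi]

end ResCube

end DifferentialMatrix

/-! ## Filtered complexes -/

section FilteredComplexes

variable {ι : Type}

/-- The function vanishes outside of `P`. -/
def SuppIn (P : ι → Prop) (f : ι → ℚ) : Prop := ∀ i, f i ≠ 0 → P i

theorem SuppIn.mono {P P' : ι → Prop} {f : ι → ℚ} (hf : SuppIn P f) (h : ∀ i, P i → P' i) :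
    SuppIn P' f := fun i hi => h i (hf i hi)

theorem SuppIn.eq_zero {P : ι → Prop} {f : ι → ℚ} (hf : SuppIn P f) {i : ι} (h : ¬ P i) : f i = 0 :=
  by_contra fun h' => h (hf i h')

theorem SuppIn.add {P : ι → Prop} {f g : ι → ℚ} (hf : SuppIn P f) (hg : SuppIn P g) :
    SuppIn P (f + g) := fun i hi => by
  by_contra h
  exact hi (by rw [Pi.add_apply, hf.eq_zero h, hg.eq_zero h, add_zero])

theorem SuppIn.smul {P : ι → Prop} {f : ι → ℚ} (hf : SuppIn P f) (u : ℚ) :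
    SuppIn P (u • f) := fun i hi => by
  by_contra h
  exact hi (by rw [Pi.smul_apply, hf.eq_zero h, smul_zero])

theorem SuppIn.sub {P : ι → Prop} {f g : ι → ℚ} (hf : SuppIn P f) (hg : SuppIn P g) :
    SuppIn P (f - g) := by
  rw [sub_eq_add_neg, ← neg_one_smul ℚ g]
  exact hf.add (hg.smul _)

open Classical in
/-- The restriction of a function to a set. -/
noncomputable def projIn (P : ι → Prop) : Module.End ℚ (ι → ℚ) where
  toFun f i := if P i then f i else 0
  map_add' f g := by ext i; by_cases h : P i <;> simp [h]
  map_smul' u f := by ext i; by_cases h : P i <;> simp [h]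

theorem projIn_of {P : ι → Prop} {i : ι} (h : P i) (f : ι → ℚ) : projIn P f i = f i := if_pos h

theorem projIn_of_not {P : ι → Prop} {i : ι} (h : ¬ P i) (f : ι → ℚ) : projIn P f i = 0 := if_neg h

theorem suppIn_projIn (P : ι → Prop) (f : ι → ℚ) : SuppIn P (projIn P f) := fun i hi => by
  by_contra h
  exact hi (projIn_of_not h f)

theorem SuppIn.projIn {P : ι → Prop} {f : ι → ℚ} (hf : SuppIn P f) (P' : ι → Prop) :
    SuppIn P (projIn P' f) := fun i hi => by
  by_cases h : P' i
  · rw [projIn_of h] at hi; exact hf i hi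
  · exact absurd (projIn_of_not h f) hi

theorem SuppIn.projIn_eq {P P' : ι → Prop} {f : ι → ℚ} (hf : SuppIn P f) (h : ∀ i, P i → P' i) :
    _root_.projIn P' f = f := by
  ext i
  by_cases hi : P' i
  · exact projIn_of hi f
  · rw [projIn_of_not hi, hf.eq_zero (mt (h i) hi)]

theorem SuppIn.projIn_eq_zero {P P' : ι → Prop} {f : ι → ℚ} (hf : SuppIn P f)
    (h : ∀ i, P i → ¬ P' i) : _root_.projIn P' f = 0 := by
  ext i
  by_cases hi : P' i
  · rw [projIn_of hi, hf.eq_zero fun hP => h i hP hi, Pi.zero_apply]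
  · exact projIn_of_not hi f

variable [Fintype ι]

/-- The operator of a matrix. -/
noncomputable def matOp (c : ι → ι → ℚ) : Module.End ℚ (ι → ℚ) where
  toFun f β := ∑ α, c β α * f α
  map_add' f g := by ext; simp [mul_add, Finset.sum_add_distrib]
  map_smul' u f := by ext; simp [Finset.mul_sum, mul_left_comm]

theorem matOp_apply (c : ι → ι → ℚ) (f : ι → ℚ) (β : ι) : matOp c f β = ∑ α, c β α * f α := rfl

theorem projIn_matOp {c : ι → ι → ℚ} {P P' : ι → Prop} (h : ∀ β α, c β α ≠ 0 → (P β ↔ P' α))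
    (f : ι → ℚ) : projIn P (matOp c f) = matOp c (projIn P' f) := by
  ext β
  by_cases hβ : P β
  · rw [projIn_of hβ, matOp_apply, matOp_apply]
    refine Finset.sum_congr rfl fun α _ => ?_
    by_cases hc : c β α = 0
    · rw [hc, zero_mul, zero_mul]
    · rw [projIn_of ((h β α hc).1 hβ)]
  · rw [projIn_of_not hβ, matOp_apply, Finset.sum_eq_zero fun α _ => ?_]
    by_cases hc : c β α = 0
    · rw [hc, zero_mul]
    · rw [projIn_of_not (mt (h β α hc).2 hβ), mul_zero]

theorem SuppIn.matOp {c : ι → ι → ℚ} {P P' : ι → Prop} {f : ι → ℚ} (hf : SuppIn P f)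
    (h : ∀ β α, c β α ≠ 0 → P α → P' β) : SuppIn P' (matOp c f) := by
  intro β hβ
  obtain ⟨α, -, hα⟩ := Finset.exists_ne_zero_of_sum_ne_zero hβ
  exact h β α (left_ne_zero_of_mul hα) (hf α (right_ne_zero_of_mul hα))

variable (ι) in
/-- The matrix of a differential that does not lower the filtration `q` and is homogeneous with
respect to `q` modulo `4` and to `h`. -/
structure FilteredMatrix where
  q : ι → ℤ
  h : ι → ℤ
  c : ι → ι → ℚ
  hq : ∀ {β α}, c β α ≠ 0 → ∃ j : ℕ, q β = q α + 4 * j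
  hh : ∀ {β α}, c β α ≠ 0 → h β = h α + 1
  sq : ∀ β α, ∑ γ, c β γ * c γ α = 0

namespace FilteredMatrix

variable (M : FilteredMatrix ι)

/-- The differential. -/
noncomputable def d : Module.End ℚ (ι → ℚ) := matOp M.c

open Classical in
/-- The part of the differential of a given degree. -/
noncomputable def part (j : ℕ) : Module.End ℚ (ι → ℚ) :=
  matOp fun β α => if M.q β = M.q α + 4 * j then M.c β α else 0

variable {M} {a : ℤ}

theorem d_d (f : ι → ℚ) : M.d (M.d f) = 0 := by
  ext β
  simp only [d, matOp_apply, Finset.mul_sum]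
  rw [Finset.sum_comm]
  refine Finset.sum_eq_zero fun α _ => ?_
  simp only [← mul_assoc]
  rw [← Finset.sum_mul, M.sq, zero_mul]

/-- This is the component of degree 4n of d² = 0. -/
theorem sum_part_part (n : ℕ) (f : ι → ℚ) :
    ∑ p ∈ Finset.HasAntidiagonal.antidiagonal n, M.part p.1 (M.part p.2 f) = 0 := by
  classical
  ext β
  rw [Finset.sum_apply, Pi.zero_apply]
  simp only [part, matOp_apply, Finset.mul_sum]
  rw [Finset.sum_comm]
  simp only [Finset.sum_comm (s := Finset.HasAntidiagonal.antidiagonal n)]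
  rw [Finset.sum_comm]
  refine Finset.sum_eq_zero fun α _ => ?_
  have key : ∀ γ, ∑ p ∈ Finset.HasAntidiagonal.antidiagonal n,
      (if M.q β = M.q γ + 4 * (p.1 : ℕ) then M.c β γ else 0) *
        ((if M.q γ = M.q α + 4 * (p.2 : ℕ) then M.c γ α else 0) * f α) =
      if M.q β = M.q α + 4 * n then M.c β γ * M.c γ α * f α else 0 := by
    intro γ
    by_cases h1 : M.c β γ = 0
    · simp [h1]
    by_cases h2 : M.c γ α = 0
    · simp [h2]
    obtain ⟨i, hi⟩ := M.hq h1
    obtain ⟨j, hj⟩ := M.hq h2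
    split_ifs with hn
    · rw [Finset.sum_eq_single_of_mem (i, j) (by rw [Finset.HasAntidiagonal.mem_antidiagonal]; omega), if_pos hi,
        if_pos hj, mul_assoc]
      rintro ⟨i', j'⟩ - hne
      by_cases h3 : M.q β = M.q γ + 4 * (i' : ℕ)
      · by_cases h4 : M.q γ = M.q α + 4 * (j' : ℕ)
        · exact absurd (Prod.ext (by simp only; omega) (by simp only; omega)) hne
        · rw [if_neg h4, zero_mul, mul_zero]
      · rw [if_neg h3, zero_mul]
    · refine Finset.sum_eq_zero fun p hp => ?_
      rw [Finset.HasAntidiagonal.mem_antidiagonal] at hp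
      by_cases h3 : M.q β = M.q γ + 4 * (p.1 : ℕ)
      · rw [if_neg (by omega : ¬ M.q γ = M.q α + 4 * (p.2 : ℕ)), zero_mul, mul_zero]
      · rw [if_neg h3, zero_mul]
  rw [Finset.sum_congr rfl fun γ _ => key γ]
  split_ifs
  · rw [← Finset.sum_mul, M.sq, zero_mul]
  · exact Finset.sum_const_zero

theorem part_zero_one (f : ι → ℚ) : M.part 0 (M.part 1 f) = -M.part 1 (M.part 0 f) := by
  have := sum_part_part (M := M) 1 f
  rw [show Finset.HasAntidiagonal.antidiagonal 1 = {(0, 1), (1, 0)} from rfl] at this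
  simp at this
  exact eq_neg_of_add_eq_zero_left this

/-- On the homology of `part 0` the square of `part 1` vanishes, with `part 2` as homotopy; so `part
1` induces a differential there. -/
theorem part_one_one (f : ι → ℚ) : M.part 1 (M.part 1 f) =
    -M.part 0 (M.part 2 f) - M.part 2 (M.part 0 f) := by
  have := sum_part_part (M := M) 2 f
  rw [show Finset.HasAntidiagonal.antidiagonal 2 = {(0, 2), (1, 1), (2, 0)} from rfl] at this
  simp at this
  linear_combination (exp := 1) this

theorem projIn_part (j : ℕ) (f : ι → ℚ) :
    projIn (fun i => M.q i = a + 4 * j) (M.part j f) = M.part j (projIn (fun i => M.q i = a) f) := by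
  classical
  refine projIn_matOp (fun β α hc => ?_) f
  have := (ite_ne_right_iff.1 hc).1
  constructor <;> intro <;> omega

theorem suppIn_d {P : ℤ → Prop} (hP : ∀ i (j : ℕ), P i → P (i + 4 * j)) {f : ι → ℚ}
    (hf : SuppIn (fun i => P (M.q i)) f) : SuppIn (fun i => P (M.q i)) (M.d f) := by
  refine hf.matOp fun β α hc h => ?_
  obtain ⟨j, hj⟩ := M.hq hc
  rw [hj]
  exact hP _ _ h

theorem d_apply_of_eq {f : ι → ℚ} (hf : SuppIn (fun i => a ≤ M.q i) f) :
    projIn (fun i => M.q i = a) (M.d f) = M.part 0 (projIn (fun i => M.q i = a) f) := by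
  classical
  ext β
  rw [part, matOp_apply]
  by_cases hβ : M.q β = a
  · rw [projIn_of (P := fun i => M.q i = a) hβ, d, matOp_apply]
    refine Finset.sum_congr rfl fun α _ => ?_
    by_cases hc : M.c β α = 0
    · simp [hc]
    by_cases hα : f α = 0
    · simp [hα, projIn]
    obtain ⟨j, hj⟩ := M.hq hc
    have := hf α hα
    have h1 : M.q α = a := by omega
    rw [if_pos (by omega), projIn_of (P := fun i => M.q i = a) h1]
  · rw [projIn_of_not (P := fun i => M.q i = a) hβ, Finset.sum_eq_zero fun α _ => ?_]
    by_cases hα : M.q α = a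
    · rw [if_neg (by rw [hα]; simpa using hβ), zero_mul]
    · rw [projIn_of_not (P := fun i => M.q i = a) hα, mul_zero]

/-- From level a on, only the levels a and a + 4 reach level a + 4: the differential preserves
degrees modulo 4 and does not lower them. -/
theorem d_apply_of_eq_add {f : ι → ℚ} (hf : SuppIn (fun i => a ≤ M.q i) f) :
    projIn (fun i => M.q i = a + 4) (M.d f) = M.part 0 (projIn (fun i => M.q i = a + 4) f) +
      M.part 1 (projIn (fun i => M.q i = a) f) := by
  classical
  ext β
  rw [Pi.add_apply, part, part, matOp_apply, matOp_apply, ← Finset.sum_add_distrib]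
  by_cases hβ : M.q β = a + 4
  · rw [projIn_of (P := fun i => M.q i = a + 4) hβ, d, matOp_apply]
    refine Finset.sum_congr rfl fun α _ => ?_
    by_cases hc : M.c β α = 0
    · simp [hc]
    by_cases hα : f α = 0
    · simp [hα, projIn]
    obtain ⟨j, hj⟩ := M.hq hc
    have := hf α hα
    rcases (by omega : M.q α = a ∨ M.q α = a + 4) with h1 | h1
    · rw [if_neg (by push_cast; omega), if_pos (by push_cast; omega),
        projIn_of (P := fun i => M.q i = a) h1, zero_mul, zero_add]
    · rw [if_pos (by push_cast; omega), if_neg (by push_cast; omega),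
        projIn_of (P := fun i => M.q i = a + 4) h1, zero_mul, add_zero]
  · rw [projIn_of_not (P := fun i => M.q i = a + 4) hβ, Finset.sum_eq_zero fun α _ => ?_]
    have h1 : (if M.q β = M.q α + 4 * ((0 : ℕ) : ℤ) then M.c β α else 0) *
        projIn (fun i => M.q i = a + 4) f α = 0 := by
      by_cases hα : M.q α = a + 4
      · rw [if_neg (by push_cast; omega), zero_mul]
      · rw [projIn_of_not (P := fun i => M.q i = a + 4) hα, mul_zero]
    have h2 : (if M.q β = M.q α + 4 * ((1 : ℕ) : ℤ) then M.c β α else 0) *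
        projIn (fun i => M.q i = a) f α = 0 := by
      by_cases hα : M.q α = a
      · rw [if_neg (by push_cast; omega), zero_mul]
      · rw [projIn_of_not (P := fun i => M.q i = a) hα, mul_zero]
    rw [h1, h2, add_zero]

/-- The positions above a given one. -/
def above (M : FilteredMatrix ι) (a : ℤ) (i : ι) : Prop := ∃ j : ℕ, M.q i = a + 4 * j

theorem above_le {i : ι} (h : M.above a i) : a ≤ M.q i := by
  obtain ⟨j, hj⟩ := h
  omega

theorem suppIn_d_above {f : ι → ℚ} (hf : SuppIn (M.above a) f) : SuppIn (M.above a) (M.d f) :=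
  suppIn_d (P := fun i => ∃ j : ℕ, i = a + 4 * j) (by
    rintro i j ⟨l, rfl⟩
    exact ⟨l + j, by push_cast; ring⟩) hf

theorem suppIn_above_of {f : ι → ℚ} (hf : SuppIn (M.above a) f)
    (h : projIn (fun i => M.q i = a) f = 0) : SuppIn (M.above (a + 4)) f := by
  intro i hi
  obtain ⟨j, hj⟩ := hf i hi
  obtain _ | j := j
  · have := congrFun h i
    rw [projIn_of (P := fun i => M.q i = a) (by simpa using hj)] at this
    exact absurd this hi
  · exact ⟨j, by rw [hj]; push_cast; ring⟩

/-- The differential is strict up to a shift of the filtration by `4`. -/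
def Strict (M : FilteredMatrix ι) : Prop :=
  ∀ (a : ℤ) (f : ι → ℚ), SuppIn (fun i => a ≤ M.q i) (M.d f) →
    ∃ g, SuppIn (fun i => a - 4 ≤ M.q i) g ∧ M.d g = M.d f

/-- The filtration levels of the classes that do not vanish. -/
def levels (M : FilteredMatrix ι) : Set ℤ :=
  {a | ∃ z, M.d z = 0 ∧ SuppIn (fun i => a ≤ M.q i) z ∧ z ∉ LinearMap.range M.d}

/-- A class that survives the first differential lifts to a true cycle. Correcting z by w' pushes
the differential to level a + 8. Strictness provides a term of level a + 4 with the same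
differential, and subtracting it does not affect the leading term z. -/
theorem exists_lift (hM : M.Strict) {z w : ι → ℚ} (hz : SuppIn (fun i => M.q i = a) z)
    (h0 : M.part 0 z = 0) (h1 : M.part 1 z = M.part 0 w) :
    ∃ y, M.d y = 0 ∧ SuppIn (M.above a) y ∧ projIn (fun i => M.q i = a) y = z := by
  set w' := projIn (fun i => M.q i = a + 4) w with hw'
  have hwS : SuppIn (fun i => M.q i = a + 4) w' := suppIn_projIn _ _
  have hzw : SuppIn (M.above a) (z - w') :=
    (hz.mono fun i hi => ⟨0, by simpa using hi⟩).sub (hwS.mono fun i hi => ⟨1, by simpa using hi⟩)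
  have hle := hzw.mono (P' := fun i => a ≤ M.q i) fun i => above_le
  have e1 : projIn (fun i => M.q i = a) (z - w') = z := by
    rw [map_sub, hz.projIn_eq fun i => id, hwS.projIn_eq_zero fun i h h' => by omega, sub_zero]
  have e2 : projIn (fun i => M.q i = a + 4) (z - w') = -w' := by
    rw [map_sub, hz.projIn_eq_zero fun i h h' => by omega, hwS.projIn_eq fun i => id, zero_sub]
  have e3 : M.part 0 w' = M.part 1 z := by
    have := projIn_part (M := M) (a := a + 4) 0 w
    rw [hw', ← this, ← h1]
    have h2 := projIn_part (M := M) (a := a) 1 z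
    rw [hz.projIn_eq fun i => id] at h2
    simpa using h2
  have d1 := suppIn_above_of (suppIn_d_above hzw) (by rw [d_apply_of_eq hle, e1, h0])
  have d2 := suppIn_above_of d1 (by rw [d_apply_of_eq_add hle, e1, e2, map_neg, e3]; simp)
  obtain ⟨g, hg, hg'⟩ := hM (a + 4 + 4) (z - w') (d2.mono fun i => above_le)
  -- The term given by strictness may have entries in other residues modulo 4. The differential
  -- respects residues, so these entries can be dropped.
  have hg2 : M.d (projIn (M.above (a + 4)) g) = M.d (z - w') := by
    have h3 : ∀ f, projIn (fun i => ∃ j : ℤ, M.q i = a + 4 * j) (M.d f) =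
        M.d (projIn (fun i => ∃ j : ℤ, M.q i = a + 4 * j) f) := projIn_matOp fun β α hc => by
      obtain ⟨j, hj⟩ := M.hq hc
      exact ⟨fun ⟨l, hl⟩ => ⟨l - j, by omega⟩, fun ⟨l, hl⟩ => ⟨l + j, by omega⟩⟩
    refine Eq.trans ?_ (d1.projIn_eq (P' := fun i => ∃ j : ℤ, M.q i = a + 4 * j)
      (fun i ⟨j, hj⟩ => ⟨j + 1, by omega⟩))
    rw [← hg', h3]
    congr 1
    ext i
    by_cases hi : M.above (a + 4) i
    · obtain ⟨j, hj⟩ := id hi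
      rw [projIn_of hi, projIn_of (P := fun i => ∃ j : ℤ, M.q i = a + 4 * j) ⟨j + 1, by omega⟩]
    · rw [projIn_of_not hi]
      by_cases hi' : ∃ j : ℤ, M.q i = a + 4 * j
      · rw [projIn_of (P := fun i => ∃ j : ℤ, M.q i = a + 4 * j) hi', hg.eq_zero]
        intro hle
        obtain ⟨j, hj⟩ := hi'
        exact hi ⟨(j - 1).toNat, by omega⟩
      · rw [projIn_of_not (P := fun i => ∃ j : ℤ, M.q i = a + 4 * j) hi']
  have hg3 := suppIn_projIn (M.above (a + 4)) g
  refine ⟨z - w' - projIn (M.above (a + 4)) g, ?_, hzw.sub (hg3.mono ?_), ?_⟩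
  · rw [map_sub, hg2, sub_self]
  · rintro i ⟨j, hj⟩
    exact ⟨j + 1, by rw [hj]; push_cast; ring⟩
  · rw [map_sub, e1, hg3.projIn_eq_zero fun i h h' => by have := above_le h; omega, sub_zero]

/-- By strictness a preimage may be chosen at level a − 4; its two lowest components are `y` and
`w`. So leading terms of boundaries vanish on the second page. -/
theorem exists_of_mem_range (hM : M.Strict) {z : ι → ℚ} (hz : SuppIn (fun i => a ≤ M.q i) z)
    (h : z ∈ LinearMap.range M.d) : ∃ y w, M.part 0 y = 0 ∧
      projIn (fun i => M.q i = a) z = M.part 1 y + M.part 0 w := by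
  obtain ⟨f, rfl⟩ := h
  obtain ⟨g, hg, hg'⟩ := hM a f hz
  refine ⟨projIn (fun i => M.q i = a - 4) g, projIn (fun i => M.q i = a) g, ?_, ?_⟩
  · rw [← d_apply_of_eq hg, hg', hz.projIn_eq_zero fun i h h' => by omega]
  · have := d_apply_of_eq_add hg
    rw [sub_add_cancel, hg'] at this
    rw [this, add_comm]

/-- If the leading term of z vanishes on the second page, subtracting d(y' + w') moves z to level a
+ 4 without changing its class. -/
theorem mem_levels_of (z : ι → ℚ) (hz : M.d z = 0) (hz' : z ∉ LinearMap.range M.d)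
    (hS : SuppIn (M.above a) z) {y w : ι → ℚ} (hy : M.part 0 y = 0)
    (h : projIn (fun i => M.q i = a) z = M.part 1 y + M.part 0 w) : a + 4 ∈ M.levels := by
  set y' := projIn (fun i => M.q i = a - 4) y with hy'
  set w' := projIn (fun i => M.q i = a) w with hw'
  have hyS : SuppIn (fun i => M.q i = a - 4) y' := suppIn_projIn _ _
  have hwS : SuppIn (fun i => M.q i = a) w' := suppIn_projIn _ _
  have hf : SuppIn (M.above (a - 4)) (y' + w') :=
    (hyS.mono fun i hi => ⟨0, by simpa using hi⟩).add
      (hwS.mono fun i hi => ⟨1, by push_cast; omega⟩)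
  have hle := hf.mono (P' := fun i => a - 4 ≤ M.q i) fun i => above_le
  have e1 : projIn (fun i => M.q i = a - 4) (y' + w') = y' := by
    rw [map_add, hyS.projIn_eq fun i => id, hwS.projIn_eq_zero fun i h h' => by omega, add_zero]
  have e2 : projIn (fun i => M.q i = a) (y' + w') = w' := by
    rw [map_add, hwS.projIn_eq fun i => id, hyS.projIn_eq_zero fun i h h' => by omega, zero_add]
  have p0 : ∀ (b : ℤ) f, projIn (fun i => M.q i = b) (M.part 0 f) =
      M.part 0 (projIn (fun i => M.q i = b) f) := fun b f => by
    simpa using projIn_part (M := M) (a := b) 0 f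
  have hy0 : M.part 0 y' = 0 := by rw [hy', ← p0, hy, map_zero]
  have e3 : projIn (fun i => M.q i = a) z = M.part 1 y' + M.part 0 w' := by
    have h1 := projIn_part (M := M) (a := a - 4) 1 y
    have h2 : (fun i => M.q i = a - 4 + 4 * ((1 : ℕ) : ℤ)) = fun i => M.q i = a := by
      funext i
      push_cast
      rw [sub_add_cancel]
    rw [h2] at h1
    rw [hy', hw', ← h1, ← p0, ← map_add, ← h]
    exact ((suppIn_projIn _ z).projIn_eq fun i => id).symm
  have d1 := suppIn_above_of (suppIn_d_above hf) (by rw [d_apply_of_eq hle, e1, hy0])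
  rw [sub_add_cancel] at d1
  have e4 : projIn (fun i => M.q i = a) (M.d (y' + w')) = M.part 1 y' + M.part 0 w' := by
    have := d_apply_of_eq_add hle
    rw [sub_add_cancel, e1, e2] at this
    rw [this, add_comm]
  have d2 := suppIn_above_of (hS.sub d1) (by rw [map_sub, e3, e4, sub_self])
  refine ⟨_, ?_, d2.mono fun i => above_le, fun hr => hz' ?_⟩
  · rw [map_sub, hz, d_d, sub_zero]
  · rw [← sub_add_cancel z (M.d (y' + w'))]
    exact add_mem hr ⟨_, rfl⟩

end FilteredMatrix

end FilteredComplexes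

/-! ## Bases adapted to a differential -/

/-- The vectors a_i are chosen in `T` such that the Φ(a_i) form a basis of the range. As `p` gives a
basis of the kernel modulo the range, the families p, Φ(a_i) and a_i together form a basis. The
choice from `T` later makes the pairs homogeneous. -/
theorem exists_basis_of_range_of_ker {k V : Type} [Field k] [AddCommGroup V] [Module k V]
    [Module.Finite k V] (Φ : Module.End k V) (hΦ : ∀ x, Φ (Φ x) = 0) {p : Bool → V}
    (hp : ∀ i, Φ (p i) = 0)
    (hker : ∀ x, Φ x = 0 → ∃ (u v : k) (y : V), x = u • p false + v • p true + Φ y)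
    (hli : ∀ (u v : k) (y : V), u • p false + v • p true = Φ y → u = 0 ∧ v = 0)
    {T : Set V} (hT : Submodule.span k T = ⊤) :
    ∃ (r : ℕ) (a : Fin r → V) (b : Module.Basis (Bool ⊕ Fin r × Bool) k V),
      (∀ i, a i ∈ T) ∧ (∀ i, b (.inl i) = p i) ∧
        ∀ i, b (.inr (i, false)) = a i ∧ b (.inr (i, true)) = Φ (a i) := by
  obtain ⟨B, hB, hBs, hBl⟩ := exists_linearIndependent k (Φ '' T)
  have hfin : Finite B := hBl.finite
  obtain ⟨r, ⟨e⟩⟩ := Finite.exists_equiv_fin B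
  choose a haT ha using fun i : Fin r => hB (e.symm i).2
  have hfl : LinearIndependent k fun i => Φ (a i) := by
    have : (fun i => Φ (a i)) = (fun x : B => (x : V)) ∘ e.symm := funext ha
    rw [this]
    exact hBl.comp _ e.symm.injective
  have hspan : ∀ x, ∃ c : Fin r → k, Φ x = ∑ i, c i • Φ (a i) := by
    intro x
    have h1 : Φ x ∈ Submodule.span k (Set.range fun i => Φ (a i)) := by
      have : (Set.range fun i => Φ (a i)) = B := by
        have : (fun i => Φ (a i)) = (fun x : B => (x : V)) ∘ e.symm := funext ha
        rw [this, Set.range_comp, e.symm.surjective.range_eq, Set.image_univ, Subtype.range_coe]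
      rw [this, hBs, ← Submodule.map_span, hT]
      exact ⟨x, trivial, rfl⟩
    obtain ⟨c, hc⟩ := (Submodule.mem_span_range_iff_exists_fun k).1 h1
    exact ⟨c, hc.symm⟩
  set g : Bool ⊕ Fin r × Bool → V :=
    Sum.elim p fun x => if x.2 then Φ (a x.1) else a x.1 with hg
  have hsum : ∀ c : Bool ⊕ Fin r × Bool → k, ∑ x, c x • g x =
      c (.inl false) • p false + c (.inl true) • p true + (∑ i, c (.inr (i, true)) • Φ (a i) +
        ∑ i, c (.inr (i, false)) • a i) := by
    intro c
    rw [Fintype.sum_sum_type, Fintype.sum_prod_type]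
    simp only [Fintype.sum_bool, hg, Sum.elim_inl, Sum.elim_inr, if_true, Bool.false_eq_true,
      if_false, Finset.sum_add_distrib]
    rw [add_comm (c (.inl true) • p true)]
  have hgl : LinearIndependent k g := by
    rw [Fintype.linearIndependent_iff]
    intro c hc
    rw [hsum] at hc
    have h1 := congrArg Φ hc
    simp only [map_add, map_smul, hp, map_sum, hΦ, smul_zero, Finset.sum_const_zero, zero_add,
      map_zero] at h1
    have h2 := Fintype.linearIndependent_iff.1 hfl _ h1
    simp only [h2, zero_smul, Finset.sum_const_zero, add_zero] at hc
    have h3 := hli (c (.inl false)) (c (.inl true)) (-∑ i, c (.inr (i, true)) • a i) (by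
      rw [map_neg, map_sum]
      simp only [map_smul]
      exact eq_neg_of_add_eq_zero_left hc)
    rw [h3.1, h3.2, zero_smul, zero_smul, zero_add, zero_add] at hc
    have h4 := Fintype.linearIndependent_iff.1 hfl _ hc
    rintro ((_ | _) | ⟨i, _ | _⟩)
    exacts [h3.1, h3.2, h2 i, h4 i]
  have hgs : ⊤ ≤ Submodule.span k (Set.range g) := by
    rintro x -
    obtain ⟨c, hc⟩ := hspan x
    obtain ⟨u, v, y, hy⟩ := hker (x - ∑ i, c i • a i) (by
      rw [map_sub, hc, map_sum]
      simp only [map_smul, sub_self])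
    obtain ⟨c', hc'⟩ := hspan y
    rw [Submodule.mem_span_range_iff_exists_fun]
    refine ⟨Sum.elim (fun i => if i then v else u) fun x => if x.2 then c' x.1 else c x.1, ?_⟩
    rw [hsum]
    simp only [Sum.elim_inl, Sum.elim_inr, if_true, Bool.false_eq_true, if_false]
    rw [← hc', ← add_assoc, ← hy, sub_add_cancel]
  refine ⟨r, a, Module.Basis.mk hgl hgs, haT, fun i => ?_, fun i => ⟨?_, ?_⟩⟩ <;>
    rw [Module.Basis.mk_apply] <;> rfl

/-! ## The knight move decomposition of a filtered complex -/

namespace FilteredMatrix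

variable {ι : Type} [Fintype ι] {M : FilteredMatrix ι} {a : ℤ}

theorem projIn_modEq (f : ι → ℚ) : projIn (fun i => M.q i ≡ a [ZMOD 4]) (M.d f) =
    M.d (projIn (fun i => M.q i ≡ a [ZMOD 4]) f) := projIn_matOp (fun β α hc => by
  obtain ⟨j, hj⟩ := M.hq hc
  rw [hj]
  constructor <;> intro h <;> unfold Int.ModEq at * <;> omega) f

theorem projIn_part_add {y : ι → ℚ} (hy : M.part 0 y = 0) (w : ι → ℚ) (a : ℤ) :
    ∃ y' w', M.part 0 y' = 0 ∧
      projIn (fun i => M.q i = a) (M.part 1 y + M.part 0 w) = M.part 1 y' + M.part 0 w' := by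
  have p0 : ∀ (b : ℤ) f, projIn (fun i => M.q i = b) (M.part 0 f) =
      M.part 0 (projIn (fun i => M.q i = b) f) := fun b f => by
    simpa using projIn_part (M := M) (a := b) 0 f
  have p1 := projIn_part (M := M) (a := a - 4) 1 y
  have h2 : (fun i => M.q i = a - 4 + 4 * ((1 : ℕ) : ℤ)) = fun i => M.q i = a := by
    funext i
    push_cast
    rw [sub_add_cancel]
  rw [h2] at p1
  exact ⟨projIn (fun i => M.q i = a - 4) y, projIn (fun i => M.q i = a) w,
    by rw [← p0, hy, map_zero], by rw [map_add, p1, p0]⟩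

/-- The structure of Lee's complex of a knot: an involution of degree `-2` and generators of the
homology on which it acts by `1` and by `-1`. -/
structure Eigenbasis (M : FilteredMatrix ι) where
  X : Module.End ℚ (ι → ℚ)
  A : ι → ℚ
  B : ι → ℚ
  X_d : ∀ f, X (M.d f) = M.d (X f)
  X_X : ∀ f, X (X f) = f
  X_supp : ∀ a f, SuppIn (fun i => M.above a i ∧ M.h i = 0) f →
    SuppIn (fun i => M.above (a - 2) i ∧ M.h i = 0) (X f)
  A_supp : SuppIn (fun i => M.h i = 0) A
  B_supp : SuppIn (fun i => M.h i = 0) B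
  X_A : X A = A
  X_B : X B = -B
  d_A : M.d A = 0
  span : ∀ z, M.d z = 0 → ∃ (α β : ℚ) (y : ι → ℚ), z = α • A + β • B + M.d y
  A_notMem : A ∉ LinearMap.range M.d

/-- The degrees of the finitely many indices bound the levels from above, and any lower bound for
these degrees is a level because of the cycle `A`. -/
theorem exists_isGreatest_levels (S : M.Eigenbasis) : ∃ s, IsGreatest M.levels s := by
  obtain ⟨b, hb⟩ := (Set.finite_range M.q).bddAbove
  obtain ⟨b', hb'⟩ := (Set.finite_range M.q).bddBelow
  have hle : ∀ a ∈ M.levels, a ≤ b := by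
    rintro a ⟨z, -, hz, hz'⟩
    have : z ≠ 0 := by
      rintro rfl
      exact hz' (zero_mem _)
    obtain ⟨i, hi⟩ := Function.ne_iff.1 this
    exact (hz i hi).trans (hb ⟨i, rfl⟩)
  obtain ⟨s, hs, hs'⟩ := Int.exists_greatest_of_bdd (P := fun a => a ∈ M.levels) ⟨b, hle⟩
    ⟨b', S.A, S.d_A, fun i _ => hb' ⟨i, rfl⟩, S.A_notMem⟩
  exact ⟨s, hs, fun a ha => hs' a ha⟩

theorem mem_range_of_projIn {P : ι → Prop} {z : ι → ℚ}
    (h1 : projIn P z ∈ LinearMap.range M.d) (h2 : projIn (fun i => ¬ P i) z ∈ LinearMap.range M.d) :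
    z ∈ LinearMap.range M.d := by
  have : z = projIn P z + projIn (fun i => ¬ P i) z := by
    ext i
    by_cases h : P i
    · rw [Pi.add_apply, projIn_of h, projIn_of_not (P := fun i => ¬ P i) (not_not.2 h), add_zero]
    · rw [Pi.add_apply, projIn_of_not h, projIn_of (P := fun i => ¬ P i) h, zero_add]
  rw [this]
  exact add_mem h1 h2

/-- A cycle of top level is split according to q modulo 4 and then according to h. The residues
other than that of s start at level s + 1, so they contribute a boundary; outside h = 0 there is no
homology, as both generators have h = 0. -/
theorem exists_top_cycle (S : M.Eigenbasis) {s : ℤ} (hs : IsGreatest M.levels s) :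
    ∃ P, M.d P = 0 ∧ P ∉ LinearMap.range M.d ∧ SuppIn (fun i => M.above s i ∧ M.h i = 0) P := by
  obtain ⟨z, hz, hzs, hzr⟩ := hs.1
  set z' := projIn (fun i => M.q i ≡ s [ZMOD 4]) z with hz'
  have dz' : M.d z' = 0 := by rw [hz', ← projIn_modEq, hz, map_zero]
  have hzr' : z' ∉ LinearMap.range M.d := fun h => hzr <| mem_range_of_projIn h <| by
    by_contra h'
    have : s + 1 ∈ M.levels := by
      refine ⟨_, ?_, ?_, h'⟩
      · have : projIn (fun i => ¬ M.q i ≡ s [ZMOD 4]) (M.d z) =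
            M.d (projIn (fun i => ¬ M.q i ≡ s [ZMOD 4]) z) := projIn_matOp (fun β α hc => by
          obtain ⟨j, hj⟩ := M.hq hc
          rw [hj]
          constructor <;> intro h <;> unfold Int.ModEq at * <;> omega) z
        rw [← this, hz, map_zero]
      · intro i hi
        have h1 := hzs.projIn _ i hi
        have h2 := suppIn_projIn _ _ i hi
        have : M.q i ≠ s := fun h => h2 (by rw [h])
        change s + 1 ≤ M.q i
        omega
    have := hs.2 this
    omega
  have hzs' : SuppIn (M.above s) z' := fun i hi => by
    have h1 := hzs.projIn _ i hi
    have h2 : M.q i ≡ s [ZMOD 4] := suppIn_projIn _ _ i hi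
    unfold Int.ModEq at h2
    exact ⟨((M.q i - s) / 4).toNat, by omega⟩
  have hh : ∀ (P : ℤ → Prop) f, projIn (fun i => P (M.h i)) (M.d f) =
      M.d (projIn (fun i => P (M.h i + 1)) f) := fun P f => projIn_matOp (fun β α hc => by
    rw [M.hh hc]) f
  refine ⟨projIn (fun i => M.h i = 0) z', ?_, fun h => hzr' (mem_range_of_projIn h ?_),
    fun i hi => ⟨hzs'.projIn _ i hi, suppIn_projIn _ _ i hi⟩⟩
  · have := hh (fun j => j = 1) z'
    rw [dz', map_zero] at this
    simpa using this.symm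
  · obtain ⟨α, β, y, hy⟩ := S.span z' dz'
    rw [hy, map_add, map_add, map_smul, map_smul,
      S.A_supp.projIn_eq_zero fun i h h' => h' h, S.B_supp.projIn_eq_zero fun i h h' => h' h,
      hh (fun j => ¬ j = 0) y]
    exact ⟨_, by rw [smul_zero, smul_zero, zero_add, zero_add]⟩

/-- Generators of the homology in the two top filtration levels. -/
theorem exists_top_cycles (S : M.Eigenbasis) {s : ℤ} (hs : IsGreatest M.levels s) :
    ∃ P₀ P₁, M.d P₀ = 0 ∧ M.d P₁ = 0 ∧ P₀ ∉ LinearMap.range M.d ∧ P₁ ∉ LinearMap.range M.d ∧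
      SuppIn (fun i => M.above (s - 2) i ∧ M.h i = 0) P₀ ∧
      SuppIn (fun i => M.above s i ∧ M.h i = 0) P₁ ∧
      ∀ z, M.d z = 0 → ∃ (u v : ℚ) (y : ι → ℚ), z = u • P₀ + v • P₁ + M.d y := by
  obtain ⟨P, dP, hP, hPs⟩ := exists_top_cycle S hs
  have hXs := S.X_supp _ _ hPs
  have hXr : S.X P ∉ LinearMap.range M.d := by
    rintro ⟨f, hf⟩
    exact hP ⟨S.X f, by rw [← S.X_d, hf, S.X_X]⟩
  have e1 : projIn (fun i => M.q i ≡ s [ZMOD 4]) P = P := hPs.projIn_eq fun i ⟨⟨j, hj⟩, _⟩ => by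
    rw [hj]
    unfold Int.ModEq
    omega
  have e2 : projIn (fun i => M.q i ≡ s [ZMOD 4]) (S.X P) = 0 :=
    hXs.projIn_eq_zero fun i ⟨⟨j, hj⟩, _⟩ => by
      rw [hj]
      unfold Int.ModEq
      omega
  -- The involution shifts degrees by 2 modulo 4, so P and X P lie in different residues. A relation
  -- X P = c P + d f with c ≠ 0 would therefore make P a boundary.
  have key : ∀ (c : ℚ) f, S.X P = c • P + M.d f → c = 0 := by
    intro c f h
    by_contra hc
    have := congrArg (projIn fun i => M.q i ≡ s [ZMOD 4]) h
    rw [e2, map_add, map_smul, e1, projIn_modEq] at this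
    apply hP
    refine ⟨(-c⁻¹) • projIn (fun i => M.q i ≡ s [ZMOD 4]) f, ?_⟩
    rw [map_smul, eq_neg_of_add_eq_zero_right this.symm, smul_neg, neg_smul, neg_neg,
      inv_smul_smul₀ hc]
  obtain ⟨α, β, y, hy⟩ := S.span P dP
  have hXP : S.X P = α • S.A - β • S.B + M.d (S.X y) := by
    rw [hy, map_add, map_add, map_smul, map_smul, S.X_A, S.X_B, S.X_d, smul_neg, ← sub_eq_add_neg]
  -- If only one of the generators A and B occurred in P, then X P would be homologous to P or to
  -- −P.
  have hβ : β ≠ 0 := by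
    rintro rfl
    refine one_ne_zero (key 1 (S.X y - y) ?_)
    rw [hXP, map_sub, one_smul]
    linear_combination (norm := module) -hy
  have hα : α ≠ 0 := by
    rintro rfl
    refine neg_ne_zero.2 one_ne_zero (key (-1) (S.X y + y) ?_)
    rw [hXP, map_add]
    linear_combination (norm := module) hy
  refine ⟨S.X P, P, by rw [← S.X_d, dP, map_zero], dP, hXr, hP, hXs, hPs, fun z hz => ?_⟩
  obtain ⟨α', β', y', hz'⟩ := S.span z hz
  -- Modulo boundaries, A = (P + X P) / (2α) and B = (P − X P) / (2β).
  refine ⟨(α' / α - β' / β) / 2, (α' / α + β' / β) / 2,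
    y' - ((α' / α - β' / β) / 2) • S.X y - ((α' / α + β' / β) / 2) • y, ?_⟩
  have h1 : S.A = (α⁻¹ / 2) • (P + S.X P - M.d y - M.d (S.X y)) := by
    rw [show P + S.X P - M.d y - M.d (S.X y) = (2 * α) • S.A by
      linear_combination (norm := module) hy + hXP, smul_smul,
      show α⁻¹ / 2 * (2 * α) = 1 by field_simp, one_smul]
  have h2 : S.B = (β⁻¹ / 2) • (P - S.X P - M.d y + M.d (S.X y)) := by
    rw [show P - S.X P - M.d y + M.d (S.X y) = (2 * β) • S.B by
      linear_combination (norm := module) hy - hXP, smul_smul,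
      show β⁻¹ / 2 * (2 * β) = 1 by field_simp, one_smul]
  rw [hz', h1, h2, map_sub, map_sub, map_smul, map_smul]
  module

theorem projIn_part_zero (f : ι → ℚ) (a : ℤ) : projIn (fun i => M.q i = a) (M.part 0 f) =
    M.part 0 (projIn (fun i => M.q i = a) f) := by
  simpa using projIn_part (M := M) (a := a) 0 f

theorem projIn_projIn_of_ne {f : ι → ℚ} {b c : ℤ} (h : b ≠ c) :
    projIn (fun i => M.q i = b) (projIn (fun i => M.q i = c) f) = 0 :=
  (suppIn_projIn _ f).projIn_eq_zero fun i h1 h2 => h (h2.symm.trans h1)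

/-- The differential of the `E₁` page on cycles of pure degree. -/
theorem exists_eq_of_pure (hM : M.Strict) {s : ℤ} (hs : IsGreatest M.levels s) {P₀ P₁ : ι → ℚ}
    (h0 : SuppIn (M.above (s - 2)) P₀) (h1 : SuppIn (M.above s) P₁)
    (hP : ∀ z, M.d z = 0 → ∃ (u v : ℚ) (y : ι → ℚ), z = u • P₀ + v • P₁ + M.d y)
    {z w : ι → ℚ} (hz : SuppIn (fun i => M.q i = a) z)
    (hz0 : M.part 0 z = 0) (hz1 : M.part 1 z = M.part 0 w) :
    ∃ (u v : ℚ) (y w' : ι → ℚ), M.part 0 y = 0 ∧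
      z = u • projIn (fun i => M.q i = s - 2) P₀ + v • projIn (fun i => M.q i = s) P₁ +
        M.part 1 y + M.part 0 w' := by
  obtain ⟨y, dy, hy, rfl⟩ := exists_lift hM hz hz0 hz1
  have of_range : ∀ x, SuppIn (fun i => a ≤ M.q i) x → x ∈ LinearMap.range M.d →
      ∃ y w, M.part 0 y = 0 ∧ projIn (fun i => M.q i = a) x = M.part 1 y + M.part 0 w :=
    fun x hx hr => exists_of_mem_range hM hx hr
  -- If the lift bounds, its leading term vanishes on the second page. Otherwise its level a is at
  -- most s, and the lift is expressed through P₀ and P₁.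
  by_cases hr : y ∈ LinearMap.range M.d
  · obtain ⟨y', w', hy', e⟩ := of_range y (hy.mono fun i => above_le) hr
    exact ⟨0, 0, y', w', hy', by rw [e]; module⟩
  have has : a ≤ s := hs.2 ⟨y, dy, hy.mono fun i => above_le, hr⟩
  obtain ⟨u, v, η, e⟩ := hP y dy
  have hmod : ∀ {b : ℤ} {x : ι → ℚ}, SuppIn (M.above b) x → 
      projIn (fun i => M.q i ≡ a [ZMOD 4]) x = if b ≡ a [ZMOD 4] then x else 0 := by
    intro b x hx
    have key : ∀ i, M.above b i → (M.q i ≡ a [ZMOD 4] ↔ b ≡ a [ZMOD 4]) := by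
      rintro i ⟨j, hj⟩
      rw [hj]
      unfold Int.ModEq
      constructor <;> intro h <;> omega
    split_ifs with h
    · exact hx.projIn_eq fun i hi => (key i hi).2 h
    · exact hx.projIn_eq_zero fun i hi h' => h ((key i hi).1 h')
  have e' := congrArg (projIn fun i => M.q i ≡ a [ZMOD 4]) e
  rw [map_add, map_add, map_smul, map_smul, hmod hy, hmod h0, hmod h1, projIn_modEq,
    if_pos (Int.ModEq.refl a)] at e'
  set η' := projIn (fun i => M.q i ≡ a [ZMOD 4]) η
  -- P₀ may be subtracted within level a only if a ≤ s − 2. The residue decides: P₀ drops out unless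
  -- s − 2 ≡ a modulo 4, and then a ≤ s implies a ≤ s − 2.
  have fin : ∀ (u v : ℚ), y = u • P₀ + v • P₁ + M.d η' → (u ≠ 0 → a ≤ s - 2) → 
      ∃ (u v : ℚ) (y' w' : ι → ℚ), M.part 0 y' = 0 ∧ projIn (fun i => M.q i = a) y =
        u • projIn (fun i => M.q i = s - 2) P₀ + v • projIn (fun i => M.q i = s) P₁ +
          M.part 1 y' + M.part 0 w' := by
    intro u v e hu
    have hsub : SuppIn (fun i => a ≤ M.q i) (u • P₀) := by
      by_cases hu0 : u = 0
      · intro i hi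
        rw [hu0, zero_smul] at hi
        exact absurd rfl hi
      · exact (h0.smul u).mono fun i hi => (hu hu0).trans (above_le hi)
    obtain ⟨y', w', hy', e1⟩ := of_range (y - u • P₀ - v • P₁)
      (((hy.mono fun i => above_le).sub hsub).sub
        ((h1.smul v).mono fun i hi => has.trans (above_le hi)))
      ⟨η', by rw [e]; module⟩
    rw [map_sub, map_sub, map_smul, map_smul] at e1
    have pr : ∀ {b : ℤ} {x : ι → ℚ} (c : ℚ), SuppIn (M.above b) x → (c ≠ 0 → a ≤ b) → ∃ c' : ℚ,
        c • projIn (fun i => M.q i = a) x = c' • projIn (fun i => M.q i = b) x := by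
      intro b x c hx hc
      by_cases hc0 : c = 0
      · exact ⟨0, by rw [hc0, zero_smul, zero_smul]⟩
      obtain hlt | rfl := (hc hc0).lt_or_eq
      · refine ⟨0, ?_⟩
        rw [hx.projIn_eq_zero fun i hi h => by have := above_le hi; omega, smul_zero, zero_smul]
      · exact ⟨c, rfl⟩
    obtain ⟨u', hu'⟩ := pr u h0 hu
    obtain ⟨v', hv'⟩ := pr v h1 fun _ => has
    refine ⟨u', v', y', w', hy', ?_⟩
    rw [← hu', ← hv', add_assoc, ← e1]
    module
  by_cases c0 : s - 2 ≡ a [ZMOD 4]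
  · rw [if_pos c0] at e'
    refine fin u (if s ≡ a [ZMOD 4] then v else 0) ?_ fun _ => ?_
    · rw [e']
      split_ifs <;> simp
    · unfold Int.ModEq at c0
      omega
  · rw [if_neg c0] at e'
    refine fin 0 (if s ≡ a [ZMOD 4] then v else 0) ?_ fun h => absurd rfl h
    · rw [e']
      split_ifs <;> simp

/-- A nontrivial relation would allow a multiple of P₀ or P₁ to be moved up by 4, to level s + 2 or
s + 4, above the maximum. -/
theorem eq_zero_of_eq {s : ℤ} (hs : IsGreatest M.levels s) {P₀ P₁ : ι → ℚ}
    (d0 : M.d P₀ = 0) (d1 : M.d P₁ = 0)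
    (r0 : P₀ ∉ LinearMap.range M.d) (r1 : P₁ ∉ LinearMap.range M.d)
    (h0 : SuppIn (M.above (s - 2)) P₀) (h1 : SuppIn (M.above s) P₁)
    {u v : ℚ} {y w : ι → ℚ} (hy : M.part 0 y = 0)
    (h : u • projIn (fun i => M.q i = s - 2) P₀ + v • projIn (fun i => M.q i = s) P₁ =
      M.part 1 y + M.part 0 w) : u = 0 ∧ v = 0 := by
  have key : ∀ {b : ℤ} {x : ι → ℚ} {c : ℚ}, M.d x = 0 → x ∉ LinearMap.range M.d →
      SuppIn (M.above b) x → s < b + 4 →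
      c • projIn (fun i => M.q i = b) x = projIn (fun i => M.q i = b) (M.part 1 y + M.part 0 w) →
      c = 0 := by
    intro b x c dx rx hx hb e
    by_contra hc
    obtain ⟨y', w', hy', e'⟩ := projIn_part_add hy w b
    have := hs.2 (mem_levels_of (c • x) (by rw [map_smul, dx, smul_zero]) (fun hr => rx (by
      simpa [smul_smul, hc] using Submodule.smul_mem _ c⁻¹ hr)) (hx.smul c) hy'
      (by rw [map_smul, e, e']))
    omega
  constructor
  · refine key d0 r0 h0 (by omega) ?_
    rw [← h, map_add, map_smul, map_smul, projIn_projIn_of_ne (b := s - 2) (c := s) (by omega), smul_zero,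
      add_zero,
      (suppIn_projIn _ P₀).projIn_eq fun i => id]
  · refine key d1 r1 h1 (by omega) ?_
    rw [← h, map_add, map_smul, map_smul, projIn_projIn_of_ne (b := s) (c := s - 2) (by omega), smul_zero,
      zero_add,
      (suppIn_projIn _ P₁).projIn_eq fun i => id]

/-- These are the two lowest components of d x = 0: the leading term of a cycle survives to the
second page. -/
theorem part_one_eq_of_d_eq_zero {b : ℤ} {x : ι → ℚ} (dx : M.d x = 0) (hx : SuppIn (M.above b) x) :
    M.part 0 (projIn (fun i => M.q i = b) x) = 0 ∧ 
      ∃ w, M.part 1 (projIn (fun i => M.q i = b) x) = M.part 0 w := by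
  have hle := hx.mono (P' := fun i => b ≤ M.q i) fun i => above_le
  have h1 := d_apply_of_eq hle
  have h2 := d_apply_of_eq_add hle
  rw [dx, map_zero] at h1 h2
  exact ⟨h1.symm, -projIn (fun i => M.q i = b + 4) x, by
    rw [map_neg]
    exact eq_neg_of_add_eq_zero_right h2.symm⟩

theorem sum_projIn (f : ι → ℚ) :
    ∑ a ∈ Finset.univ.image M.q, projIn (fun i => M.q i = a) f = f := by
  classical
  ext i
  rw [Finset.sum_apply, Finset.sum_eq_single (M.q i), projIn_of (P := fun j => M.q j = M.q i) rfl]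
  · exact fun b _ hb => projIn_of_not (P := fun j => M.q j = b) (Ne.symm hb) f
  · exact fun h => absurd (Finset.mem_image_of_mem _ (Finset.mem_univ i)) h

theorem exists_eq (hM : M.Strict) {s : ℤ} (hs : IsGreatest M.levels s) {P₀ P₁ : ι → ℚ}
    (h0 : SuppIn (M.above (s - 2)) P₀) (h1 : SuppIn (M.above s) P₁)
    (hP : ∀ z, M.d z = 0 → ∃ (u v : ℚ) (y : ι → ℚ), z = u • P₀ + v • P₁ + M.d y)
    {z w : ι → ℚ} (hz0 : M.part 0 z = 0) (hz1 : M.part 1 z = M.part 0 w) :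
    ∃ (u v : ℚ) (y w' : ι → ℚ), M.part 0 y = 0 ∧
      z = u • projIn (fun i => M.q i = s - 2) P₀ + v • projIn (fun i => M.q i = s) P₁ +
        M.part 1 y + M.part 0 w' := by
  have key : ∀ a, ∃ (u v : ℚ) (y w' : ι → ℚ), M.part 0 y = 0 ∧
      projIn (fun i => M.q i = a) z =
        u • projIn (fun i => M.q i = s - 2) P₀ + v • projIn (fun i => M.q i = s) P₁ +
        M.part 1 y + M.part 0 w' := by
    intro a
    refine exists_eq_of_pure hM hs h0 h1 hP (a := a) (w := projIn (fun i => M.q i = a + 4) w)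
      (suppIn_projIn _ z) ?_ ?_
    · rw [← projIn_part_zero, hz0, map_zero]
    · rw [← projIn_part_zero, ← hz1]
      simpa using (projIn_part (M := M) (a := a) 1 z).symm
  choose u v y w' hy e using key
  refine ⟨∑ a ∈ Finset.univ.image M.q, u a, ∑ a ∈ Finset.univ.image M.q, v a,
    ∑ a ∈ Finset.univ.image M.q, y a, ∑ a ∈ Finset.univ.image M.q, w' a, ?_, ?_⟩
  · rw [map_sum, Finset.sum_eq_zero fun a _ => hy a]
  · conv_lhs => rw [← sum_projIn (M := M) z]
    rw [map_sum, map_sum, Finset.sum_smul, Finset.sum_smul, ← Finset.sum_add_distrib,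
      ← Finset.sum_add_distrib, ← Finset.sum_add_distrib]
    exact Finset.sum_congr rfl fun a _ => e a

variable (M) in
/-- The homology of the part of degree zero. -/
abbrev PageOne : Type :=
  LinearMap.ker (M.part 0) ⧸ (LinearMap.range (M.part 0)).submoduleOf (LinearMap.ker (M.part 0))

variable (M) in
/-- The homogeneous part of the homology of the part of degree zero. -/
def pagePart (h q : ℤ) : Set M.PageOne :=
  {y | ∃ z : LinearMap.ker (M.part 0), Submodule.Quotient.mk z = y ∧
    SuppIn (fun i => M.q i = q ∧ M.h i = h) z.1}

variable (M) in
/-- The map of the cycles of the part of degree zero that is induced by the part of degree one. -/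
noncomputable def cyclesMap : Module.End ℚ (LinearMap.ker (M.part 0)) :=
  (M.part 1).restrict fun f hf => by
    rw [LinearMap.mem_ker] at hf ⊢
    rw [part_zero_one, hf, map_zero, neg_zero]

variable (M) in
/-- The differential of the first page of the spectral sequence. -/
noncomputable def pageMap : Module.End ℚ M.PageOne :=
  Submodule.mapQ _ _ M.cyclesMap (by
    rintro ⟨_, _⟩ ⟨w, rfl⟩
    exact ⟨-M.part 1 w, by rw [map_neg, part_zero_one, neg_neg]; rfl⟩)

theorem pageMap_mk (z : LinearMap.ker (M.part 0)) :
    M.pageMap (Submodule.Quotient.mk z) = Submodule.Quotient.mk (M.cyclesMap z) := rfl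

theorem mk_eq_zero {z : LinearMap.ker (M.part 0)} :
    (Submodule.Quotient.mk z : M.PageOne) = 0 ↔ ∃ w, z.1 = M.part 0 w := by
  rw [Submodule.Quotient.mk_eq_zero]
  exact ⟨fun ⟨w, h⟩ => ⟨w, h.symm⟩, fun ⟨w, h⟩ => ⟨w, h.symm⟩⟩

theorem projIn_part_h (j : ℕ) (f : ι → ℚ) (h : ℤ) : projIn (fun i => M.h i = h + 1) (M.part j f) =
    M.part j (projIn (fun i => M.h i = h) f) := by
  classical
  refine projIn_matOp (fun β α hc => ?_) f
  have := M.hh (ite_ne_right_iff.1 hc).2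
  constructor <;> intro <;> omega

theorem span_pagePart : Submodule.span ℚ {y | ∃ h q, y ∈ M.pagePart h q} = ⊤ := by
  classical
  rw [eq_top_iff]
  rintro y -
  obtain ⟨z, rfl⟩ := Submodule.Quotient.mk_surjective _ y
  have hz0 : M.part 0 z.1 = 0 := z.2
  have hc : ∀ h q, projIn (fun i => M.h i = h) (projIn (fun i => M.q i = q) z.1) ∈
      LinearMap.ker (M.part 0) := fun h q => by
    rw [LinearMap.mem_ker, ← projIn_part_h, ← projIn_part_zero, hz0, map_zero, map_zero]
  have e : z = ∑ q ∈ Finset.univ.image M.q, ∑ h ∈ Finset.univ.image M.h,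
      (⟨_, hc h q⟩ : LinearMap.ker (M.part 0)) := by
    ext i
    simp only [AddSubmonoidClass.coe_finsetSum, Finset.sum_apply]
    rw [Finset.sum_eq_single (M.q i), Finset.sum_eq_single (M.h i),
      projIn_of (P := fun j => M.h j = M.h i) rfl, projIn_of (P := fun j => M.q j = M.q i) rfl]
    · exact fun b _ hb => projIn_of_not (P := fun j => M.h j = b) (Ne.symm hb) _
    · exact fun h => absurd (Finset.mem_image_of_mem _ (Finset.mem_univ i)) h
    · refine fun b _ hb => Finset.sum_eq_zero fun h _ => ?_
      by_cases hh : M.h i = h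
      · rw [projIn_of (P := fun j => M.h j = h) hh,
          projIn_of_not (P := fun j => M.q j = b) (Ne.symm hb)]
      · exact projIn_of_not (P := fun j => M.h j = h) hh _
    · exact fun h => absurd (Finset.mem_image_of_mem _ (Finset.mem_univ i)) h
  rw [e, ← Submodule.mkQ_apply, map_sum]
  refine sum_mem fun q _ => ?_
  rw [map_sum]
  exact sum_mem fun h _ => Submodule.subset_span ⟨h, q, _, rfl, fun i hi =>
    ⟨(suppIn_projIn _ z.1).projIn _ i hi, suppIn_projIn _ _ i hi⟩⟩

theorem pageMap_mem_pagePart {h q : ℤ} {y : M.PageOne} (hy : y ∈ M.pagePart h q) :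
    M.pageMap y ∈ M.pagePart (h + 1) (q + 4) := by
  classical
  obtain ⟨z, rfl, hz⟩ := hy
  refine ⟨_, rfl, hz.matOp fun β α hc hα => ?_⟩
  rw [ite_ne_right_iff] at hc
  have := M.hh hc.2
  have := hc.1
  push_cast at this
  constructor <;> omega

/-- The knight move decomposition of the homology of the part of degree zero. -/
theorem exists_knight_basis (hM : M.Strict) (S : M.Eigenbasis) {s : ℤ}
    (hs : IsGreatest M.levels s) :
    ∃ (r : ℕ) (l m : Fin r → ℤ) (b : Module.Basis (Bool ⊕ Fin r × Bool) ℚ M.PageOne),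
      b (.inl false) ∈ M.pagePart 0 (s - 2) ∧ b (.inl true) ∈ M.pagePart 0 s ∧
      ∀ i, b (.inr (i, false)) ∈ M.pagePart (l i) (m i) ∧
        b (.inr (i, true)) ∈ M.pagePart (l i + 1) (m i + 4) := by
  obtain ⟨P₀, P₁, d0, d1, r0, r1, h0, h1, hP⟩ := exists_top_cycles S hs
  have a0 : SuppIn (M.above (s - 2)) P₀ := h0.mono fun i h => h.1
  have a1 : SuppIn (M.above s) P₁ := h1.mono fun i h => h.1
  obtain ⟨c0, w0, e0⟩ := part_one_eq_of_d_eq_zero d0 a0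
  obtain ⟨c1, w1, e1⟩ := part_one_eq_of_d_eq_zero d1 a1
  set q0 : LinearMap.ker (M.part 0) := ⟨_, c0⟩ with hq0
  set q1 : LinearMap.ker (M.part 0) := ⟨_, c1⟩ with hq1
  set p : Bool → M.PageOne :=
    fun i => if i then Submodule.Quotient.mk q1 else Submodule.Quotient.mk q0
  have k1 : ∀ x, M.pageMap (M.pageMap x) = 0 := by
    intro x
    obtain ⟨z, rfl⟩ := Submodule.Quotient.mk_surjective _ x
    rw [pageMap_mk, pageMap_mk, mk_eq_zero]
    have hz : M.part 0 z.1 = 0 := z.2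
    refine ⟨-M.part 2 z.1, ?_⟩
    change M.part 1 (M.part 1 z.1) = _
    rw [part_one_one, hz, map_zero, sub_zero, map_neg]
  have k2 : ∀ i, M.pageMap (p i) = 0 := by
    rintro (_ | _)
    · exact mk_eq_zero.2 ⟨w0, e0⟩
    · exact mk_eq_zero.2 ⟨w1, e1⟩
  have k3 : ∀ x, M.pageMap x = 0 → ∃ (u v : ℚ) (y : M.PageOne),
      x = u • p false + v • p true + M.pageMap y := by
    intro x hx
    obtain ⟨z, rfl⟩ := Submodule.Quotient.mk_surjective _ x
    obtain ⟨w, hw⟩ := mk_eq_zero.1 hx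
    obtain ⟨u, v, y, w', hy, e⟩ := exists_eq hM hs a0 a1 hP z.2 hw
    refine ⟨u, v, Submodule.Quotient.mk ⟨y, hy⟩, ?_⟩
    change Submodule.Quotient.mk z = Submodule.Quotient.mk (u • q0 + v • q1 + M.cyclesMap ⟨y, hy⟩)
    rw [← sub_eq_zero, ← Submodule.Quotient.mk_sub, mk_eq_zero]
    refine ⟨w', ?_⟩
    rw [← sub_eq_iff_eq_add'] at e
    exact e
  have k4 : ∀ (u v : ℚ) (y : M.PageOne), u • p false + v • p true = M.pageMap y →
      u = 0 ∧ v = 0 := by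
    intro u v x hx
    obtain ⟨y, rfl⟩ := Submodule.Quotient.mk_surjective _ x
    change Submodule.Quotient.mk (u • q0 + v • q1) = Submodule.Quotient.mk (M.cyclesMap y) at hx
    rw [← sub_eq_zero, ← Submodule.Quotient.mk_sub, mk_eq_zero] at hx
    obtain ⟨w, hw⟩ := hx
    refine eq_zero_of_eq hs d0 d1 r0 r1 a0 a1 (y := y.1) (w := w) y.2 ?_
    rw [← hw]
    exact (add_sub_cancel (M.part 1 y.1) _).symm
  obtain ⟨r, a, b, haT, hb, hb'⟩ := exists_basis_of_range_of_ker M.pageMap k1 k2 k3 k4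
    (span_pagePart (M := M))
  choose l m hlm using haT
  refine ⟨r, l, m, b, ?_, ?_, fun i => ⟨?_, ?_⟩⟩
  · rw [hb]
    exact ⟨q0, rfl, fun i hi => ⟨suppIn_projIn _ _ i hi, (h0.projIn _ i hi).2⟩⟩
  · rw [hb]
    exact ⟨q1, rfl, fun i hi => ⟨suppIn_projIn _ _ i hi, (h1.projIn _ i hi).2⟩⟩
  · rw [(hb' i).1]
    exact hlm i
  · rw [(hb' i).2]
    exact pageMap_mem_pagePart (hlm i)

end FilteredMatrix

/-! ## The filtered complex of a cube -/

section CubeFiltration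

variable {E : Type} {n : ℕ} {R : ResCube E n}

namespace ResCube

/-- The matrix of the differential, with the gradings shifted. -/
noncomputable def Planar.filtered [Finite E] (hR : R.Planar) (sq sh : ℤ) :
    FilteredMatrix R.Idx where
  q α := R.qdeg α + sq
  h α := hgt α.1 - sh
  c β α := R.mat β α
  hq h := by
    obtain ⟨j, hj⟩ := (hR.mat_ne_zero (by exact_mod_cast h)).1
    exact ⟨j, by rw [hj]; ring⟩
  hh h := by
    rw [(hR.mat_ne_zero (by exact_mod_cast h)).2]
    push_cast
    ring
  sq β α := by
    classical
    -- At τ = 1 the powers of τ disappear, so d² = 0 on basis vectors is the identity of matrices.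
    have h1 := hR.coord_diff (k := ℚ) (τ := 1)
      (R.diff ℚ 1 ((R.coord ℚ 1).symm (Pi.single α 1))) β
    rw [diff_diff hR, map_zero] at h1
    simp only [hR.coord_diff, one_pow, mul_one, LinearEquiv.apply_symm_apply, Pi.single_apply,
      mul_ite, mul_zero, Finset.sum_ite_eq', Finset.mem_univ, if_true] at h1
    exact h1.symm

variable [Finite E] {sq sh : ℤ} (hR : R.Planar)

theorem Planar.coord_diff_one (z : R.Chain ℚ 1) : R.coord ℚ 1 (R.diff ℚ 1 z) =
    (hR.filtered sq sh).d (R.coord ℚ 1 z) := by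
  ext β
  rw [hR.coord_diff, FilteredMatrix.d, matOp_apply]
  simp [filtered]

/-- At τ = 0 exactly the entries that preserve the degree survive. -/
theorem Planar.coord_diff_zero (z : R.Chain ℚ 0) : R.coord ℚ 0 (R.diff ℚ 0 z) =
    (hR.filtered sq sh).part 0 (R.coord ℚ 0 z) := by
  classical
  ext β
  rw [hR.coord_diff, FilteredMatrix.part, matOp_apply]
  refine Finset.sum_congr rfl fun α _ => ?_
  by_cases h : R.mat β α = 0
  · simp [filtered, h]
  obtain ⟨j, hj⟩ := (hR.mat_ne_zero h).1
  have h1 : ((R.qdeg β - R.qdeg α) / 4).toNat = j := by omega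
  rw [h1]
  obtain rfl | hj0 := Nat.eq_zero_or_pos j
  · have : R.qdeg β = R.qdeg α := by omega
    simp [filtered, this]
  · have : R.qdeg β ≠ R.qdeg α := by omega
    simp [filtered, this, hj0.ne']

-- The complex over ℚ[t] is the Rees construction of the filtered one. Homogenising f and d f
-- relative to level a gives a relation D(xt) = t^N yt, so yt represents a torsion class and t yt =
-- D w. The coefficients of w in the right degrees form the new preimage, and the extra factor t is
-- the shift by 4.
open Polynomial in
theorem Planar.strict (hT : ∀ z : R.Chain ℚ[X] X, R.diff ℚ[X] X z = 0 → ∀ N : ℕ,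
      (X : ℚ[X]) ^ N • z ∈ LinearMap.range (R.diff ℚ[X] X) →
      (X : ℚ[X]) • z ∈ LinearMap.range (R.diff ℚ[X] X)) :
    (hR.filtered sq sh).Strict := by
  classical
  intro a f hf
  set M := hR.filtered sq sh with hM
  set y := M.d f with hy
  have hyβ : ∀ β, y β = ∑ α, (R.mat β α : ℚ) * f α := fun β => rfl
  have hq : ∀ α, M.q α = R.qdeg α + sq := fun α => rfl
  -- The entries of f may lie far below level a; the factor t^N makes their exponents nonnegative.
  -- Degrees not congruent to a modulo 4 are rounded, which is harmless because the differential
  -- preserves residues.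
  obtain ⟨N, hN⟩ : ∃ N : ℕ, ∀ α, 0 ≤ (M.q α - a) / 4 + N := by
    obtain ⟨b, hb⟩ := (Set.finite_range fun α => (M.q α - a) / 4).bddBelow
    exact ⟨(-b).toNat, fun α => by have := hb ⟨α, rfl⟩; simp only at this; omega⟩
  set xt : R.Chain ℚ[X] X := (R.coord ℚ[X] X).symm
    fun α => C (f α) * X ^ ((M.q α - a) / 4 + N).toNat with hxt
  set yt : R.Chain ℚ[X] X := (R.coord ℚ[X] X).symm
    fun α => C (y α) * X ^ ((M.q α - a) / 4).toNat with hyt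
  have h1 : R.diff ℚ[X] X xt = (X : ℚ[X]) ^ N • yt := by
    apply (R.coord ℚ[X] X).injective
    ext1 β
    rw [hR.coord_diff, map_smul, Pi.smul_apply, hxt, hyt]
    simp only [LinearEquiv.apply_symm_apply]
    have h2 : ∀ α, (R.mat β α : ℚ[X]) * X ^ ((R.qdeg β - R.qdeg α) / 4).toNat *
        (C (f α) * X ^ ((M.q α - a) / 4 + N).toNat) =
        C (R.mat β α * f α) * X ^ ((M.q β - a) / 4 + N).toNat := by
      intro α
      by_cases h : R.mat β α = 0
      · simp [h]
      obtain ⟨j, hj⟩ := (hR.mat_ne_zero h).1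
      have h3 : ((M.q β - a) / 4 + N).toNat =
          ((R.qdeg β - R.qdeg α) / 4).toNat + ((M.q α - a) / 4 + N).toNat := by
        have := hN α
        rw [hq, hq] at *
        omega
      rw [h3, pow_add, map_mul, ← map_intCast (C : ℚ →+* ℚ[X])]
      ring
    rw [Finset.sum_congr rfl fun α _ => h2 α, ← Finset.sum_mul, ← map_sum, ← hyβ]
    by_cases h0 : y β = 0
    · simp [h0]
    have := hf β h0
    rw [show ((M.q β - a) / 4 + N).toNat = N + ((M.q β - a) / 4).toNat by omega, pow_add,
      smul_eq_mul]
    ring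
  have h2 : R.diff ℚ[X] X yt = 0 := by
    apply (R.coord ℚ[X] X).injective
    have h3 := congrArg (R.coord ℚ[X] X) (congrArg (R.diff ℚ[X] X) h1)
    rw [diff_diff hR, map_smul, map_smul, map_zero] at h3
    rw [map_zero]
    exact (smul_eq_zero.1 h3.symm).resolve_left (pow_ne_zero _ X_ne_zero)
  obtain ⟨w, hw⟩ := hT yt h2 N ⟨xt, h1⟩
  -- The exponent (q − a)/4 + 1 is the one at which t yt has the coefficient y; it is nonnegative
  -- from level a − 4 on.
  refine ⟨fun α => if a - 4 ≤ M.q α then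
    (R.coord ℚ[X] X w α).coeff ((M.q α - a) / 4 + 1).toNat else 0, fun α hα => by
      by_contra h
      exact hα (if_neg h), ?_⟩
  ext β
  change ∑ α, (R.mat β α : ℚ) * _ = y β
  by_cases hβ : a - 4 ≤ M.q β
  · have h3 := congrArg (fun z => (R.coord ℚ[X] X z β).coeff ((M.q β - a) / 4 + 1).toNat) hw
    simp only [hR.coord_diff, map_smul, Pi.smul_apply, finsetSum_coeff] at h3
    have h4 : ((X : ℚ[X]) • R.coord ℚ[X] X yt β).coeff ((M.q β - a) / 4 + 1).toNat = y β := by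
      rw [hyt, LinearEquiv.apply_symm_apply, smul_eq_mul]
      by_cases h0 : y β = 0
      · simp [h0]
      have := hf β h0
      rw [show ((M.q β - a) / 4 + 1).toNat = ((M.q β - a) / 4).toNat + 1 by omega, coeff_X_mul,
        coeff_C_mul_X_pow, if_pos rfl]
    rw [h4] at h3
    rw [← h3]
    refine Finset.sum_congr rfl fun α _ => ?_
    by_cases h : R.mat β α = 0
    · simp [h]
    obtain ⟨j, hj⟩ := (hR.mat_ne_zero h).1
    rw [mul_assoc, ← map_intCast (C : ℚ →+* ℚ[X]), coeff_C_mul, coeff_X_pow_mul']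
    congr 1
    rw [hq, hq] at *
    split_ifs with c1 c2 c2
    · congr 1
      omega
    · omega
    · omega
    · rfl
  · rw [hf.eq_zero (i := β) (by omega)]
    refine Finset.sum_eq_zero fun α _ => ?_
    by_cases h : R.mat β α = 0
    · simp [h]
    obtain ⟨j, hj⟩ := (hR.mat_ne_zero h).1
    rw [if_neg (by rw [hq] at *; omega), mul_zero]

end ResCube

variable {k : Type} [CommRing k] {τ : k}

/-- Multiplication by X_e adds one variable, and reductions X² = τ remove pairs. In quantum degrees
this is a drop by 2 followed by steps of 4 upwards. -/
theorem circEquiv_xv_mul_ne_zero [Finite E] (r : Setoid E) (e : E) {z : CircRing k τ r}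
    {T : Finset (Quotient r)} (h : circEquiv k τ r (xv k τ r e * z) T ≠ 0) :
    ∃ S, circEquiv k τ r z S ≠ 0 ∧ ∃ j : ℕ, S.card + 1 = T.card + 2 * j := by
  classical
  have : Fintype (Finset (Quotient r)) := Fintype.ofFinite _
  rw [circ_eq_sum r z, Finset.mul_sum, map_sum, Finsupp.finsetSum_apply] at h
  obtain ⟨S, -, hS⟩ := Finset.exists_ne_zero_of_sum_ne_zero h
  rw [mul_smul_comm, map_smul, Finsupp.smul_apply, circleMonomial_eq,
    show xv k τ r e = circMk k τ r (MvPolynomial.monomial (Finsupp.single e 1) 1) from rfl,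
    ← map_mul, MvPolynomial.monomial_mul, mul_one, circEquiv_monomial, Finsupp.single_apply] at hS
  refine ⟨S, left_ne_zero_of_mul hS, half (circlesOf r (Finsupp.single e 1 + edgeMonomial r S)), ?_⟩
  obtain ⟨rfl, -⟩ := ite_ne_right_iff.1 (right_ne_zero_of_mul hS)
  rw [← degree_eq_half, degree_circlesOf, map_add, degree_edgeMonomial, Finsupp.degree_single,
    add_comm]

namespace PD

variable {D : PD E}

theorem circles_eq (v : D.Cube) : D.circles v = Nat.card (Quotient (D.rc.rel v)) :=
  Nat.card_congr
    { toFun := Quot.lift (fun e => Quotient.mk _ e) fun _ _ h => Quotient.sound (rc_adj h)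
      invFun := Quotient.lift (fun e => Quot.mk _ e) fun _ _ h => Quot.eqvGen_sound h
      left_inv := by rintro ⟨e⟩; rfl
      right_inv := by rintro ⟨e⟩; rfl }

/-- Reducing a monomial to a square-free one raises the degree by multiples of 4, unless the result
is zero; `hP` asks that P be stable under this. For τ = 0 it is no restriction, and for τ = 1 it
holds for conditions of the form q ≤ j. -/
theorem mem_vertexPart [Finite E] {P : ℤ → Prop}
    (hP : ∀ i (j : ℕ), τ ^ j ≠ 0 → P i → P (i + 4 * j)) {v : D.Cube} {z : D.VertexRing k τ v} :
    z ∈ D.vertexPart k τ v P ↔ ∀ S, circEquiv k τ (D.rc.rel v) z S ≠ 0 →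
      P (D.rc.qdeg ⟨v, S⟩ + (D.nPos - 2 * D.nNeg)) := by
  classical
  have hq : ∀ S, D.rc.qdeg ⟨v, S⟩ + (D.nPos - 2 * D.nNeg) = D.topDegree v - 2 * S.card := by
    intro S
    rw [ResCube.qdeg, topDegree, circles_eq]
    change (D.height v : ℤ) + _ - _ + _ = _
    ring
  constructor
  · intro h
    induction h using Submodule.span_induction with
    | zero =>
      intro S hS
      exact absurd (DFunLike.congr_fun (map_zero (circEquiv k τ (D.rc.rel v))) S) hS
    | add y z _ _ hy hz =>
      intro S hS
      have := DFunLike.congr_fun (map_add (circEquiv k τ (D.rc.rel v)) y z) S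
      by_contra h
      exact hS (this.trans ((congrArg₂ (· + ·) (not_not.1 (mt (hy S) h))
        (not_not.1 (mt (hz S) h))).trans (add_zero 0)))
    | smul u y _ hy =>
      intro S hS
      have := DFunLike.congr_fun (map_smul (circEquiv k τ (D.rc.rel v)) u y) S
      by_contra h
      exact hS (this.trans ((congrArg (u • ·) (not_not.1 (mt (hy S) h))).trans (smul_zero u)))
    | mem y hy =>
      obtain ⟨m, hm, rfl⟩ := hy
      intro S hS
      have h1 := DFunLike.congr_fun (circEquiv_monomial (k := k) (τ := τ) (D.rc.rel v) m) S
      have hS' := fun h => hS (h1.trans h)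
      rw [Finsupp.single_apply] at hS'
      obtain ⟨rfl, h2⟩ := ite_ne_right_iff.1 hS'
      have h3 := degree_eq_half (circlesOf (D.rc.rel v) m)
      rw [degree_circlesOf] at h3
      rw [hq, show D.topDegree v - 2 * ((oddPart (circlesOf (D.rc.rel v) m)).card : ℤ) =
        D.topDegree v - 2 * (m.degree : ℤ) + 4 * (half (circlesOf (D.rc.rel v) m) : ℕ) by
        rw [h3]; push_cast; ring]
      exact hP _ _ h2 hm
  · intro h
    have : Fintype (Finset (Quotient (D.rc.rel v))) := Fintype.ofFinite _
    have e : z = ∑ S, circEquiv k τ (D.rc.rel v) z S • circleMonomial (D.rc.rel v) S :=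
      circ_eq_sum (D.rc.rel v) z
    rw [e]
    refine Submodule.sum_mem _ fun S _ => ?_
    by_cases h0 : circEquiv k τ (D.rc.rel v) z S = 0
    · rw [h0, zero_smul]
      exact zero_mem _
    · refine Submodule.smul_mem _ _ (Submodule.subset_span ⟨edgeMonomial _ S, ?_, ?_⟩)
      · rw [degree_edgeMonomial, ← hq]
        exact h S h0
      · exact circleMonomial_eq _ S

end PD

end CubeFiltration

/-! ## Lee's generators -/

section LeeGenerators

open MvPolynomial

variable {E : Type} {k : Type} [CommRing k] {τ : k} {n : ℕ}

theorem saddle_circMk_mul (r r' : Setoid E) (a c : E) (p : MvPolynomial E k)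
    (z : CircRing k τ r) :
    saddle k τ r r' a c (circMk k τ r p * z) = circMk k τ r' p * saddle k τ r r' a c z := by
  obtain ⟨q, rfl⟩ := circMk_surjective r z
  by_cases h : circIdeal k τ r ≤ Submodule.comap
      (LinearMap.mulLeft (MvPolynomial E k) (saddleFactor k r' a c)) (circIdeal k τ r')
  · rw [saddle, dif_pos h, ← map_mul, polyMap_mk, polyMap_mk, ← map_mul, mul_left_comm]
  · rw [saddle, dif_neg h]
    simp

/-- The rational sign of a colour. -/
def colourSign (b : Bool) : ℚ := if b then 1 else -1

theorem colourSign_mul_self (b : Bool) : colourSign b * colourSign b = 1 := by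
  cases b <;> norm_num [colourSign]

theorem colourSign_not (b : Bool) : colourSign (!b) = -colourSign b := by
  cases b <;> norm_num [colourSign]

theorem colourSign_ne_zero (b : Bool) : colourSign b ≠ 0 := by
  cases b <;> norm_num [colourSign]

theorem colourSign_of_ne {b b' : Bool} (h : b ≠ b') : colourSign b = -colourSign b' := by
  cases b <;> cases b' <;> simp_all [colourSign]

theorem circMk_C_mul (r : Setoid E) (x : ℚ) (p : MvPolynomial E ℚ) :
    circMk ℚ 1 r (C x * p) = x • circMk ℚ 1 r p := by
  rw [← smul_eq_C_mul, map_smul]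

section Idempotents

variable [Fintype E]

/-- The polynomial of the idempotent of a colouring of the edges. -/
noncomputable def colourPoly (o : E → Bool) : MvPolynomial E ℚ :=
  ∏ e, (C (1 / 2) + C (colourSign (o e) / 2) * X e)

/-- The idempotent of a colouring of the edges. -/
noncomputable def colourIdem (r : Setoid E) (o : E → Bool) : CircRing ℚ 1 r :=
  circMk ℚ 1 r (colourPoly o)

variable {r : Setoid E} {o : E → Bool}

theorem xv_mul_colourIdem (e : E) :
    xv ℚ 1 r e * colourIdem r o = colourSign (o e) • colourIdem r o := by
  classical
  rw [colourIdem, colourPoly, ← Finset.mul_prod_erase _ _ (Finset.mem_univ e), map_mul,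
    ← mul_assoc, ← smul_mul_assoc]
  congr 1
  rw [map_add, circMk_C_mul, circMk_X, mul_add, mul_smul_comm, xv_sq, map_one, smul_add, smul_smul,
    ← mul_one (C (1 / 2) : MvPolynomial E ℚ), circMk_C_mul, map_one, mul_smul_comm, mul_one, smul_smul,
    show colourSign (o e) * (colourSign (o e) / 2) = 1 / 2 by
      rw [← mul_div_assoc, colourSign_mul_self], mul_one_div, add_comm]

theorem circMk_mul_colourIdem (p : MvPolynomial E ℚ) :
    circMk ℚ 1 r p * colourIdem r o = eval (fun e => colourSign (o e)) p • colourIdem r o := by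
  induction p using MvPolynomial.induction_on with
  | C a => rw [← mul_one (C a), circMk_C_mul, map_one, smul_mul_assoc, one_mul, mul_one, eval_C]
  | add p q hp hq => rw [map_add, add_mul, hp, hq, map_add, add_smul]
  | mul_X p e hp =>
    rw [map_mul, mul_assoc, circMk_X, xv_mul_colourIdem, mul_smul_comm, hp, map_mul, eval_X,
      smul_smul, mul_comm]

/-- The common variable of the two edges would act on the idempotent by both signs. -/
theorem colourIdem_eq_zero {e e' : E} (h : r e e') (hne : o e ≠ o e') : colourIdem r o = 0 := by
  have h1 := xv_mul_colourIdem (r := r) (o := o) e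
  rw [xv_eq h, xv_mul_colourIdem, colourSign_of_ne hne, neg_smul] at h1
  have h2 : (2 * colourSign (o e')) • colourIdem r o = 0 := by
    rw [mul_smul, two_smul]
    nth_rewrite 1 [h1]
    exact neg_add_cancel _
  exact (smul_eq_zero.1 h2).resolve_left (mul_ne_zero two_ne_zero (colourSign_ne_zero _))

/-- Expand the product over all edges of (1 + X_e)/2 + (1 − X_e)/2 = 1. -/
theorem sum_colourIdem [DecidableEq E] : ∑ o, colourIdem r o = 1 := by
  simp only [colourIdem, colourPoly]
  rw [← map_sum, ← Fintype.prod_sum fun e b => C (1 / 2) + C (colourSign b / 2) * X e,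
    Finset.prod_eq_one, map_one]
  intro e _
  rw [Fintype.sum_bool]
  simp only [colourSign]
  rw [if_pos trivial, if_neg Bool.false_ne_true, neg_div, C_neg]
  have : (C (1 / 2) + C (1 / 2) : MvPolynomial E ℚ) = 1 := by
    rw [← C_add]
    norm_num
  linear_combination this

end Idempotents

namespace ResCube

variable (R : ResCube E n)

/-- Multiplication by a polynomial in the edge variables. -/
noncomputable def mulPoly (p : MvPolynomial E k) : Module.End k (R.Chain k τ) :=
  mapV k τ fun v => LinearMap.mulLeft k (circMk k τ (R.rel v) p)

theorem mulPoly_apply (p : MvPolynomial E k) (z : R.Chain k τ) (v : Fin n → Bool) :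
    R.mulPoly p z v = circMk k τ (R.rel v) p * z v := rfl

theorem diff_mulPoly (p : MvPolynomial E k) (z : R.Chain k τ) :
    R.diff k τ (R.mulPoly p z) = R.mulPoly p (R.diff k τ z) :=
  (mapV_diff (R := R) (R' := R) _ (fun _ _ _ _ => (saddle_circMk_mul ..).symm) z).symm

variable {R} [Fintype E] {o : E → Bool}

theorem mulX_mulPoly (e : E) (z : R.Chain ℚ 1) :
    R.mulX ℚ 1 e (R.mulPoly (colourPoly o) z) =
      colourSign (o e) • R.mulPoly (colourPoly o) z := by
  funext v
  rw [mulX_apply, Pi.smul_apply, mulPoly_apply, ← mul_assoc, ← smul_mul_assoc]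
  exact congrArg (· * z v) (xv_mul_colourIdem e)

theorem sum_mulPoly [DecidableEq E] (z : R.Chain ℚ 1) :
    ∑ o : E → Bool, R.mulPoly (colourPoly o) z = z := by
  funext v
  rw [Finset.sum_apply]
  simp only [mulPoly_apply]
  rw [← Finset.sum_mul]
  exact (congrArg (· * z v) sum_colourIdem).trans (one_mul _)

/-- On this summand X_a + X_c acts by 2 or −2, but it is null-homotopic. -/
theorem Planar.mulPoly_mem_range (hR : R.Planar) {i : Fin n} {z : R.Chain ℚ 1}
    (hz : R.diff ℚ 1 z = 0) (h : o (R.a i) = o (R.c i)) :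
    R.mulPoly (colourPoly o) z ∈ LinearMap.range (R.diff ℚ 1) := by
  obtain ⟨H, hH⟩ := exists_nullHtpy_at (k := ℚ) (τ := 1) hR i
  have h1 := hH (R.mulPoly (colourPoly o) z)
  rw [diff_mulPoly, hz, map_zero, map_zero, add_zero, mulX_mulPoly, mulX_mulPoly, h,
    ← add_smul, ← two_mul] at h1
  have h2 := Submodule.smul_mem (LinearMap.range (R.diff ℚ 1)) (2 * colourSign (o (R.c i)))⁻¹
    ⟨_, h1⟩
  rwa [inv_smul_smul₀ (mul_ne_zero two_ne_zero (colourSign_ne_zero _))] at h2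

end ResCube

namespace PD

variable {D : PD E} {o : E → Bool}

/-- The oriented resolution. -/
def orientedVertex (D : PD E) : D.Cube := fun i => !(D.crossings.get i).pos

theorem hgt_orientedVertex (D : PD E) : ResCube.hgt D.orientedVertex = D.nNeg := by
  unfold ResCube.hgt orientedVertex nNeg
  generalize D.crossings = l
  induction l with
  | nil => rfl
  | cons x l ih =>
    refine (Fin.card_filter_univ_succ (n := l.length) _).trans ?_
    rw [List.countP_cons, ← ih]
    simp only [List.get_cons_zero]
    split_ifs <;> simp_all [add_comm]

/-- At every crossing the arcs of the oriented resolution join the edges that `Crossing.Check`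
colours equally. -/
theorem Check.rel_orientedVertex (h : D.Check o) {e e' : E}
    (he : D.rc.rel D.orientedVertex e e') : o e = o e' := by
  induction he with
  | refl => rfl
  | symm _ _ _ ih => exact ih.symm
  | trans _ _ _ _ _ ih ih' => exact ih.trans ih'
  | rel e e' he =>
    obtain he | ⟨i, he⟩ := he
    · exact h.joins _ he
    · have hc := h.crossings _ (List.get_mem D.crossings i)
      simp only [orientedVertex] at he
      unfold Crossing.Check at hc
      cases hp : (D.crossings.get i).pos <;> rw [hp] at he hc <;>
        simp [Crossing.arcs] at he hc <;> rcases he with ⟨rfl, rfl⟩ | ⟨rfl, rfl⟩ <;> tauto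

/-- Any other vertex uses the other arcs at some crossing, and these join edges of different
colours. -/
theorem Check.colourIdem_eq_zero [Fintype E] (h : D.Check o) {v : D.Cube}
    (hv : v ≠ D.orientedVertex) : colourIdem (D.rc.rel v) o = 0 := by
  obtain ⟨i, hi⟩ := Function.ne_iff.1 hv
  have hc := h.crossings _ (List.get_mem D.crossings i)
  unfold Crossing.Check at hc
  cases hp : (D.crossings.get i).pos <;> simp only [orientedVertex, hp] at hi hc
  · have hi : v i = false := by simpa using hi
    refine _root_.colourIdem_eq_zero (rc_false hi).1 ?_
    simp at hc
    grind
  · have hi : v i = true := by simpa using hi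
    refine _root_.colourIdem_eq_zero (rc_true hi).1 ?_
    simp at hc
    grind

theorem Check.not (h : D.Check o) : D.Check fun e => !o e := by
  refine ⟨fun x hx => ?_, fun p hp => congrArg _ (h.joins p hp)⟩
  have := h.crossings x hx
  unfold Crossing.Check at this ⊢
  split_ifs at this ⊢ <;> simpa using this

/-- The colours at a crossing for which the corresponding summand is not contractible. -/
theorem IsKnot.eq_or_eq_not (hD : D.IsKnot) (h : D.Check o) {c : E → Bool}
    (h1 : ∀ i, c (D.rc.a i) ≠ c (D.rc.c i))
    (h2 : ∀ i, c (D.crossings.get i).b ≠ c (D.crossings.get i).d)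
    (h3 : ∀ p ∈ D.joins, c p.1 = c p.2) : c = o ∨ c = fun e => !o e := by
  have key := hD.const_of_strands (fun e => xor (c e) (o e)) fun p hp => by
    obtain hp | hp := List.mem_append.1 hp
    · obtain ⟨x, hx, hp⟩ := List.mem_flatMap.1 hp
      obtain ⟨i, rfl⟩ := List.mem_iff_get.1 hx
      have hc := h.crossings _ hx
      have g1 := h1 i
      have g2 := h2 i
      simp only [rc] at g1 g2
      revert hc hp g1 g2
      generalize D.crossings.get i = x
      intro hp hc g1 g2
      unfold Crossing.Check at hc
      unfold Crossing.strands at hp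
      cases hpos : x.pos <;> rw [hpos] at hc hp <;> simp at hc hp <;> rcases hp with rfl | rfl <;>
        simp only <;> revert hc g1 g2 <;>
        generalize c x.a = c1 <;> generalize c x.b = c2 <;> generalize c x.c = c3 <;>
        generalize c x.d = c4 <;> generalize o x.a = o1 <;> generalize o x.b = o2 <;>
        generalize o x.c = o3 <;> generalize o x.d = o4 <;> revert c1 c2 c3 c4 o1 o2 o3 o4 <;> decide
    · simp only [h3 p hp, h.joins p hp]
  obtain ⟨e⟩ := hD.nonempty
  cases he : xor (c e) (o e)
  · left
    funext e'
    have := key e' e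
    rw [he] at this
    simpa using this
  · right
    funext e'
    have := key e' e
    rw [he] at this
    revert this
    generalize c e' = x
    generalize o e' = y
    revert x y
    decide

end PD

end LeeGenerators

/-! ### Lee homology of a knot is generated by two cycles. -/

section LeeBasis

open MvPolynomial

variable {E : Type} [Fintype E] {D : PD E} {o : E → Bool}

namespace PD

/-- Lee's generator for a colouring of the edges. -/
noncomputable def leeCycle (D : PD E) (o : E → Bool) : D.rc.Chain ℚ 1 :=
  fun v => colourIdem (D.rc.rel v) o

theorem mulX_leeCycle (e : E) :
    D.rc.mulX ℚ 1 e (D.leeCycle o) = colourSign (o e) • D.leeCycle o :=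
  funext fun _ => xv_mul_colourIdem e

/-- Only the oriented resolution contributes, and there polynomials act on the idempotent through
their values at the colours. -/
theorem Check.exists_mulPoly_eq (h : D.Check o) (z : D.rc.Chain ℚ 1) :
    ∃ α : ℚ, D.rc.mulPoly (colourPoly o) z = α • D.leeCycle o := by
  obtain ⟨p, hp⟩ := circMk_surjective (D.rc.rel D.orientedVertex) (z D.orientedVertex)
  refine ⟨eval (fun e => colourSign (o e)) p, funext fun v => ?_⟩
  change colourIdem (D.rc.rel v) o * z v =
    (eval (fun e => colourSign (o e)) p : ℚ) • colourIdem (D.rc.rel v) o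
  by_cases hv : v = D.orientedVertex
  · subst hv
    rw [← hp, mul_comm, circMk_mul_colourIdem]
  · rw [h.colourIdem_eq_zero hv, zero_mul, smul_zero]

/-- The two ends of an edge of the cube are not both the oriented resolution, and at the other end
the idempotent vanishes. -/
theorem Check.diff_leeCycle (h : D.Check o) : D.rc.diff ℚ 1 (D.leeCycle o) = 0 := by
  funext v
  rw [ResCube.diff_apply, Finset.sum_eq_zero fun i _ => ?_, Pi.zero_apply]
  split_ifs with hi
  · have : saddle ℚ 1 (D.rc.rel (Function.update v i false)) (D.rc.rel v) (D.rc.a i) (D.rc.c i)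
        (D.leeCycle o (Function.update v i false)) = 0 := by
      by_cases hv : v = D.orientedVertex
      · rw [leeCycle, h.colourIdem_eq_zero, map_zero]
        intro h'
        have := congrFun (h'.trans hv.symm) i
        rw [Function.update_self, hi] at this
        exact Bool.false_ne_true this
      · rw [leeCycle, ← mul_one (colourIdem _ o), colourIdem, saddle_circMk_mul]
        change colourIdem (D.rc.rel v) o * _ = 0
        rw [h.colourIdem_eq_zero hv, zero_mul]
    rw [this, smul_zero]
  · rfl

/-- At the oriented resolution, evaluation at the colours annihilates images of saddles, since X_a =
X_c on them while `a` and `c` have opposite colours. It sends the generator to 1. -/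
theorem Check.leeCycle_notMem (h : D.Check o) (hP : D.rc.Planar) :
    D.leeCycle o ∉ LinearMap.range (D.rc.diff ℚ 1) := by
  rintro ⟨f, hf⟩
  let ev : CircRing ℚ 1 (D.rc.rel D.orientedVertex) →ₐ[ℚ] ℚ :=
    circLift _ (fun e => colourSign (o e)) (fun e => colourSign_mul_self _)
      fun e e' he => by rw [h.rel_orientedVertex he]
  have hev : ∀ e, ev (xv ℚ 1 _ e) = colourSign (o e) := fun e => circLift_xv ..
  have h1 := congrArg ev (congrFun hf D.orientedVertex)
  rw [ResCube.diff_apply, map_sum, Finset.sum_eq_zero fun i _ => ?_] at h1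
  · have h2 : ev (colourIdem _ o) = 1 := by
      rw [colourIdem, colourPoly, map_prod, map_prod, Finset.prod_eq_one]
      intro e _
      rw [map_add, circMk_C_mul, map_add, map_smul, circMk_X, hev,
        ← mul_one (C (1 / 2) : MvPolynomial E ℚ), circMk_C_mul, map_smul, map_one, map_one,
        smul_eq_mul, smul_eq_mul, div_mul_eq_mul_div (colourSign (o e)), colourSign_mul_self]
      norm_num
    rw [leeCycle, h2] at h1
    exact zero_ne_one h1
  · split_ifs with hi
    · have h2 := congrArg ev (xv_mul_saddle (k := ℚ) (τ := 1) (hP _ i hi)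
        (f (Function.update D.orientedVertex i false)))
      have hne : o (D.rc.a i) ≠ o (D.rc.c i) := by
        have := h.crossings _ (List.get_mem D.crossings i)
        unfold Crossing.Check at this
        split_ifs at this <;> exact this.2.2
      rw [map_mul, map_mul, hev, hev, colourSign_of_ne hne] at h2
      rw [map_smul]
      have h3 := colourSign_ne_zero (o (D.rc.c i))
      have h4 : ev (saddle ℚ 1 (D.rc.rel (Function.update D.orientedVertex i false))
          (D.rc.rel D.orientedVertex) (D.rc.a i) (D.rc.c i)
          (f (Function.update D.orientedVertex i false))) = 0 := by
        refine (mul_eq_zero.1 (?_ : (2 * colourSign (o (D.rc.c i))) * _ = 0)).resolve_left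
          (mul_ne_zero two_ne_zero h3)
        linear_combination -h2
      rw [h4, smul_zero]
    · exact map_zero ev

/-- The colour idempotents decompose a cycle. A summand bounds or vanishes unless its colours differ
along both strands of every crossing and agree at marked points, which leaves only `o` and its
complement. -/
theorem IsKnot.exists_eq_leeCycle (hD : D.IsKnot) (h : D.Check o) {z : D.rc.Chain ℚ 1}
    (hz : D.rc.diff ℚ 1 z = 0) : ∃ (α β : ℚ) (y : D.rc.Chain ℚ 1),
      z = α • D.leeCycle o + β • D.leeCycle (fun e => !o e) + D.rc.diff ℚ 1 y := by
  classical
  have hP := rc_planar hD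
  have hbd : ∀ (v : D.Cube) (i : Fin D.crossings.length),
      xv ℚ 1 (D.rc.rel v) (D.crossings.get i).a + xv ℚ 1 (D.rc.rel v) (D.crossings.get i).c =
      xv ℚ 1 (D.rc.rel v) (D.crossings.get i).b + xv ℚ 1 (D.rc.rel v) (D.crossings.get i).d := by
    intro v i
    cases hv : v i
    · rw [xv_eq (rc_false hv).1, xv_eq (rc_false hv).2]
    · rw [xv_eq (rc_true hv).1, ← xv_eq (rc_true hv).2, add_comm]
  have hsmall : ∀ c : E → Bool, c ≠ o → c ≠ (fun e => !o e) →
      D.rc.mulPoly (colourPoly c) z ∈ LinearMap.range (D.rc.diff ℚ 1) := by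
    intro c hc hc'
    by_contra hn
    refine (hD.eq_or_eq_not h (fun i hi => hn (hP.mulPoly_mem_range hz hi)) (fun i hi => hn ?_)
      fun p hp => ?_).elim hc hc'
    · by_cases hac : c (D.rc.a i) = c (D.rc.c i)
      · exact hP.mulPoly_mem_range hz hac
      -- Equal colours on `b, d` and different ones on `a, c` contradict X_a + X_c = X_b + X_d, so
      -- the idempotent is zero in every resolution.
      · have h1 : D.rc.mulPoly (colourPoly c) z = 0 := by
          funext v
          have h2 := congrArg (· * colourIdem (D.rc.rel v) c) (hbd v i)
          simp only [add_mul, xv_mul_colourIdem] at h2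
          rw [hi, ← add_smul, ← add_smul, ← two_mul,
            colourSign_of_ne (b := c (D.crossings.get i).a) (b' := c (D.crossings.get i).c) hac,
            neg_add_cancel, zero_smul] at h2
          change colourIdem _ c * z v = 0
          rw [(smul_eq_zero.1 h2.symm).resolve_left
            (mul_ne_zero two_ne_zero (colourSign_ne_zero _)), zero_mul]
        rw [h1]
        exact zero_mem _
    · by_contra hne
      have h1 : D.rc.mulPoly (colourPoly c) z = 0 := by
        funext v
        change colourIdem _ c * z v = 0
        rw [colourIdem_eq_zero (rc_join hp) hne, zero_mul]
      rw [h1] at hn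
      exact hn (zero_mem _)
  obtain ⟨e⟩ := hD.nonempty
  have hne : (fun e => !o e) ≠ o := fun h => by simpa using congrFun h e
  obtain ⟨α, hα⟩ := h.exists_mulPoly_eq z
  obtain ⟨β, hβ⟩ := h.not.exists_mulPoly_eq z
  have hsum := ResCube.sum_mulPoly z
  rw [← Finset.add_sum_erase _ _ (Finset.mem_univ o), ← Finset.add_sum_erase _ _
    (Finset.mem_erase.2 ⟨hne, Finset.mem_univ _⟩), hα, hβ] at hsum
  obtain ⟨y, hy⟩ : _ ∈ LinearMap.range (D.rc.diff ℚ 1) := sum_mem (t := (Finset.univ.erase o).erase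
    fun e => !o e) (f := fun c => D.rc.mulPoly (colourPoly c) z) fun c hc => by
      simp only [Finset.mem_erase] at hc
      exact hsmall c hc.2.1 hc.1
  exact ⟨α, β, y, by rw [hy, add_assoc]; exact hsum.symm⟩

/-- The filtered complex of a knot diagram. -/
noncomputable def IsKnot.filtered (hD : D.IsKnot) : FilteredMatrix D.rc.Idx :=
  (rc_planar hD).filtered (D.nPos - 2 * D.nNeg) D.nNeg

theorem IsKnot.suppIn_mulX (hD : D.IsKnot) (e : E) {a : ℤ} {z : D.rc.Chain ℚ 1}
    (hz : SuppIn (fun i => hD.filtered.above a i ∧ hD.filtered.h i = 0) (D.rc.coord ℚ 1 z)) :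
    SuppIn (fun i => hD.filtered.above (a - 2) i ∧ hD.filtered.h i = 0)
      (D.rc.coord ℚ 1 (D.rc.mulX ℚ 1 e z)) := by
  rintro ⟨v, T⟩ hT
  obtain ⟨S, hS, j, hj⟩ := circEquiv_xv_mul_ne_zero (D.rc.rel v) e hT
  obtain ⟨⟨l, hl⟩, hh⟩ := hz ⟨v, S⟩ hS
  refine ⟨⟨l + j, ?_⟩, hh⟩
  have hj' : S.card + 1 = T.card + 2 * j := hj
  have hl' : (ResCube.hgt v : ℤ) + Nat.card (Quotient (D.rc.rel v)) - 2 * S.card +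
    (D.nPos - 2 * D.nNeg) = a + 4 * l := hl
  change (ResCube.hgt v : ℤ) + Nat.card (Quotient (D.rc.rel v)) - 2 * T.card +
    (D.nPos - 2 * D.nNeg) = a - 2 + 4 * (l + j : ℕ)
  push_cast
  omega

theorem Check.suppIn_leeCycle (h : D.Check o) (hD : D.IsKnot) :
    SuppIn (fun i => hD.filtered.h i = 0) (D.rc.coord ℚ 1 (D.leeCycle o)) := by
  rintro ⟨v, S⟩ hS
  by_cases hv : v = D.orientedVertex
  · subst hv
    change (ResCube.hgt D.orientedVertex : ℤ) - D.nNeg = 0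
    rw [hgt_orientedVertex, sub_self]
  · refine absurd ?_ hS
    change circEquiv ℚ 1 (D.rc.rel v) (colourIdem _ o) S = 0
    rw [h.colourIdem_eq_zero hv, map_zero, Finsupp.zero_apply]

theorem IsKnot.exists_eigenbasis (hD : D.IsKnot) : Nonempty hD.filtered.Eigenbasis := by
  have hP := rc_planar hD
  obtain ⟨o, h⟩ := hD.exists_check
  obtain ⟨e⟩ := hD.nonempty
  set F := D.rc.coord ℚ 1
  -- The sign normalises the variable so that it fixes the generator of `o` and negates the one of
  -- the complementary colouring.
  set x : Module.End ℚ (D.rc.Chain ℚ 1) := colourSign (o e) • D.rc.mulX ℚ 1 e with hx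
  have hd : ∀ z, F (D.rc.diff ℚ 1 z) = hD.filtered.d (F z) := hP.coord_diff_one
  have hd' : ∀ f, hD.filtered.d f = F (D.rc.diff ℚ 1 (F.symm f)) := fun f => by
    rw [hd, LinearEquiv.apply_symm_apply]
  refine ⟨{
    X := F.toLinearMap ∘ₗ x ∘ₗ F.symm.toLinearMap
    A := F (D.leeCycle o)
    B := F (D.leeCycle fun e => !o e)
    X_d := fun f => ?_
    X_X := fun f => ?_
    X_supp := fun a f hf => ?_
    A_supp := h.suppIn_leeCycle hD
    B_supp := h.not.suppIn_leeCycle hD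
    X_A := ?_
    X_B := ?_
    d_A := by rw [← hd, h.diff_leeCycle, map_zero]
    span := fun z hz => ?_
    A_notMem := ?_ }⟩
  · simp only [LinearMap.comp_apply, LinearEquiv.coe_coe, hd', LinearEquiv.symm_apply_apply, hx,
      LinearMap.smul_apply, map_smul, ResCube.diff_mulX]
  · simp only [LinearMap.comp_apply, LinearEquiv.coe_coe, LinearEquiv.symm_apply_apply, hx,
      LinearMap.smul_apply, map_smul, mulX_mulX, smul_smul, colourSign_mul_self, one_smul,
      LinearEquiv.apply_symm_apply]
  · simp only [LinearMap.comp_apply, LinearEquiv.coe_coe, hx, LinearMap.smul_apply, map_smul]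
    refine (hD.suppIn_mulX e ?_).smul _
    rwa [LinearEquiv.apply_symm_apply]
  · simp only [LinearMap.comp_apply, LinearEquiv.coe_coe, LinearEquiv.symm_apply_apply, hx,
      LinearMap.smul_apply, mulX_leeCycle, smul_smul, colourSign_mul_self, one_smul]
  · simp only [LinearMap.comp_apply, LinearEquiv.coe_coe, LinearEquiv.symm_apply_apply, hx,
      LinearMap.smul_apply, mulX_leeCycle, colourSign_not, neg_smul, smul_neg, smul_smul,
      colourSign_mul_self, one_smul, map_neg]
  · obtain ⟨α, β, y, hy⟩ := hD.exists_eq_leeCycle h (z := F.symm z) (F.injective (by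
      rw [hd, LinearEquiv.apply_symm_apply, hz, map_zero]))
    refine ⟨α, β, F y, ?_⟩
    rw [← hd, ← map_smul, ← map_smul, ← map_add, ← map_add, ← hy, LinearEquiv.apply_symm_apply]
  · rintro ⟨f, hf⟩
    exact h.leeCycle_notMem hP ⟨F.symm f, F.injective (by rw [← hd', hf])⟩

end PD

end LeeBasis

/-! ## The knight move decomposition -/

namespace KnotDiagram

variable (D : KnotDiagram)

/-- The levels of the filtration in terms of coordinates. -/
theorem levels_eq [Fintype D.E] :
    {q : ℤ | ∃ y ∈ D.leeFiltration q, y ≠ 0} = D.isKnot.filtered.levels := by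
  have hP := PD.rc_planar D.isKnot
  set F := (D.pd.toRc ℚ 1).trans (D.pd.rc.coord ℚ 1) with hF
  have hd : ∀ z, F (D.pd.diff ℚ 1 z) = D.isKnot.filtered.d (F z) := fun z => by
    rw [hF, LinearEquiv.trans_apply, PD.toRc_diff hP]
    exact hP.coord_diff_one _
  have hS : ∀ (q : ℤ) z, (∀ v, z v ∈ D.pd.vertexPart ℚ 1 v fun j => q ≤ j) ↔
      SuppIn (fun i => q ≤ D.isKnot.filtered.q i) (F z) := fun q z =>
    ⟨fun h ⟨v, S⟩ hS => (PD.mem_vertexPart (fun i j _ hi => by omega)).1 (h v) S hS,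
      fun h v => (PD.mem_vertexPart (fun i j _ hi => by omega)).2 fun S hS => h ⟨v, S⟩ hS⟩
  ext q
  constructor
  · rintro ⟨_, ⟨z, rfl, hz⟩, hne⟩
    refine ⟨F z.1, ?_, (hS q z.1).1 hz, ?_⟩
    · rw [← hd, LinearMap.mem_ker.1 z.2, map_zero]
    · rintro ⟨f, hf⟩
      refine hne ((Submodule.Quotient.mk_eq_zero _).2 ⟨F.symm f, F.injective ?_⟩)
      rw [hd, LinearEquiv.apply_symm_apply, hf]
      rfl
  · rintro ⟨f, hf, hq, hr⟩
    obtain ⟨z, rfl⟩ := F.surjective f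
    have hz : z ∈ LinearMap.ker (D.pd.diff ℚ 1) := F.injective (by rw [hd, hf, map_zero])
    refine ⟨_, ⟨⟨z, hz⟩, rfl, (hS q z).2 hq⟩, fun h => hr ?_⟩
    obtain ⟨w, hw⟩ := (Submodule.Quotient.mk_eq_zero _).1 h
    exact ⟨F w, (hd w).symm.trans (congrArg F hw)⟩

/-- Khovanov homology in terms of coordinates. -/
theorem exists_kh_equiv [Fintype D.E] : ∃ e : D.isKnot.filtered.PageOne ≃ₗ[ℚ] D.Kh,
    ∀ h q, ∀ y ∈ D.isKnot.filtered.pagePart h q, e y ∈ D.khPart h q := by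
  have hP := PD.rc_planar D.isKnot
  set F := (D.pd.toRc ℚ 0).trans (D.pd.rc.coord ℚ 0) with hF
  have hd : ∀ z, F (D.pd.diff ℚ 0 z) = D.isKnot.filtered.part 0 (F z) := fun z => by
    rw [hF, LinearEquiv.trans_apply, PD.toRc_diff hP]
    exact hP.coord_diff_zero _
  have hk : (LinearMap.ker (D.pd.diff ℚ 0)).map F.toLinearMap =
      LinearMap.ker (D.isKnot.filtered.part 0) := by
    ext f
    constructor
    · rintro ⟨z, hz, rfl⟩
      change D.isKnot.filtered.part 0 (F z) = 0
      rw [← hd, LinearMap.mem_ker.1 hz, map_zero]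
    · intro hf
      refine ⟨F.symm f, F.injective ?_, F.apply_symm_apply f⟩
      rw [hd, LinearEquiv.apply_symm_apply, LinearMap.mem_ker.1 hf, map_zero]
  set G := (F.ofSubmodules _ _ hk).symm with hG
  have hF' : ∀ y, F (G y).1 = y.1 := fun y => F.apply_symm_apply y.1
  have hr : ((LinearMap.range (D.isKnot.filtered.part 0)).submoduleOf
      (LinearMap.ker (D.isKnot.filtered.part 0))).map G.toLinearMap =
      (LinearMap.range (D.pd.diff ℚ 0)).submoduleOf (LinearMap.ker (D.pd.diff ℚ 0)) := by
    ext z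
    constructor
    · rintro ⟨y, ⟨f, hf⟩, rfl⟩
      refine ⟨F.symm f, F.injective ?_⟩
      rw [hd, LinearEquiv.apply_symm_apply, hf]
      exact (hF' y).symm
    · rintro ⟨w, hw⟩
      refine ⟨G.symm z, ⟨F w, ?_⟩, G.apply_symm_apply z⟩
      rw [← hd, hw]
      exact (congrArg (fun z => F z.1) (G.apply_symm_apply z)).symm.trans (hF' _)
  refine ⟨Submodule.Quotient.equiv _ _ G hr, ?_⟩
  rintro h q _ ⟨y, rfl, hy⟩
  refine ⟨G y, rfl, fun v => ?_⟩
  have hc : ∀ S, circEquiv ℚ 0 (D.pd.rc.rel v) ((G y).1 v) S ≠ 0 →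
      D.isKnot.filtered.q ⟨v, S⟩ = q ∧ D.isKnot.filtered.h ⟨v, S⟩ = h := fun S hS =>
    hy ⟨v, S⟩ fun h0 => hS ((congrFun (hF' y) ⟨v, S⟩).trans h0)
  refine ⟨(PD.mem_vertexPart fun i j hj hi => ?_).2 fun S hS => (hc S hS).1, fun hv => ?_⟩
  · obtain rfl : j = 0 := by
      by_contra h0
      exact hj (zero_pow h0)
    simpa using hi
  · obtain ⟨S, hS⟩ := Finsupp.ne_iff.1 fun h0 => hv ((circEquiv ℚ 0 (D.pd.rc.rel v)).injective
      (h0.trans (map_zero (circEquiv ℚ 0 (D.pd.rc.rel v))).symm))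
    exact (hc S hS).2

theorem hasKnightMoveDecomposition {D : KnotDiagram} (h : D.knot.unknottingNumber ≤ 2) :
    D.HasKnightMoveDecomposition D.s := by
  have := D.isKnot.finite
  have : Fintype D.E := Fintype.ofFinite _
  obtain ⟨S⟩ := D.isKnot.exists_eigenbasis
  obtain ⟨s, hs⟩ := FilteredMatrix.exists_isGreatest_levels S
  have hM : D.isKnot.filtered.Strict :=
    (PD.rc_planar D.isKnot).strict fun z hz N hN => KnotDiagram.smul_mem_range h hz hN
  obtain ⟨r, l, m, b, h0, h1, h2⟩ := FilteredMatrix.exists_knight_basis hM S hs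
  obtain ⟨e, he⟩ := D.exists_kh_equiv
  -- Here s is s_max, so the levels s − 2 and s of the two special classes are `D.s - 1` and `D.s +
  -- 1`.
  have hsD : D.s = s - 1 := by
    rw [KnotDiagram.s, D.levels_eq, hs.csSup_eq]
  refine ⟨r, l, m, b.map e, ?_, ?_, fun i => ⟨he _ _ _ (h2 i).1, he _ _ _ (h2 i).2⟩⟩
  · rw [hsD, sub_sub]
    exact he _ _ _ h0
  · rw [hsD, sub_add_cancel]
    exact he _ _ _ h1

end KnotDiagram

theorem mainTheorem3 (K : Knot) (hK : K.unknottingNumber ≤ 2) (D : KnotDiagram)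
    (hD : D.knot = K) :
    D.uT ≤ 1 ∧ D.HasKnightMoveDecomposition D.s := by
  subst hD
  exact ⟨KnotDiagram.uT_le_one hK, KnotDiagram.hasKnightMoveDecomposition hK⟩
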